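/- Let $d\ge 1$ and let $|\cdot|$ and $|\cdot|_\infty$ be the Euclidean and the maximum norm on $\mathbb R^d$. A countable collection $\mathcal S$ of cubes of $\mathbb R^d$ (with sides parallel to the axes) is $\frac12$-sparse if there are pairwise disjoint measurable sets $E_Q\subset Q$, $Q\in\mathcal S$, with $|E_Q|\ge\frac12|Q|$. Put $\langle f\rangle_{p,Q}=|Q|^{-1/p}\|f\mathbf 1_Q\|_p$, and let $L^\infty_0(\mathbb R^d)$ be the space of bounded compactly supported functions $f:\mathbb R^d\to\mathbb C$. For a sublinear operator $T$ mapping $L^\infty_0(\mathbb R^d)$ into nonnegative locally integrable functions, the sparse norm $\|T\|_{(p_1,p_2),\mathsf{sparse}}$ is the infimum of the constants $C$ such that for all $f_1,f_2\in L^\infty_0(\mathbb R^d)$ there is a $\frac12$-sparse collection $\mathcal S$ with $$|\langle Tf_1,f_2\rangle|\le C\sum_{Q\in\mathcal S}|Q|\,\langle f_1\rangle_{p_1,Q}\langle f_2\rangle_{p_2,Q}$$ (a bound on this norm includes the claim that $T$ maps $L^\infty_0(\mathbb R^d)$ into locally integrable functions). For $\alpha>0$, call a sequence $\{K_s:\mathbb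 R^d\to\mathbb C\}_{s\in\mathbb Z}$ of measurable functions an $\alpha$-family if for all $s\in\mathbb Z$ and $\xi\in\mathbb R^d$ $$\operatorname{supp}K_s\subset\{x:2^{s-4}<|x|_\infty<2^{s-2}\},\qquad \|K_s\|_\infty\le 2^{-sd},\qquad |\widehat{K_s}(\xi)|\le\min\{|2^s\xi|^{\alpha},|2^s\xi|^{-\alpha}\}$$ (at $\xi=0$ the last condition means $\widehat{K_s}(0)=0$), where $\widehat{K}(\xi)=\int K(x)e^{-2\pi i x\cdot\xi}\,dx$. Its maximal truncation is $$T_\star f(x)=\sup_{t_1\le t_2,\ t_1,t_2\in\mathbb Z}\Big|\sum_{t_1<s\le t_2}K_s*f(x)\Big| .$$ **Theorem.** (i) For every $\alpha>0$ there is a constant $C$, depending only on $d$ and $\alpha$, such that for all $0<\varepsilon<1$ and all $\alpha$-families $\{K_s\}$ $$\|T_\star\|_{(1+\varepsilon,1+\varepsilon),\mathsf{sparse}}\le\frac C\varepsilon .$$ (ii) For measurable $\Omega:S^{d-1}\to\mathbb C$ with $\|\Omega\|_\infty\le1$ and $\int_{S^{d-1}}\Omega=0$ put $$T_{\Omega,\star}f(x)=\sup_{\delta>0}\Big|\int_{\delta<|t|<1/\delta}f(x-t)\frac{\Omega(t/|t|)}{|t|^d}\,dt\Big|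 ,$$ and let $\mathrm Mf(x)=\sup_{Q\ni x}\langle f\rangle_{1,Q}$ be the Hardy-Littlewood maximal function over cubes. There is a constant $C$, depending only on $d$, such that for every such $\Omega$ there is a $\frac1d$-family $\{K_s\}$ with $$T_{\Omega,\star}f(x)\le C\big(\mathrm Mf(x)+T_\star f(x)\big)\qquad\text{for all } f\in L^\infty_0(\mathbb R^d),\ x\in\mathbb R^d .$$ (iii) There is a constant $C$, depending only on $d$, such that for all $0<\varepsilon<1$ and all $\Omega$ as in (ii) $$\|T_{\Omega,\star}\|_{(1+\varepsilon,1+\varepsilon),\mathsf{sparse}}\le\frac C\varepsilon .$$ -/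

import Mathlib

open MeasureTheory
open scoped ENNReal NNReal FourierTransform Convolution

noncomputable section

namespace SparseMaxTrunc

/-- The space `ℝ^d`, with its Euclidean norm and Lebesgue measure. -/
abbrev Rd (d : ℕ) : Type := EuclideanSpace ℝ (Fin d)

/-- The norm `|x|_∞` on `ℝ^d`, i.e. the maximum of the `|x i|`. -/
def supNorm {d : ℕ} (x : Rd d) : ℝ := ‖(fun i => x i : Fin d → ℝ)‖

/-! ### Sparse collections and sparse bounds -/

/-- A cube of `ℝ^d` (sides parallel to the axes), given by its lower corner and its positive
side length. -/
structure Cube (d : ℕ) where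
  corner : Rd d
  side : ℝ
  side_pos : 0 < side

/-- The (half-open) set of points of a cube. -/
def Cube.toSet {d : ℕ} (Q : Cube d) : Set (Rd d) :=
  {x | ∀ i, Q.corner i ≤ x i ∧ x i < Q.corner i + Q.side}

/-- A countable collection `S` of cubes is `η`-sparse: there are pairwise disjoint measurable
`E Q ⊆ Q`, `Q ∈ S`, with `|E Q| ≥ η |Q|`. -/
def IsSparse {d : ℕ} (η : ℝ≥0) (S : Set (Cube d)) : Prop :=
  S.Countable ∧ ∃ E : Cube d → Set (Rd d),
    (∀ Q ∈ S, MeasurableSet (E Q) ∧ E Q ⊆ Q.toSet ∧ η * volume Q.toSet ≤ volume (E Q)) ∧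
    S.PairwiseDisjoint E

/-- The `p`-average `⟨f⟩_{p,Q} = ‖f 1_Q‖_p / |Q|^{1/p}`. -/
def avg {d : ℕ} (p : ℝ) (f : Rd d → ℂ) (Q : Cube d) : ℝ≥0∞ :=
  eLpNorm (Q.toSet.indicator f) (ENNReal.ofReal p) volume / volume Q.toSet ^ (1 / p)

/-- The space `L^∞_0(ℝ^d)` of complex-valued, (essentially) bounded and compactly supported
functions. -/
def LinftyZero {d : ℕ} (f : Rd d → ℂ) : Prop :=
  MemLp f ∞ volume ∧ HasCompactSupport f

/-- The operator `T`, with values in nonnegative functions, maps `L^∞_0(ℝ^d)` into locally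
integrable functions and has the sparse `(p₁, p₂)` bound with the constant `C`. Since `T f₁ ≥ 0`
and the right-hand side depends on `|f₂|` only, bounding `|⟨T f₁, f₂⟩|` for all `f₂` is the same
as bounding `∫ T f₁ |f₂|` for all `f₂`. -/
def HasSparseBound {d : ℕ} (T : (Rd d → ℂ) → Rd d → ℝ≥0∞) (p₁ p₂ : ℝ) (C : ℝ≥0) : Prop :=
  (∀ f, LinftyZero f → AEMeasurable (T f) volume ∧
    ∀ B : Set (Rd d), IsCompact B → ∫⁻ x in B, T f x < ∞) ∧
  ∀ f₁ f₂ : Rd d → ℂ, LinftyZero f₁ → LinftyZero f₂ →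
    ∃ S : Set (Cube d), IsSparse (1 / 2) S ∧
      ∫⁻ x, T f₁ x * ‖f₂ x‖ₑ ≤
        C * ∑' Q : S, volume (Q : Cube d).toSet * (avg p₁ f₁ Q * avg p₂ f₂ Q)

/-- The sparse norm `‖T‖_{(p₁,p₂),sparse}`: the infimum of the constants in the sparse `(p₁, p₂)`
bound (`∞` if there is none). -/
def sparseNorm {d : ℕ} (T : (Rd d → ℂ) → Rd d → ℝ≥0∞) (p₁ p₂ : ℝ) : ℝ≥0∞ :=
  ⨅ (C : ℝ≥0) (_ : HasSparseBound T p₁ p₂ C), (C : ℝ≥0∞)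

theorem HasSparseBound.mono {d : ℕ} {T : (Rd d → ℂ) → Rd d → ℝ≥0∞} {p₁ p₂ : ℝ} {C C' : ℝ≥0}
    (h : HasSparseBound T p₁ p₂ C) (hC : C ≤ C') : HasSparseBound T p₁ p₂ C' := by
  refine ⟨h.1, fun f₁ f₂ h₁ h₂ => ?_⟩
  obtain ⟨S, hS, hle⟩ := h.2 f₁ f₂ h₁ h₂
  exact ⟨S, hS, hle.trans (by gcongr)⟩

theorem HasSparseBound.sparseNorm_le {d : ℕ} {T : (Rd d → ℂ) → Rd d → ℝ≥0∞} {p₁ p₂ : ℝ}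
    {C : ℝ≥0} (h : HasSparseBound T p₁ p₂ C) : sparseNorm T p₁ p₂ ≤ C :=
  iInf₂_le C h

theorem hasSparseBound_of_sparseNorm_lt {d : ℕ} {T : (Rd d → ℂ) → Rd d → ℝ≥0∞} {p₁ p₂ : ℝ}
    {C : ℝ≥0} (h : sparseNorm T p₁ p₂ < C) : HasSparseBound T p₁ p₂ C := by
  simp only [sparseNorm, iInf_lt_iff] at h
  obtain ⟨C', h', hlt⟩ := h
  exact h'.mono (by exact_mod_cast hlt.le)

/-! ### The kernels and their maximal truncations -/

/-- The conditions on the family `{K_s}` with decay exponent `α`. The Fourier condition at `ξ = 0`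
reads `K̂_s(0) = 0`, because `0 ^ α = 0`. -/
structure IsKernelFamily {d : ℕ} (α : ℝ) (K : ℤ → Rd d → ℂ) : Prop where
  meas : ∀ s, AEStronglyMeasurable (K s) volume
  supp : ∀ s x, K s x ≠ 0 → (2 : ℝ) ^ (s - 4) < supNorm x ∧ supNorm x < (2 : ℝ) ^ (s - 2)
  bound : ∀ s, ∀ᵐ x, ‖K s x‖ ≤ (2 : ℝ) ^ (-(s * (d : ℤ)))
  fourier : ∀ s ξ, ‖𝓕 (K s) ξ‖ ≤ min (‖(2 : ℝ) ^ s • ξ‖ ^ α) (‖(2 : ℝ) ^ s • ξ‖ ^ (-α))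

/-- The truncated singular integral `T f(x, t₁, t₂) = ∑_{t₁ < s ≤ t₂} (K_s * f)(x)`. -/
def trunc {d : ℕ} (K : ℤ → Rd d → ℂ) (f : Rd d → ℂ) (x : Rd d) (t₁ t₂ : ℤ) : ℂ :=
  ∑ s ∈ Finset.Ioc t₁ t₂, (K s ⋆[ContinuousLinearMap.mul ℂ ℂ, volume] f) x

/-- The maximal truncation `T_⋆ f(x) = sup_{t₁ ≤ t₂} |T f(x, t₁, t₂)|`. -/
def maxTrunc {d : ℕ} (K : ℤ → Rd d → ℂ) (f : Rd d → ℂ) (x : Rd d) : ℝ≥0∞ :=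
  ⨆ (t₁ : ℤ) (t₂ : ℤ) (_ : t₁ ≤ t₂), ‖trunc K f x t₁ t₂‖ₑ

/-- The Hardy-Littlewood maximal function: the supremum of `⟨f⟩_{1,Q}` over cubes `Q ∋ x`. -/
def hlMax {d : ℕ} (f : Rd d → ℂ) (x : Rd d) : ℝ≥0∞ :=
  ⨆ (Q : Cube d) (_ : x ∈ Q.toSet), avg 1 f Q

/-! ### Rough singular integrals -/

/-- The unit sphere `S^{d-1}`. -/
abbrev UnitSphere (d : ℕ) : Type := Metric.sphere (0 : Rd d) 1

/-- The surface measure of the unit sphere. -/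
def surfaceMeasure (d : ℕ) : Measure (UnitSphere d) := (volume : Measure (Rd d)).toSphere

/-- The direction `t / |t|` of a nonzero vector. -/
def direction {d : ℕ} (t : Rd d) (ht : t ≠ 0) : UnitSphere d :=
  ⟨‖t‖⁻¹ • t, by
    rw [mem_sphere_zero_iff_norm, norm_smul, norm_inv, norm_norm,
      inv_mul_cancel₀ (norm_ne_zero_iff.mpr ht)]⟩

open Classical in
/-- The homogeneous kernel `Ω(t/|t|) / |t|^d` (set to `0` at the irrelevant point `t = 0`). -/
def roughKernel {d : ℕ} (Ω : UnitSphere d → ℂ) (t : Rd d) : ℂ :=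
  if ht : t = 0 then 0 else Ω (direction t ht) / ((‖t‖ ^ d : ℝ) : ℂ)

/-- The truncated rough singular integral
`T_{Ω,δ} f(x) = ∫_{δ < |t| < 1/δ} f(x - t) Ω(t/|t|) / |t|^d dt`. -/
def roughTrunc {d : ℕ} (Ω : UnitSphere d → ℂ) (δ : ℝ) (f : Rd d → ℂ) (x : Rd d) : ℂ :=
  ∫ t in {t : Rd d | δ < ‖t‖ ∧ ‖t‖ < 1 / δ}, f (x - t) * roughKernel Ω t

/-- The maximal rough singular integral `T_{Ω,⋆} f(x) = sup_{δ > 0} |T_{Ω,δ} f(x)|`. -/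
def roughMax {d : ℕ} (Ω : UnitSphere d → ℂ) (f : Rd d → ℂ) (x : Rd d) : ℝ≥0∞ :=
  ⨆ (δ : ℝ) (_ : 0 < δ), ‖roughTrunc Ω δ f x‖ₑ

/-- `Ω ∈ L^∞(S^{d-1})` with `‖Ω‖_∞ ≤ 1` and vanishing integral over the sphere. -/
structure IsRoughSymbol {d : ℕ} (Ω : UnitSphere d → ℂ) : Prop where
  meas : AEStronglyMeasurable Ω (surfaceMeasure d)
  bound : ∀ᵐ θ ∂(surfaceMeasure d), ‖Ω θ‖ ≤ 1
  mean_zero : ∫ θ, Ω θ ∂(surfaceMeasure d) = 0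

end SparseMaxTrunc

end

open MeasureTheory
open scoped ENNReal NNReal FourierTransform Convolution

noncomputable section

namespace SparseMaxTrunc

variable {d : ℕ}

/-! ### The maximum norm and the volume of cubes -/

/-! Fix `p = 1 + ε`. Everything is reduced to a bilinear inequality: `∫ T_⋆f₁ |f₂|` is at most `C/ε`
times the supremum of the sparse forms, `sparseSup`. A single sparse collection is then extracted at
the cost of a factor 2 (`hasSparseBound_of_le`).

Layers. The kernel `K_s` is mollified at the scales `2^(s-Δ)`, `Δ = 0, 2, 4, 8, …`, and telescoped
into layers. A layer of depth `Δ` has kernels that are Lipschitz with constant `2^Δ` relative to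
their scale. The Fourier decay makes the mollification errors small, so its maximal truncations have
norm `B ≲ 2^(-aΔ/2)` on `L²` (`smoothFamily_layer`). This `L²` bound is of Cotlar type
(`exists_lintegral_truncSup_sq_le`): the sum of the pieces above the level `t` is the mollification,
at scale `2^t`, of the sum of all the pieces, hence controlled by a maximal function, up to an error
whose multipliers are square summable in `t`.

One layer, locally (`SmoothFamily.lintegral_truncSup_le`). Replace `f₁` by its averages over
stopping cells. The difference has mean zero on the cells; pairing it with the smoothness of the
kernels gains geometrically once a cell is more than `Δ` generations below the scale, so all scales
together cost `Δ + 1`. The averaged function is bounded and its truncations are almost constant on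
the cells, so `f₂` may be averaged as well, and `L²` gives the factor `B`. This uses only `L¹`
averages, but it does not decay in `Δ`. Therefore both functions are cut at `t` times their
`p`-averages (`SmoothFamily.lintegral_truncSup_le_of_rpow`): every term with a tall factor gains
`t^(1-p) = t^(-ε)`, while the remaining term costs `B t` by `L²`. With `t = 2^(aΔ/4)` the layer
costs `(Δ + 1) 2^(-aεΔ/4)`. Summed over the lacunary depths this is `O(1/ε)` by Cauchy condensation;
over all integers `Δ` the same sum would be of order `1/ε²`.

From local to global (`SmoothFamily.setLIntegral_truncSup_le`). On a dyadic cube `Q` the scales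
above the stopping cells cost the product of the `p`-averages times `|Q|`. On at least half of `Q`
no stopping occurs before the bottom level, and there the bilinear maximal function is at least that
product. So the cost is charged to that half, and induction handles the stopping cells in the other
half. The charged sets are disjoint, and what is left is the integral of the bilinear maximal
function. This has a sparse bound because averages jump by a large factor only on small subsets
(`Grid.exists_sparse`); triples of dyadic cubes are handled through `3^d` shifted grids.

Rough kernels. The kernel is cut into dyadic shells in the maximum norm. The radial integral over a
shell is `log 2` in every direction, so each piece keeps mean zero (`integral_radial_shell`), and
smoothness in the radial direction alone gives the Fourier decay
(`NiceSymbol.enorm_fourier_shell_le`, `exists_lintegral_wideShell_le`). Euclidean truncations differ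
from the dyadic ones only where `|t|` is comparable to `δ` or `1/δ`, which costs `M f`. The last
sparse bound follows because `M` has a sparse bound with exponents 1. -/

theorem abs_apply_le_supNorm (x : Rd d) (i : Fin d) : |x i| ≤ supNorm x :=
  norm_le_pi_norm (fun i => x i : Fin d → ℝ) i

theorem supNorm_lt_iff {x : Rd d} {r : ℝ} (hr : 0 < r) : supNorm x < r ↔ ∀ i, |x i| < r :=
  pi_norm_lt_iff hr

theorem supNorm_le_iff {x : Rd d} {r : ℝ} (hr : 0 ≤ r) : supNorm x ≤ r ↔ ∀ i, |x i| ≤ r :=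
  pi_norm_le_iff_of_nonneg hr

theorem supNorm_nonneg (x : Rd d) : 0 ≤ supNorm x := norm_nonneg _

theorem supNorm_neg (x : Rd d) : supNorm (-x) = supNorm x :=
  norm_neg (fun i => x i : Fin d → ℝ)

theorem supNorm_sub_comm (x y : Rd d) : supNorm (x - y) = supNorm (y - x) := by
  rw [← supNorm_neg, neg_sub]

theorem supNorm_add_le (x y : Rd d) : supNorm (x + y) ≤ supNorm x + supNorm y :=
  norm_add_le (fun i => x i : Fin d → ℝ) (fun i => y i)

theorem supNorm_smul (c : ℝ) (x : Rd d) : supNorm (c • x) = |c| * supNorm x :=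
  norm_smul c (fun i => x i : Fin d → ℝ)

theorem continuous_supNorm : Continuous (supNorm : Rd d → ℝ) := by
  unfold supNorm
  fun_prop

theorem measurable_supNorm : Measurable (supNorm : Rd d → ℝ) := continuous_supNorm.measurable

theorem supNorm_le_norm (x : Rd d) : supNorm x ≤ ‖x‖ :=
  (supNorm_le_iff (norm_nonneg x)).2 fun i => PiLp.norm_apply_le x i

theorem norm_le_supNorm (x : Rd d) : ‖x‖ ≤ √d * supNorm x := by
  rw [EuclideanSpace.norm_eq]
  calc √(∑ i, ‖x i‖ ^ 2) ≤ √(∑ _i : Fin d, supNorm x ^ 2) := by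
        apply Real.sqrt_le_sqrt
        gcongr with i
        exact abs_apply_le_supNorm x i
    _ = √d * supNorm x := by
        simp [Real.sqrt_mul, Real.sqrt_sq (supNorm_nonneg x)]

theorem Cube.measurableSet_toSet (Q : Cube d) : MeasurableSet Q.toSet := by
  have : Q.toSet = ⋂ i, {x : Rd d | Q.corner i ≤ x i ∧ x i < Q.corner i + Q.side} := by
    ext x; simp [Cube.toSet]
  rw [this]
  refine MeasurableSet.iInter fun i => ?_
  have h : Measurable fun x : Rd d => x i := by fun_prop
  exact h measurableSet_Ico

theorem Cube.volume_toSet (Q : Cube d) : volume Q.toSet = ENNReal.ofReal Q.side ^ d := by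
  have h := (EuclideanSpace.volume_preserving_symm_measurableEquiv_toLp (Fin d)).symm
  have : Q.toSet = (MeasurableEquiv.toLp 2 (Fin d → ℝ)).symm ⁻¹'
      (Set.pi Set.univ fun i => Set.Ico (Q.corner i) (Q.corner i + Q.side)) := by
    ext x; simp [Cube.toSet, Set.mem_pi]
  rw [this, (EuclideanSpace.volume_preserving_symm_measurableEquiv_toLp (Fin d)).measure_preimage
    (MeasurableSet.univ_pi fun i => measurableSet_Ico).nullMeasurableSet, Real.volume_pi_Ico]
  simp

theorem Cube.volume_ne_zero (Q : Cube d) : volume Q.toSet ≠ 0 := by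
  rw [Q.volume_toSet]
  exact pow_ne_zero _ (by simpa using Q.side_pos)

theorem Cube.volume_ne_top (Q : Cube d) : volume Q.toSet ≠ ∞ := by
  rw [Q.volume_toSet]; simp

/-! ### Grids -/

/-- A nested system of partitions of `ℝ^d` into cubes. -/
structure Grid (d : ℕ) where
  idx : ℤ → Rd d → (Fin d → ℤ)
  cube : ℤ → (Fin d → ℤ) → Cube d
  mem_iff : ∀ j n x, x ∈ (cube j n).toSet ↔ idx j x = n
  nested : ∀ j x y, idx j x = idx j y → idx (j + 1) x = idx (j + 1) y

namespace Grid

variable (G : Grid d)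

/-- The cell of level `j` that contains `x`. -/
def cell (j : ℤ) (x : Rd d) : Set (Rd d) := {y | G.idx j y = G.idx j x}

theorem cell_eq (j : ℤ) (x : Rd d) : G.cell j x = (G.cube j (G.idx j x)).toSet := by
  ext y; exact (G.mem_iff j _ y).symm

theorem mem_cell {j : ℤ} {x y : Rd d} : y ∈ G.cell j x ↔ G.idx j y = G.idx j x := Iff.rfl

theorem self_mem_cell (j : ℤ) (x : Rd d) : x ∈ G.cell j x := rfl

theorem cell_congr {j : ℤ} {x y : Rd d} (h : G.idx j y = G.idx j x) : G.cell j y = G.cell j x := by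
  simp [cell, h]

theorem measurableSet_cell (j : ℤ) (x : Rd d) : MeasurableSet (G.cell j x) :=
  G.cell_eq j x ▸ Cube.measurableSet_toSet _

theorem volume_cell_ne_zero (j : ℤ) (x : Rd d) : volume (G.cell j x) ≠ 0 :=
  G.cell_eq j x ▸ Cube.volume_ne_zero _

theorem volume_cell_ne_top (j : ℤ) (x : Rd d) : volume (G.cell j x) ≠ ∞ :=
  G.cell_eq j x ▸ Cube.volume_ne_top _

theorem idx_mono {i j : ℤ} (hij : i ≤ j) {x y : Rd d} (h : G.idx i x = G.idx i y) :
    G.idx j x = G.idx j y := by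
  induction j, hij using Int.leInduction with
  | base => exact h
  | succ j _ ih => exact G.nested j x y ih

theorem cell_mono {i j : ℤ} (hij : i ≤ j) (x : Rd d) : G.cell i x ⊆ G.cell j x :=
  fun _ hy => G.idx_mono hij hy

theorem measurable_idx (j : ℤ) : Measurable (G.idx j) := by
  refine measurable_to_countable' fun n => ?_
  have : G.idx j ⁻¹' {n} = (G.cube j n).toSet := by
    ext y; exact (G.mem_iff j n y).symm
  rw [this]
  exact Cube.measurableSet_toSet _

/-- There are only countably many cells of level `j`, and any preimage is a union of such cells. -/
theorem measurable_of_idx {β : Type*} [MeasurableSpace β] {j : ℤ} {u : Rd d → β}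
    (h : ∀ x y, G.idx j x = G.idx j y → u x = u y) : Measurable u := by
  classical
  intro s hs
  have : u ⁻¹' s = G.idx j ⁻¹' (G.idx j '' (u ⁻¹' s)) := by
    ext x
    constructor
    · exact fun hx => ⟨x, hx, rfl⟩
    · rintro ⟨y, hy, hxy⟩
      simpa [← h y x hxy] using hy
  rw [this]
  exact G.measurable_idx j (Set.to_countable _).measurableSet

/-- A function `σ` picking the level of a cell at each point, in such a way that the cells
picked form a partition. -/
def IsStopping (σ : Rd d → ℤ) : Prop := ∀ x y, G.idx (σ x) y = G.idx (σ x) x → σ y = σ x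

/-- The average of `F` over the cell picked by `σ`. -/
def avgσ (σ : Rd d → ℤ) (F : Rd d → ℝ≥0∞) (x : Rd d) : ℝ≥0∞ :=
  (volume (G.cell (σ x) x))⁻¹ * ∫⁻ y in G.cell (σ x) x, F y

variable {G} {σ : Rd d → ℤ}

/-- The label of the cell picked by `σ` at `x`. -/
def lab (G : Grid d) (σ : Rd d → ℤ) (x : Rd d) : ℤ × (Fin d → ℤ) := (σ x, G.idx (σ x) x)

/-- The fibres of the label are exactly the cells picked by `σ`. Since labels are countable,
integrals split into countable sums over these cells. -/
theorem IsStopping.lab_eq_iff (hσ : G.IsStopping σ) {x y : Rd d} :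
    lab G σ y = lab G σ x ↔ y ∈ G.cell (σ x) x := by
  constructor
  · intro h
    have h1 : σ y = σ x := congrArg Prod.fst h
    have h2 : G.idx (σ y) y = G.idx (σ x) x := congrArg Prod.snd h
    rw [h1] at h2
    exact h2
  · intro h
    have h1 : σ y = σ x := hσ x y h
    simp only [lab, h1, Prod.mk.injEq, true_and]
    exact h

theorem IsStopping.measurable (hσ : G.IsStopping σ) : Measurable σ := by
  refine measurable_to_countable' fun j => ?_
  have : σ ⁻¹' {j} = ⋃ n ∈ {n | ∃ x, σ x = j ∧ G.idx j x = n}, (G.cube j n).toSet := by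
    ext x
    simp only [Set.mem_preimage, Set.mem_singleton_iff, Set.mem_ofPred_eq, Set.mem_iUnion,
      exists_prop, G.mem_iff]
    constructor
    · exact fun h => ⟨_, ⟨x, h, rfl⟩, rfl⟩
    · rintro ⟨n, ⟨y, hy, rfl⟩, h⟩
      subst hy
      exact hσ y x h
  rw [this]
  exact MeasurableSet.biUnion (Set.to_countable _) fun _ _ => Cube.measurableSet_toSet _

theorem IsStopping.measurable_lab (hσ : G.IsStopping σ) : Measurable (lab G σ) := by
  refine measurable_to_countable' fun c => ?_
  by_cases h : ∃ x, lab G σ x = c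
  · obtain ⟨x, rfl⟩ := h
    have : lab G σ ⁻¹' {lab G σ x} = G.cell (σ x) x := by
      ext y; exact hσ.lab_eq_iff
    rw [this]
    exact G.measurableSet_cell _ _
  · have : lab G σ ⁻¹' {c} = ∅ := by
      ext y; simpa using fun hy => h ⟨y, hy⟩
    simp [this]

theorem IsStopping.cell_eq_of_mem (hσ : G.IsStopping σ) {x y : Rd d} (h : y ∈ G.cell (σ x) x) :
    G.cell (σ y) y = G.cell (σ x) x := by
  rw [hσ x y h]
  exact G.cell_congr h

theorem IsStopping.const (j : ℤ) : G.IsStopping fun _ => j := fun _ _ _ => rfl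

theorem IsStopping.avgσ_congr (hσ : G.IsStopping σ) (F : Rd d → ℝ≥0∞) {x y : Rd d}
    (h : y ∈ G.cell (σ x) x) : G.avgσ σ F y = G.avgσ σ F x := by
  simp only [avgσ, hσ.cell_eq_of_mem h]

theorem IsStopping.measurable_of_lab {β : Type*} [MeasurableSpace β] (hσ : G.IsStopping σ)
    {u : Rd d → β} (h : ∀ x, ∀ y ∈ G.cell (σ x) x, u y = u x) : Measurable u := by
  intro s hs
  have : u ⁻¹' s = lab G σ ⁻¹' (lab G σ '' (u ⁻¹' s)) := by
    ext x
    constructor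
    · exact fun hx => ⟨x, hx, rfl⟩
    · rintro ⟨y, hy, hxy⟩
      have := h x y (hσ.lab_eq_iff.1 hxy)
      simpa [← this] using hy
  rw [this]
  exact hσ.measurable_lab (Set.to_countable _).measurableSet

theorem IsStopping.measurable_avgσ (hσ : G.IsStopping σ) (F : Rd d → ℝ≥0∞) :
    Measurable (G.avgσ σ F) :=
  hσ.measurable_of_lab fun _ _ hy => hσ.avgσ_congr F hy

/-- The integral as a sum over the cells of the partition. -/
theorem IsStopping.lintegral_eq_tsum (hσ : G.IsStopping σ) (F : Rd d → ℝ≥0∞) :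
    ∫⁻ x, F x = ∑' c : ℤ × (Fin d → ℤ), ∫⁻ x in lab G σ ⁻¹' {c}, F x := by
  rw [← lintegral_iUnion (fun c => hσ.measurable_lab (MeasurableSet.singleton c))]
  · rw [← Set.preimage_iUnion, Set.iUnion_singleton_eq_range, Set.range_id', Set.preimage_univ,
      Measure.restrict_univ]
  · intro a b hab
    exact Disjoint.preimage _ (by simpa using hab)

/-- Averaging over the cells of a partition is self-adjoint. -/
theorem IsStopping.lintegral_avgσ_mul (hσ : G.IsStopping σ) (F U : Rd d → ℝ≥0∞)
    (hF : Measurable F) (hU : Measurable U) :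
    ∫⁻ x, G.avgσ σ F x * U x = ∫⁻ x, F x * G.avgσ σ U x := by
  rw [hσ.lintegral_eq_tsum, hσ.lintegral_eq_tsum (fun x => F x * _)]
  congr 1
  ext c
  by_cases h : ∃ x, lab G σ x = c
  · obtain ⟨x, rfl⟩ := h
    have : lab G σ ⁻¹' {lab G σ x} = G.cell (σ x) x := by
      ext y; exact hσ.lab_eq_iff
    rw [this]
    have e1 : ∫⁻ y in G.cell (σ x) x, G.avgσ σ F y * U y =
        ∫⁻ y in G.cell (σ x) x, G.avgσ σ F x * U y :=
      setLIntegral_congr_fun (G.measurableSet_cell _ _) fun y hy => by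
        simp only [hσ.avgσ_congr F hy]
    have e2 : ∫⁻ y in G.cell (σ x) x, F y * G.avgσ σ U y =
        ∫⁻ y in G.cell (σ x) x, F y * G.avgσ σ U x :=
      setLIntegral_congr_fun (G.measurableSet_cell _ _) fun y hy => by
        simp only [hσ.avgσ_congr U hy]
    rw [e1, e2, lintegral_const_mul _ hU, lintegral_mul_const _ hF]
    simp only [avgσ]
    ring
  · have : lab G σ ⁻¹' {c} = ∅ := by
      ext y; simpa using fun hy => h ⟨y, hy⟩
    simp [this]

/-- The average over the cell of level `j`. -/
def avg (G : Grid d) (j : ℤ) (F : Rd d → ℝ≥0∞) (x : Rd d) : ℝ≥0∞ := G.avgσ (fun _ => j) F x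

theorem avg_congr (F : Rd d → ℝ≥0∞) {j : ℤ} {x y : Rd d} (h : G.idx j x = G.idx j y) :
    G.avg j F x = G.avg j F y :=
  (IsStopping.const j).avgσ_congr F h

theorem avg_def (j : ℤ) (F : Rd d → ℝ≥0∞) (x : Rd d) :
    G.avg j F x = (volume (G.cell j x))⁻¹ * ∫⁻ y in G.cell j x, F y := rfl

theorem measurable_avg (j : ℤ) (F : Rd d → ℝ≥0∞) : Measurable (G.avg j F) :=
  (IsStopping.const j).measurable_avgσ F

/-- The average over the sets that are unions of cells. -/
theorem setLIntegral_avg (j : ℤ) (F : Rd d → ℝ≥0∞) (hF : Measurable F) {A : Set (Rd d)}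
    (hA : ∀ x y, G.idx j x = G.idx j y → x ∈ A → y ∈ A) :
    ∫⁻ x in A, G.avg j F x = ∫⁻ x in A, F x := by
  classical
  have hAm : MeasurableSet A := by
    have : Measurable fun x => (x ∈ A : Prop) :=
      G.measurable_of_idx (j := j) fun x y h => propext ⟨hA x y h, hA y x h.symm⟩
    exact measurableSet_setOfPred.2 this
  -- Averaging fixes the indicator of a union of cells, so self-adjointness moves the average off
  -- `F`.
  have h1 : ∀ x, G.avg j (A.indicator 1) x = A.indicator 1 x := by
    intro x
    by_cases hx : x ∈ A
    · have : ∫⁻ y in G.cell j x, A.indicator (1 : Rd d → ℝ≥0∞) y = volume (G.cell j x) := by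
        rw [setLIntegral_congr_fun (G.measurableSet_cell _ _) (g := fun _ => 1)]
        · simp
        · intro y hy
          simp [hA x y hy.symm hx]
      rw [avg_def, this, ENNReal.inv_mul_cancel (G.volume_cell_ne_zero _ _)
        (G.volume_cell_ne_top _ _)]
      simp [hx]
    · have : ∫⁻ y in G.cell j x, A.indicator (1 : Rd d → ℝ≥0∞) y = 0 := by
        rw [setLIntegral_congr_fun (G.measurableSet_cell _ _) (g := fun _ => 0)]
        · simp
        · intro y hy
          have : y ∉ A := fun h => hx (hA y x hy h)
          simp [this]
      rw [avg_def, this]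
      simp [hx]
  have h2 := (IsStopping.const (G := G) j).lintegral_avgσ_mul F (A.indicator 1) hF
    (measurable_one.indicator hAm)
  have h3 : ∀ x, G.avgσ (fun _ => j) (A.indicator 1) x = A.indicator 1 x := h1
  simp only [h3] at h2
  have h4 : ∀ u : Rd d → ℝ≥0∞, ∫⁻ x, u x * A.indicator 1 x = ∫⁻ x in A, u x := by
    intro u
    rw [← lintegral_indicator hAm]
    congr 1; ext x
    by_cases hx : x ∈ A <;> simp [hx]
  rw [h4, h4] at h2
  exact h2

/-- The maximal function over the cells of level at most `n`. -/
def maxAvg (G : Grid d) (n : ℤ) (F : Rd d → ℝ≥0∞) (x : Rd d) : ℝ≥0∞ :=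
  ⨆ (j : ℤ) (_ : j ≤ n), G.avg j F x

theorem measurable_maxAvg (n : ℤ) (F : Rd d → ℝ≥0∞) : Measurable (G.maxAvg n F) :=
  Measurable.iSup fun j => Measurable.iSup fun _ => G.measurable_avg j F

/-- For functions of the level `j ≤ n` that are constant on the cells, the points where some value
is large split according to the largest such level. -/
theorem exists_max_level {n : ℤ} {P : ℤ → Prop} (h : ∃ j ≤ n, P j) :
    ∃ j ≤ n, P j ∧ ∀ i ≤ n, j < i → ¬ P i := by
  classical
  obtain ⟨j, ⟨hj, hP⟩, hmax⟩ := Int.exists_greatest_of_bdd (P := fun j => j ≤ n ∧ P j)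
    ⟨n, fun z hz => hz.1⟩ h
  exact ⟨j, hj, hP, fun i hi hji hPi => by have := hmax i ⟨hi, hPi⟩; omega⟩

/-- The weak type `(1,1)` inequality. -/
theorem weak_type (n : ℤ) (F : Rd d → ℝ≥0∞) (hF : Measurable F) (r : ℝ≥0∞) :
    r * volume {x | r < G.maxAvg n F x} ≤ ∫⁻ x, F x := by
  -- Points are sorted by the largest level at which the average exceeds `r`; it exists because
  -- levels are bounded by `n`. Each `A j` is a union of cells of level `j`, on which the average
  -- may be replaced by `F`.
  set A : ℤ → Set (Rd d) := fun j =>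
    {x | (j ≤ n ∧ r < G.avg j F x) ∧ ∀ i ≤ n, j < i → ¬ r < G.avg i F x} with hAdef
  have hsat : ∀ j x y, G.idx j x = G.idx j y → x ∈ A j → y ∈ A j := by
    rintro j x y h ⟨⟨h1, h2⟩, h3⟩
    refine ⟨⟨h1, avg_congr F h ▸ h2⟩, fun i hi hji => ?_⟩
    rw [← avg_congr F (G.idx_mono hji.le h)]
    exact h3 i hi hji
  have hAm : ∀ j, MeasurableSet (A j) := fun j => by
    have : Measurable fun x => (x ∈ A j : Prop) :=
      G.measurable_of_idx (j := j) fun x y h => propext ⟨hsat j x y h, hsat j y x h.symm⟩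
    exact measurableSet_setOfPred.2 this
  have hdisj : Pairwise (Function.onFun Disjoint A) := by
    intro i j hij
    refine Set.disjoint_left.2 ?_
    rintro x ⟨⟨h1, h2⟩, h3⟩ ⟨⟨h1', h2'⟩, h3'⟩
    rcases lt_or_gt_of_ne hij with h | h
    · exact h3 j h1' h h2'
    · exact h3' i h1 h h2
  have hU : {x | r < G.maxAvg n F x} = ⋃ j, A j := by
    ext x
    simp only [Set.mem_ofPred_eq, maxAvg, lt_iSup_iff, Set.mem_iUnion, exists_prop]
    constructor
    · intro h
      obtain ⟨j, hj, hP, hmax⟩ := exists_max_level h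
      exact ⟨j, ⟨hj, hP⟩, hmax⟩
    · rintro ⟨j, ⟨h1, h2⟩, -⟩
      exact ⟨j, h1, h2⟩
  calc r * volume {x | r < G.maxAvg n F x} = ∑' j, r * volume (A j) := by
        rw [hU, measure_iUnion hdisj hAm, ENNReal.tsum_mul_left]
    _ ≤ ∑' j, ∫⁻ x in A j, F x := by
        refine ENNReal.tsum_le_tsum fun j => ?_
        rw [← setLIntegral_avg j F hF (hsat j), ← setLIntegral_const]
        exact setLIntegral_mono (G.measurable_avg j F) fun x hx => hx.1.2.le
    _ = ∫⁻ x in ⋃ j, A j, F x := (lintegral_iUnion hAm hdisj F).symm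
    _ ≤ ∫⁻ x, F x := setLIntegral_le_lintegral _ _

end Grid

/-! ### The dyadic grid and its shifts -/

/-- The grid of cubes of side `w 2^j`, where the corners at level `j` are shifted by
`(-1)^j 2^j r`, for `w ∈ {1, 3}`. -/
def shiftGrid (w c : ℕ) (h : w * c = 3) (r : Fin d → ℤ) : Grid d where
  idx j x i := ⌊(x i / 2 ^ j - (j.negOnePow : ℤ) * r i) / w⌋
  cube j n :=
    { corner := WithLp.toLp 2 fun i => (w * n i + (j.negOnePow : ℤ) * r i) * 2 ^ j
      side := w * 2 ^ j
      side_pos := by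
        have : 0 < w := Nat.pos_of_ne_zero fun h0 => by simp [h0] at h
        positivity }
  mem_iff j n x := by
    have hw : (0 : ℝ) < w := by
      have : 0 < w := Nat.pos_of_ne_zero fun h0 => by simp [h0] at h
      exact_mod_cast this
    have h2 : (0 : ℝ) < 2 ^ j := by positivity
    simp only [Cube.toSet, Set.mem_ofPred_eq, funext_iff, Int.floor_eq_iff]
    refine forall_congr' fun i => and_congr ?_ ?_
    · rw [le_div_iff₀ hw, le_sub_iff_add_le, le_div_iff₀ h2, mul_comm (n i : ℝ)]
    · rw [div_lt_iff₀ hw, sub_lt_iff_lt_add, div_lt_iff₀ h2]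
      constructor <;> intro h <;> refine h.trans_le (le_of_eq ?_) <;> ring
  nested j x y hxy := by
    have hw0 : 0 < w := Nat.pos_of_ne_zero fun h0 => by simp [h0] at h
    have hw : (0 : ℝ) < w := by exact_mod_cast hw0
    -- The shifts at the levels `j` and `j + 1` differ by `-3 (-1)^j 2^j r`. As `w * c = 3`, this is
    -- an integer multiple of the side `w 2^j`, so the larger cells are unions of smaller ones.
    have key : ∀ z : Rd d, ∀ i, ⌊(z i / 2 ^ (j + 1) - ((j + 1).negOnePow : ℤ) * r i) / w⌋ =
        (⌊(z i / 2 ^ j - (j.negOnePow : ℤ) * r i) / w⌋ + c * ((j.negOnePow : ℤ) * r i)) / 2 := by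
      intro z i
      have hc : ((w : ℝ) * c) = 3 := by exact_mod_cast h
      have e1 : (z i / 2 ^ (j + 1) - ((j + 1).negOnePow : ℤ) * r i) / w =
          ((z i / 2 ^ j - (j.negOnePow : ℤ) * r i) / w +
            (c * ((j.negOnePow : ℤ) * r i) : ℤ)) / (2 : ℕ) := by
        rw [Int.negOnePow_succ, zpow_add₀ (by norm_num)]
        push_cast
        field_simp
        linear_combination (-(2 ^ j * ((j.negOnePow : ℤ) : ℝ) * r i) : ℝ) * hc
      rw [e1, Int.floor_div_natCast, Int.floor_add_intCast]
      simp
    funext i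
    rw [key, key]
    have := congrFun hxy i
    rw [this]

/-- The standard dyadic grid. -/
def dyadic (d : ℕ) : Grid d := shiftGrid 1 3 rfl 0

/-- The grid of triple dyadic cubes labelled by `r`. -/
def triGrid (r : Fin d → Fin 3) : Grid d := shiftGrid 3 1 rfl fun i => (r i : ℤ)

theorem dyadic_idx (j : ℤ) (x : Rd d) (i : Fin d) : (dyadic d).idx j x i = ⌊x i / 2 ^ j⌋ := by
  simp [dyadic, shiftGrid]

theorem dyadic_idx_succ (j : ℤ) (x : Rd d) (i : Fin d) :
    (dyadic d).idx (j + 1) x i = (dyadic d).idx j x i / 2 := by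
  rw [dyadic_idx, dyadic_idx, zpow_add₀ (by norm_num), zpow_one, ← div_div]
  have := Int.floor_div_natCast (x i / 2 ^ j) 2
  simpa using this

/-- The measure of a dyadic cube of side `2 ^ j`. -/
def cellVol (d : ℕ) (j : ℤ) : ℝ≥0∞ := ENNReal.ofReal (2 ^ j) ^ d

theorem cellVol_ne_zero (j : ℤ) : cellVol d j ≠ 0 :=
  pow_ne_zero _ (by simpa using zpow_pos (by norm_num) _)

theorem cellVol_ne_top (j : ℤ) : cellVol d j ≠ ∞ := by simp [cellVol]

theorem cellVol_succ (j : ℤ) : cellVol d (j + 1) = 2 ^ d * cellVol d j := by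
  rw [cellVol, cellVol, ← mul_pow, zpow_add₀ (by norm_num), zpow_one, mul_comm,
    ENNReal.ofReal_mul (by norm_num)]
  simp

theorem volume_dyadic_cell (j : ℤ) (x : Rd d) : volume ((dyadic d).cell j x) = cellVol d j := by
  rw [Grid.cell_eq, Cube.volume_toSet]
  simp [dyadic, shiftGrid, cellVol]

/-- The union of a dyadic cube of side `2 ^ j` and its neighbours. -/
def tri (j : ℤ) (x : Rd d) : Set (Rd d) :=
  {y | ∀ i, |(dyadic d).idx j y i - (dyadic d).idx j x i| ≤ 1}

theorem mem_tri {j : ℤ} {x y : Rd d} :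
    y ∈ tri j x ↔ ∀ i, |(dyadic d).idx j y i - (dyadic d).idx j x i| ≤ 1 := Iff.rfl

theorem mem_tri_comm {j : ℤ} {x y : Rd d} : y ∈ tri j x ↔ x ∈ tri j y := by
  simp only [mem_tri, abs_sub_comm]

theorem cell_subset_tri (j : ℤ) (x : Rd d) : (dyadic d).cell j x ⊆ tri j x := by
  intro y hy i
  rw [(dyadic d).mem_cell.1 hy]
  simp

theorem tri_congr {j : ℤ} {x y : Rd d} (h : (dyadic d).idx j x = (dyadic d).idx j y) :
    tri j x = tri j y := by
  simp [tri, h]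

/-- Triples of dyadic cubes belong to one of the shifted grids. -/
theorem exists_tri_eq_cell (j : ℤ) (x : Rd d) :
    ∃ r : Fin d → Fin 3, tri j x = (triGrid r).cell j x := by
  -- The first index of a triple is `n - 1`; its residue modulo 3, with the sign `(-1)^j` of the
  -- shift, selects the grid.
  have h1 : ∀ n : ℤ, ∃ r : Fin 3, ∃ l : ℤ, n - 1 = 3 * l + (j.negOnePow : ℤ) * (r : ℤ) := by
    intro n
    rcases Int.units_eq_one_or j.negOnePow with h | h
    · rw [h]
      refine ⟨⟨((n - 1) % 3).toNat, by omega⟩, (n - 1) / 3, ?_⟩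
      simp only [Units.val_one]
      omega
    · rw [h]
      refine ⟨⟨((-(n - 1)) % 3).toNat, by omega⟩, -((-(n - 1)) / 3), ?_⟩
      simp only [Units.val_neg, Units.val_one]
      omega
  choose r l hrl using fun i => h1 ((dyadic d).idx j x i)
  refine ⟨r, ?_⟩
  have h2 : ∀ y : Rd d, ∀ i, (triGrid r).idx j y i = l i ↔
      |(dyadic d).idx j y i - (dyadic d).idx j x i| ≤ 1 := by
    intro y i
    have e1 : (triGrid r).idx j y i =
        ((dyadic d).idx j y i - (j.negOnePow : ℤ) * (r i : ℤ)) / 3 := by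
      rw [dyadic_idx]
      simp only [triGrid, shiftGrid]
      have := Int.floor_div_natCast
        (y i / 2 ^ j - (((j.negOnePow : ℤ) * (r i : ℤ) : ℤ) : ℝ)) 3
      rw [Int.floor_sub_intCast] at this
      simpa using this
    rw [e1, abs_le]
    have := hrl i
    omega
  have h3 : (triGrid r).idx j x = l := funext fun i => (h2 x i).2 (by simp)
  ext y
  rw [mem_tri, Grid.mem_cell, h3, funext_iff]
  exact forall_congr' fun i => (h2 y i).symm

theorem volume_tri (j : ℤ) (x : Rd d) : volume (tri j x) = 3 ^ d * cellVol d j := by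
  obtain ⟨r, hr⟩ := exists_tri_eq_cell j x
  rw [hr, Grid.cell_eq, Cube.volume_toSet]
  simp [triGrid, shiftGrid, cellVol, mul_pow, ENNReal.ofReal_mul]

theorem measurableSet_tri (j : ℤ) (x : Rd d) : MeasurableSet (tri j x) := by
  obtain ⟨r, hr⟩ := exists_tri_eq_cell j x
  rw [hr]
  exact Grid.measurableSet_cell _ _ _

theorem volume_tri_ne_zero (j : ℤ) (x : Rd d) : volume (tri j x) ≠ 0 := by
  rw [volume_tri]; exact mul_ne_zero (by simp) (cellVol_ne_zero j)

theorem volume_tri_ne_top (j : ℤ) (x : Rd d) : volume (tri j x) ≠ ∞ := by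
  rw [volume_tri]; exact ENNReal.mul_ne_top (by simp) (cellVol_ne_top j)

/-- The average over the triple of the dyadic cube of side `2 ^ j` at `x`. -/
def triAvg (j : ℤ) (F : Rd d → ℝ≥0∞) (x : Rd d) : ℝ≥0∞ :=
  (volume (tri j x))⁻¹ * ∫⁻ y in tri j x, F y

theorem triAvg_congr (F : Rd d → ℝ≥0∞) {j : ℤ} {x y : Rd d}
    (h : (dyadic d).idx j x = (dyadic d).idx j y) : triAvg j F x = triAvg j F y := by
  simp [triAvg, tri_congr h]

theorem measurable_triAvg (j : ℤ) (F : Rd d → ℝ≥0∞) : Measurable (triAvg j F) :=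
  (dyadic d).measurable_of_idx (j := j) fun _ _ h => triAvg_congr F h

theorem exists_triAvg_eq (j : ℤ) (x : Rd d) :
    ∃ r : Fin d → Fin 3, ∀ F, triAvg j F x = (triGrid r).avg j F x := by
  obtain ⟨r, hr⟩ := exists_tri_eq_cell j x
  exact ⟨r, fun F => by rw [triAvg, Grid.avg_def, hr]⟩

/-- Every triple is a cell of one of the `3 ^ d` shifted grids, so the weak type inequalities of
these grids add up. -/
theorem volume_lt_triAvg (n : ℤ) (F : Rd d → ℝ≥0∞) (hF : Measurable F) (r : ℝ≥0∞) :
    r * volume {x | ∃ j ≤ n, r < triAvg j F x} ≤ 3 ^ d * ∫⁻ x, F x := by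
  have hsub : {x | ∃ j ≤ n, r < triAvg j F x} ⊆
      ⋃ c : Fin d → Fin 3, {x | r < (triGrid c).maxAvg n F x} := by
    rintro x ⟨j, hj, hlt⟩
    obtain ⟨c, hc⟩ := exists_triAvg_eq j x
    rw [hc] at hlt
    exact Set.mem_iUnion.2 ⟨c, hlt.trans_le
      (le_iSup₂ (f := fun i (_ : i ≤ n) => (triGrid c).avg i F x) j hj)⟩
  calc r * volume {x | ∃ j ≤ n, r < triAvg j F x}
      ≤ r * ∑ c : Fin d → Fin 3, volume {x | r < (triGrid c).maxAvg n F x} := by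
        gcongr
        exact (measure_mono hsub).trans (measure_iUnion_fintype_le _ _)
    _ = ∑ c : Fin d → Fin 3, r * volume {x | r < (triGrid c).maxAvg n F x} := Finset.mul_sum _ _ _
    _ ≤ ∑ _c : Fin d → Fin 3, ∫⁻ x, F x := by
        gcongr with c
        exact (triGrid c).weak_type n F hF r
    _ = 3 ^ d * ∫⁻ x, F x := by simp

/-! ### The maximal function on `L²` -/

/-- Interpolation between weak type `(1,1)` and `L^∞`: at height `t` only the part of `F` above
`t/2` matters, and the layer cake formula integrates the levels. The constant is `8 = 2 · 2 · 2`,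
from the layer cake formula, the height `t/2` and the range `t < 2F`. The bound `M` serves only to
keep everything finite. -/
theorem Grid.lintegral_maxAvg_sq (G : Grid d) (n : ℤ) (F : Rd d → ℝ≥0∞) (hF : Measurable F)
    {M : ℝ≥0∞} (hM : M ≠ ∞) (hFM : ∀ x, F x ≤ M) :
    ∫⁻ x, G.maxAvg n F x ^ 2 ≤ 8 * ∫⁻ x, F x ^ 2 := by
  have havg : ∀ j x (U : Rd d → ℝ≥0∞) (c : ℝ≥0∞), (∀ y, U y ≤ c) → G.avg j U x ≤ c := by
    intro j x U c hU
    rw [Grid.avg_def]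
    calc (volume (G.cell j x))⁻¹ * ∫⁻ y in G.cell j x, U y
        ≤ (volume (G.cell j x))⁻¹ * ∫⁻ _y in G.cell j x, c := by gcongr; exact hU _
      _ = c := by
          rw [setLIntegral_const, mul_comm c, ← mul_assoc,
            ENNReal.inv_mul_cancel (G.volume_cell_ne_zero _ _) (G.volume_cell_ne_top _ _), one_mul]
  have hmax : ∀ x, G.maxAvg n F x ≤ M := fun x => iSup₂_le fun j _ => havg j x F M hFM
  have hfin : ∀ x, G.maxAvg n F x ≠ ∞ := fun x => ne_top_of_le_ne_top hM (hmax x)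
  have hlevel : ∀ t : ℝ, 0 < t → ENNReal.ofReal t * volume {x | t < (G.maxAvg n F x).toReal} ≤
      2 * ∫⁻ x in {x | ENNReal.ofReal t < 2 * F x}, F x := by
    intro t ht
    set s := ENNReal.ofReal t with hs
    have hs0 : s / 2 + s / 2 = s := ENNReal.add_halves s
    set U : Rd d → ℝ≥0∞ := {x | s < 2 * F x}.indicator F with hU
    have hmeas : MeasurableSet {x | s < 2 * F x} :=
      measurableSet_lt measurable_const (hF.const_mul 2)
    have hUm : Measurable U := hF.indicator hmeas
    have hFU : ∀ y, F y ≤ U y + s / 2 := by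
      intro y
      by_cases hy : s < 2 * F y
      · simp [hU, hy]
      · have : F y ≤ s / 2 := by
          rw [ENNReal.le_div_iff_mul_le (by simp) (by simp), mul_comm]
          exact not_lt.1 hy
        exact this.trans (by simp)
    have hsub : {x | t < (G.maxAvg n F x).toReal} ⊆ {x | s / 2 < G.maxAvg n U x} := by
      intro x hx
      have hx' : s < G.maxAvg n F x := (ENNReal.ofReal_lt_iff_lt_toReal ht.le (hfin x)).2 hx
      obtain ⟨j, hj, hlt⟩ : ∃ j, ∃ _ : j ≤ n, s < G.avg j F x := by
        simpa [Grid.maxAvg, lt_iSup_iff] using hx'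
      have h1 : G.avg j F x ≤ G.avg j U x + s / 2 := by
        rw [Grid.avg_def, Grid.avg_def]
        calc (volume (G.cell j x))⁻¹ * ∫⁻ y in G.cell j x, F y
            ≤ (volume (G.cell j x))⁻¹ * ∫⁻ y in G.cell j x, (U y + s / 2) := by
              gcongr; exact hFU _
          _ = _ := by
              rw [lintegral_add_left hUm, setLIntegral_const, mul_add, mul_comm (s / 2),
                ← mul_assoc _ _ (s / 2), ENNReal.inv_mul_cancel (G.volume_cell_ne_zero _ _)
                (G.volume_cell_ne_top _ _), one_mul]
      have h2 : s / 2 < G.avg j U x := by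
        by_contra hcon
        have := hlt.trans_le (h1.trans (add_le_add_left (not_lt.1 hcon) _))
        rw [hs0] at this
        exact lt_irrefl _ this
      exact h2.trans_le (le_iSup₂ (f := fun i (_ : i ≤ n) => G.avg i U x) j hj)
    have hw := G.weak_type n U hUm (s / 2)
    calc s * volume {x | t < (G.maxAvg n F x).toReal}
        ≤ s * volume {x | s / 2 < G.maxAvg n U x} := by gcongr
      _ = 2 * (s / 2 * volume {x | s / 2 < G.maxAvg n U x}) := by
          rw [← mul_assoc, two_mul (s / 2), hs0]
      _ ≤ 2 * ∫⁻ x, U x := by gcongr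
      _ = 2 * ∫⁻ x in {x | s < 2 * F x}, F x := by rw [hU, lintegral_indicator hmeas]
  have hlayer := lintegral_rpow_eq_lintegral_meas_lt_mul (volume : Measure (Rd d))
    (f := fun x => (G.maxAvg n F x).toReal) (Filter.Eventually.of_forall fun _ => by simp)
    (G.measurable_maxAvg n F).ennreal_toReal.aemeasurable (p := 2) (by norm_num)
  have e0 : ∀ x, ENNReal.ofReal ((G.maxAvg n F x).toReal ^ (2 : ℝ)) = G.maxAvg n F x ^ 2 := by
    intro x
    rw [← ENNReal.ofReal_rpow_of_nonneg (by simp) (by norm_num), ENNReal.ofReal_toReal (hfin x)]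
    norm_cast
  simp only [e0] at hlayer
  rw [hlayer]
  have hjm : Measurable fun p : ℝ × Rd d =>
      ({p : ℝ × Rd d | ENNReal.ofReal p.1 < 2 * F p.2}.indicator (fun p => F p.2) p) := by
    refine Measurable.indicator (hF.comp measurable_snd) ?_
    exact measurableSet_lt (by fun_prop) ((hF.comp measurable_snd).const_mul 2)
  calc ENNReal.ofReal 2 * ∫⁻ t in Set.Ioi (0 : ℝ),
        volume {x | t < (G.maxAvg n F x).toReal} * ENNReal.ofReal (t ^ ((2 : ℝ) - 1))
      ≤ ENNReal.ofReal 2 * ∫⁻ t in Set.Ioi (0 : ℝ),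
          2 * ∫⁻ x in {x | ENNReal.ofReal t < 2 * F x}, F x := by
        refine mul_le_mul_right (setLIntegral_mono' measurableSet_Ioi fun t ht => ?_) _
        have : (t : ℝ) ^ ((2 : ℝ) - 1) = t := by norm_num
        rw [this, mul_comm]
        exact hlevel t ht
    _ = 4 * ∫⁻ t in Set.Ioi (0 : ℝ), ∫⁻ x,
          {p : ℝ × Rd d | ENNReal.ofReal p.1 < 2 * F p.2}.indicator (fun p => F p.2) (t, x) := by
        rw [lintegral_const_mul' _ _ (by simp), ← mul_assoc]
        congr 1
        · rw [show (4 : ℝ≥0∞) = 2 * 2 by norm_num]; simp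
        · refine setLIntegral_congr_fun measurableSet_Ioi fun t _ => ?_
          rw [← lintegral_indicator (measurableSet_lt measurable_const (hF.const_mul 2))]
          rfl
    _ = 4 * ∫⁻ x, ∫⁻ t in Set.Ioi (0 : ℝ),
          {p : ℝ × Rd d | ENNReal.ofReal p.1 < 2 * F p.2}.indicator (fun p => F p.2) (t, x) := by
        rw [lintegral_lintegral_swap]
        exact hjm.aemeasurable
    _ ≤ 4 * ∫⁻ x, F x * (2 * F x) := by
        gcongr with x
        have hFx : F x ≠ ∞ := ne_top_of_le_ne_top hM (hFM x)
        calc ∫⁻ t in Set.Ioi (0 : ℝ),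
              {p : ℝ × Rd d | ENNReal.ofReal p.1 < 2 * F p.2}.indicator (fun p => F p.2) (t, x)
            = ∫⁻ t in Set.Ioi (0 : ℝ), (Set.Iio (2 * F x).toReal).indicator (fun _ => F x) t := by
              refine setLIntegral_congr_fun measurableSet_Ioi fun t ht => ?_
              have hiff : ENNReal.ofReal t < 2 * F x ↔ t < (2 * F x).toReal :=
                ENNReal.ofReal_lt_iff_lt_toReal (le_of_lt ht)
                  (ENNReal.mul_ne_top (by simp) hFx)
              simp [Set.indicator, hiff]
          _ ≤ F x * (2 * F x) := by
              rw [lintegral_indicator measurableSet_Iio, setLIntegral_const,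
                Measure.restrict_apply measurableSet_Iio, Set.inter_comm, Set.Ioi_inter_Iio,
                Real.volume_Ioo, sub_zero, ENNReal.ofReal_toReal
                (ENNReal.mul_ne_top (by simp) hFx)]
    _ = 8 * ∫⁻ x, F x ^ 2 := by
        rw [← lintegral_const_mul' _ _ (by simp), ← lintegral_const_mul' _ _ (by simp)]
        congr 1; ext x; ring

theorem lintegral_iSup_triAvg_sq (n : ℤ) (F : Rd d → ℝ≥0∞) (hF : Measurable F)
    {M : ℝ≥0∞} (hM : M ≠ ∞) (hFM : ∀ x, F x ≤ M) :
    ∫⁻ x, (⨆ (j : ℤ) (_ : j ≤ n), triAvg j F x) ^ 2 ≤ 8 * 3 ^ d * ∫⁻ x, F x ^ 2 := by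
  calc ∫⁻ x, (⨆ (j : ℤ) (_ : j ≤ n), triAvg j F x) ^ 2
      ≤ ∫⁻ x, ∑ c : Fin d → Fin 3, (triGrid c).maxAvg n F x ^ 2 := by
        refine lintegral_mono fun x => ?_
        have h1 : (⨆ (j : ℤ) (_ : j ≤ n), triAvg j F x) ≤
            Finset.univ.sup fun c : Fin d → Fin 3 => (triGrid c).maxAvg n F x := by
          refine iSup₂_le fun j hj => ?_
          obtain ⟨c, hc⟩ := exists_triAvg_eq j x
          rw [hc]
          exact (le_iSup₂ (f := fun i (_ : i ≤ n) => (triGrid c).avg i F x) j hj).trans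
            (Finset.le_sup (f := fun c : Fin d → Fin 3 => (triGrid c).maxAvg n F x)
              (Finset.mem_univ c))
        obtain ⟨c, -, hc⟩ := Finset.exists_mem_eq_sup (Finset.univ : Finset (Fin d → Fin 3))
          Finset.univ_nonempty (fun c => (triGrid c).maxAvg n F x)
        rw [hc] at h1
        calc _ ≤ (triGrid c).maxAvg n F x ^ 2 := by gcongr
          _ ≤ _ := Finset.single_le_sum (f := fun c => (triGrid c).maxAvg n F x ^ 2)
              (fun _ _ => zero_le) (Finset.mem_univ c)
    _ = ∑ c : Fin d → Fin 3, ∫⁻ x, (triGrid c).maxAvg n F x ^ 2 :=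
        lintegral_finsetSum _ fun c _ => ((triGrid c).measurable_maxAvg n F).pow_const 2
    _ ≤ ∑ _c : Fin d → Fin 3, 8 * ∫⁻ x, F x ^ 2 := by
        gcongr with c
        exact (triGrid c).lintegral_maxAvg_sq n F hF hM hFM
    _ = _ := by simp; ring

/-! ### Sparse domination of dyadic maximal functions -/

/-- The supremum of the sparse forms of two functions. -/
def sparseSup (p : ℝ) (f₁ f₂ : Rd d → ℂ) : ℝ≥0∞ :=
  ⨆ (S : Set (Cube d)) (_ : IsSparse (1 / 2) S),
    ∑' Q : S, volume (Q : Cube d).toSet * (SparseMaxTrunc.avg p f₁ Q * SparseMaxTrunc.avg p f₂ Q)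

/-- A quantity attached to cubes, the large values of which on subcubes are taken on small sets,
is dominated by its sum over two sparse collections. -/
theorem Grid.exists_sparse (G : Grid d) (n : ℤ) (b : Cube d → ℝ≥0∞) {R : ℝ≥0∞} (hR1 : 1 < R)
    (hR : R ≠ ∞)
    (hgap : ∀ j ≤ n, ∀ x, 2 * volume (G.cell j x ∩
      {y | ∃ i ≤ j, R * b (G.cube j (G.idx j x)) < b (G.cube i (G.idx i y))}) ≤
        volume (G.cell j x))
    (hfin : ∀ x, (⨆ (j : ℤ) (_ : j ≤ n), b (G.cube j (G.idx j x))) ≠ ∞) :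
    ∃ S : Fin 2 → Set (Cube d), (∀ e, IsSparse (1 / 2) (S e)) ∧
      ∀ x, (⨆ (j : ℤ) (_ : j ≤ n), b (G.cube j (G.idx j x))) ≤
        ∑ e, ∑' Q : S e, R * (Q : Cube d).toSet.indicator (fun _ => b Q) x := by
  classical
  have hR0 : R ≠ 0 := (zero_lt_one.trans hR1).ne'
  -- The triple `(j, index, k)` records a cell with `R^k < b ≤ R^(k+1)` such that no larger cell
  -- around it, up to level `n`, exceeds `R^k`. The collections are separated by the parity of `k`.
  set P : Fin 2 → ℤ × (Fin d → ℤ) × ℤ → Prop := fun e q =>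
    q.1 ≤ n ∧ q.2.2 % 2 = (e : ℕ) ∧ R ^ q.2.2 < b (G.cube q.1 q.2.1) ∧
      b (G.cube q.1 q.2.1) ≤ R ^ (q.2.2 + 1) ∧
      ∀ i ≤ n, q.1 < i → ∀ x ∈ (G.cube q.1 q.2.1).toSet, b (G.cube i (G.idx i x)) ≤ R ^ q.2.2
    with hP
  set S : Fin 2 → Set (Cube d) := fun e => {Q | ∃ q, P e q ∧ G.cube q.1 q.2.1 = Q} with hS
  refine ⟨S, fun e => ?_, fun x => ?_⟩
  · have hne : ∀ Q : Cube d, ∃ q : ℤ × (Fin d → ℤ) × ℤ, Q ∈ S e → P e q ∧ G.cube q.1 q.2.1 = Q := by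
      intro Q
      by_cases h : Q ∈ S e
      · obtain ⟨q, hq⟩ := h
        exact ⟨q, fun _ => hq⟩
      · exact ⟨(0, 0, 0), fun h' => absurd h' h⟩
    choose q hq using hne
    -- From `Q` with exponent `k` remove the points lying in some cell of no larger level with `b >
    -- R^(k+2)`. Since `R b(Q) ≤ R^(k+2)`, `hgap` shows that at most half of `Q` is lost.
    refine ⟨?_, fun Q => Q.toSet \ {y | ∃ i ≤ (q Q).1,
      R ^ ((q Q).2.2 + 2) < b (G.cube i (G.idx i y))}, fun Q hQ => ⟨?_, Set.sdiff_subset, ?_⟩, ?_⟩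
    · have : S e = (fun q : ℤ × (Fin d → ℤ) × ℤ => G.cube q.1 q.2.1) '' {q | P e q} := by
        ext Q; simp [hS]
      rw [this]
      exact (Set.to_countable _).image _
    · refine Q.measurableSet_toSet.diff ?_
      have : {y | ∃ i ≤ (q Q).1, R ^ ((q Q).2.2 + 2) < b (G.cube i (G.idx i y))} =
          ⋃ i, ⋃ (_ : i ≤ (q Q).1), {y | R ^ ((q Q).2.2 + 2) < b (G.cube i (G.idx i y))} := by
        ext y; simp
      rw [this]
      refine MeasurableSet.iUnion fun i => MeasurableSet.iUnion fun _ => ?_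
      have hm : Measurable fun y => b (G.cube i (G.idx i y)) :=
        G.measurable_of_idx (j := i) fun x y h => by rw [h]
      exact measurableSet_lt measurable_const hm
    · obtain ⟨⟨h1, h2, h3, h4, h5⟩, h6⟩ := hq Q hQ
      obtain ⟨x, hx⟩ : Q.toSet.Nonempty := by
        by_contra h
        rw [Set.not_nonempty_iff_eq_empty] at h
        exact Q.volume_ne_zero (by simp [h])
      have hidx : G.idx (q Q).1 x = (q Q).2.1 := by
        rw [← G.mem_iff, h6]; exact hx
      have hcell : G.cell (q Q).1 x = Q.toSet := by rw [G.cell_eq, hidx, h6]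
      have hg := hgap (q Q).1 h1 x
      rw [hcell, hidx, h6] at hg
      set B := {y | ∃ i ≤ (q Q).1, R ^ ((q Q).2.2 + 2) < b (G.cube i (G.idx i y))} with hB
      have hsub : Q.toSet ∩ B ⊆
          Q.toSet ∩ {y | ∃ i ≤ (q Q).1, R * b Q < b (G.cube i (G.idx i y))} := by
        rintro y ⟨hy, i, hi, hlt⟩
        refine ⟨hy, i, hi, lt_of_le_of_lt ?_ hlt⟩
        calc R * b Q ≤ R * R ^ ((q Q).2.2 + 1) := by rw [h6] at h4; gcongr
          _ = R ^ ((q Q).2.2 + 2) := by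
              rw [show (q Q).2.2 + 2 = 1 + ((q Q).2.2 + 1) by ring,
                ENNReal.zpow_add hR0 hR 1, zpow_one]
      have h2B : 2 * volume (Q.toSet ∩ B) ≤ volume Q.toSet :=
        (mul_le_mul_right (measure_mono hsub) 2).trans hg
      have hsplit : volume Q.toSet ≤ volume (Q.toSet ∩ B) + volume (Q.toSet \ B) := by
        calc volume Q.toSet = volume ((Q.toSet ∩ B) ∪ (Q.toSet \ B)) := by
              rw [Set.inter_union_sdiff]
          _ ≤ _ := measure_union_le _ _
      have hhalf : volume (Q.toSet ∩ B) ≤ volume Q.toSet / 2 := by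
        rw [ENNReal.le_div_iff_mul_le (by simp) (by simp), mul_comm]
        exact h2B
      have h7 : volume Q.toSet / 2 ≤ volume (Q.toSet \ B) := by
        have h8 : volume Q.toSet / 2 + volume Q.toSet / 2 ≤
            volume Q.toSet / 2 + volume (Q.toSet \ B) := by
          rw [ENNReal.add_halves]
          exact hsplit.trans (by gcongr)
        exact (ENNReal.add_le_add_iff_left
          (ENNReal.div_ne_top Q.volume_ne_top (by simp))).1 h8
      refine le_trans (le_of_eq ?_) h7
      rw [ENNReal.div_eq_inv_mul]
      congr 1
      simp
    · intro Q hQ Q' hQ' hne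
      -- If `Q` is strictly below `Q'` and they meet, maximality of `Q` forces a strictly larger
      -- exponent; by equal parity it is larger by at least 2, so `Q` was removed from `Q'`.
      have main : ∀ Q ∈ S e, ∀ Q' ∈ S e, Q ≠ Q' → (q Q).1 ≤ (q Q').1 →
          Disjoint (Q.toSet \ {y | ∃ i ≤ (q Q).1, R ^ ((q Q).2.2 + 2) < b (G.cube i (G.idx i y))})
            (Q'.toSet \ {y | ∃ i ≤ (q Q').1,
              R ^ ((q Q').2.2 + 2) < b (G.cube i (G.idx i y))}) := by
        intro Q hQ Q' hQ' hne hle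
        obtain ⟨⟨h1, h2, h3, h4, h5⟩, h6⟩ := hq Q hQ
        obtain ⟨⟨h1', h2', h3', h4', h5'⟩, h6'⟩ := hq Q' hQ'
        refine Set.disjoint_left.2 ?_
        rintro y ⟨hy, -⟩ ⟨hy', hyB⟩
        have hi : G.idx (q Q).1 y = (q Q).2.1 := by rw [← G.mem_iff, h6]; exact hy
        have hi' : G.idx (q Q').1 y = (q Q').2.1 := by rw [← G.mem_iff, h6']; exact hy'
        rcases hle.eq_or_lt with heq | hlt
        · apply hne
          rw [← h6, ← h6', ← hi, ← hi', heq]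
        · apply hyB
          refine ⟨(q Q).1, hle, ?_⟩
          rw [hi]
          refine lt_of_le_of_lt ?_ h3
          have h9 := h5 (q Q').1 h1' hlt y (by rw [h6]; exact hy)
          rw [hi'] at h9
          have h10 : R ^ (q Q').2.2 < R ^ (q Q).2.2 := h3'.trans_le h9
          have h11 : (q Q').2.2 < (q Q).2.2 := by
            by_contra hcon
            exact absurd (ENNReal.zpow_le_of_le hR1.le (not_lt.1 hcon)) (not_le.2 h10)
          exact ENNReal.zpow_le_of_le hR1.le (by omega)
      rcases le_total (q Q).1 (q Q').1 with h | h
      · exact main Q hQ Q' hQ' hne h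
      · exact (main Q' hQ' Q hQ hne.symm h).symm
  · set v := ⨆ (j : ℤ) (_ : j ≤ n), b (G.cube j (G.idx j x)) with hv
    rcases eq_or_ne v 0 with h0 | h0
    · rw [h0]; exact zero_le
    -- With `R^k < v ≤ R^(k+1)`, the largest cell around `x` with `b > R^k` is selected, and there
    -- `v ≤ R b`.
    obtain ⟨k, hk1, hk2⟩ := ENNReal.exists_mem_Ioc_zpow h0 (hfin x) hR1 hR
    obtain ⟨j, hj, hPj, hmax⟩ := exists_max_level (n := n)
      (P := fun j => R ^ k < b (G.cube j (G.idx j x))) (by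
        simpa only [hv, lt_iSup_iff, exists_prop] using hk1)
    set Q := G.cube j (G.idx j x) with hQ
    have hbQ : b Q ≤ v := le_iSup₂ (f := fun j (_ : j ≤ n) => b (G.cube j (G.idx j x))) j hj
    have hxQ : x ∈ Q.toSet := (G.mem_iff _ _ _).2 rfl
    set e : Fin 2 := ⟨(k % 2).toNat, by omega⟩ with he
    have hQS : Q ∈ S e := by
      refine ⟨(j, G.idx j x, k), ⟨hj, by simp [he]; omega, hPj, hbQ.trans hk2, ?_⟩, rfl⟩
      intro i hi hji y hy
      have : G.idx j y = G.idx j x := (G.mem_iff _ _ _).1 hy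
      rw [G.idx_mono hji.le this]
      exact not_lt.1 (hmax i hi hji)
    calc v ≤ R * b Q := by
          refine hk2.trans ?_
          rw [add_comm, ENNReal.zpow_add hR0 hR 1, zpow_one]
          gcongr
      _ = R * Q.toSet.indicator (fun _ => b Q) x := by simp [hxQ]
      _ ≤ ∑' Q : S e, R * (Q : Cube d).toSet.indicator (fun _ => b Q) x :=
          ENNReal.le_tsum (f := fun Q : S e => R * (Q : Cube d).toSet.indicator (fun _ => b Q) x)
            ⟨Q, hQS⟩
      _ ≤ _ := Finset.single_le_sum
          (f := fun e => ∑' Q : S e, R * (Q : Cube d).toSet.indicator (fun _ => b Q) x)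
          (fun _ _ => zero_le) (Finset.mem_univ e)

theorem avg_eq {p : ℝ} (hp : 0 < p) (f : Rd d → ℂ) (Q : Cube d) :
    SparseMaxTrunc.avg p f Q =
      ((volume Q.toSet)⁻¹ * ∫⁻ y in Q.toSet, ‖f y‖ₑ ^ p) ^ (1 / p) := by
  rw [SparseMaxTrunc.avg, eLpNorm_indicator_eq_eLpNorm_restrict Q.measurableSet_toSet,
    eLpNorm_eq_lintegral_rpow_enorm_toReal (by simpa using hp) (by simp),
    ENNReal.toReal_ofReal hp.le, ENNReal.div_eq_inv_mul,
    ENNReal.mul_rpow_of_nonneg _ _ (by positivity), ENNReal.inv_rpow]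

namespace Grid

variable (G : Grid d)

theorem avg_cube_eq {p : ℝ} (hp : 0 < p) (f : Rd d → ℂ) (j : ℤ) (x : Rd d) :
    SparseMaxTrunc.avg p f (G.cube j (G.idx j x)) = (G.avg j (fun y => ‖f y‖ₑ ^ p) x) ^ (1 / p) := by
  rw [avg_eq hp, Grid.avg_def, G.cell_eq]

/-- Averages over subcubes are large only on a small set. -/
theorem volume_avg_gap {p : ℝ} (hp : 1 ≤ p) {f : Rd d → ℂ} (hf : Measurable f) (j : ℤ) (x : Rd d)
    (hint : ∫⁻ y in G.cell j x, ‖f y‖ₑ ^ p ≠ ∞) :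
    4 * volume (G.cell j x ∩ {y | ∃ i ≤ j, 4 * SparseMaxTrunc.avg p f (G.cube j (G.idx j x)) <
      SparseMaxTrunc.avg p f (G.cube i (G.idx i y))}) ≤ volume (G.cell j x) := by
  have hp0 : 0 < p := by linarith
  set F : Rd d → ℝ≥0∞ := fun y => ‖f y‖ₑ ^ p with hF
  have hFm : Measurable F := hf.enorm.pow_const p
  set U := (G.cell j x).indicator F with hU
  have hUm : Measurable U := hFm.indicator (G.measurableSet_cell j x)
  set m := G.avg j F x with hm
  have hvol := G.volume_cell_ne_zero j x
  have hvolt := G.volume_cell_ne_top j x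
  have hmint : m * volume (G.cell j x) = ∫⁻ y in G.cell j x, F y := by
    rw [hm, Grid.avg_def, mul_comm, ← mul_assoc, ENNReal.mul_inv_cancel hvol hvolt, one_mul]
  have hmtop : m ≠ ∞ := ENNReal.mul_ne_top (ENNReal.inv_ne_top.2 hvol) hint
  -- After raising to the power `p` the threshold is `4^p m`, with `m` the average of `|f|^p`. Cells
  -- of level at most `j` inside the given cell do not see the rest of `f`, so the weak type
  -- inequality applies to the localized function.
  have hsub : G.cell j x ∩ {y | ∃ i ≤ j, 4 * SparseMaxTrunc.avg p f (G.cube j (G.idx j x)) <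
      SparseMaxTrunc.avg p f (G.cube i (G.idx i y))} ⊆ {y | 4 ^ p * m < G.maxAvg j U y} := by
    rintro y ⟨hy, i, hi, hlt⟩
    rw [G.avg_cube_eq hp0, G.avg_cube_eq hp0] at hlt
    have h1 : 4 ^ p * m < G.avg i F y := by
      have h2 := ENNReal.rpow_lt_rpow hlt hp0
      rwa [ENNReal.mul_rpow_of_nonneg _ _ hp0.le, ← ENNReal.rpow_mul, ← ENNReal.rpow_mul,
        one_div_mul_cancel hp0.ne', ENNReal.rpow_one, ENNReal.rpow_one] at h2
    refine h1.trans_le ?_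
    have h3 : G.avg i F y = G.avg i U y := by
      rw [Grid.avg_def, Grid.avg_def]
      congr 1
      refine setLIntegral_congr_fun (G.measurableSet_cell _ _) fun z hz => ?_
      have : z ∈ G.cell j x := by
        rw [← G.cell_congr hy]
        exact G.cell_mono hi y hz
      simp [hU, this]
    rw [h3]
    exact le_iSup₂ (f := fun i (_ : i ≤ j) => G.avg i U y) i hi
  -- The weak type inequality at height 0 says nothing, but then `f` vanishes almost everywhere on
  -- the cell and no average is positive.
  rcases eq_or_ne m 0 with h0 | h0
  · have hzero : ∫⁻ y, U y = 0 := by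
      rw [hU, lintegral_indicator (G.measurableSet_cell j x), ← hmint, h0, zero_mul]
    have hempty : {y | 4 ^ p * m < G.maxAvg j U y} = ∅ := by
      ext y
      simp only [h0, mul_zero, Set.mem_ofPred_eq, Set.mem_empty_iff_false, iff_false, not_lt]
      refine iSup₂_le fun i _ => ?_
      rw [Grid.avg_def]
      have : ∫⁻ z in G.cell i y, U z = 0 :=
        le_antisymm ((setLIntegral_le_lintegral _ _).trans hzero.le) zero_le
      simp [this]
    rw [Set.subset_empty_iff.1 (hsub.trans hempty.subset)]
    simp
  · have hw := G.weak_type j U hUm (4 ^ p * m)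
    rw [hU, lintegral_indicator (G.measurableSet_cell j x), ← hmint] at hw
    have h4 : (4 : ℝ≥0∞) ≤ 4 ^ p := by
      calc (4 : ℝ≥0∞) = 4 ^ (1 : ℝ) := by simp
        _ ≤ 4 ^ p := ENNReal.rpow_le_rpow_of_exponent_le (by norm_num) hp
    have h5 : m * (4 * volume (G.cell j x ∩ {y | ∃ i ≤ j,
        4 * SparseMaxTrunc.avg p f (G.cube j (G.idx j x)) <
          SparseMaxTrunc.avg p f (G.cube i (G.idx i y))})) ≤ m * volume (G.cell j x) := by
      refine le_trans ?_ hw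
      rw [← mul_assoc, mul_comm m 4]
      exact mul_le_mul' (mul_le_mul_left h4 m) (measure_mono hsub)
    exact (ENNReal.mul_le_mul_iff_right h0 hmtop).1 h5

theorem exists_lt_of_mul_lt {a b a' b' : ℝ≥0∞} (h : 16 * (a * b) < a' * b') :
    4 * a < a' ∨ 4 * b < b' := by
  by_contra hcon
  simp only [not_or, not_lt] at hcon
  refine absurd h (not_lt.2 ?_)
  calc a' * b' ≤ (4 * a) * (4 * b) := by gcongr <;> tauto
    _ = 16 * (a * b) := by ring

theorem avg_le_of_bound {p : ℝ} (hp : 0 < p) {f : Rd d → ℂ} {M : ℝ≥0∞} (hM : ∀ x, ‖f x‖ₑ ≤ M)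
    (Q : Cube d) : SparseMaxTrunc.avg p f Q ≤ M := by
  rw [avg_eq hp]
  calc ((volume Q.toSet)⁻¹ * ∫⁻ y in Q.toSet, ‖f y‖ₑ ^ p) ^ (1 / p)
      ≤ ((volume Q.toSet)⁻¹ * ∫⁻ _y in Q.toSet, M ^ p) ^ (1 / p) := by
        gcongr; exact hM _
    _ = M := by
        rw [setLIntegral_const, mul_comm (M ^ p), ← mul_assoc,
          ENNReal.inv_mul_cancel Q.volume_ne_zero Q.volume_ne_top, one_mul, ← ENNReal.rpow_mul,
          mul_one_div_cancel hp.ne', ENNReal.rpow_one]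

/-- The bilinear maximal function over the cells of a grid is controlled by sparse forms. -/
theorem lintegral_maxProd_le {p : ℝ} (hp : 1 ≤ p) {f₁ f₂ : Rd d → ℂ} (hf₁ : Measurable f₁)
    (hf₂ : Measurable f₂) {M : ℝ≥0∞} (hM : M ≠ ∞) (h₁ : ∀ x, ‖f₁ x‖ₑ ≤ M) (h₂ : ∀ x, ‖f₂ x‖ₑ ≤ M)
    (n : ℤ) :
    ∫⁻ x, (⨆ (j : ℤ) (_ : j ≤ n), SparseMaxTrunc.avg p f₁ (G.cube j (G.idx j x)) *
      SparseMaxTrunc.avg p f₂ (G.cube j (G.idx j x))) ≤ 32 * sparseSup p f₁ f₂ := by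
  have hp0 : 0 < p := by linarith
  have hint : ∀ f : Rd d → ℂ, (∀ x, ‖f x‖ₑ ≤ M) → ∀ j x,
      ∫⁻ y in G.cell j x, ‖f y‖ₑ ^ p ≠ ∞ := by
    intro f hf j x
    refine ne_top_of_le_ne_top (b := ∫⁻ _y in G.cell j x, M ^ p) ?_ ?_
    · rw [setLIntegral_const]
      exact ENNReal.mul_ne_top (ENNReal.rpow_ne_top_of_nonneg hp0.le hM) (G.volume_cell_ne_top _ _)
    · gcongr; exact hf _
  -- A product grows by `16 = 4 · 4` only if one factor grows by 4. Each of these events fills at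
  -- most a quarter of the cell, together at most half. Two parity classes then give `32 = 2 · 16`.
  obtain ⟨S, hS, hdom⟩ := G.exists_sparse n
    (fun Q => SparseMaxTrunc.avg p f₁ Q * SparseMaxTrunc.avg p f₂ Q) (R := 16) (by norm_num)
    (by norm_num) (fun j _ x => by
      have g1 := G.volume_avg_gap hp hf₁ j x (hint f₁ h₁ j x)
      have g2 := G.volume_avg_gap hp hf₂ j x (hint f₂ h₂ j x)
      set A := G.cell j x ∩ {y | ∃ i ≤ j, 4 * SparseMaxTrunc.avg p f₁ (G.cube j (G.idx j x)) <
        SparseMaxTrunc.avg p f₁ (G.cube i (G.idx i y))}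
      set B := G.cell j x ∩ {y | ∃ i ≤ j, 4 * SparseMaxTrunc.avg p f₂ (G.cube j (G.idx j x)) <
        SparseMaxTrunc.avg p f₂ (G.cube i (G.idx i y))}
      have hsub : G.cell j x ∩ {y | ∃ i ≤ j, 16 * (SparseMaxTrunc.avg p f₁ (G.cube j (G.idx j x)) *
          SparseMaxTrunc.avg p f₂ (G.cube j (G.idx j x))) <
          SparseMaxTrunc.avg p f₁ (G.cube i (G.idx i y)) *
          SparseMaxTrunc.avg p f₂ (G.cube i (G.idx i y))} ⊆ A ∪ B := by
        rintro y ⟨hy, i, hi, hlt⟩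
        rcases exists_lt_of_mul_lt hlt with h | h
        · exact Or.inl ⟨hy, i, hi, h⟩
        · exact Or.inr ⟨hy, i, hi, h⟩
      have h3 : 2 * (2 * (volume A + volume B)) ≤ 2 * volume (G.cell j x) := by
        calc 2 * (2 * (volume A + volume B)) = 4 * volume A + 4 * volume B := by ring
          _ ≤ volume (G.cell j x) + volume (G.cell j x) := add_le_add g1 g2
          _ = 2 * volume (G.cell j x) := (two_mul _).symm
      have h4 := (ENNReal.mul_le_mul_iff_right (by simp) (by simp)).1 h3
      refine le_trans ?_ h4
      gcongr
      exact (measure_mono hsub).trans (measure_union_le _ _))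
    (fun x => ne_top_of_le_ne_top (ENNReal.mul_ne_top hM hM) (iSup₂_le fun j _ =>
      mul_le_mul' (avg_le_of_bound hp0 h₁ _) (avg_le_of_bound hp0 h₂ _)))
  calc _ ≤ ∫⁻ x, ∑ e, ∑' Q : S e, 16 * (Q : Cube d).toSet.indicator
          (fun _ => SparseMaxTrunc.avg p f₁ Q * SparseMaxTrunc.avg p f₂ Q) x :=
        lintegral_mono hdom
    _ = ∑ e, ∑' Q : S e, 16 * (volume (Q : Cube d).toSet *
          (SparseMaxTrunc.avg p f₁ Q * SparseMaxTrunc.avg p f₂ Q)) := by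
        have hm : ∀ Q : Cube d, Measurable fun x => 16 * Q.toSet.indicator
          (fun _ => SparseMaxTrunc.avg p f₁ Q * SparseMaxTrunc.avg p f₂ Q) x :=
          fun Q => (measurable_const.indicator Q.measurableSet_toSet).const_mul 16
        rw [lintegral_finsetSum]
        · congr 1; ext e
          have : Countable (S e) := (hS e).1.to_subtype
          rw [lintegral_tsum fun Q : S e => (hm Q).aemeasurable]
          congr 1; ext Q
          rw [lintegral_const_mul' _ _ (by simp), lintegral_indicator (Q : Cube d).measurableSet_toSet,
            setLIntegral_const]
          ring
        · intro e _
          have : Countable (S e) := (hS e).1.to_subtype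
          exact Measurable.tsum fun Q : S e => hm Q
    _ ≤ ∑ _e : Fin 2, 16 * sparseSup p f₁ f₂ := by
        gcongr with e
        rw [ENNReal.tsum_mul_left]
        gcongr
        exact le_iSup₂ (f := fun (S : Set (Cube d)) (_ : IsSparse (1 / 2) S) =>
          ∑' Q : S, volume (Q : Cube d).toSet *
            (SparseMaxTrunc.avg p f₁ Q * SparseMaxTrunc.avg p f₂ Q)) (S e) (hS e)
    _ = 32 * sparseSup p f₁ f₂ := by
        rw [Finset.sum_const]; simp; ring

/-- The maximal function over the cells of a grid has a sparse bound. -/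
theorem lintegral_maxAvg_mul_le {f₁ f₂ : Rd d → ℂ} (hf₁ : Measurable f₁)
    (hf₂ : Measurable f₂) {M : ℝ≥0∞} (hM : M ≠ ∞) (h₁ : ∀ x, ‖f₁ x‖ₑ ≤ M) (n : ℤ) :
    ∫⁻ x, G.maxAvg n (fun y => ‖f₁ y‖ₑ) x * ‖f₂ x‖ₑ ≤ 8 * sparseSup 1 f₁ f₂ := by
  have hint : ∀ j x, ∫⁻ y in G.cell j x, ‖f₁ y‖ₑ ^ (1 : ℝ) ≠ ∞ := by
    intro j x
    refine ne_top_of_le_ne_top (b := ∫⁻ _y in G.cell j x, M ^ (1 : ℝ)) ?_ ?_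
    · rw [setLIntegral_const]
      exact ENNReal.mul_ne_top (by simpa) (G.volume_cell_ne_top _ _)
    · gcongr; exact h₁ _
  obtain ⟨S, hS, hdom⟩ := G.exists_sparse n
    (fun Q => SparseMaxTrunc.avg 1 f₁ Q) (R := 4) (by norm_num)
    (by norm_num) (fun j _ x => by
      refine le_trans ?_ (G.volume_avg_gap le_rfl hf₁ j x (hint j x))
      gcongr
      norm_num)
    (fun x => ne_top_of_le_ne_top hM (iSup₂_le fun j _ => avg_le_of_bound one_pos h₁ _))
  have hrew : ∀ x, G.maxAvg n (fun y => ‖f₁ y‖ₑ) x =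
      ⨆ (j : ℤ) (_ : j ≤ n), SparseMaxTrunc.avg 1 f₁ (G.cube j (G.idx j x)) := by
    intro x
    simp only [maxAvg, G.avg_cube_eq one_pos]
    simp
  simp only [hrew]
  calc _ ≤ ∫⁻ x, ∑ e, ∑' Q : S e, 4 * ((Q : Cube d).toSet.indicator
          (fun _ => SparseMaxTrunc.avg 1 f₁ Q) x * ‖f₂ x‖ₑ) := by
        refine lintegral_mono fun x => ?_
        refine (mul_le_mul_left (hdom x) _).trans (le_of_eq ?_)
        rw [Finset.sum_mul]
        simp only [← ENNReal.tsum_mul_right, mul_assoc]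
    _ = ∑ e, ∑' Q : S e, 4 * (volume (Q : Cube d).toSet *
          (SparseMaxTrunc.avg 1 f₁ Q * SparseMaxTrunc.avg 1 f₂ Q)) := by
        have hm : ∀ Q : Cube d, Measurable fun x => 4 * (Q.toSet.indicator
          (fun _ => SparseMaxTrunc.avg 1 f₁ Q) x * ‖f₂ x‖ₑ) :=
          fun Q => ((measurable_const.indicator Q.measurableSet_toSet).mul hf₂.enorm).const_mul 4
        rw [lintegral_finsetSum]
        · congr 1; ext e
          have : Countable (S e) := (hS e).1.to_subtype
          rw [lintegral_tsum fun Q : S e => (hm Q).aemeasurable]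
          congr 1; ext Q
          rw [lintegral_const_mul' _ _ (by simp)]
          congr 1
          have : ∀ x, (Q : Cube d).toSet.indicator (fun _ => SparseMaxTrunc.avg 1 f₁ Q) x * ‖f₂ x‖ₑ =
              (Q : Cube d).toSet.indicator (fun x => SparseMaxTrunc.avg 1 f₁ Q * ‖f₂ x‖ₑ) x := by
            intro x
            by_cases hx : x ∈ (Q : Cube d).toSet <;> simp [hx]
          simp only [this]
          rw [lintegral_indicator (Q : Cube d).measurableSet_toSet, lintegral_const_mul _ hf₂.enorm,
            avg_eq one_pos f₂]
          simp only [ENNReal.rpow_one, div_one]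
          rw [mul_left_comm, ← mul_assoc (volume (Q : Cube d).toSet),
            ENNReal.mul_inv_cancel (Q : Cube d).volume_ne_zero (Q : Cube d).volume_ne_top, one_mul]
        · intro e _
          have : Countable (S e) := (hS e).1.to_subtype
          exact Measurable.tsum fun Q : S e => hm Q
    _ ≤ ∑ _e : Fin 2, 4 * sparseSup 1 f₁ f₂ := by
        gcongr with e
        rw [ENNReal.tsum_mul_left]
        gcongr
        exact le_iSup₂ (f := fun (S : Set (Cube d)) (_ : IsSparse (1 / 2) S) =>
          ∑' Q : S, volume (Q : Cube d).toSet *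
            (SparseMaxTrunc.avg 1 f₁ Q * SparseMaxTrunc.avg 1 f₂ Q)) (S e) (hS e)
    _ = 8 * sparseSup 1 f₁ f₂ := by
        rw [Finset.sum_const]; simp; ring

end Grid

/-- The bilinear maximal function over triples of dyadic cubes of side at most `2 ^ n`. -/
def maxTriProd (p : ℝ) (f₁ f₂ : Rd d → ℂ) (n : ℤ) (x : Rd d) : ℝ≥0∞ :=
  ⨆ (j : ℤ) (_ : j ≤ n), triAvg j (fun y => ‖f₁ y‖ₑ ^ p) x ^ (1 / p) *
    triAvg j (fun y => ‖f₂ y‖ₑ ^ p) x ^ (1 / p)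

theorem measurable_maxTriProd (p : ℝ) (f₁ f₂ : Rd d → ℂ) (n : ℤ) :
    Measurable (maxTriProd p f₁ f₂ n) :=
  Measurable.iSup fun j => Measurable.iSup fun _ =>
    ((measurable_triAvg j _).pow_const _).mul ((measurable_triAvg j _).pow_const _)

theorem lintegral_maxTriProd_le {p : ℝ} (hp : 1 ≤ p) {f₁ f₂ : Rd d → ℂ} (hf₁ : Measurable f₁)
    (hf₂ : Measurable f₂) {M : ℝ≥0∞} (hM : M ≠ ∞) (h₁ : ∀ x, ‖f₁ x‖ₑ ≤ M) (h₂ : ∀ x, ‖f₂ x‖ₑ ≤ M)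
    (n : ℤ) : ∫⁻ x, maxTriProd p f₁ f₂ n x ≤ 3 ^ d * 32 * sparseSup p f₁ f₂ := by
  have hp0 : 0 < p := by linarith
  set A : (Fin d → Fin 3) → Rd d → ℝ≥0∞ := fun c x => ⨆ (j : ℤ) (_ : j ≤ n),
    avg p f₁ ((triGrid c).cube j ((triGrid c).idx j x)) *
      avg p f₂ ((triGrid c).cube j ((triGrid c).idx j x)) with hA
  have hAm : ∀ c, Measurable (A c) := fun c => Measurable.iSup fun j => Measurable.iSup fun _ =>
    (triGrid c).measurable_of_idx (j := j) fun x y h => by rw [h]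
  calc ∫⁻ x, maxTriProd p f₁ f₂ n x ≤ ∫⁻ x, ∑ c, A c x := by
        refine lintegral_mono fun x => iSup₂_le fun j hj => ?_
        obtain ⟨c, hc⟩ := exists_triAvg_eq j x
        rw [hc, hc, ← Grid.avg_cube_eq _ hp0, ← Grid.avg_cube_eq _ hp0]
        refine le_trans ?_ (Finset.single_le_sum (f := fun c => A c x) (fun _ _ => zero_le)
          (Finset.mem_univ c))
        exact le_iSup₂ (f := fun j (_ : j ≤ n) =>
          avg p f₁ ((triGrid c).cube j ((triGrid c).idx j x)) *
          avg p f₂ ((triGrid c).cube j ((triGrid c).idx j x))) j hj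
    _ = ∑ c, ∫⁻ x, A c x := lintegral_finsetSum _ fun c _ => hAm c
    _ ≤ ∑ _c : Fin d → Fin 3, 32 * sparseSup p f₁ f₂ := by
        gcongr with c
        exact (triGrid c).lintegral_maxProd_le hp hf₁ hf₂ hM h₁ h₂ n
    _ = _ := by simp; ring

/-! ### Bounded functions of bounded support and their convolutions -/

/-- A bounded measurable function of bounded support. -/
structure NiceFun (f : Rd d → ℂ) : Prop where
  meas : Measurable f
  bdd : ∃ C : ℝ, ∀ x, ‖f x‖ ≤ C
  supp : ∃ R : ℝ, ∀ x, R < ‖x‖ → f x = 0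

theorem NiceFun.integrable {f : Rd d → ℂ} (hf : NiceFun f) : Integrable f := by
  obtain ⟨C, hC⟩ := hf.bdd
  obtain ⟨R, hR⟩ := hf.supp
  have h1 : IntegrableOn f (Metric.closedBall 0 R) :=
    Measure.integrableOn_of_bounded (M := C) (measure_closedBall_lt_top).ne
      hf.meas.aestronglyMeasurable (Filter.Eventually.of_forall hC)
  refine (integrableOn_iff_integrable_of_support_subset ?_).1 h1
  intro x hx
  rw [mem_closedBall_zero_iff]
  by_contra h
  exact hx (hR x (not_le.1 h))

theorem NiceFun.of_le {f g : Rd d → ℂ} (hf : NiceFun f) (hg : Measurable g)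
    (h : ∀ x, ‖g x‖ ≤ ‖f x‖) : NiceFun g := by
  obtain ⟨C, hC⟩ := hf.bdd
  obtain ⟨R, hR⟩ := hf.supp
  exact ⟨hg, ⟨C, fun x => (h x).trans (hC x)⟩, ⟨R, fun x hx => by
    have := h x
    rw [hR x hx, norm_zero] at this
    exact norm_le_zero_iff.1 this⟩⟩

theorem NiceFun.indicator {f : Rd d → ℂ} (hf : NiceFun f) {s : Set (Rd d)} (hs : MeasurableSet s) :
    NiceFun (s.indicator f) :=
  hf.of_le (hf.meas.indicator hs) fun _ => norm_indicator_le_norm_self _ _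

theorem NiceFun.sub {f g : Rd d → ℂ} (hf : NiceFun f) (hg : NiceFun g) :
    NiceFun (fun x => f x - g x) := by
  obtain ⟨C, hC⟩ := hf.bdd
  obtain ⟨R, hR⟩ := hf.supp
  obtain ⟨C', hC'⟩ := hg.bdd
  obtain ⟨R', hR'⟩ := hg.supp
  exact ⟨hf.meas.sub hg.meas, ⟨C + C', fun x => (norm_sub_le _ _).trans (add_le_add (hC x) (hC' x))⟩,
    ⟨max R R', fun x hx => by
      rw [hR x ((le_max_left _ _).trans_lt hx), hR' x ((le_max_right _ _).trans_lt hx), sub_zero]⟩⟩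

theorem NiceFun.convolutionExistsAt {K f : Rd d → ℂ} (hK : Integrable K) (hf : NiceFun f)
    (x : Rd d) : ConvolutionExistsAt K f x (ContinuousLinearMap.mul ℂ ℂ) volume := by
  obtain ⟨C, hC⟩ := hf.bdd
  exact hK.mul_bdd (c := C) (hf.meas.comp (measurable_const.sub measurable_id)).aestronglyMeasurable
    (Filter.Eventually.of_forall fun t => hC _)

theorem NiceFun.integrable_mul_sub {K f : Rd d → ℂ} (hK : Integrable K) (hf : NiceFun f)
    (x : Rd d) : Integrable fun y => K (x - y) * f y := by
  have := (hf.convolutionExistsAt hK x).integrable_swap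
  simpa using this

theorem conv_eq (K f : Rd d → ℂ) (x : Rd d) :
    (K ⋆[ContinuousLinearMap.mul ℂ ℂ, volume] f) x = ∫ y, K (x - y) * f y := by
  rw [convolution_eq_swap]; rfl

theorem conv_sub {K f g : Rd d → ℂ} (hK : Integrable K) (hf : NiceFun f) (hg : NiceFun g)
    (x : Rd d) : (K ⋆[ContinuousLinearMap.mul ℂ ℂ, volume] fun y => f y - g y) x =
      (K ⋆[ContinuousLinearMap.mul ℂ ℂ, volume] f) x -
        (K ⋆[ContinuousLinearMap.mul ℂ ℂ, volume] g) x := by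
  rw [conv_eq, conv_eq, conv_eq, ← integral_sub (hf.integrable_mul_sub hK x)
    (hg.integrable_mul_sub hK x)]
  simp only [mul_sub]

theorem enorm_conv_le (K f : Rd d → ℂ) (x : Rd d) :
    ‖(K ⋆[ContinuousLinearMap.mul ℂ ℂ, volume] f) x‖ₑ ≤ ∫⁻ y, ‖K (x - y)‖ₑ * ‖f y‖ₑ := by
  rw [conv_eq]
  refine (enorm_integral_le_lintegral_enorm _).trans (le_of_eq ?_)
  simp only [enorm_mul]

/-! ### Maximal truncations with restricted parameters -/

/-- The maximal truncation over the parameters `a ≤ t₁ ≤ t₂ ≤ b`. -/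
def truncSup (K : ℤ → Rd d → ℂ) (f : Rd d → ℂ) (x : Rd d) (a b : ℤ) : ℝ≥0∞ :=
  ⨆ (t₁ : ℤ) (t₂ : ℤ) (_ : t₁ ≤ t₂) (_ : t₂ ≤ b) (_ : a ≤ t₁), ‖trunc K f x t₁ t₂‖ₑ

theorem le_truncSup {K : ℤ → Rd d → ℂ} {f : Rd d → ℂ} {x : Rd d} {a b t₁ t₂ : ℤ} (h : t₁ ≤ t₂)
    (hb : t₂ ≤ b) (ha : a ≤ t₁) : ‖trunc K f x t₁ t₂‖ₑ ≤ truncSup K f x a b :=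
  le_iSup_of_le t₁ (le_iSup_of_le t₂ (le_iSup_of_le h (le_iSup_of_le hb (le_iSup_of_le ha le_rfl))))

theorem truncSup_le {K : ℤ → Rd d → ℂ} {f : Rd d → ℂ} {x : Rd d} {a b : ℤ} {c : ℝ≥0∞}
    (h : ∀ t₁ t₂, t₁ ≤ t₂ → t₂ ≤ b → a ≤ t₁ → ‖trunc K f x t₁ t₂‖ₑ ≤ c) :
    truncSup K f x a b ≤ c :=
  iSup_le fun t₁ => iSup_le fun t₂ => iSup_le fun h1 => iSup_le fun h2 => iSup_le fun h3 =>
    h t₁ t₂ h1 h2 h3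

theorem truncSup_mono (K : ℤ → Rd d → ℂ) (f : Rd d → ℂ) (x : Rd d) {a a' b b' : ℤ} (ha : a' ≤ a)
    (hb : b ≤ b') : truncSup K f x a b ≤ truncSup K f x a' b' :=
  truncSup_le fun _ _ h1 h2 h3 => le_truncSup h1 (h2.trans hb) (ha.trans h3)

/-- Maximal truncations split at any intermediate level. -/
theorem truncSup_le_add (K : ℤ → Rd d → ℂ) (f : Rd d → ℂ) (x : Rd d) {a m b : ℤ} :
    truncSup K f x a b ≤ truncSup K f x a m + truncSup K f x m b := by
  refine truncSup_le fun t₁ t₂ h1 h2 h3 => ?_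
  rcases le_total t₂ m with h | h
  · exact (le_truncSup h1 h h3).trans le_self_add
  rcases le_total m t₁ with h' | h'
  · exact (le_truncSup h1 h2 h').trans le_add_self
  have : trunc K f x t₁ t₂ = trunc K f x t₁ m + trunc K f x m t₂ := by
    rw [trunc, trunc, trunc, ← Finset.sum_union]
    · rw [Finset.Ioc_union_Ioc_eq_Ioc h' h]
    · exact Finset.Ioc_disjoint_Ioc_of_le le_rfl
  rw [this]
  exact (enorm_add_le _ _).trans (add_le_add (le_truncSup h' le_rfl h3) (le_truncSup h h2 le_rfl))

theorem truncSup_sub_le {K : ℤ → Rd d → ℂ} (hK : ∀ s, Integrable (K s)) {f g : Rd d → ℂ}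
    (hf : NiceFun f) (hg : NiceFun g) (x : Rd d) (a b : ℤ) :
    truncSup K f x a b ≤ truncSup K g x a b +
      ∑ s ∈ Finset.Ioc a b,
        ‖(K s ⋆[ContinuousLinearMap.mul ℂ ℂ, volume] fun y => f y - g y) x‖ₑ := by
  refine truncSup_le fun t₁ t₂ h1 h2 h3 => ?_
  have : trunc K f x t₁ t₂ = trunc K g x t₁ t₂ + ∑ s ∈ Finset.Ioc t₁ t₂,
      (K s ⋆[ContinuousLinearMap.mul ℂ ℂ, volume] fun y => f y - g y) x := by
    rw [trunc, trunc, ← Finset.sum_add_distrib]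
    refine Finset.sum_congr rfl fun s _ => ?_
    rw [conv_sub (hK s) hf hg]; ring
  rw [this]
  refine (enorm_add_le _ _).trans (add_le_add (le_truncSup h1 h2 h3) ?_)
  refine (enorm_sum_le _ _).trans ?_
  exact Finset.sum_le_sum_of_subset (Finset.Ioc_subset_Ioc h3 h2)

theorem truncSup_add_le {K : ℤ → Rd d → ℂ} (hK : ∀ s, Integrable (K s)) {f g : Rd d → ℂ}
    (hf : NiceFun f) (hg : NiceFun g) (x : Rd d) (a b : ℤ) :
    truncSup K f x a b ≤ truncSup K g x a b + truncSup K (fun y => f y - g y) x a b := by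
  refine truncSup_le fun t₁ t₂ h1 h2 h3 => ?_
  have : trunc K f x t₁ t₂ = trunc K g x t₁ t₂ + trunc K (fun y => f y - g y) x t₁ t₂ := by
    rw [trunc, trunc, trunc, ← Finset.sum_add_distrib]
    refine Finset.sum_congr rfl fun s _ => ?_
    rw [conv_sub (hK s) hf hg]; ring
  rw [this]
  exact (enorm_add_le _ _).trans (add_le_add (le_truncSup h1 h2 h3) (le_truncSup h1 h2 h3))

theorem measurable_truncSup {K : ℤ → Rd d → ℂ} {f : Rd d → ℂ}
    (h : ∀ s, Measurable (K s ⋆[ContinuousLinearMap.mul ℂ ℂ, volume] f)) {σ : Rd d → ℤ}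
    (hσ : Measurable σ) (b : ℤ) : Measurable fun x => truncSup K f x (σ x) b := by
  refine Measurable.iSup fun t₁ => Measurable.iSup fun t₂ => Measurable.iSup fun _ =>
    Measurable.iSup fun _ => ?_
  have hm : Measurable fun x => ‖trunc K f x t₁ t₂‖ₑ :=
    (Finset.measurable_sum _ fun s _ => h s).enorm
  have : (fun x => ⨆ (_ : σ x ≤ t₁), ‖trunc K f x t₁ t₂‖ₑ) =
      {x | σ x ≤ t₁}.indicator fun x => ‖trunc K f x t₁ t₂‖ₑ := by
    ext x
    by_cases hx : σ x ≤ t₁ <;> simp [hx]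
  rw [this]
  exact hm.indicator (measurableSet_le hσ measurable_const)

/-! ### Conditional averages of complex functions -/

namespace Grid

variable {G : Grid d} {σ : Rd d → ℤ}

/-- The average of a complex function over the cell picked by `σ`. -/
def cavg (G : Grid d) (σ : Rd d → ℤ) (f : Rd d → ℂ) (x : Rd d) : ℂ := ⨍ y in G.cell (σ x) x, f y

theorem enorm_cavg_le (f : Rd d → ℂ) (x : Rd d) :
    ‖G.cavg σ f x‖ₑ ≤ G.avgσ σ (fun y => ‖f y‖ₑ) x := by
  rw [cavg, setAverage_eq, enorm_smul, avgσ]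
  refine mul_le_mul' (le_of_eq ?_) (enorm_integral_le_lintegral_enorm _)
  rw [Real.enorm_eq_ofReal (by positivity), Measure.real, ← ENNReal.toReal_inv,
    ENNReal.ofReal_toReal (ENNReal.inv_ne_top.2 (G.volume_cell_ne_zero _ _))]

theorem IsStopping.cavg_congr (hσ : G.IsStopping σ) (f : Rd d → ℂ) {x y : Rd d}
    (h : y ∈ G.cell (σ x) x) : G.cavg σ f y = G.cavg σ f x := by
  simp only [cavg, hσ.cell_eq_of_mem h]

theorem IsStopping.measurable_cavg (hσ : G.IsStopping σ) (f : Rd d → ℂ) :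
    Measurable (G.cavg σ f) :=
  hσ.measurable_of_lab fun _ _ hy => hσ.cavg_congr f hy

theorem IsStopping.integral_eq_tsum (hσ : G.IsStopping σ) {f : Rd d → ℂ} (hf : Integrable f) :
    ∫ x, f x = ∑' c : ℤ × (Fin d → ℤ), ∫ x in lab G σ ⁻¹' {c}, f x := by
  rw [← integral_iUnion (fun c => hσ.measurable_lab (MeasurableSet.singleton c)) _ hf.integrableOn]
  · rw [← Set.preimage_iUnion, Set.iUnion_singleton_eq_range, Set.range_id', Set.preimage_univ,
      Measure.restrict_univ]
  · intro a b hab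
    exact Disjoint.preimage _ (by simpa using hab)

/-- On each cell both sides are the product of the integrals of `u` and `f` divided by the volume.
-/
theorem IsStopping.integral_mul_cavg (hσ : G.IsStopping σ) {u f : Rd d → ℂ}
    (h1 : Integrable fun x => u x * G.cavg σ f x) (h2 : Integrable fun x => G.cavg σ u x * f x) :
    ∫ x, u x * G.cavg σ f x = ∫ x, G.cavg σ u x * f x := by
  rw [hσ.integral_eq_tsum h1, hσ.integral_eq_tsum h2]
  congr 1
  ext c
  by_cases h : ∃ x, lab G σ x = c
  · obtain ⟨x, rfl⟩ := h
    have : lab G σ ⁻¹' {lab G σ x} = G.cell (σ x) x := by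
      ext y; exact hσ.lab_eq_iff
    rw [this]
    have e1 : ∫ y in G.cell (σ x) x, u y * G.cavg σ f y =
        ∫ y in G.cell (σ x) x, u y * G.cavg σ f x :=
      setIntegral_congr_fun (G.measurableSet_cell _ _) fun y hy => by
        simp only [hσ.cavg_congr f hy]
    have e2 : ∫ y in G.cell (σ x) x, G.cavg σ u y * f y =
        ∫ y in G.cell (σ x) x, G.cavg σ u x * f y :=
      setIntegral_congr_fun (G.measurableSet_cell _ _) fun y hy => by
        simp only [hσ.cavg_congr u hy]
    rw [e1, e2, integral_mul_const, integral_const_mul]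
    simp only [cavg, setAverage_eq, Complex.real_smul]
    ring
  · have : lab G σ ⁻¹' {c} = ∅ := by
      ext y; simpa using fun hy => h ⟨y, hy⟩
    simp [this]

theorem enorm_sub_cavg_le {u : Rd d → ℂ} (hu : ∀ j x, IntegrableOn u (G.cell j x)) (y : Rd d) :
    ‖u y - G.cavg σ u y‖ₑ ≤ (volume (G.cell (σ y) y))⁻¹ *
      ∫⁻ z in G.cell (σ y) y, ‖u y - u z‖ₑ := by
  have hv : (volume.real (G.cell (σ y) y)) ≠ 0 :=
    (ENNReal.toReal_ne_zero).2 ⟨G.volume_cell_ne_zero _ _, G.volume_cell_ne_top _ _⟩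
  have : u y - G.cavg σ u y = ⨍ z in G.cell (σ y) y, (u y - u z) := by
    rw [cavg, setAverage_eq, setAverage_eq, integral_sub _ (hu _ _), setIntegral_const, smul_sub,
      smul_smul, inv_mul_cancel₀ hv, one_smul]
    exact integrableOn_const (G.volume_cell_ne_top _ _)
  rw [this, setAverage_eq, enorm_smul]
  refine mul_le_mul' (le_of_eq ?_) (enorm_integral_le_lintegral_enorm _)
  rw [Real.enorm_eq_ofReal (by positivity), Measure.real, ← ENNReal.toReal_inv,
    ENNReal.ofReal_toReal (ENNReal.inv_ne_top.2 (G.volume_cell_ne_zero _ _))]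

theorem avgσ_le_of_le {F : Rd d → ℝ≥0∞} {c : ℝ≥0∞} {x : Rd d}
    (h : ∀ y ∈ G.cell (σ x) x, F y ≤ c) : G.avgσ σ F x ≤ c := by
  rw [avgσ]
  calc (volume (G.cell (σ x) x))⁻¹ * ∫⁻ y in G.cell (σ x) x, F y
      ≤ (volume (G.cell (σ x) x))⁻¹ * ∫⁻ _y in G.cell (σ x) x, c := by
        gcongr 1
        exact setLIntegral_mono' (G.measurableSet_cell _ _) h
    _ = c := by
        rw [setLIntegral_const, mul_comm c, ← mul_assoc,
          ENNReal.inv_mul_cancel (G.volume_cell_ne_zero _ _) (G.volume_cell_ne_top _ _), one_mul]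

theorem enorm_cavg_le_of_bound {f : Rd d → ℂ} {c : ℝ≥0∞} (h : ∀ x, ‖f x‖ₑ ≤ c)
    (x : Rd d) : ‖G.cavg σ f x‖ₑ ≤ c :=
  (enorm_cavg_le f x).trans (avgσ_le_of_le fun y _ => h y)

end Grid

/-! ### Neighbouring dyadic cubes and distances in the maximum norm -/

theorem mem_tri_of_supNorm_le {j : ℤ} {x y : Rd d} (h : supNorm (y - x) ≤ 2 ^ j) : y ∈ tri j x := by
  intro i
  have h2 : (0 : ℝ) < 2 ^ j := by positivity
  have h1 : |y i - x i| ≤ 2 ^ j := (abs_apply_le_supNorm (y - x) i).trans h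
  rw [abs_le] at h1
  rw [dyadic_idx, dyadic_idx, abs_le]
  have e1 : y i / 2 ^ j ≤ x i / 2 ^ j + 1 := by
    rw [div_add_one h2.ne', div_le_div_iff_of_pos_right h2]; linarith
  have e2 : x i / 2 ^ j ≤ y i / 2 ^ j + 1 := by
    rw [div_add_one h2.ne', div_le_div_iff_of_pos_right h2]; linarith
  have f1 := Int.floor_le_floor e1
  have f2 := Int.floor_le_floor e2
  rw [Int.floor_add_one] at f1 f2
  constructor <;> linarith

theorem supNorm_sub_lt_of_mem_tri {j : ℤ} {x y : Rd d} (h : y ∈ tri j x) :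
    supNorm (y - x) < 2 * 2 ^ j := by
  have h2 : (0 : ℝ) < 2 ^ j := by positivity
  rw [supNorm_lt_iff (by positivity)]
  intro i
  have h1 := h i
  rw [dyadic_idx, dyadic_idx, abs_le] at h1
  have h3 : (-1 : ℝ) ≤ ⌊y i / 2 ^ j⌋ - ⌊x i / 2 ^ j⌋ := by exact_mod_cast h1.1
  have h4 : (⌊y i / 2 ^ j⌋ : ℝ) - ⌊x i / 2 ^ j⌋ ≤ 1 := by exact_mod_cast h1.2
  have a1 := Int.floor_le (y i / 2 ^ j)
  have a2 := Int.lt_floor_add_one (y i / 2 ^ j)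
  have b1 := Int.floor_le (x i / 2 ^ j)
  have b2 := Int.lt_floor_add_one (x i / 2 ^ j)
  have : |y i / 2 ^ j - x i / 2 ^ j| < 2 := by rw [abs_lt]; constructor <;> linarith
  rw [← sub_div, abs_div, abs_of_pos h2, div_lt_iff₀ h2] at this
  exact this

theorem supNorm_sub_lt_of_mem_cell {j : ℤ} {x y : Rd d} (h : y ∈ (dyadic d).cell j x) :
    supNorm (y - x) < 2 ^ j := by
  have h2 : (0 : ℝ) < 2 ^ j := by positivity
  rw [supNorm_lt_iff h2]
  intro i
  have h1 := congrFun ((dyadic d).mem_cell.1 h) i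
  rw [dyadic_idx, dyadic_idx] at h1
  have h3 : (⌊y i / 2 ^ j⌋ : ℝ) = ⌊x i / 2 ^ j⌋ := by exact_mod_cast h1
  have a1 := Int.floor_le (y i / 2 ^ j)
  have a2 := Int.lt_floor_add_one (y i / 2 ^ j)
  have b1 := Int.floor_le (x i / 2 ^ j)
  have b2 := Int.lt_floor_add_one (x i / 2 ^ j)
  have : |y i / 2 ^ j - x i / 2 ^ j| < 1 := by rw [abs_lt]; constructor <;> linarith
  rw [← sub_div, abs_div, abs_of_pos h2, div_lt_iff₀ h2, one_mul] at this
  exact this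

theorem norm_le_of_mem_tri {j : ℤ} {x y : Rd d} (h : y ∈ tri j x) :
    ‖y‖ ≤ ‖x‖ + √d * (2 * 2 ^ j) := by
  have h1 := norm_le_supNorm (y - x)
  have h2 := supNorm_sub_lt_of_mem_tri h
  have h3 : √d * supNorm (y - x) ≤ √d * (2 * 2 ^ j) := by gcongr
  have h4 : ‖y‖ ≤ ‖x‖ + ‖y - x‖ := by
    simpa using norm_add_le x (y - x)
  linarith

/-- Cells picked by `σ` have level at most `k`, so averaging over them does not leave the union `tri
k x₀` of cells of level `k`. -/
theorem cavg_eq_zero {σ : Rd d → ℤ} {f : Rd d → ℂ} {k : ℤ} (hk : ∀ x, σ x ≤ k) {x₀ : Rd d}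
    (hf : ∀ x, x ∉ tri k x₀ → f x = 0) {x : Rd d} (hx : x ∉ tri k x₀) :
    (dyadic d).cavg σ f x = 0 := by
  rw [Grid.cavg, setAverage_eq, setIntegral_congr_fun (g := fun _ => 0)
    ((dyadic d).measurableSet_cell _ _)]
  · simp
  · intro y hy
    refine hf y fun h => hx ?_
    have : (dyadic d).idx k y = (dyadic d).idx k x := (dyadic d).cell_mono (hk x) x hy
    rw [mem_tri_comm, ← tri_congr this, mem_tri_comm]
    exact h

theorem niceFun_cavg {σ : Rd d → ℤ} (hσ : (dyadic d).IsStopping σ) {f : Rd d → ℂ} (hf : NiceFun f)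
    {k : ℤ} (hk : ∀ x, σ x ≤ k) {x₀ : Rd d} (hsupp : ∀ x, x ∉ tri k x₀ → f x = 0) :
    NiceFun ((dyadic d).cavg σ f) := by
  obtain ⟨C, hC⟩ := hf.bdd
  refine ⟨hσ.measurable_cavg f, ⟨C, fun x => ?_⟩, ⟨‖x₀‖ + √d * (2 * 2 ^ k), fun x hx => ?_⟩⟩
  · have h0 : 0 ≤ C := (norm_nonneg _).trans (hC x)
    have h1 : ∀ y, ‖f y‖ₑ ≤ ENNReal.ofReal C := fun y => by
      rw [← ofReal_norm]; exact ENNReal.ofReal_le_ofReal (hC y)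
    have h2 := Grid.enorm_cavg_le_of_bound (G := dyadic d) (σ := σ) h1 x
    rw [← ofReal_norm] at h2
    exact (ENNReal.ofReal_le_ofReal_iff h0).1 h2
  · exact cavg_eq_zero hk hsupp fun h => absurd (norm_le_of_mem_tri h) (not_le.2 hx)

/-! ### The basic estimate for smooth families -/

/-- A family of kernels at the scales `2 ^ s` with size constant `A`, Lipschitz constants
`A 2 ^ Δ` and maximal truncations bounded by `B` on `L²`. -/
structure SmoothFamily (A : ℝ≥0∞) (Δ : ℕ) (B : ℝ≥0∞) (H : ℤ → Rd d → ℂ) : Prop where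
  cont : ∀ s, Continuous (H s)
  supp : ∀ s x, H s x ≠ 0 → supNorm x < 2 ^ (s - 1)
  bound : ∀ s x, ‖H s x‖ₑ ≤ A * (cellVol d s)⁻¹
  lip : ∀ s x y, ‖H s x - H s y‖ₑ ≤
    A * (cellVol d s)⁻¹ * ENNReal.ofReal (2 ^ ((Δ : ℤ) - s) * supNorm (x - y))
  l2 : ∀ f, NiceFun f → ∀ a b, ∫⁻ x, truncSup H f x a b ^ 2 ≤ B ^ 2 * ∫⁻ x, ‖f x‖ₑ ^ 2

/-- The oscillation factor of a smooth family on cells that are `i` generations below the scale. -/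
def oscW (Δ i : ℕ) : ℝ≥0∞ := min 2 (ENNReal.ofReal (2 ^ ((Δ : ℤ) - i)))

/-- The first `Δ` generations use the trivial bound 2, the later ones a geometric series. This is
the source of the linear loss in `Δ`. -/
theorem tsum_oscW_le (Δ : ℕ) : ∑' i, oscW Δ i ≤ 2 * Δ + 2 := by
  rw [← ENNReal.summable.sum_add_tsum_nat_add' (f := oscW Δ) (k := Δ)]
  refine add_le_add ?_ ?_
  · calc ∑ i ∈ Finset.range Δ, oscW Δ i ≤ ∑ _i ∈ Finset.range Δ, (2 : ℝ≥0∞) :=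
        Finset.sum_le_sum fun i _ => min_le_left _ _
      _ = 2 * Δ := by simp [mul_comm]
  · calc ∑' i, oscW Δ (i + Δ) ≤ ∑' i : ℕ, (2⁻¹ : ℝ≥0∞) ^ i := by
          refine ENNReal.tsum_le_tsum fun i => (min_le_right _ _).trans (le_of_eq ?_)
          rw [show (Δ : ℤ) - (i + Δ : ℕ) = -(i : ℤ) by push_cast; ring, zpow_neg, zpow_natCast,
            ← inv_pow, ENNReal.ofReal_pow (by positivity), ENNReal.ofReal_inv_of_pos (by norm_num)]
          simp
      _ = 2 := ENNReal.tsum_geometric_two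

theorem sum_oscW_le (Δ : ℕ) (a k : ℤ) :
    ∑ s ∈ Finset.Icc a k, oscW Δ (s - a).toNat ≤ 2 * Δ + 2 := by
  have : ∑ s ∈ Finset.Icc a k, oscW Δ (s - a).toNat =
      ∑ i ∈ (Finset.Icc a k).image (fun s => (s - a).toNat), oscW Δ i := by
    rw [Finset.sum_image]
    intro x hx y hy hxy
    simp only [Finset.coe_Icc, Set.mem_Icc] at hx hy
    simp only at hxy
    omega
  rw [this]
  exact (ENNReal.sum_le_tsum _).trans (tsum_oscW_le Δ)

namespace SmoothFamily

variable {A B : ℝ≥0∞} {Δ : ℕ} {H : ℤ → Rd d → ℂ}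

theorem hasCompactSupport (hH : SmoothFamily A Δ B H) (s : ℤ) : HasCompactSupport (H s) := by
  refine HasCompactSupport.intro (isCompact_closedBall 0 (√d * 2 ^ (s - 1))) fun x hx => ?_
  by_contra h
  apply hx
  rw [mem_closedBall_zero_iff]
  refine (norm_le_supNorm x).trans ?_
  have := hH.supp s x h
  gcongr

theorem integrable (hH : SmoothFamily A Δ B H) (s : ℤ) : Integrable (H s) :=
  (hH.cont s).integrable_of_hasCompactSupport (hH.hasCompactSupport s)

theorem measurable_conv (hH : SmoothFamily A Δ B H) {f : Rd d → ℂ} (hf : NiceFun f) (s : ℤ) :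
    Measurable (H s ⋆[ContinuousLinearMap.mul ℂ ℂ, volume] f) :=
  ((hH.hasCompactSupport s).continuous_convolution_left _ (hH.cont s)
    hf.integrable.locallyIntegrable).measurable

theorem osc (hH : SmoothFamily A Δ B H) {s j : ℤ} (hjs : j ≤ s) {x y : Rd d}
    (h : supNorm (x - y) ≤ 2 ^ j) :
    ‖H s x - H s y‖ₑ ≤ A * (cellVol d s)⁻¹ * oscW Δ (s - j).toNat := by
  rw [oscW, mul_min]
  refine le_min ?_ ?_
  · calc ‖H s x - H s y‖ₑ ≤ ‖H s x‖ₑ + ‖H s y‖ₑ := enorm_sub_le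
      _ ≤ A * (cellVol d s)⁻¹ + A * (cellVol d s)⁻¹ := add_le_add (hH.bound s x) (hH.bound s y)
      _ = _ := by ring
  · refine (hH.lip s x y).trans ?_
    gcongr
    calc (2 : ℝ) ^ ((Δ : ℤ) - s) * supNorm (x - y) ≤ 2 ^ ((Δ : ℤ) - s) * 2 ^ j := by gcongr
      _ = 2 ^ ((Δ : ℤ) - (s - j).toNat) := by
          rw [← zpow_add₀ (by norm_num)]
          congr 1
          omega

/-- Cancellation: the convolution with a function of vanishing averages. -/
theorem enorm_conv_sub_cavg_le (hH : SmoothFamily A Δ B H) {σ : Rd d → ℤ}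
    (hσ : (dyadic d).IsStopping σ) {k : ℤ} (hk : ∀ x, σ x ≤ k) {f : Rd d → ℂ} (hf : NiceFun f)
    {x₀ : Rd d} (hsupp : ∀ x, x ∉ tri k x₀ → f x = 0) (s : ℤ) (x : Rd d) :
    ‖(H s ⋆[ContinuousLinearMap.mul ℂ ℂ, volume] fun y => f y - (dyadic d).cavg σ f y) x‖ₑ ≤
      ∫⁻ y, ‖f y‖ₑ * ((volume ((dyadic d).cell (σ y) y))⁻¹ *
        ∫⁻ z in (dyadic d).cell (σ y) y, ‖H s (x - y) - H s (x - z)‖ₑ) := by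
  have hE := niceFun_cavg hσ hf hk hsupp
  set u : Rd d → ℂ := fun y => H s (x - y) with hu
  have huc : Continuous u := (hH.cont s).comp (by fun_prop)
  have hui : Integrable u := (hH.integrable s).comp_sub_left x
  obtain ⟨C, hC⟩ : ∃ C : ℝ≥0∞, C ≠ ∞ ∧ ∀ y, ‖u y‖ₑ ≤ C := by
    obtain ⟨C, hC⟩ := (hH.hasCompactSupport s).exists_bound_of_continuous (hH.cont s)
    refine ⟨ENNReal.ofReal C, by simp, fun y => ?_⟩
    rw [← ofReal_norm]
    exact ENNReal.ofReal_le_ofReal (hC _)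
  have hEu : Integrable fun y => (dyadic d).cavg σ u y * f y := by
    refine hf.integrable.bdd_mul (c := C.toReal) (hσ.measurable_cavg u).aestronglyMeasurable
      (Filter.Eventually.of_forall fun y => ?_)
    have := Grid.enorm_cavg_le_of_bound (G := dyadic d) (σ := σ) hC.2 y
    rw [← toReal_enorm]
    exact ENNReal.toReal_mono hC.1 this
  have h1 : Integrable fun y => u y * f y := hf.integrable_mul_sub (hH.integrable s) x
  have h2 : Integrable fun y => u y * (dyadic d).cavg σ f y :=
    hE.integrable_mul_sub (hH.integrable s) x
  have : (H s ⋆[ContinuousLinearMap.mul ℂ ℂ, volume] fun y => f y - (dyadic d).cavg σ f y) x =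
      ∫ y, (u y - (dyadic d).cavg σ u y) * f y := by
    rw [conv_sub (hH.integrable s) hf hE, conv_eq, conv_eq]
    change (∫ y, u y * f y) - ∫ y, u y * (dyadic d).cavg σ f y = _
    -- The average is moved from `f` to the kernel, whose oscillation on the stopping cells is what
    -- remains.
    rw [hσ.integral_mul_cavg h2 hEu, ← integral_sub h1 hEu]
    simp only [sub_mul]
  rw [this]
  refine (enorm_integral_le_lintegral_enorm _).trans (lintegral_mono fun y => ?_)
  rw [enorm_mul, mul_comm]
  gcongr
  exact Grid.enorm_sub_cavg_le (fun j x => hui.integrableOn) y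

/-- The contribution of the oscillating part. -/
theorem lintegral_sum_conv_sub_cavg_le (hH : SmoothFamily A Δ B H) {σ : Rd d → ℤ}
    (hσ : (dyadic d).IsStopping σ) {b k : ℤ} (hb : ∀ x, b ≤ σ x) (hk : ∀ x, σ x ≤ k)
    (hW : ∀ x x', supNorm (x - x') ≤ 2 ^ (σ x' - 1) → σ x' - 1 ≤ σ x)
    {f : Rd d → ℂ} (hf : NiceFun f) {x₀ : Rd d} (hsupp : ∀ x, x ∉ tri k x₀ → f x = 0)
    {h : Rd d → ℝ≥0∞} (hh : Measurable h) {ν₁ ν₂ : ℝ≥0∞}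
    (h₁ : ∀ x j, σ x ≤ j → j ≤ k → ∫⁻ y in tri j x, ‖f y‖ₑ ≤ ν₁ * cellVol d j)
    (h₂ : ∀ x j, σ x ≤ j → j ≤ k → ∫⁻ y in tri j x, h y ≤ ν₂ * cellVol d j) :
    ∫⁻ x, (∑ s ∈ Finset.Ioc (σ x) k, ‖(H s ⋆[ContinuousLinearMap.mul ℂ ℂ, volume]
      fun y => f y - (dyadic d).cavg σ f y) x‖ₑ) * h x ≤
        A * (2 * Δ + 2) * ν₁ * ν₂ * cellVol d k := by
  classical
  -- The majorant of the oscillation of `H s (x - ·)` on the stopping cell of `y`. It depends on `x`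
  -- and `y` only through their level `s` cells and `σ y`, which gives joint measurability.
  obtain ⟨κ, hκ⟩ : ∃ κ : ℤ → Rd d → Rd d → ℝ≥0∞, ∀ s x y, κ s x y =
      if σ y ≤ s ∧ x ∈ tri s y then A * (cellVol d s)⁻¹ * oscW Δ (s - σ y).toNat else 0 :=
    ⟨_, fun _ _ _ => rfl⟩
  have hσm := hσ.measurable
  have hκm : ∀ s, Measurable (fun p : Rd d × Rd d => κ s p.1 p.2) := by
    intro s
    have h1 : (fun p : Rd d × Rd d => κ s p.1 p.2) =
        (fun q : (Fin d → ℤ) × (Fin d → ℤ) × ℤ => if q.2.2 ≤ s ∧ ∀ i, |q.1 i - q.2.1 i| ≤ 1 then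
          A * (cellVol d s)⁻¹ * oscW Δ (s - q.2.2).toNat else 0) ∘
        fun p => ((dyadic d).idx s p.1, (dyadic d).idx s p.2, σ p.2) := by
      ext p
      simp only [hκ, Function.comp, mem_tri]
    rw [h1]
    refine (measurable_of_countable _).comp ?_
    exact (((dyadic d).measurable_idx s).comp measurable_fst).prodMk
      ((((dyadic d).measurable_idx s).comp measurable_snd).prodMk (hσm.comp measurable_snd))
  have hκ1 : ∀ s x, Measurable fun y => κ s x y := fun s x => (hκm s).comp measurable_prodMk_left
  have hκ2 : ∀ s y, Measurable fun x => κ s x y := fun s y => (hκm s).comp measurable_prodMk_right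
  have hpt : ∀ x, ∀ s, σ x < s → ∀ y, ((volume ((dyadic d).cell (σ y) y))⁻¹ *
        ∫⁻ z in (dyadic d).cell (σ y) y, ‖H s (x - y) - H s (x - z)‖ₑ) ≤ κ s x y := by
    intro x s hs y
    have hpt' : ∀ z ∈ (dyadic d).cell (σ y) y, ‖H s (x - y) - H s (x - z)‖ₑ ≤ κ s x y := by
      intro z hz
      by_cases h0 : H s (x - y) = 0 ∧ H s (x - z) = 0
      · rw [h0.1, h0.2]; simp
      have key : ∀ w ∈ (dyadic d).cell (σ y) y, H s (x - w) ≠ 0 → σ y ≤ s ∧ x ∈ tri s y := by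
        intro w hw hne
        have hlt := hH.supp s _ hne
        have hσw : σ w = σ y := hσ y w hw
        -- This is where the Whitney condition enters. If `σ w > s`, then `x` and `w` are closer
        -- than `2^(s-1) ≤ 2^(σ w - 1)`, so `σ w - 1 ≤ σ x < s`, a contradiction.
        have hle : σ y ≤ s := by
          by_contra hcon
          have h3 : supNorm (x - w) ≤ 2 ^ (σ w - 1) :=
            hlt.le.trans (zpow_le_zpow_right₀ (by norm_num) (by omega))
          have := hW x w h3
          omega
        refine ⟨hle, ?_⟩
        have h4 : (dyadic d).idx s w = (dyadic d).idx s y := (dyadic d).idx_mono hle hw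
        rw [← tri_congr h4]
        exact mem_tri_of_supNorm_le (hlt.le.trans (zpow_le_zpow_right₀ (by norm_num) (by omega)))
      have hmem : σ y ≤ s ∧ x ∈ tri s y := by
        by_cases h1 : H s (x - y) = 0
        · exact key z hz fun h2 => h0 ⟨h1, h2⟩
        · exact key y ((dyadic d).self_mem_cell _ _) h1
      have : κ s x y = A * (cellVol d s)⁻¹ * oscW Δ (s - σ y).toNat := by
        rw [hκ, if_pos hmem]
      rw [this]
      refine hH.osc hmem.1 ?_
      have e : (x - y) - (x - z) = z - y := by abel
      rw [e]
      exact (supNorm_sub_lt_of_mem_cell hz).le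
    exact Grid.avgσ_le_of_le (G := dyadic d) (σ := σ)
      (F := fun z => ‖H s (x - y) - H s (x - z)‖ₑ) hpt'
  have hfm := hf.meas.enorm
  calc _ ≤ ∫⁻ x, (∑ s ∈ Finset.Ioc b k, ∫⁻ y, ‖f y‖ₑ * κ s x y) * h x := by
        refine lintegral_mono fun x => mul_le_mul_left ?_ _
        calc _ ≤ ∑ s ∈ Finset.Ioc (σ x) k, ∫⁻ y, ‖f y‖ₑ * κ s x y := by
              refine Finset.sum_le_sum fun s hs => ?_
              refine (hH.enorm_conv_sub_cavg_le hσ hk hf hsupp s x).trans ?_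
              gcongr with y
              exact hpt x s (Finset.mem_Ioc.1 hs).1 y
          _ ≤ _ := Finset.sum_le_sum_of_subset (Finset.Ioc_subset_Ioc (hb x) le_rfl)
    _ = ∑ s ∈ Finset.Ioc b k, ∫⁻ x, ∫⁻ y, ‖f y‖ₑ * κ s x y * h x := by
        rw [← lintegral_finsetSum]
        · refine lintegral_congr fun x => ?_
          rw [Finset.sum_mul]
          refine Finset.sum_congr rfl fun s _ => ?_
          rw [← lintegral_mul_const]
          exact hfm.mul (hκ1 s x)
        · intro s _
          exact Measurable.lintegral_prod_right' (f := fun p : Rd d × Rd d =>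
            ‖f p.2‖ₑ * κ s p.1 p.2 * h p.1)
            (((hfm.comp measurable_snd).mul (hκm s)).mul (hh.comp measurable_fst))
    -- Integrating in `x` first leaves the integral of `h` over the triple of level `s` at `y`. The
    -- hypothesis on `h` covers it, because `κ` vanishes unless `σ y ≤ s`.
    _ = ∑ s ∈ Finset.Ioc b k, ∫⁻ y, ‖f y‖ₑ * ∫⁻ x, κ s x y * h x := by
        refine Finset.sum_congr rfl fun s _ => ?_
        rw [lintegral_lintegral_swap]
        · refine lintegral_congr fun y => ?_
          rw [← lintegral_const_mul]
          · simp only [mul_assoc]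
          · exact (hκ2 s y).mul hh
        · exact (((hfm.comp measurable_snd).mul (hκm s)).mul (hh.comp measurable_fst)).aemeasurable
    _ ≤ ∑ s ∈ Finset.Ioc b k, ∫⁻ y, ‖f y‖ₑ *
          (if σ y ≤ s then A * ν₂ * oscW Δ (s - σ y).toNat else 0) := by
        refine Finset.sum_le_sum fun s hs => lintegral_mono fun y => mul_le_mul_right ?_ _
        by_cases hy : σ y ≤ s
        · rw [if_pos hy]
          have e : ∀ x, κ s x y * h x =
              (tri s y).indicator (fun x => A * (cellVol d s)⁻¹ * oscW Δ (s - σ y).toNat * h x) x := by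
            intro x
            by_cases hx : x ∈ tri s y
            · rw [hκ, if_pos ⟨hy, hx⟩, Set.indicator_of_mem hx]
            · rw [hκ, if_neg fun hc => hx hc.2, Set.indicator_of_notMem hx, zero_mul]
          simp only [e]
          rw [lintegral_indicator (measurableSet_tri s y), lintegral_const_mul _ hh]
          calc A * (cellVol d s)⁻¹ * oscW Δ (s - σ y).toNat * ∫⁻ x in tri s y, h x
              ≤ A * (cellVol d s)⁻¹ * oscW Δ (s - σ y).toNat * (ν₂ * cellVol d s) := by
                gcongr; exact h₂ y s hy (Finset.mem_Ioc.1 hs).2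
            _ = A * ν₂ * oscW Δ (s - σ y).toNat * ((cellVol d s)⁻¹ * cellVol d s) := by ring
            _ = _ := by
                rw [ENNReal.inv_mul_cancel (cellVol_ne_zero s) (cellVol_ne_top s), mul_one]
        · rw [if_neg hy]
          simp [hκ, hy]
    _ = ∫⁻ y, ‖f y‖ₑ * ∑ s ∈ Finset.Ioc b k,
          (if σ y ≤ s then A * ν₂ * oscW Δ (s - σ y).toNat else 0) := by
        rw [← lintegral_finsetSum]
        · simp only [Finset.mul_sum]
        · intro s _
          refine hfm.mul ?_
          exact (measurable_of_countable fun m : ℤ =>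
            if m ≤ s then A * ν₂ * oscW Δ (s - m).toNat else 0).comp hσm
    -- For fixed `y` the levels `s ≥ σ y` are distinct generations above the stopping cell, so the
    -- oscillation factors sum to at most `2Δ + 2`.
    _ ≤ ∫⁻ y, ‖f y‖ₑ * (A * ν₂ * (2 * Δ + 2)) := by
        gcongr with y
        rw [← Finset.sum_filter]
        calc _ ≤ ∑ s ∈ Finset.Icc (σ y) k, A * ν₂ * oscW Δ (s - σ y).toNat := by
              refine Finset.sum_le_sum_of_subset fun s hs => ?_
              simp only [Finset.mem_filter, Finset.mem_Ioc, Finset.mem_Icc] at hs ⊢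
              exact ⟨hs.2, hs.1.2⟩
          _ ≤ _ := by
              rw [← Finset.mul_sum]
              gcongr
              exact sum_oscW_le Δ _ _
    _ = (∫⁻ y in tri k x₀, ‖f y‖ₑ) * (A * ν₂ * (2 * Δ + 2)) := by
        rw [lintegral_mul_const _ hfm, ← lintegral_indicator (measurableSet_tri k x₀)]
        congr 2
        ext y
        by_cases hy : y ∈ tri k x₀
        · simp [hy]
        · simp [hy, hsupp y hy]
    _ ≤ ν₁ * cellVol d k * (A * ν₂ * (2 * Δ + 2)) := by
        gcongr
        exact h₁ x₀ k (hk x₀) le_rfl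
    _ = _ := by ring

/-- The oscillation of maximal truncations of bounded functions on the stopping cells. -/
theorem truncSup_osc (hH : SmoothFamily A Δ B H) {g : Rd d → ℂ} (hg : NiceFun g) {ν : ℝ≥0∞}
    (hν : ∀ x, ‖g x‖ₑ ≤ ν) {j k : ℤ} {x z : Rd d} (hz : z ∈ (dyadic d).cell j x) :
    truncSup H g x j k ≤ truncSup H g z j k + 3 ^ d * A * (2 * Δ + 2) * ν := by
  -- At levels above `j` the points `x` and `z` have the same triple, to which both convolutions are
  -- confined; only the kernel oscillates.
  have hone : ∀ s, j < s → ‖(H s ⋆[ContinuousLinearMap.mul ℂ ℂ, volume] g) x -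
      (H s ⋆[ContinuousLinearMap.mul ℂ ℂ, volume] g) z‖ₑ ≤
        3 ^ d * A * ν * oscW Δ (s - j).toNat := by
    intro s hs
    rw [conv_eq, conv_eq, ← integral_sub (hg.integrable_mul_sub (hH.integrable s) x)
      (hg.integrable_mul_sub (hH.integrable s) z)]
    refine (enorm_integral_le_lintegral_enorm _).trans ?_
    have hzs : (dyadic d).idx s z = (dyadic d).idx s x := (dyadic d).idx_mono hs.le hz
    calc ∫⁻ y, ‖H s (x - y) * g y - H s (z - y) * g y‖ₑ
        ≤ ∫⁻ y, (tri s x).indicator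
            (fun _ => A * (cellVol d s)⁻¹ * oscW Δ (s - j).toNat * ν) y := by
          refine lintegral_mono fun y => ?_
          by_cases hy : y ∈ tri s x
          · rw [Set.indicator_of_mem hy, ← sub_mul, enorm_mul]
            refine mul_le_mul' (hH.osc hs.le ?_) (hν y)
            have e : (x - y) - (z - y) = x - z := by abel
            rw [e, supNorm_sub_comm]
            exact (supNorm_sub_lt_of_mem_cell hz).le
          · have hout : ∀ w, tri s w = tri s x → H s (w - y) = 0 := by
              intro w hw
              by_contra hne
              apply hy
              rw [← hw, mem_tri_comm]
              exact mem_tri_of_supNorm_le ((hH.supp s _ hne).le.trans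
                (zpow_le_zpow_right₀ (by norm_num) (by omega)))
            rw [hout x rfl, hout z (tri_congr hzs)]
            simp
      _ = A * (cellVol d s)⁻¹ * oscW Δ (s - j).toNat * ν * (3 ^ d * cellVol d s) := by
          rw [lintegral_indicator (measurableSet_tri s x), setLIntegral_const, volume_tri]
      _ = 3 ^ d * A * ν * oscW Δ (s - j).toNat * ((cellVol d s)⁻¹ * cellVol d s) := by ring
      _ = _ := by rw [ENNReal.inv_mul_cancel (cellVol_ne_zero s) (cellVol_ne_top s), mul_one]
  refine truncSup_le fun t₁ t₂ h1 h2 h3 => ?_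
  have : trunc H g x t₁ t₂ = trunc H g z t₁ t₂ + ∑ s ∈ Finset.Ioc t₁ t₂,
      ((H s ⋆[ContinuousLinearMap.mul ℂ ℂ, volume] g) x -
        (H s ⋆[ContinuousLinearMap.mul ℂ ℂ, volume] g) z) := by
    rw [trunc, trunc, ← Finset.sum_add_distrib]
    exact Finset.sum_congr rfl fun s _ => by ring
  rw [this]
  refine (enorm_add_le _ _).trans (add_le_add (le_truncSup h1 h2 h3) ?_)
  calc _ ≤ ∑ s ∈ Finset.Ioc t₁ t₂, 3 ^ d * A * ν * oscW Δ (s - j).toNat := by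
        refine (enorm_sum_le _ _).trans (Finset.sum_le_sum fun s hs => hone s ?_)
        exact h3.trans_lt (Finset.mem_Ioc.1 hs).1
    _ ≤ ∑ s ∈ Finset.Icc j t₂, 3 ^ d * A * ν * oscW Δ (s - j).toNat := by
        refine Finset.sum_le_sum_of_subset fun s hs => ?_
        simp only [Finset.mem_Ioc, Finset.mem_Icc] at hs ⊢
        exact ⟨h3.trans hs.1.le, hs.2⟩
    _ ≤ 3 ^ d * A * ν * (2 * Δ + 2) := by
        rw [← Finset.mul_sum]
        gcongr
        exact sum_oscW_le Δ _ _
    _ = _ := by ring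

end SmoothFamily

theorem sq_lintegral_mul_le {F U : Rd d → ℝ≥0∞} (hF : Measurable F) (hU : Measurable U) :
    (∫⁻ x, F x * U x) ^ 2 ≤ (∫⁻ x, F x ^ 2) * ∫⁻ x, U x ^ 2 := by
  have h := ENNReal.lintegral_mul_le_Lp_mul_Lq (volume : Measure (Rd d))
    (p := 2) (q := 2) ⟨by norm_num, by norm_num, by norm_num⟩ hF.aemeasurable hU.aemeasurable
  have h2 := pow_le_pow_left' h 2
  rw [mul_pow, ← ENNReal.rpow_natCast, ← ENNReal.rpow_natCast, ← ENNReal.rpow_natCast,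
    ← ENNReal.rpow_mul, ← ENNReal.rpow_mul] at h2
  simpa using h2

theorem le_of_sq_le_sq {a b : ℝ≥0∞} (h : a ^ 2 ≤ b ^ 2) : a ≤ b := by
  by_contra hcon
  exact absurd h (not_le.2 (ENNReal.pow_lt_pow_left (by norm_num) (not_le.1 hcon)))

namespace SmoothFamily

variable {A B : ℝ≥0∞} {Δ : ℕ} {H : ℤ → Rd d → ℂ}

/-- Cauchy-Schwarz and the `L²` bound. -/
theorem lintegral_truncSup_mul_le (hH : SmoothFamily A Δ B H) {σ : Rd d → ℤ} (hσ : Measurable σ)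
    {b k : ℤ} (hb : ∀ x, b ≤ σ x) {f : Rd d → ℂ} (hf : NiceFun f) {h : Rd d → ℝ≥0∞}
    (hh : Measurable h) {a c : ℝ≥0∞} (hfa : ∫⁻ x, ‖f x‖ₑ ^ 2 ≤ a ^ 2)
    (hhc : ∫⁻ x, h x ^ 2 ≤ c ^ 2) :
    ∫⁻ x, truncSup H f x (σ x) k * h x ≤ B * a * c := by
  refine le_of_sq_le_sq ?_
  refine (sq_lintegral_mul_le (measurable_truncSup (hH.measurable_conv hf) hσ k) hh).trans ?_
  rw [mul_pow, mul_pow]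
  refine mul_le_mul' ?_ hhc
  calc ∫⁻ x, truncSup H f x (σ x) k ^ 2 ≤ ∫⁻ x, truncSup H f x b k ^ 2 := by
        gcongr with x
        exact truncSup_mono _ _ _ (hb x) le_rfl
    _ ≤ B ^ 2 * ∫⁻ x, ‖f x‖ₑ ^ 2 := hH.l2 f hf b k
    _ ≤ _ := by gcongr

/-- The basic estimate: local averages at the stopping scales control the truncations above
these scales. -/
theorem lintegral_truncSup_le (hH : SmoothFamily A Δ B H) {σ : Rd d → ℤ}
    (hσ : (dyadic d).IsStopping σ) {b k : ℤ} (hb : ∀ x, b ≤ σ x) (hk : ∀ x, σ x ≤ k)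
    (hW : ∀ x x', supNorm (x - x') ≤ 2 ^ (σ x' - 1) → σ x' - 1 ≤ σ x)
    {f : Rd d → ℂ} (hf : NiceFun f) {x₀ : Rd d} (hsupp : ∀ x, x ∉ tri k x₀ → f x = 0)
    {h : Rd d → ℝ≥0∞} (hh : Measurable h) (hhs : ∀ x, x ∉ (dyadic d).cell k x₀ → h x = 0)
    {ν₁ ν₂ : ℝ≥0∞}
    (h₁ : ∀ x j, σ x ≤ j → j ≤ k → ∫⁻ y in tri j x, ‖f y‖ₑ ≤ ν₁ * cellVol d j)
    (h₂ : ∀ x j, σ x ≤ j → j ≤ k → ∫⁻ y in tri j x, h y ≤ ν₂ * cellVol d j) :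
    ∫⁻ x, truncSup H f x (σ x) k * h x ≤
      2 * 3 ^ d * (A * (2 * Δ + 2) + B) * (ν₁ * ν₂) * cellVol d k := by
  have hE := niceFun_cavg hσ hf hk hsupp
  -- The function is split into its averages `g`, bounded by `ν₁`, and a part with mean zero on the
  -- stopping cells.
  set g := (dyadic d).cavg σ f with hg
  set G : Rd d → ℝ≥0∞ := fun x => truncSup H g x (σ x) k with hG
  have hGm : Measurable G := measurable_truncSup (hH.measurable_conv hE) hσ.measurable k
  have havg : ∀ (F : Rd d → ℝ≥0∞) (ν : ℝ≥0∞),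
      (∀ x j, σ x ≤ j → j ≤ k → ∫⁻ y in tri j x, F y ≤ ν * cellVol d j) →
      ∀ x, (dyadic d).avgσ σ F x ≤ ν := by
    intro F ν hF x
    rw [Grid.avgσ, volume_dyadic_cell]
    calc _ ≤ (cellVol d (σ x))⁻¹ * (ν * cellVol d (σ x)) := by
          gcongr
          exact (lintegral_mono_set (cell_subset_tri _ _)).trans (hF x _ le_rfl (hk x))
      _ = ν := by
          rw [mul_comm ν, ← mul_assoc, ENNReal.inv_mul_cancel (cellVol_ne_zero _)
            (cellVol_ne_top _), one_mul]
  have hgν : ∀ x, ‖g x‖ₑ ≤ ν₁ := fun x => (Grid.enorm_cavg_le f x).trans (havg _ _ h₁ x)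
  have hone : (1 : ℝ≥0∞) ≤ 3 ^ d := one_le_pow₀ (by norm_num)
  -- Squaring the factor `3 ^ d` makes the product in the Cauchy-Schwarz step below a perfect
  -- square.
  have hsub : 3 ^ d * cellVol d k ≤ (3 ^ d) ^ 2 * cellVol d k := by
    rw [sq, mul_assoc]
    exact le_mul_of_one_le_left' hone
  have hint_h : ∫⁻ x, h x ≤ ν₂ * cellVol d k := by
    calc ∫⁻ x, h x = ∫⁻ x in tri k x₀, h x := by
          rw [← lintegral_indicator (measurableSet_tri k x₀)]
          congr 1; ext x
          by_cases hx : x ∈ tri k x₀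
          · simp [hx]
          · simp [hx, hhs x fun hc => hx (cell_subset_tri _ _ hc)]
      _ ≤ _ := h₂ x₀ k (hk x₀) le_rfl
  -- The truncations of `g` above the stopping level hardly vary on a stopping cell, so `G` may be
  -- replaced by its cell average. By self-adjointness the average then falls on `h`.
  have hGavg : ∀ x, G x ≤ (dyadic d).avgσ σ G x + 3 ^ d * A * (2 * Δ + 2) * ν₁ := by
    intro x
    have h3 : ∀ z ∈ (dyadic d).cell (σ x) x, G x ≤ G z + 3 ^ d * A * (2 * Δ + 2) * ν₁ := by
      intro z hz
      simp only [hG, hσ x z hz]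
      exact hH.truncSup_osc hE hgν hz
    have hv0 := (dyadic d).volume_cell_ne_zero (σ x) x
    have hvt := (dyadic d).volume_cell_ne_top (σ x) x
    calc G x = (volume ((dyadic d).cell (σ x) x))⁻¹ * ∫⁻ _z in (dyadic d).cell (σ x) x, G x := by
          rw [setLIntegral_const, mul_comm (G x), ← mul_assoc, ENNReal.inv_mul_cancel hv0 hvt,
            one_mul]
      _ ≤ (volume ((dyadic d).cell (σ x) x))⁻¹ * ∫⁻ z in (dyadic d).cell (σ x) x,
            (G z + 3 ^ d * A * (2 * Δ + 2) * ν₁) := by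
          gcongr 1
          exact setLIntegral_mono' ((dyadic d).measurableSet_cell _ _) h3
      _ = _ := by
          rw [lintegral_add_left hGm, setLIntegral_const, mul_add, Grid.avgσ,
            mul_comm _ (volume _), ← mul_assoc _ (volume _), ENNReal.inv_mul_cancel hv0 hvt,
            one_mul]
  have hEh0 : ∀ x, x ∉ (dyadic d).cell k x₀ → (dyadic d).avgσ σ h x = 0 := by
    intro x hx
    rw [Grid.avgσ, setLIntegral_congr_fun (g := fun _ => 0) ((dyadic d).measurableSet_cell _ _)]
    · simp
    · intro y hy
      refine hhs y fun hc => hx ?_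
      exact ((dyadic d).cell_mono (hk x) x hy).symm.trans hc
  have hg2 : ∫⁻ x, ‖g x‖ₑ ^ 2 ≤ ν₁ ^ 2 * (3 ^ d * cellVol d k) := by
    calc ∫⁻ x, ‖g x‖ₑ ^ 2 ≤ ∫⁻ _x in tri k x₀, ν₁ ^ 2 := by
          rw [← lintegral_indicator (measurableSet_tri _ _)]
          gcongr with x
          by_cases hx : x ∈ tri k x₀
          · rw [Set.indicator_of_mem hx]
            gcongr
            exact hgν x
          · simp [hg, cavg_eq_zero hk hsupp hx]
      _ = _ := by rw [setLIntegral_const, volume_tri]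
  -- After averaging, both functions are bounded, by `ν₁` and `ν₂`, and of support comparable to
  -- `Q`; hence the `L²` bound costs nothing beyond `B`.
  have hGEh : ∫⁻ x, G x * (dyadic d).avgσ σ h x ≤ B * (3 ^ d * ν₁) * ν₂ * cellVol d k := by
    refine le_of_sq_le_sq ?_
    refine (sq_lintegral_mul_le hGm (hσ.measurable_avgσ h)).trans ?_
    have h5 : ∫⁻ x, G x ^ 2 ≤ B ^ 2 * (ν₁ ^ 2 * (3 ^ d * cellVol d k)) := by
      calc ∫⁻ x, G x ^ 2 ≤ ∫⁻ x, truncSup H g x b k ^ 2 := by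
            gcongr with x
            exact truncSup_mono _ _ _ (hb x) le_rfl
        _ ≤ B ^ 2 * ∫⁻ x, ‖g x‖ₑ ^ 2 := hH.l2 g hE b k
        _ ≤ _ := by gcongr
    have h6 : ∫⁻ x, (dyadic d).avgσ σ h x ^ 2 ≤ ν₂ ^ 2 * cellVol d k := by
      calc ∫⁻ x, (dyadic d).avgσ σ h x ^ 2 ≤ ∫⁻ _x in (dyadic d).cell k x₀, ν₂ ^ 2 := by
            rw [← lintegral_indicator ((dyadic d).measurableSet_cell _ _)]
            gcongr with x
            by_cases hx : x ∈ (dyadic d).cell k x₀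
            · rw [Set.indicator_of_mem hx]
              gcongr
              exact havg _ _ h₂ x
            · simp [hEh0 x hx]
        _ = ν₂ ^ 2 * cellVol d k := by rw [setLIntegral_const, volume_dyadic_cell]
    calc _ ≤ B ^ 2 * (ν₁ ^ 2 * ((3 ^ d) ^ 2 * cellVol d k)) * (ν₂ ^ 2 * cellVol d k) := by
          refine mul_le_mul' (h5.trans ?_) h6
          gcongr
      _ = _ := by ring
  calc ∫⁻ x, truncSup H f x (σ x) k * h x
      ≤ ∫⁻ x, ((G x * h x) + (∑ s ∈ Finset.Ioc (σ x) k, ‖(H s ⋆[ContinuousLinearMap.mul ℂ ℂ,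
          volume] fun y => f y - g y) x‖ₑ) * h x) := by
        refine lintegral_mono fun x => ?_
        rw [← add_mul]
        gcongr
        exact truncSup_sub_le hH.integrable hf hE x (σ x) k
    _ = (∫⁻ x, G x * h x) + ∫⁻ x, (∑ s ∈ Finset.Ioc (σ x) k, ‖(H s ⋆[ContinuousLinearMap.mul ℂ ℂ,
          volume] fun y => f y - g y) x‖ₑ) * h x := lintegral_add_left (hGm.mul hh) _
    _ ≤ (B * (3 ^ d * ν₁) * ν₂ * cellVol d k + 3 ^ d * A * (2 * Δ + 2) * ν₁ * (ν₂ * cellVol d k)) +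
          A * (2 * Δ + 2) * ν₁ * ν₂ * cellVol d k := by
        refine add_le_add ?_ (hH.lintegral_sum_conv_sub_cavg_le hσ hb hk hW hf hsupp hh h₁ h₂)
        calc ∫⁻ x, G x * h x
            ≤ ∫⁻ x, ((dyadic d).avgσ σ G x * h x + 3 ^ d * A * (2 * Δ + 2) * ν₁ * h x) := by
              refine lintegral_mono fun x => ?_
              rw [← add_mul]
              gcongr
              exact hGavg x
          _ = (∫⁻ x, G x * (dyadic d).avgσ σ h x) + 3 ^ d * A * (2 * Δ + 2) * ν₁ * ∫⁻ x, h x := by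
              have hm : Measurable fun x => (dyadic d).avgσ σ G x * h x :=
                (hσ.measurable_avgσ G).mul hh
              rw [lintegral_add_left hm, lintegral_const_mul _ hh,
                hσ.lintegral_avgσ_mul G h hGm hh]
          _ ≤ _ := by gcongr
    _ ≤ (B * (3 ^ d * ν₁) * ν₂ * cellVol d k + 3 ^ d * A * (2 * Δ + 2) * ν₁ * (ν₂ * cellVol d k)) +
          (3 ^ d * (A * (2 * Δ + 2) * ν₁ * ν₂ * cellVol d k) +
            B * (3 ^ d * ν₁) * ν₂ * cellVol d k) := by
        gcongr
        exact (le_mul_of_one_le_left' hone).trans le_self_add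
    _ = _ := by ring

end SmoothFamily

/-! ### Truncation of functions at a height -/

theorem le_rpow_mul_rpow {a m : ℝ≥0∞} {p : ℝ} (hp : 1 ≤ p) (hm0 : m ≠ 0) (ha : a ≠ ∞)
    (h : m ≤ a) : a ≤ m ^ (1 - p) * a ^ p := by
  have ha0 : a ≠ 0 := (lt_of_lt_of_le (pos_iff_ne_zero.2 hm0) h).ne'
  calc a = a ^ (1 - p) * a ^ p := by
        rw [← ENNReal.rpow_add _ _ ha0 ha]; simp
    _ ≤ m ^ (1 - p) * a ^ p := by
        gcongr 1
        rw [show 1 - p = -(p - 1) by ring, ENNReal.rpow_neg, ENNReal.rpow_neg, ENNReal.inv_le_inv]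
        exact ENNReal.rpow_le_rpow h (by linarith)

theorem sq_le_rpow_mul_rpow {a m : ℝ≥0∞} {p : ℝ} (hp2 : p ≤ 2) (ha : a ≠ ∞)
    (h : a ≤ m) : a ^ 2 ≤ m ^ (2 - p) * a ^ p := by
  rcases eq_or_ne a 0 with h0 | ha0
  · simp [h0]
  calc a ^ 2 = a ^ (2 - p) * a ^ p := by
        rw [← ENNReal.rpow_add _ _ ha0 ha]; simp
    _ ≤ m ^ (2 - p) * a ^ p := by
        gcongr 1
        exact ENNReal.rpow_le_rpow h (by linarith)

/-! ### Stopping levels -/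

theorem cellVol_mono {i j : ℤ} (h : i ≤ j) : cellVol d i ≤ cellVol d j := by
  unfold cellVol
  gcongr
  norm_num

/-- Stopping levels of Whitney type: up to the stopping cells, the averages of two functions are
controlled by their averages over the top cube. -/
theorem exists_stopping {b k : ℤ} (hbk : b ≤ k) {F : Fin 2 → Rd d → ℝ≥0∞}
    (hF : ∀ e, Measurable (F e)) {m : Fin 2 → ℝ≥0∞} (hm0 : ∀ e, m e ≠ 0) (hm : ∀ e, m e ≠ ∞)
    (hFm : ∀ e, ∫⁻ x, F e x ≤ m e * (3 ^ d * cellVol d k)) :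
    ∃ σ : Rd d → ℤ, (dyadic d).IsStopping σ ∧ (∀ x, b ≤ σ x) ∧ (∀ x, σ x ≤ k) ∧
      (b < k → ∀ x, σ x < k) ∧
      (∀ x x', supNorm (x - x') ≤ 2 ^ (σ x' - 1) → σ x' - 1 ≤ σ x) ∧
      (∀ e x j, σ x ≤ j → j ≤ k →
        ∫⁻ y in tri j x, F e y ≤ 4 * 108 ^ d * m e * cellVol d j) ∧
      2 * volume {x | σ x ≠ b} ≤ cellVol d k := by
  classical
  -- In the weak type estimate one `3 ^ d` comes from the shifted grids and one from the volume of
  -- the triple, while 4 accounts for two functions and a set of at most half the volume.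
  set κ : ℝ≥0∞ := 4 * 9 ^ d with hκ
  have hκ0 : κ ≠ 0 := by positivity
  have hκt : κ ≠ ∞ := ENNReal.mul_ne_top (by norm_num) (by simp)
  have hκ1 : (1 : ℝ≥0∞) ≤ κ := by
    calc (1 : ℝ≥0∞) = 1 * 1 := by norm_num
      _ ≤ 4 * 9 ^ d := mul_le_mul' (by norm_num) (one_le_pow₀ (by norm_num))
  -- A point is good from level `j` on if all its averages at the levels `j, …, k` are under
  -- control. A cell is active if it or a neighbour contains such a point; admitting neighbours
  -- produces the Whitney property.
  set bad : ℤ → Rd d → Prop := fun j y => ∃ e, κ * m e < triAvg j (F e) y with hbad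
  set good : ℤ → Rd d → Prop := fun j y => ∀ i, j ≤ i → i ≤ k → ¬ bad i y with hgood
  set active : ℤ → Rd d → Prop := fun j x => ∃ y ∈ tri j x, good j y with hactive
  have act_congr : ∀ j x y, (dyadic d).idx j x = (dyadic d).idx j y → active j x → active j y := by
    rintro j x y h ⟨z, hz, hg⟩
    exact ⟨z, tri_congr h ▸ hz, hg⟩
  -- Going down from `k`, one stops at the first inactive cell, or at the bottom level `b` if there
  -- is none above it.
  choose σ hσk hσP hσmax using fun x => Grid.exists_max_level (n := k)
    (P := fun j => b ≤ j ∧ (j = b ∨ ¬ active j x)) ⟨b, hbk, le_rfl, Or.inl rfl⟩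
  have act_above : ∀ x i, σ x < i → i ≤ k → active i x := by
    intro x i hi hik
    by_contra hcon
    exact hσmax x i hik hi ⟨(hσP x).1.trans hi.le, Or.inr hcon⟩
  have not_act : ∀ x, σ x ≠ b → ¬ active (σ x) x := fun x h =>
    (hσP x).2.resolve_left h
  have tot : ∀ e j (y : Rd d), (volume (tri j y))⁻¹ * ∫⁻ z, F e z ≤
      m e * (3 ^ d * cellVol d k) * (volume (tri j y))⁻¹ := fun e j y => by
    rw [mul_comm]; gcongr; exact hFm e
  have act_top : ∀ x, active k x := by
    intro x
    refine ⟨x, cell_subset_tri _ _ ((dyadic d).self_mem_cell _ _), fun i hki hik => ?_⟩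
    obtain rfl : i = k := le_antisymm hik hki
    rintro ⟨e, he⟩
    refine absurd he (not_lt.2 ?_)
    calc triAvg i (F e) x ≤ (volume (tri i x))⁻¹ * ∫⁻ z, F e z := by
          unfold triAvg; gcongr; exact Measure.restrict_le_self
      _ ≤ m e * (3 ^ d * cellVol d i) * (volume (tri i x))⁻¹ := tot e i x
      _ = m e := by
          rw [volume_tri, mul_assoc, ENNReal.mul_inv_cancel _ _, mul_one]
          · exact mul_ne_zero (by simp) (cellVol_ne_zero i)
          · exact ENNReal.mul_ne_top (by simp) (cellVol_ne_top i)
      _ ≤ κ * m e := le_mul_of_one_le_left' hκ1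
  refine ⟨σ, ?_, fun x => (hσP x).1, hσk, ?_, ?_, ?_, ?_⟩
  · intro x y hxy
    have hcg : ∀ j, σ x ≤ j → (dyadic d).idx j y = (dyadic d).idx j x := fun j hj =>
      (dyadic d).idx_mono hj hxy
    rcases lt_trichotomy (σ y) (σ x) with h | h | h
    · have h1 := act_above y (σ x) h (hσk x)
      have h2 : σ x ≠ b := fun hb => absurd (hσP y).1 (not_le.2 (hb ▸ h))
      exact absurd (act_congr _ _ _ (hcg _ le_rfl) h1) (not_act x h2)
    · exact h
    · have h1 := act_above x (σ y) h (hσk y)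
      have h2 : σ y ≠ b := fun hb => absurd (hσP x).1 (not_le.2 (hb ▸ h))
      exact absurd (act_congr _ _ _ (hcg _ h.le).symm h1) (not_act y h2)
  · intro hlt x
    refine lt_of_le_of_ne (hσk x) fun h => ?_
    have h1 : σ x ≠ b := by omega
    exact not_act x h1 (h ▸ act_top x)
  · intro x x' hxx
    by_contra hcon
    have hcon := not_le.1 hcon
    have hne : σ x' ≠ b := by have := (hσP x).1; omega
    refine not_act x' hne ?_
    -- If `x` stopped below `σ x' - 1`, a good point `y` would be next to `x`, which is next to
    -- `x'`, at that level. Their indices differ by at most 2, hence by at most 1 one level up, so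
    -- the stopping cell of `x'` would be active.
    obtain ⟨y, hy, hg⟩ := act_above x (σ x' - 1) hcon (by have := hσk x'; omega)
    refine ⟨y, fun i => ?_, fun i hi hik => hg i (by omega) hik⟩
    have h1 := mem_tri_of_supNorm_le hxx i
    have h2 := hy i
    have e1 := dyadic_idx_succ (σ x' - 1) y i
    have e2 := dyadic_idx_succ (σ x' - 1) x' i
    rw [sub_add_cancel] at e1 e2
    rw [e1, e2]
    rw [abs_le] at h1 h2 ⊢
    omega
  · intro e x j hxj hjk
    -- For `j ≥ k - 1` no stopping information is needed: the total integral suffices, as `|Q_k| ≤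
    -- 2^d |Q_j|`.
    have hbig : ∀ l : ℕ, k ≤ j + l → l ≤ 1 →
        ∫⁻ y in tri j x, F e y ≤ 4 * 108 ^ d * m e * cellVol d j := by
      intro l hl hl1
      have h1 : cellVol d k ≤ 2 ^ d * cellVol d j := by
        rw [← cellVol_succ]
        exact cellVol_mono (by omega)
      calc ∫⁻ y in tri j x, F e y ≤ ∫⁻ y, F e y := setLIntegral_le_lintegral _ _
        _ ≤ m e * (3 ^ d * (2 ^ d * cellVol d j)) := (hFm e).trans (by gcongr)
        _ = 6 ^ d * m e * cellVol d j := by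
            rw [show (6 : ℝ≥0∞) = 3 * 2 by norm_num, mul_pow]; ring
        _ ≤ 4 * 108 ^ d * m e * cellVol d j := by
            gcongr
            calc (6 : ℝ≥0∞) ^ d ≤ 108 ^ d := by gcongr; norm_num
              _ ≤ 4 * 108 ^ d := le_mul_of_one_le_left' (by norm_num)
    by_cases hj1 : k ≤ j + 1
    · exact hbig 1 (by exact_mod_cast hj1) le_rfl
    · obtain ⟨y, hy, hg⟩ := act_above x (j + 1) (by omega) (by omega)
      -- Level `j + 1` at `x` is active with witness `y`, but `y` may lie in a neighbouring cell.
      -- Two levels above `j` its triple contains that of `x`. The constant is `4 · 108^d = κ · 3^d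
      -- · 4^d`.
      have hsub : tri j x ⊆ tri (j + 2) y := by
        intro z hz i
        have h1 := hz i
        have h2 := hy i
        have e1 : ∀ w : Rd d, (dyadic d).idx (j + 2) w i = (dyadic d).idx (j + 1) w i / 2 := by
          intro w
          rw [← dyadic_idx_succ]; congr 1; ring
        have e2 := dyadic_idx_succ j z i
        have e3 := dyadic_idx_succ j x i
        rw [e1, e1]
        rw [abs_le] at h1 h2 ⊢
        omega
      have h3 := hg (j + 2) (by omega) (by omega)
      simp only [hbad, not_exists, not_lt] at h3
      have h4 := h3 e
      rw [triAvg, volume_tri] at h4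
      have hv0 : (3 ^ d * cellVol d (j + 2) : ℝ≥0∞) ≠ 0 := mul_ne_zero (by simp) (cellVol_ne_zero _)
      have hvt : (3 ^ d * cellVol d (j + 2) : ℝ≥0∞) ≠ ∞ := ENNReal.mul_ne_top (by simp) (cellVol_ne_top _)
      calc ∫⁻ y in tri j x, F e y ≤ ∫⁻ z in tri (j + 2) y, F e z := lintegral_mono_set hsub
        _ = (3 ^ d * cellVol d (j + 2)) * ((3 ^ d * cellVol d (j + 2))⁻¹ *
              ∫⁻ z in tri (j + 2) y, F e z) := by
            rw [← mul_assoc, ENNReal.mul_inv_cancel hv0 hvt, one_mul]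
        _ ≤ (3 ^ d * cellVol d (j + 2)) * (κ * m e) := by gcongr
        _ = _ := by
            rw [show j + 2 = j + 1 + 1 by ring, cellVol_succ, cellVol_succ, hκ,
              show (108 : ℝ≥0∞) = 3 * 2 * 2 * 9 by norm_num, mul_pow, mul_pow, mul_pow]
            ring
  -- A point that stops above `b` has an inactive cell; in particular it is not itself good, so one
  -- of its averages exceeds the threshold.
  · have hsub : {x | σ x ≠ b} ⊆ ⋃ e, {x | ∃ j ≤ k, κ * m e < triAvg j (F e) x} := by
      intro x hx
      have h1 := not_act x hx
      have h2 : ¬ good (σ x) x := fun hg =>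
        h1 ⟨x, cell_subset_tri _ _ ((dyadic d).self_mem_cell _ _), hg⟩
      simp only [hgood, not_forall, not_not] at h2
      obtain ⟨i, -, hik, e, he⟩ := h2
      exact Set.mem_iUnion.2 ⟨e, i, hik, he⟩
    have hw : ∀ e, κ * volume {x | ∃ j ≤ k, κ * m e < triAvg j (F e) x} ≤
        3 ^ d * (3 ^ d * cellVol d k) := by
      intro e
      have h1 := volume_lt_triAvg k (F e) (hF e) (κ * m e)
      have h2 : m e * (κ * volume {x | ∃ j ≤ k, κ * m e < triAvg j (F e) x}) ≤
          m e * (3 ^ d * (3 ^ d * cellVol d k)) := by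
        calc _ = κ * m e * volume {x | ∃ j ≤ k, κ * m e < triAvg j (F e) x} := by ring
          _ ≤ 3 ^ d * (m e * (3 ^ d * cellVol d k)) := h1.trans (by gcongr; exact hFm e)
          _ = _ := by ring
      exact (ENNReal.mul_le_mul_iff_right (hm0 e) (hm e)).1 h2
    have h5 : κ * (2 * volume {x | σ x ≠ b}) ≤ κ * cellVol d k := by
      calc κ * (2 * volume {x | σ x ≠ b})
          ≤ κ * (2 * ∑ e, volume {x | ∃ j ≤ k, κ * m e < triAvg j (F e) x}) := by
            gcongr
            exact (measure_mono hsub).trans (measure_iUnion_fintype_le _ _)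
        _ = 2 * ∑ e, κ * volume {x | ∃ j ≤ k, κ * m e < triAvg j (F e) x} := by
            rw [← Finset.mul_sum]; ring
        _ ≤ 2 * ∑ _e : Fin 2, 3 ^ d * (3 ^ d * cellVol d k) := by
            exact mul_le_mul_right (Finset.sum_le_sum fun e _ => hw e) 2
        _ = κ * cellVol d k := by
            rw [Finset.sum_const, hκ, show (9 : ℝ≥0∞) = 3 * 3 by norm_num, mul_pow]
            simp
            ring
    exact (ENNReal.mul_le_mul_iff_right hκ0 hκt).1 h5

namespace SmoothFamily

variable {A B : ℝ≥0∞} {Δ : ℕ} {H : ℤ → Rd d → ℂ}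

/-- The estimate for one stopping generation: the tall parts of the functions are controlled by
the basic estimate, and the bounded parts by the `L²` bound. -/
theorem lintegral_truncSup_le_of_rpow (hH : SmoothFamily A Δ B H) {σ : Rd d → ℤ}
    (hσ : (dyadic d).IsStopping σ) {b k : ℤ} (hb : ∀ x, b ≤ σ x) (hk : ∀ x, σ x ≤ k)
    (hW : ∀ x x', supNorm (x - x') ≤ 2 ^ (σ x' - 1) → σ x' - 1 ≤ σ x)
    {f₁ f₂ : Rd d → ℂ} (hf₁ : NiceFun f₁) (hf₂ : NiceFun f₂) {x₀ : Rd d}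
    (hs₁ : ∀ x, x ∉ tri k x₀ → f₁ x = 0) (hs₂ : ∀ x, x ∉ (dyadic d).cell k x₀ → f₂ x = 0)
    {p : ℝ} (hp : 1 ≤ p) (hp2 : p ≤ 2) {c μ₁ μ₂ t : ℝ≥0∞} (hc : 3 ^ d ≤ c) (ht : 1 ≤ t)
    (ht' : t ≠ ∞)
    (hμ₁ : μ₁ ≠ 0) (hμ₂ : μ₂ ≠ 0) (hμ₁' : μ₁ ≠ ∞) (hμ₂' : μ₂ ≠ ∞)
    (h₁ : ∀ x j, σ x ≤ j → j ≤ k → ∫⁻ y in tri j x, ‖f₁ y‖ₑ ^ p ≤ c * μ₁ ^ p * cellVol d j)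
    (h₂ : ∀ x j, σ x ≤ j → j ≤ k → ∫⁻ y in tri j x, ‖f₂ y‖ₑ ^ p ≤ c * μ₂ ^ p * cellVol d j) :
    ∫⁻ x, truncSup H f₁ x (σ x) k * ‖f₂ x‖ₑ ≤
      8 * 3 ^ d * c ^ 2 * ((A * (2 * Δ + 2) + B) * t ^ (1 - p) + B * t) * (μ₁ * μ₂) *
        cellVol d k := by
  have hp0 : 0 < p := by linarith
  have ht0 : t ≠ 0 := (zero_lt_one.trans_le ht).ne'
  have hone : (1 : ℝ≥0∞) ≤ c := (one_le_pow₀ (by norm_num)).trans hc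
  -- the tall part, the truncated part and their integrals
  have htall : ∀ (f : Rd d → ℂ) (μ : ℝ≥0∞), μ ≠ 0 → μ ≠ ∞ → NiceFun f →
      (∀ x j, σ x ≤ j → j ≤ k → ∫⁻ y in tri j x, ‖f y‖ₑ ^ p ≤ c * μ ^ p * cellVol d j) →
      ∀ x j, σ x ≤ j → j ≤ k → ∫⁻ y in tri j x, ‖{y | t * μ < ‖f y‖ₑ}.indicator f y‖ₑ ≤
        c * t ^ (1 - p) * μ * cellVol d j := by
    intro f μ hμ hμt hf hfp x j hxj hjk
    calc ∫⁻ y in tri j x, ‖{y | t * μ < ‖f y‖ₑ}.indicator f y‖ₑ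
        ≤ ∫⁻ y in tri j x, (t * μ) ^ (1 - p) * ‖f y‖ₑ ^ p := by
          gcongr with y
          by_cases hy : t * μ < ‖f y‖ₑ
          · rw [Set.indicator_of_mem (by exact hy)]
            exact le_rpow_mul_rpow hp (mul_ne_zero ht0 hμ) (by simp) hy.le
          · rw [Set.indicator_of_notMem (by exact hy)]
            simp
      _ = (t * μ) ^ (1 - p) * ∫⁻ y in tri j x, ‖f y‖ₑ ^ p :=
          lintegral_const_mul _ (hf.meas.enorm.pow_const p)
      _ ≤ (t * μ) ^ (1 - p) * (c * μ ^ p * cellVol d j) := by gcongr; exact hfp x j hxj hjk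
      _ = c * t ^ (1 - p) * (μ ^ (1 - p) * μ ^ p) * cellVol d j := by
          rw [ENNReal.mul_rpow_of_ne_top ht' hμt]; ring
      _ = _ := by rw [← ENNReal.rpow_add _ _ hμ hμt]; simp
  have hall : ∀ (f : Rd d → ℂ) (μ : ℝ≥0∞), μ ≠ 0 → μ ≠ ∞ → NiceFun f →
      (∀ x j, σ x ≤ j → j ≤ k → ∫⁻ y in tri j x, ‖f y‖ₑ ^ p ≤ c * μ ^ p * cellVol d j) →
      ∀ x j, σ x ≤ j → j ≤ k → ∫⁻ y in tri j x, ‖f y‖ₑ ≤ 2 * c * μ * cellVol d j := by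
    intro f μ hμ hμt hf hfp x j hxj hjk
    calc ∫⁻ y in tri j x, ‖f y‖ₑ ≤ ∫⁻ y in tri j x, (μ + μ ^ (1 - p) * ‖f y‖ₑ ^ p) := by
          gcongr with y
          rcases le_total ‖f y‖ₑ μ with h | h
          · exact h.trans le_self_add
          · exact (le_rpow_mul_rpow hp hμ (by simp) h).trans le_add_self
      _ = μ * (3 ^ d * cellVol d j) + μ ^ (1 - p) * ∫⁻ y in tri j x, ‖f y‖ₑ ^ p := by
          rw [lintegral_add_left measurable_const, setLIntegral_const, volume_tri,
            lintegral_const_mul _ (hf.meas.enorm.pow_const p)]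
      _ ≤ μ * (c * cellVol d j) + μ ^ (1 - p) * (c * μ ^ p * cellVol d j) := by
          gcongr
          exact hfp x j hxj hjk
      _ = μ * (c * cellVol d j) + (μ ^ (1 - p) * μ ^ p) * (c * cellVol d j) := by ring
      _ = _ := by rw [← ENNReal.rpow_add _ _ hμ hμt]; simp; ring
  have hlow : ∀ (f : Rd d → ℂ) (μ : ℝ≥0∞), μ ≠ 0 → μ ≠ ∞ → NiceFun f →
      (∀ x, x ∉ tri k x₀ → f x = 0) →
      (∀ x j, σ x ≤ j → j ≤ k → ∫⁻ y in tri j x, ‖f y‖ₑ ^ p ≤ c * μ ^ p * cellVol d j) →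
      ∫⁻ y, ‖f y - {y | t * μ < ‖f y‖ₑ}.indicator f y‖ₑ ^ 2 ≤
        c * t ^ (2 - p) * μ ^ 2 * cellVol d k := by
    intro f μ hμ hμt hf hs hfp
    calc ∫⁻ y, ‖f y - {y | t * μ < ‖f y‖ₑ}.indicator f y‖ₑ ^ 2
        ≤ ∫⁻ y in tri k x₀, (t * μ) ^ (2 - p) * ‖f y‖ₑ ^ p := by
          rw [← lintegral_indicator (measurableSet_tri k x₀)]
          gcongr with y
          by_cases hy0 : y ∈ tri k x₀
          · rw [Set.indicator_of_mem hy0]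
            by_cases hy : t * μ < ‖f y‖ₑ
            · rw [Set.indicator_of_mem (by exact hy)]
              simp
            · rw [Set.indicator_of_notMem (by exact hy), sub_zero]
              exact sq_le_rpow_mul_rpow hp2 (by simp) (not_lt.1 hy)
          · rw [Set.indicator_of_notMem hy0]
            simp [hs y hy0]
      _ = (t * μ) ^ (2 - p) * ∫⁻ y in tri k x₀, ‖f y‖ₑ ^ p :=
          lintegral_const_mul _ (hf.meas.enorm.pow_const p)
      _ ≤ (t * μ) ^ (2 - p) * (c * μ ^ p * cellVol d k) := by
          gcongr; exact hfp x₀ k (hk x₀) le_rfl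
      _ = c * t ^ (2 - p) * (μ ^ (2 - p) * μ ^ p) * cellVol d k := by
          rw [ENNReal.mul_rpow_of_ne_top ht' hμt]; ring
      _ = _ := by rw [← ENNReal.rpow_add _ _ hμ hμt]; simp
  have hms : ∀ (f : Rd d → ℂ) (μ : ℝ≥0∞), NiceFun f → MeasurableSet {y | t * μ < ‖f y‖ₑ} :=
    fun f μ hf => measurableSet_lt measurable_const hf.meas.enorm
  have hs₂' : ∀ x, x ∉ tri k x₀ → f₂ x = 0 := fun x hx =>
    hs₂ x fun h => hx (cell_subset_tri _ _ h)
  -- The pairing splits as tall with full, low with tall, low with low. The first two have a tall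
  -- factor, with small `L¹` averages; the third is handled on `L²`.
  set T₁ := {y | t * μ₁ < ‖f₁ y‖ₑ}.indicator f₁ with hT₁
  set T₂ := {y | t * μ₂ < ‖f₂ y‖ₑ}.indicator f₂ with hT₂
  have nT₁ : NiceFun T₁ := hf₁.indicator (hms f₁ μ₁ hf₁)
  have nT₂ : NiceFun T₂ := hf₂.indicator (hms f₂ μ₂ hf₂)
  have nL₁ := hf₁.sub nT₁
  have nL₂ := hf₂.sub nT₂
  set C₀ : ℝ≥0∞ := 2 * 3 ^ d * (A * (2 * Δ + 2) + B) with hC₀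
  have mG₁ : Measurable fun x => truncSup H f₁ x (σ x) k :=
    measurable_truncSup (hH.measurable_conv hf₁) hσ.measurable k
  have mGL : Measurable fun x => truncSup H (fun y => f₁ y - T₁ y) x (σ x) k :=
    measurable_truncSup (hH.measurable_conv nL₁) hσ.measurable k
  have mGT : Measurable fun x => truncSup H T₁ x (σ x) k :=
    measurable_truncSup (hH.measurable_conv nT₁) hσ.measurable k
  have hLle : ∀ y, ‖f₁ y - T₁ y‖ₑ ≤ ‖f₁ y‖ₑ := by
    intro y
    simp only [hT₁, Set.indicator_apply]
    split_ifs <;> simp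
  -- the three terms
  have term1 : ∫⁻ x, truncSup H T₁ x (σ x) k * ‖f₂ x‖ₑ ≤
      C₀ * ((c * t ^ (1 - p) * μ₁) * (2 * c * μ₂)) * cellVol d k :=
    hH.lintegral_truncSup_le (x₀ := x₀) hσ hb hk hW nT₁
      (fun x hx => by simp only [hT₁, Set.indicator_apply, hs₁ x hx, ite_self]) hf₂.meas.enorm
      (fun x hx => by simp [hs₂ x hx]) (htall f₁ μ₁ hμ₁ hμ₁' hf₁ h₁) (hall f₂ μ₂ hμ₂ hμ₂' hf₂ h₂)
  have term2 : ∫⁻ x, truncSup H (fun y => f₁ y - T₁ y) x (σ x) k * ‖T₂ x‖ₑ ≤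
      C₀ * ((2 * c * μ₁) * (c * t ^ (1 - p) * μ₂)) * cellVol d k :=
    hH.lintegral_truncSup_le (x₀ := x₀) hσ hb hk hW nL₁
      (fun x hx => by simp [hT₁, hs₁ x hx]) nT₂.meas.enorm
      (fun x hx => by simp [hT₂, hs₂ x hx])
      (fun x j hxj hjk => (lintegral_mono fun y => hLle y).trans
        (hall f₁ μ₁ hμ₁ hμ₁' hf₁ h₁ x j hxj hjk)) (htall f₂ μ₂ hμ₂ hμ₂' hf₂ h₂)
  -- The `L²` bounds of the low parts are written as squares, to match the Cauchy-Schwarz estimate.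
  -- The two square roots recombine in `term3'`, where `p ≥ 1` gives `t^(2-p) ≤ t`.
  have hsq : ∀ μ : ℝ≥0∞, (c * t ^ (2 - p) * μ ^ 2 * cellVol d k) =
      ((c * t ^ (2 - p) * cellVol d k) ^ (1 / 2 : ℝ) * μ) ^ 2 := by
    intro μ
    rw [mul_pow, ← ENNReal.rpow_natCast (_ ^ (1 / 2 : ℝ)), ← ENNReal.rpow_mul]
    norm_num
    ring
  have term3 : ∫⁻ x, truncSup H (fun y => f₁ y - T₁ y) x (σ x) k * ‖f₂ x - T₂ x‖ₑ ≤
      B * ((c * t ^ (2 - p) * cellVol d k) ^ (1 / 2 : ℝ) * μ₁) *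
        ((c * t ^ (2 - p) * cellVol d k) ^ (1 / 2 : ℝ) * μ₂) := by
    refine hH.lintegral_truncSup_mul_le hσ.measurable hb nL₁ nL₂.meas.enorm ?_ ?_
    · rw [← hsq]; exact hlow f₁ μ₁ hμ₁ hμ₁' hf₁ hs₁ h₁
    · rw [← hsq]; exact hlow f₂ μ₂ hμ₂ hμ₂' hf₂ hs₂' h₂
  have term3' : B * ((c * t ^ (2 - p) * cellVol d k) ^ (1 / 2 : ℝ) * μ₁) *
        ((c * t ^ (2 - p) * cellVol d k) ^ (1 / 2 : ℝ) * μ₂) ≤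
      B * (c * t) * (μ₁ * μ₂) * cellVol d k := by
    calc _ = B * ((c * t ^ (2 - p) * cellVol d k) ^ (1 / 2 : ℝ)) ^ 2 * (μ₁ * μ₂) := by ring
      _ = B * (c * t ^ (2 - p)) * (μ₁ * μ₂) * cellVol d k := by
          rw [← ENNReal.rpow_natCast (_ ^ (1 / 2 : ℝ)), ← ENNReal.rpow_mul]
          norm_num
          ring
      _ ≤ _ := by
          gcongr
          calc t ^ (2 - p) ≤ t ^ (1 : ℝ) := ENNReal.rpow_le_rpow_of_exponent_le ht (by linarith)
            _ = t := ENNReal.rpow_one t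
  calc ∫⁻ x, truncSup H f₁ x (σ x) k * ‖f₂ x‖ₑ
      ≤ ∫⁻ x, (truncSup H T₁ x (σ x) k * ‖f₂ x‖ₑ +
          (truncSup H (fun y => f₁ y - T₁ y) x (σ x) k * ‖T₂ x‖ₑ +
            truncSup H (fun y => f₁ y - T₁ y) x (σ x) k * ‖f₂ x - T₂ x‖ₑ)) := by
        refine lintegral_mono fun x => ?_
        have e1 := truncSup_add_le hH.integrable hf₁ nT₁ x (σ x) k
        have e2 : ‖f₂ x‖ₑ ≤ ‖T₂ x‖ₑ + ‖f₂ x - T₂ x‖ₑ := by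
          calc ‖f₂ x‖ₑ = ‖T₂ x + (f₂ x - T₂ x)‖ₑ := by congr 1; ring
            _ ≤ _ := enorm_add_le _ _
        calc _ ≤ (truncSup H T₁ x (σ x) k + truncSup H (fun y => f₁ y - T₁ y) x (σ x) k) *
              ‖f₂ x‖ₑ := by gcongr
          _ ≤ truncSup H T₁ x (σ x) k * ‖f₂ x‖ₑ +
              truncSup H (fun y => f₁ y - T₁ y) x (σ x) k * (‖T₂ x‖ₑ + ‖f₂ x - T₂ x‖ₑ) := by
              rw [add_mul]; gcongr
          _ = _ := by ring
    _ = (∫⁻ x, truncSup H T₁ x (σ x) k * ‖f₂ x‖ₑ) +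
          ((∫⁻ x, truncSup H (fun y => f₁ y - T₁ y) x (σ x) k * ‖T₂ x‖ₑ) +
          ∫⁻ x, truncSup H (fun y => f₁ y - T₁ y) x (σ x) k * ‖f₂ x - T₂ x‖ₑ) := by
        have m1 : Measurable fun x => truncSup H T₁ x (σ x) k * ‖f₂ x‖ₑ := mGT.mul hf₂.meas.enorm
        have m2 : Measurable fun x => truncSup H (fun y => f₁ y - T₁ y) x (σ x) k * ‖T₂ x‖ₑ :=
          mGL.mul nT₂.meas.enorm
        rw [lintegral_add_left m1, lintegral_add_left m2]
    _ ≤ C₀ * ((c * t ^ (1 - p) * μ₁) * (2 * c * μ₂)) * cellVol d k +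
          (C₀ * ((2 * c * μ₁) * (c * t ^ (1 - p) * μ₂)) * cellVol d k +
            B * (c * t) * (μ₁ * μ₂) * cellVol d k) :=
        add_le_add term1 (add_le_add term2 (term3.trans term3'))
    _ ≤ C₀ * ((c * t ^ (1 - p) * μ₁) * (2 * c * μ₂)) * cellVol d k +
          (C₀ * ((2 * c * μ₁) * (c * t ^ (1 - p) * μ₂)) * cellVol d k +
            8 * 3 ^ d * c ^ 2 * (B * t) * (μ₁ * μ₂) * cellVol d k) := by
        have key : B * (c * t) ≤ 8 * 3 ^ d * c ^ 2 * (B * t) :=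
          calc B * (c * t) = 1 * 1 * (1 * c) * (B * t) := by ring
            _ ≤ 8 * 3 ^ d * (c * c) * (B * t) := by
                gcongr
                · norm_num
                · exact one_le_pow₀ (by norm_num)
            _ = _ := by ring
        gcongr
    _ = _ := by rw [hC₀]; ring

end SmoothFamily

/-! ### Induction on the levels -/

theorem truncSup_self (K : ℤ → Rd d → ℂ) (f : Rd d → ℂ) (x : Rd d) (b : ℤ) :
    truncSup K f x b b = 0 := by
  refine le_antisymm (truncSup_le fun t₁ t₂ h hb ha => ?_) zero_le
  obtain rfl : t₁ = t₂ := by omega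
  simp [trunc]

theorem truncSup_congr {K : ℤ → Rd d → ℂ} {f g : Rd d → ℂ} {x : Rd d} {a b : ℤ}
    (h : ∀ s ≤ b, (K s ⋆[ContinuousLinearMap.mul ℂ ℂ, volume] f) x =
      (K s ⋆[ContinuousLinearMap.mul ℂ ℂ, volume] g) x) :
    truncSup K f x a b = truncSup K g x a b := by
  have : ∀ f g : Rd d → ℂ, (∀ s ≤ b, (K s ⋆[ContinuousLinearMap.mul ℂ ℂ, volume] f) x =
      (K s ⋆[ContinuousLinearMap.mul ℂ ℂ, volume] g) x) →
      truncSup K f x a b ≤ truncSup K g x a b := by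
    intro f g h
    refine truncSup_le fun t₁ t₂ h₁₂ hb ha => ?_
    rw [show trunc K f x t₁ t₂ = trunc K g x t₁ t₂ from
      Finset.sum_congr rfl fun s hs => h s ((Finset.mem_Ioc.1 hs).2.trans hb)]
    exact le_truncSup h₁₂ hb ha
  exact le_antisymm (this f g h) (this g f fun s hs => (h s hs).symm)

namespace SmoothFamily

variable {A B : ℝ≥0∞} {Δ : ℕ} {H : ℤ → Rd d → ℂ}

/-- Kernels of level at most `k` have range below `2^(k-1)`, so from inside a cell of level `k` they
see only its triple. -/
theorem truncSup_indicator_tri (hH : SmoothFamily A Δ B H) (f : Rd d → ℂ) {k : ℤ} {x x₀ : Rd d}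
    (hx : x ∈ (dyadic d).cell k x₀) (a : ℤ) :
    truncSup H ((tri k x₀).indicator f) x a k = truncSup H f x a k := by
  refine truncSup_congr fun s hs => ?_
  rw [conv_eq, conv_eq]
  congr 1
  ext y
  by_cases hy : y ∈ tri k x₀
  · rw [Set.indicator_of_mem hy]
  · suffices h : H s (x - y) = 0 by rw [h, zero_mul, zero_mul]
    by_contra hne
    refine hy ?_
    rw [← tri_congr ((dyadic d).mem_cell.1 hx)]
    refine mem_tri_of_supNorm_le ?_
    rw [supNorm_sub_comm]
    exact (hH.supp s _ hne).le.trans (zpow_le_zpow_right₀ (by norm_num) (by omega))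

/-- The bilinear estimate on a single dyadic cell. -/
theorem setLIntegral_truncSup_le (hH : SmoothFamily A Δ B H) {b : ℤ}
    {f₁ f₂ : Rd d → ℂ} (hf₁ : NiceFun f₁) (hf₂ : NiceFun f₂) {p : ℝ} (hp : 1 ≤ p) (hp2 : p ≤ 2)
    {t : ℝ≥0∞} (ht : 1 ≤ t) (ht' : t ≠ ∞) (n : ℕ) :
    ∀ x₀, ∫⁻ x in (dyadic d).cell (b + n) x₀, truncSup H f₁ x b (b + n) * ‖f₂ x‖ₑ ≤
      2 * (8 * 3 ^ d * (4 * 108 ^ d) ^ 2 * ((A * (2 * Δ + 2) + B) * t ^ (1 - p) + B * t)) *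
        ∫⁻ x in (dyadic d).cell (b + n) x₀, maxTriProd p f₁ f₂ (b + n) x := by
  have hp0 : 0 < p := by linarith
  set D : ℝ≥0∞ := 8 * 3 ^ d * (4 * 108 ^ d) ^ 2 *
    ((A * (2 * Δ + 2) + B) * t ^ (1 - p) + B * t) with hD
  -- The induction is strong because stopping cells may have any level from `b` up to `k - 1`.
  induction n using Nat.strong_induction_on with
  | _ n ih =>
  intro x₀
  rcases Nat.eq_zero_or_pos n with rfl | hn
  · simp [truncSup_self]
  set k : ℤ := b + n with hk
  have hbk : b < k := by omega
  set Q := (dyadic d).cell k x₀ with hQ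
  have hQm : MeasurableSet Q := (dyadic d).measurableSet_cell k x₀
  set f : Fin 2 → Rd d → ℂ := ![f₁, f₂] with hf
  have hfn : ∀ e, NiceFun (f e) := by intro e; fin_cases e <;> assumption
  set F : Fin 2 → Rd d → ℝ≥0∞ := fun e => (tri k x₀).indicator fun y => ‖f e y‖ₑ ^ p with hF
  have hFm : ∀ e, Measurable (F e) := fun e =>
    ((hfn e).meas.enorm.pow_const p).indicator (measurableSet_tri k x₀)
  set m : Fin 2 → ℝ≥0∞ := fun e => triAvg k (fun y => ‖f e y‖ₑ ^ p) x₀ with hm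
  have hFint : ∀ e, ∫⁻ x, F e x = m e * (3 ^ d * cellVol d k) := by
    intro e
    simp only [hF, hm, triAvg]
    rw [lintegral_indicator (measurableSet_tri k x₀), ← volume_tri k x₀, mul_right_comm,
      ENNReal.inv_mul_cancel (volume_tri_ne_zero _ _) (volume_tri_ne_top _ _), one_mul]
  have hmt : ∀ e, m e ≠ ∞ := by
    intro e
    obtain ⟨C, hC⟩ := (hfn e).bdd
    refine ENNReal.mul_ne_top (ENNReal.inv_ne_top.2 (volume_tri_ne_zero _ _)) ?_
    refine ne_top_of_le_ne_top (b := ∫⁻ _y in tri k x₀, ENNReal.ofReal C ^ p) ?_ ?_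
    · rw [setLIntegral_const]
      exact ENNReal.mul_ne_top (by simp [hp0.le]) (volume_tri_ne_top _ _)
    · refine lintegral_mono fun y => ENNReal.rpow_le_rpow ?_ hp0.le
      rw [← ofReal_norm]
      exact ENNReal.ofReal_le_ofReal (hC y)
  have hzero : ∀ e, m e = 0 → ∀ᵐ x ∂volume.restrict (tri k x₀), f e x = 0 := by
    intro e he
    have h1 : ∫⁻ y in tri k x₀, ‖f e y‖ₑ ^ p = 0 := by
      simp only [hm, triAvg, mul_eq_zero] at he
      exact he.resolve_left (ENNReal.inv_ne_zero.2 (volume_tri_ne_top _ _))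
    rw [lintegral_eq_zero_iff ((hfn e).meas.enorm.pow_const p)] at h1
    filter_upwards [h1] with x hx
    simpa [hp0, hp0.le, not_lt.2 hp0.le] using hx
  -- The stopping construction needs positive averages. A vanishing average makes the corresponding
  -- function zero almost everywhere on the triple, and the left-hand side vanishes.
  by_cases h0 : m 0 = 0
  · have h1 := (ae_restrict_iff' (measurableSet_tri k x₀)).1 (hzero 0 h0)
    refine le_of_eq_of_le ?_ zero_le
    refine (setLIntegral_congr_fun hQm fun x hx => ?_).trans lintegral_zero
    rw [← hH.truncSup_indicator_tri f₁ hx b, truncSup_congr (g := fun _ => 0) fun s _ => ?_]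
    · have : truncSup H (fun _ => 0) x b k = 0 :=
        le_antisymm (truncSup_le fun t₁ t₂ _ _ _ => by simp [trunc, conv_eq]) zero_le
      rw [this, zero_mul]
    · rw [conv_eq, conv_eq]
      refine integral_congr_ae ?_
      filter_upwards [h1] with y hy
      by_cases hyt : y ∈ tri k x₀
      · have : f₁ y = 0 := hy hyt
        simp [this]
      · simp [hyt]
  by_cases h0' : m 1 = 0
  · have h1 := ae_restrict_of_ae_restrict_of_subset (cell_subset_tri k x₀) (hzero 1 h0')
    refine le_of_eq_of_le ?_ zero_le
    refine (lintegral_congr_ae ?_).trans lintegral_zero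
    filter_upwards [h1] with x hx
    have : f₂ x = 0 := hx
    simp [this]
  have hm0 : ∀ e, m e ≠ 0 := by intro e; fin_cases e <;> assumption
  obtain ⟨σ, hσ, hb, hσk, hσlt, hW, hF', hvol⟩ :=
    exists_stopping hbk.le hFm hm0 hmt fun e => (hFint e).le
  have hσlt := hσlt hbk
  set μ : Fin 2 → ℝ≥0∞ := fun e => m e ^ (1 / p) with hμ
  have hμp : ∀ e, μ e ^ p = m e := by
    intro e
    simp only [hμ]
    rw [← ENNReal.rpow_mul, one_div, inv_mul_cancel₀ hp0.ne', ENNReal.rpow_one]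
  have hμ0 : ∀ e, μ e ≠ 0 := fun e => by simp [hμ, hm0 e, hmt e]
  have hμt : ∀ e, μ e ≠ ∞ := fun e => by simp [hμ, hm0 e, hmt e]
  set M := maxTriProd p f₁ f₂ k with hM
  have hMm : Measurable M := measurable_maxTriProd p f₁ f₂ k
  -- The level `k` itself takes part in the supremum defining `M`.
  have hMlow : ∀ x ∈ Q, μ 0 * μ 1 ≤ M x := by
    intro x hx
    have h1 : ∀ e, μ e = triAvg k (fun y => ‖f e y‖ₑ ^ p) x ^ (1 / p) := fun e => by
      simp only [hμ, hm]
      rw [triAvg_congr _ ((dyadic d).mem_cell.1 hx)]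
    rw [h1, h1]
    exact le_iSup₂_of_le (f := fun (j : ℤ) (_ : j ≤ k) =>
      triAvg j (fun y => ‖f₁ y‖ₑ ^ p) x ^ (1 / p) * triAvg j (fun y => ‖f₂ y‖ₑ ^ p) x ^ (1 / p))
      k le_rfl le_rfl
  set Z : Set (Rd d) := {x | σ x = b} with hZ
  have hZm : MeasurableSet Z := hσ.measurable (measurableSet_singleton b)
  -- the stopping generation
  have hloc : ∫⁻ x in Q, truncSup H f₁ x (σ x) k * ‖f₂ x‖ₑ ≤ D * (μ 0 * μ 1) * cellVol d k := by
    have hg₁ : NiceFun ((tri k x₀).indicator f₁) := hf₁.indicator (measurableSet_tri k x₀)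
    have hg₂ : NiceFun (Q.indicator f₂) := hf₂.indicator hQm
    have key := hH.lintegral_truncSup_le_of_rpow hσ hb hσk hW hg₁ hg₂ (x₀ := x₀)
      (fun x hx => Set.indicator_of_notMem hx _) (fun x hx => Set.indicator_of_notMem hx _) hp hp2
      (c := 4 * 108 ^ d) (μ₁ := μ 0) (μ₂ := μ 1)
      (by
        calc (3 : ℝ≥0∞) ^ d ≤ 108 ^ d := by gcongr; norm_num
          _ ≤ 4 * 108 ^ d := le_mul_of_one_le_left' (by norm_num))
      ht ht' (hμ0 0) (hμ0 1) (hμt 0) (hμt 1)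
      (fun x j hxj hjk => by
        rw [hμp]
        refine le_trans (lintegral_mono fun y => ?_) (hF' 0 x j hxj hjk)
        by_cases hy : y ∈ tri k x₀ <;> simp [hF, hf, hy, hp0])
      (fun x j hxj hjk => by
        rw [hμp]
        refine le_trans (lintegral_mono fun y => ?_) (hF' 1 x j hxj hjk)
        by_cases hy : y ∈ Q
        · simp [hF, hf, hy, cell_subset_tri k x₀ hy]
        · simp [hy, hp0])
    refine le_of_eq_of_le ?_ key
    rw [← lintegral_indicator hQm]
    congr 1
    ext x
    by_cases hx : x ∈ Q
    · rw [Set.indicator_of_mem hx, Set.indicator_of_mem hx, hH.truncSup_indicator_tri f₁ hx]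
    · simp [hx]
  -- The set `Z` where the stopping level is `b` fills at least half of `Q`, and is not used again
  -- by the induction. The cost of this generation is charged to it, whence the factor 2.
  have hhalf : cellVol d k ≤ 2 * volume (Q ∩ Z) := by
    have h1 : cellVol d k = volume (Q ∩ Z) + volume (Q \ Z) := by
      rw [measure_inter_add_sdiff Q hZm, volume_dyadic_cell]
    have h2 : 2 * volume (Q \ Z) ≤ volume (Q ∩ Z) + volume (Q \ Z) := by
      rw [← h1]
      exact le_trans (by gcongr; exact fun x hx => hx.2) hvol
    have h3 : volume (Q \ Z) ≤ volume (Q ∩ Z) := by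
      rw [two_mul] at h2
      refine (ENNReal.add_le_add_iff_right ?_).1 h2
      exact ne_top_of_le_ne_top (by rw [hQ, volume_dyadic_cell]; exact cellVol_ne_top k)
        (measure_mono Set.sdiff_subset)
    rw [h1, two_mul]
    gcongr
  have hlow : D * (μ 0 * μ 1) * cellVol d k ≤ 2 * D * ∫⁻ x in Q ∩ Z, M x := by
    calc D * (μ 0 * μ 1) * cellVol d k ≤ D * (μ 0 * μ 1) * (2 * volume (Q ∩ Z)) := by gcongr
      _ = 2 * D * ∫⁻ _x in Q ∩ Z, μ 0 * μ 1 := by rw [setLIntegral_const]; ring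
      _ ≤ 2 * D * ∫⁻ x in Q ∩ Z, M x := by
          refine mul_le_mul_right (setLIntegral_mono hMm fun x hx => hMlow x hx.1) _
  -- the cells of the next generation
  have hnext : ∫⁻ x in Q, truncSup H f₁ x b (σ x) * ‖f₂ x‖ₑ ≤ 2 * D * ∫⁻ x in Q \ Z, M x := by
    rw [← lintegral_indicator hQm, ← lintegral_indicator (hQm.diff hZm), hσ.lintegral_eq_tsum,
      hσ.lintegral_eq_tsum ((Q \ Z).indicator M), ← ENNReal.tsum_mul_left]
    refine ENNReal.tsum_le_tsum fun c => ?_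
    rcases Set.eq_empty_or_nonempty (Grid.lab (dyadic d) σ ⁻¹' {c}) with he | ⟨z, rfl⟩
    · simp [he]
    have hset : Grid.lab (dyadic d) σ ⁻¹' {Grid.lab (dyadic d) σ z} = (dyadic d).cell (σ z) z :=
      Set.ext fun y => hσ.lab_eq_iff
    rw [hset]
    set P := (dyadic d).cell (σ z) z with hP
    have hPm : MeasurableSet P := (dyadic d).measurableSet_cell _ _
    have hσP : ∀ y ∈ P, σ y = σ z := fun y hy => congrArg Prod.fst (hσ.lab_eq_iff.2 hy)
    have hsub : ∀ y ∈ P, (y ∈ Q ↔ z ∈ Q) := by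
      intro y hy
      have := (dyadic d).idx_mono (hσk z) ((dyadic d).mem_cell.1 hy)
      rw [hQ, (dyadic d).mem_cell, (dyadic d).mem_cell, this]
    by_cases hzQ : z ∈ Q
    -- Below the bottom level there are no scales left, so cells in `Z` contribute nothing; the
    -- others lie in `Q \ Z`.
    · by_cases hzb : σ z = b
      · refine le_of_eq_of_le ?_ zero_le
        refine (setLIntegral_congr_fun hPm fun y hy => ?_).trans lintegral_zero
        rw [Set.indicator_of_mem ((hsub y hy).2 hzQ), hσP y hy, hzb, truncSup_self, zero_mul]
      · have hzn : σ z = b + ((σ z - b).toNat : ℤ) := by have := hb z; omega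
        have key := ih (σ z - b).toNat (by have := hb z; have := hσlt z; omega) z
        rw [← hzn] at key
        calc _ = ∫⁻ x in P, truncSup H f₁ x b (σ z) * ‖f₂ x‖ₑ := by
              refine setLIntegral_congr_fun hPm fun y hy => ?_
              rw [Set.indicator_of_mem ((hsub y hy).2 hzQ), hσP y hy]
          _ ≤ _ := key
          _ ≤ 2 * D * ∫⁻ x in P, (Q \ Z).indicator M x := by
              refine mul_le_mul_right (setLIntegral_mono' hPm fun y hy => ?_) _
              have hyZ : y ∉ Z := by
                intro h
                exact hzb ((hσP y hy).symm.trans h)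
              rw [Set.indicator_of_mem (show y ∈ Q \ Z from ⟨(hsub y hy).2 hzQ, hyZ⟩)]
              exact biSup_mono fun j hj => hj.trans (hσk z)
    · refine le_of_eq_of_le ?_ zero_le
      refine (setLIntegral_congr_fun hPm fun y hy => ?_).trans lintegral_zero
      rw [Set.indicator_of_notMem (mt (hsub y hy).1 hzQ)]
  -- Splitting at the level `σ x`: the upper scales are charged to `Q ∩ Z`, the lower ones to `Q \
  -- Z`, so the constant does not grow along the induction.
  calc ∫⁻ x in Q, truncSup H f₁ x b k * ‖f₂ x‖ₑ
      ≤ ∫⁻ x in Q, (truncSup H f₁ x b (σ x) * ‖f₂ x‖ₑ + truncSup H f₁ x (σ x) k * ‖f₂ x‖ₑ) := by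
        refine lintegral_mono fun x => ?_
        rw [← add_mul]
        gcongr
        exact truncSup_le_add H f₁ x
    _ = (∫⁻ x in Q, truncSup H f₁ x b (σ x) * ‖f₂ x‖ₑ) +
          ∫⁻ x in Q, truncSup H f₁ x (σ x) k * ‖f₂ x‖ₑ := by
        have hm1 : Measurable fun x => truncSup H f₁ x (σ x) k * ‖f₂ x‖ₑ :=
          (measurable_truncSup (hH.measurable_conv hf₁) hσ.measurable k).mul hf₂.meas.enorm
        rw [lintegral_add_right _ hm1]
    _ ≤ (2 * D * ∫⁻ x in Q \ Z, M x) + 2 * D * ∫⁻ x in Q ∩ Z, M x :=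
        add_le_add hnext (hloc.trans hlow)
    _ = 2 * D * ∫⁻ x in Q, M x := by
        rw [← mul_add, add_comm, lintegral_inter_add_sdiff M Q hZm]

/-- The bilinear estimate for the truncations to a finite range of levels. -/
theorem lintegral_truncSup_le_sparseSup (hH : SmoothFamily A Δ B H) (b : ℤ) (n : ℕ)
    {f₁ f₂ : Rd d → ℂ} (hf₁ : NiceFun f₁) (hf₂ : NiceFun f₂) {p : ℝ} (hp : 1 ≤ p) (hp2 : p ≤ 2)
    {t : ℝ≥0∞} (ht : 1 ≤ t) (ht' : t ≠ ∞) :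
    ∫⁻ x, truncSup H f₁ x b (b + n) * ‖f₂ x‖ₑ ≤
      2 * (8 * 3 ^ d * (4 * 108 ^ d) ^ 2 * ((A * (2 * Δ + 2) + B) * t ^ (1 - p) + B * t)) *
        (3 ^ d * 32 * sparseSup p f₁ f₂) := by
  -- The cells of the top level partition the space, and the local estimates are summed over them.
  have hσ := Grid.IsStopping.const (G := dyadic d) (b + n)
  obtain ⟨C₁, hC₁⟩ := hf₁.bdd
  obtain ⟨C₂, hC₂⟩ := hf₂.bdd
  have hbd : ∀ (f : Rd d → ℂ) (C : ℝ), (∀ x, ‖f x‖ ≤ C) → C ≤ max C₁ C₂ →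
      ∀ x, ‖f x‖ₑ ≤ ENNReal.ofReal (max C₁ C₂) := fun f C h hC x => by
    rw [← ofReal_norm]
    exact ENNReal.ofReal_le_ofReal ((h x).trans hC)
  refine le_trans ?_ (mul_le_mul_right (lintegral_maxTriProd_le hp hf₁.meas hf₂.meas
    ENNReal.ofReal_ne_top (hbd f₁ C₁ hC₁ (le_max_left _ _)) (hbd f₂ C₂ hC₂ (le_max_right _ _))
    (b + n)) _)
  rw [hσ.lintegral_eq_tsum, hσ.lintegral_eq_tsum (maxTriProd p f₁ f₂ (b + n)),
    ← ENNReal.tsum_mul_left]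
  refine ENNReal.tsum_le_tsum fun c => ?_
  rcases Set.eq_empty_or_nonempty (Grid.lab (dyadic d) (fun _ => b + n) ⁻¹' {c}) with
    he | ⟨z, rfl⟩
  · simp [he]
  have hset : Grid.lab (dyadic d) (fun _ => b + n) ⁻¹' {Grid.lab (dyadic d) (fun _ => b + n) z} =
      (dyadic d).cell (b + n) z := Set.ext fun y => hσ.lab_eq_iff
  rw [hset]
  exact hH.setLIntegral_truncSup_le hf₁ hf₂ hp hp2 ht ht' n z

end SmoothFamily

/-! ### Plancherel's theorem and convolutions of bounded functions of compact support -/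

/-- Both transforms are tested against smooth functions of compact support. For the `L²` transform
duality of tempered distributions applies, for the integral transform Fubini's theorem. -/
theorem fourier_ae_eq {f : Rd d → ℂ} (h1 : Integrable f) (h2 : MemLp f 2 volume) :
    (𝓕 (h2.toLp f) : Lp ℂ 2 (volume : Measure (Rd d))) =ᵐ[volume] 𝓕 f := by
  refine ae_eq_of_integral_contDiff_smul_eq ?_ ?_ fun g hg hgs => ?_
  · exact (Lp.memLp _).locallyIntegrable (by norm_num)
  · exact (VectorFourier.fourierIntegral_continuous Real.continuous_fourierChar
      continuous_inner h1).locallyIntegrable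
  · have hgs' : HasCompactSupport fun x => (g x : ℂ) := hgs.comp_left (g := fun r : ℝ => (r : ℂ)) rfl
    set G := hgs'.toSchwartzMap (Complex.ofRealCLM.contDiff.comp hg) with hG
    have e1 : (∫ x, g x • (𝓕 (h2.toLp f) : Lp ℂ 2 (volume : Measure (Rd d))) x) =
        ∫ x, 𝓕 G x • f x := by
      have key := congrArg (fun T => T G) (Lp.fourier_toTemperedDistribution_eq (h2.toLp f))
      simp only [TemperedDistribution.fourier_apply, Lp.toTemperedDistribution_apply] at key
      calc _ = ∫ x, G x • (𝓕 (h2.toLp f) : Lp ℂ 2 (volume : Measure (Rd d))) x := by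
            congr 1
        _ = _ := key.symm
        _ = _ := by
            refine integral_congr_ae ?_
            filter_upwards [h2.coeFn_toLp] with x hx
            rw [hx]
    rw [e1]
    have e2 := VectorFourier.integral_fourierIntegral_smul_eq_flip (μ := volume) (ν := volume)
      (L := innerₗ (Rd d)) (f := G) (g := f) Real.continuous_fourierChar continuous_inner
      G.integrable h1
    rw [flip_innerₗ] at e2
    exact e2

theorem lintegral_fourier_sq {f : Rd d → ℂ} (h1 : Integrable f) (h2 : MemLp f 2 volume) :
    ∫⁻ ξ, ‖𝓕 f ξ‖ₑ ^ 2 = ∫⁻ x, ‖f x‖ₑ ^ 2 := by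
  have key := Lp.norm_fourier_eq (h2.toLp f)
  rw [Lp.norm_def, Lp.norm_def, ENNReal.toReal_eq_toReal_iff' (Lp.eLpNorm_ne_top _)
    (Lp.eLpNorm_ne_top _), eLpNorm_congr_ae (fourier_ae_eq h1 h2), eLpNorm_congr_ae h2.coeFn_toLp,
    eLpNorm_eq_lintegral_rpow_enorm_toReal (by norm_num) (by norm_num),
    eLpNorm_eq_lintegral_rpow_enorm_toReal (by norm_num) (by norm_num)] at key
  simpa using (ENNReal.rpow_left_injective (x := 1 / (2 : ℝ≥0∞).toReal) (by norm_num)) key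

namespace NiceFun

variable {f g : Rd d → ℂ}

theorem hasCompactSupport (hf : NiceFun f) : HasCompactSupport f := by
  obtain ⟨R, hR⟩ := hf.supp
  refine HasCompactSupport.of_support_subset_isCompact (isCompact_closedBall 0 R) fun x hx => ?_
  rw [mem_closedBall_zero_iff]
  by_contra h
  exact hx (hR x (not_le.1 h))

theorem memLp_two (hf : NiceFun f) : MemLp f 2 volume := by
  obtain ⟨C, hC⟩ := hf.bdd
  exact hf.hasCompactSupport.memLp_of_bound hf.meas.aestronglyMeasurable C (.of_forall hC)

theorem lintegral_fourier_sq (hf : NiceFun f) : ∫⁻ ξ, ‖𝓕 f ξ‖ₑ ^ 2 = ∫⁻ x, ‖f x‖ₑ ^ 2 :=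
  SparseMaxTrunc.lintegral_fourier_sq hf.integrable hf.memLp_two

theorem add (hf : NiceFun f) (hg : NiceFun g) : NiceFun fun x => f x + g x := by
  have h0 : NiceFun fun x => -g x := hg.of_le hg.meas.neg fun x => by simp
  simpa using hf.sub h0

theorem zero : NiceFun (fun _ : Rd d => (0 : ℂ)) :=
  ⟨measurable_const, ⟨0, by simp⟩, ⟨0, by simp⟩⟩

theorem sum {ι : Type*} (s : Finset ι) {f : ι → Rd d → ℂ} (hf : ∀ i ∈ s, NiceFun (f i)) :
    NiceFun fun x => ∑ i ∈ s, f i x := by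
  classical
  induction s using Finset.induction_on with
  | empty => simpa using zero
  | insert i s hi ih =>
    simp only [Finset.sum_insert hi]
    exact (hf i (Finset.mem_insert_self i s)).add
      (ih fun j hj => hf j (Finset.mem_insert_of_mem hj))

theorem measurable_conv (hf : NiceFun f) (hg : NiceFun g) :
    Measurable (f ⋆[ContinuousLinearMap.mul ℂ ℂ, volume] g) := by
  have : (f ⋆[ContinuousLinearMap.mul ℂ ℂ, volume] g) = fun x => ∫ y, f (x - y) * g y := by
    ext x; exact conv_eq f g x
  rw [this]
  have hm : StronglyMeasurable fun z : Rd d × Rd d => f (z.1 - z.2) * g z.2 :=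
    ((hf.meas.comp (measurable_fst.sub measurable_snd)).mul
      (hg.meas.comp measurable_snd)).stronglyMeasurable
  exact hm.integral_prod_right.measurable

theorem conv (hf : NiceFun f) (hg : NiceFun g) :
    NiceFun (f ⋆[ContinuousLinearMap.mul ℂ ℂ, volume] g) := by
  obtain ⟨C, hC⟩ := hf.bdd
  obtain ⟨R₁, hR₁⟩ := hf.supp
  obtain ⟨R₂, hR₂⟩ := hg.supp
  refine ⟨hf.measurable_conv hg, ⟨C * ∫ y, ‖g y‖, fun x => ?_⟩, ⟨R₁ + R₂, fun x hx => ?_⟩⟩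
  · rw [conv_eq, ← integral_const_mul]
    refine norm_integral_le_of_norm_le (hg.integrable.norm.const_mul C) (.of_forall fun y => ?_)
    rw [norm_mul]
    exact mul_le_mul_of_nonneg_right (hC _) (norm_nonneg _)
  · rw [conv_eq]
    refine integral_eq_zero_of_ae (.of_forall fun y => ?_)
    rcases lt_or_ge R₂ ‖y‖ with h | h
    · simp [hR₂ y h]
    · have : R₁ < ‖x - y‖ := by
        have := norm_sub_norm_le x y
        linarith
      simp [hR₁ _ this]

theorem fourier_conv (hf : NiceFun f) (hg : NiceFun g) (ξ : Rd d) :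
    𝓕 (f ⋆[ContinuousLinearMap.mul ℂ ℂ, volume] g) ξ = 𝓕 f ξ * 𝓕 g ξ :=
  Real.fourier_mul_convolution_eq hf.integrable hg.integrable ξ

theorem fourier_sub (hf : NiceFun f) (hg : NiceFun g) (ξ : Rd d) :
    𝓕 (fun x => f x - g x) ξ = 𝓕 f ξ - 𝓕 g ξ := by
  simp only [Real.fourier_eq, smul_sub]
  exact integral_sub ((Real.fourierIntegral_convergent_iff ξ).2 hf.integrable)
    ((Real.fourierIntegral_convergent_iff ξ).2 hg.integrable)

theorem fourier_sum {ι : Type*} (s : Finset ι) {f : ι → Rd d → ℂ} (hf : ∀ i ∈ s, NiceFun (f i))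
    (ξ : Rd d) : 𝓕 (fun x => ∑ i ∈ s, f i x) ξ = ∑ i ∈ s, 𝓕 (f i) ξ := by
  simp only [Real.fourier_eq, Finset.smul_sum]
  exact integral_finsetSum s fun i hi =>
    (Real.fourierIntegral_convergent_iff ξ).2 (hf i hi).integrable

theorem norm_fourier_le (f : Rd d → ℂ) (ξ : Rd d) : ‖𝓕 f ξ‖ ≤ ∫ x, ‖f x‖ := by
  rw [Real.fourier_eq]
  refine (norm_integral_le_integral_norm _).trans (le_of_eq ?_)
  simp

end NiceFun

/-! ### Mollifiers -/

/-- A Lipschitz mollifier with constants `C`. -/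
structure Mollifier (φ : Rd d → ℂ) (C : ℝ) : Prop where
  one_le : 1 ≤ C
  lip : ∀ x y, ‖φ x - φ y‖ ≤ C * ‖x - y‖
  supp : ∀ x, φ x ≠ 0 → ‖x‖ < 1 / 4
  bound : ∀ x, ‖φ x‖ ≤ C
  integral_norm : ∫ x, ‖φ x‖ = 1
  fourier_sub : ∀ ξ, ‖𝓕 φ ξ - 1‖ ≤ C * ‖ξ‖
  fourier_mul : ∀ ξ, ‖𝓕 φ ξ‖ * ‖ξ‖ ≤ C

/-- A normalized smooth bump. Its transform is close to 1 near the origin by the support condition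
and decays because the bump is a Schwartz function. -/
theorem exists_mollifier (d : ℕ) : ∃ (φ : Rd d → ℂ) (C : ℝ), Mollifier φ C := by
  let b : ContDiffBump (0 : Rd d) := ⟨1 / 8, 1 / 4, by norm_num, by norm_num⟩
  set ψ : Rd d → ℝ := b.normed volume with hψ
  have hψc : ContDiff ℝ 1 ψ := b.contDiff_normed
  have hψs : HasCompactSupport ψ := b.hasCompactSupport_normed
  have hψtop : ContDiff ℝ ((⊤ : ℕ∞) : WithTop ℕ∞) ψ := b.contDiff_normed
  obtain ⟨L, hL⟩ := hψc.lipschitzWith_of_hasCompactSupport hψs one_ne_zero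
  obtain ⟨M, hM⟩ := hψs.exists_bound_of_continuous hψc.continuous
  have hcs : HasCompactSupport fun x => (ψ x : ℂ) := hψs.comp_left (g := fun r : ℝ => (r : ℂ)) rfl
  set Φ := hcs.toSchwartzMap (Complex.ofRealCLM.contDiff.comp hψtop) with hΦ
  obtain ⟨D, hD0, hD⟩ := (𝓕 Φ).decay 1 0
  have hsupp : ∀ x, ψ x ≠ 0 → ‖x‖ < 1 / 4 := by
    intro x hx
    have : x ∈ Function.support ψ := hx
    rw [hψ, b.support_normed_eq, mem_ball_zero_iff] at this
    exact this
  have hint : ∫ x, ψ x = 1 := b.integral_normed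
  have hi : Integrable ψ := b.integrable_normed
  set C : ℝ := max (max 1 L) (max (max M D) (2 * Real.pi)) with hC
  refine ⟨fun x => (ψ x : ℂ), C, le_max_of_le_left (le_max_left _ _), fun x y => ?_,
    fun x hx => hsupp x (by exact_mod_cast hx), fun x => ?_, ?_, fun ξ => ?_, fun ξ => ?_⟩
  · rw [← Complex.ofReal_sub, Complex.norm_real, ← dist_eq_norm, ← dist_eq_norm]
    refine (hL.dist_le_mul x y).trans ?_
    gcongr
    exact le_max_of_le_left (le_max_right _ _)
  · rw [Complex.norm_real]
    exact (hM x).trans (le_max_of_le_right (le_max_of_le_left (le_max_left _ _)))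
  · rw [← hint]
    congr 1
    ext x
    rw [Complex.norm_real, Real.norm_of_nonneg (b.nonneg_normed x)]
  · have e1 : (1 : ℂ) = ∫ x, (ψ x : ℂ) := by
      rw [integral_complex_ofReal, hint, Complex.ofReal_one]
    rw [Real.fourier_eq, e1, ← integral_sub ((Real.fourierIntegral_convergent_iff ξ).2 hi.ofReal)
      hi.ofReal]
    refine (norm_integral_le_of_norm_le (hi.const_mul (C * ‖ξ‖)) (.of_forall fun x => ?_)).trans
      (le_of_eq ?_)
    · by_cases hx : ψ x = 0
      · simp [hx]
      have h1 : ‖Real.fourierChar (-inner ℝ x ξ) • (ψ x : ℂ) - ψ x‖ =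
          ‖((Real.fourierChar (-inner ℝ x ξ) : Circle) : ℂ) - 1‖ * ψ x := by
        rw [Circle.smul_def, smul_eq_mul, ← sub_one_mul, norm_mul, Complex.norm_real,
          Real.norm_of_nonneg (b.nonneg_normed x)]
      rw [h1]
      refine mul_le_mul_of_nonneg_right ?_ (b.nonneg_normed x)
      rw [Real.fourierChar_apply]
      calc _ ≤ ‖2 * Real.pi * -inner ℝ x ξ‖ := by
            rw [mul_comm]; exact Real.norm_exp_I_mul_ofReal_sub_one_le
        _ = 2 * Real.pi * |inner ℝ x ξ| := by
            rw [norm_mul, norm_neg, Real.norm_of_nonneg (by positivity), Real.norm_eq_abs]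
        _ ≤ C * (1 * ‖ξ‖) := by
            gcongr
            · exact le_max_of_le_right (le_max_right _ _)
            · refine (abs_real_inner_le_norm x ξ).trans ?_
              gcongr
              linarith [hsupp x hx]
        _ = C * ‖ξ‖ := by ring
    · rw [integral_const_mul, hint, mul_one]
  · have h1 := hD ξ
    rw [pow_one, norm_iteratedFDeriv_zero, mul_comm] at h1
    exact h1.trans (le_max_of_le_right (le_max_of_le_left (le_max_right _ _)))

/-- The dilate of a function to the scale `2 ^ t`, with the same integral. -/
def dil (φ : Rd d → ℂ) (t : ℤ) (x : Rd d) : ℂ :=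
  (((2 : ℝ) ^ (-(t * (d : ℤ))) : ℝ) : ℂ) * φ ((2 : ℝ) ^ (-t) • x)

namespace Mollifier

variable {φ : Rd d → ℂ} {C : ℝ}

theorem continuous (hφ : Mollifier φ C) : Continuous φ :=
  (LipschitzWith.of_dist_le_mul (K := C.toNNReal) fun x y => by
    rw [dist_eq_norm, dist_eq_norm, Real.coe_toNNReal _ (by linarith [hφ.one_le])]
    exact hφ.lip x y).continuous

theorem dil_supp (hφ : Mollifier φ C) (t : ℤ) {x : Rd d} (hx : dil φ t x ≠ 0) :
    ‖x‖ < 2 ^ t / 4 := by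
  have h1 : φ ((2 : ℝ) ^ (-t) • x) ≠ 0 := fun h => hx (by rw [dil, h, mul_zero])
  have h2 := hφ.supp _ h1
  rw [norm_smul, norm_zpow, Real.norm_ofNat, zpow_neg, inv_mul_lt_iff₀ (by positivity)] at h2
  linarith

theorem norm_dil_le (hφ : Mollifier φ C) (t : ℤ) (x : Rd d) :
    ‖dil φ t x‖ ≤ C * 2 ^ (-(t * (d : ℤ))) := by
  rw [dil, norm_mul, Complex.norm_real, Real.norm_of_nonneg (by positivity), mul_comm]
  gcongr
  exact hφ.bound _

theorem niceFun_dil (hφ : Mollifier φ C) (t : ℤ) : NiceFun (dil φ t) := by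
  refine ⟨?_, ⟨_, hφ.norm_dil_le t⟩, ⟨2 ^ t / 4, fun x hx => ?_⟩⟩
  · exact (continuous_const.mul (hφ.continuous.comp (continuous_const_smul _))).measurable
  · by_contra h
    exact absurd (hφ.dil_supp t h) (not_lt.2 hx.le)

end Mollifier

theorem zpow_neg_mul_natCast_eq (t : ℤ) (d : ℕ) :
    (2 : ℝ) ^ (-(t * (d : ℤ))) = |(((2 : ℝ) ^ (-t)) ^ d)| := by
  rw [abs_of_pos (by positivity), ← zpow_natCast, ← zpow_mul, neg_mul]

theorem integral_norm_dil (φ : Rd d → ℂ) (t : ℤ) : ∫ x, ‖dil φ t x‖ = ∫ x, ‖φ x‖ := by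
  simp only [dil, norm_mul, Complex.norm_real]
  rw [integral_const_mul, Measure.integral_comp_smul volume (fun x => ‖φ x‖), finrank_euclideanSpace,
    Fintype.card_fin, Real.norm_of_nonneg (by positivity), zpow_neg_mul_natCast_eq, abs_inv,
    smul_eq_mul, ← mul_assoc, mul_inv_cancel₀ (by positivity), one_mul]

theorem fourier_dil (φ : Rd d → ℂ) (t : ℤ) (ξ : Rd d) :
    𝓕 (dil φ t) ξ = 𝓕 φ ((2 : ℝ) ^ t • ξ) := by
  rw [Real.fourier_eq, Real.fourier_eq]
  have h1 := Measure.integral_comp_smul volume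
    (fun x => Real.fourierChar (-inner ℝ x ((2 : ℝ) ^ t • ξ)) • φ x) ((2 : ℝ) ^ (-t))
  rw [finrank_euclideanSpace, Fintype.card_fin] at h1
  have h2 : ∀ x : Rd d, inner ℝ ((2 : ℝ) ^ (-t) • x) ((2 : ℝ) ^ t • ξ) = inner ℝ x ξ := by
    intro x
    rw [real_inner_smul_left, real_inner_smul_right, ← mul_assoc, ← zpow_add₀ two_ne_zero]
    simp
  simp only [h2] at h1
  have h3 : (((2 : ℝ) ^ (-t)) ^ d) ≠ 0 := by positivity
  calc _ = ∫ x, (((2 : ℝ) ^ (-(t * (d : ℤ))) : ℝ) : ℂ) *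
        (Real.fourierChar (-inner ℝ x ξ) • φ ((2 : ℝ) ^ (-t) • x)) := by
        congr 1; ext x; simp only [dil, Circle.smul_def, smul_eq_mul]; ring
    _ = _ := by
        rw [integral_const_mul, h1, zpow_neg_mul_natCast_eq, abs_inv, Complex.real_smul, ← mul_assoc,
          ← Complex.ofReal_mul, mul_inv_cancel₀ (by positivity), Complex.ofReal_one, one_mul]

/-! ### The maximal truncations on `L²` -/

theorem sum_Ioc_zpow_le {q : ℝ} (hq : 1 < q) (b t : ℤ) :
    ∑ s ∈ Finset.Ioc b t, q ^ s ≤ q / (q - 1) * q ^ t := by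
  have hq0 : 0 < q := by linarith
  rcases lt_or_ge t b with h | h
  · rw [Finset.Ioc_eq_empty (by omega), Finset.sum_empty]
    have : 0 < q - 1 := by linarith
    positivity
  have key : (∑ s ∈ Finset.Ioc b t, q ^ s) * (q - 1) = q ^ (t + 1) - q ^ (b + 1) := by
    induction t, h using Int.leInduction with
    | base => simp
    | succ t ht ih =>
      rw [← Finset.insert_Ioc_right_eq_Ioc_add_one ht, Finset.sum_insert (by simp), add_mul, ih,
        zpow_add_one₀ hq0.ne' (t + 1)]
      ring
  rw [div_mul_eq_mul_div, le_div_iff₀ (by linarith), key, zpow_add_one₀ hq0.ne' t, mul_comm]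
  have : 0 < q ^ (b + 1) := by positivity
  linarith

theorem sum_Ioc_inv_zpow_le {q : ℝ} (hq : 1 < q) (t n : ℤ) :
    ∑ s ∈ Finset.Ioc t n, (q ^ s)⁻¹ ≤ q / (q - 1) * (q ^ t)⁻¹ := by
  have hq0 : 0 < q := by linarith
  rcases lt_or_ge n t with h | h
  · rw [Finset.Ioc_eq_empty (by omega), Finset.sum_empty]
    have : 0 < q - 1 := by linarith
    positivity
  have key : (∑ s ∈ Finset.Ioc t n, (q ^ s)⁻¹) * (q - 1) = (q ^ t)⁻¹ - (q ^ n)⁻¹ := by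
    induction n, h using Int.leInduction with
    | base => simp
    | succ n hn ih =>
      rw [← Finset.insert_Ioc_right_eq_Ioc_add_one hn, Finset.sum_insert (by simp), add_mul, ih,
        zpow_add_one₀ hq0.ne' n]
      field_simp
      ring
  rw [div_mul_eq_mul_div, le_div_iff₀ (by linarith), key]
  have h1 : 0 < (q ^ n)⁻¹ := by positivity
  have h2 : 1 * (q ^ t)⁻¹ ≤ q * (q ^ t)⁻¹ := by gcongr
  linarith

/-- The decay of the multipliers at the scale `2 ^ s`. -/
def dec (a : ℝ) (s : ℤ) (ξ : Rd d) : ℝ :=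
  min (‖(2 : ℝ) ^ s • ξ‖ ^ a) (‖(2 : ℝ) ^ s • ξ‖ ^ a)⁻¹

theorem dec_nonneg (a : ℝ) (s : ℤ) (ξ : Rd d) : 0 ≤ dec a s ξ :=
  le_min (by positivity) (by positivity)

theorem dec_le_one (a : ℝ) (s : ℤ) (ξ : Rd d) : dec a s ξ ≤ 1 := by
  rcases le_total (‖(2 : ℝ) ^ s • ξ‖ ^ a) 1 with h | h
  · exact (min_le_left _ _).trans h
  · exact (min_le_right _ _).trans (inv_le_one_of_one_le₀ h)

theorem norm_zpow_smul_rpow (a : ℝ) (s : ℤ) (ξ : Rd d) :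
    ‖(2 : ℝ) ^ s • ξ‖ ^ a = ((2 : ℝ) ^ a) ^ s * ‖ξ‖ ^ a := by
  rw [norm_smul, norm_zpow, Real.norm_ofNat, Real.mul_rpow (by positivity) (norm_nonneg _),
    ← Real.rpow_intCast, ← Real.rpow_mul (by norm_num), mul_comm (s : ℝ) a,
    Real.rpow_mul (by norm_num), Real.rpow_intCast]

/-- The sum of a two-sided geometric series with ratio `2 ^ a`. -/
def geomConst (a : ℝ) : ℝ := 2 ^ a / (2 ^ a - 1)

theorem one_lt_two_rpow {a : ℝ} (ha : 0 < a) : (1 : ℝ) < 2 ^ a :=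
  Real.one_lt_rpow (by norm_num) ha

theorem geomConst_pos {a : ℝ} (ha : 0 < a) : 0 < geomConst a := by
  have := one_lt_two_rpow ha
  exact div_pos (by linarith) (by linarith)

theorem sum_dec_le_left {a : ℝ} (ha : 0 < a) (b t : ℤ) (ξ : Rd d) :
    ∑ s ∈ Finset.Ioc b t, dec a s ξ ≤ geomConst a * ‖(2 : ℝ) ^ t • ξ‖ ^ a := by
  calc ∑ s ∈ Finset.Ioc b t, dec a s ξ
      ≤ ∑ s ∈ Finset.Ioc b t, ((2 : ℝ) ^ a) ^ s * ‖ξ‖ ^ a := by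
        refine Finset.sum_le_sum fun s _ => ?_
        rw [← norm_zpow_smul_rpow]
        exact min_le_left _ _
    _ ≤ geomConst a * ((2 : ℝ) ^ a) ^ t * ‖ξ‖ ^ a := by
        rw [← Finset.sum_mul]
        gcongr
        exact sum_Ioc_zpow_le (one_lt_two_rpow ha) b t
    _ = _ := by rw [norm_zpow_smul_rpow, mul_assoc]

theorem sum_dec_le_right {a : ℝ} (ha : 0 < a) (t n : ℤ) (ξ : Rd d) :
    ∑ s ∈ Finset.Ioc t n, dec a s ξ ≤ geomConst a * (‖(2 : ℝ) ^ t • ξ‖ ^ a)⁻¹ := by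
  calc ∑ s ∈ Finset.Ioc t n, dec a s ξ
      ≤ ∑ s ∈ Finset.Ioc t n, (((2 : ℝ) ^ a) ^ s)⁻¹ * (‖ξ‖ ^ a)⁻¹ := by
        refine Finset.sum_le_sum fun s _ => ?_
        rw [← mul_inv, ← norm_zpow_smul_rpow]
        exact min_le_right _ _
    _ ≤ geomConst a * (((2 : ℝ) ^ a) ^ t)⁻¹ * (‖ξ‖ ^ a)⁻¹ := by
        rw [← Finset.sum_mul]
        gcongr
        exact sum_Ioc_inv_zpow_le (one_lt_two_rpow ha) t n
    _ = _ := by rw [norm_zpow_smul_rpow, mul_assoc, mul_inv]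

/-- The sum is split at the level where `‖2^t ξ‖ ^ a` crosses 1; on either side it is a geometric
series. This crossover needs `ξ ≠ 0`. -/
theorem sum_dec_le {a : ℝ} (ha : 0 < a) (b n : ℤ) {ξ : Rd d} (hξ : ξ ≠ 0) :
    ∑ s ∈ Finset.Ioc b n, dec a s ξ ≤ 3 * geomConst a := by
  have hq := one_lt_two_rpow ha
  have hW : 0 < ‖ξ‖ ^ a := Real.rpow_pos_of_pos (norm_pos_iff.2 hξ) a
  obtain ⟨t, ht1, ht2⟩ := exists_mem_Ico_zpow (inv_pos.2 hW) hq
  have h1 : ‖(2 : ℝ) ^ t • ξ‖ ^ a ≤ 1 := by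
    rw [norm_zpow_smul_rpow]
    calc _ ≤ (‖ξ‖ ^ a)⁻¹ * ‖ξ‖ ^ a := by gcongr
      _ = 1 := inv_mul_cancel₀ hW.ne'
  have h2 : (‖(2 : ℝ) ^ (t + 1) • ξ‖ ^ a)⁻¹ ≤ 1 := by
    refine inv_le_one_of_one_le₀ ?_
    rw [norm_zpow_smul_rpow]
    calc 1 = (‖ξ‖ ^ a)⁻¹ * ‖ξ‖ ^ a := (inv_mul_cancel₀ hW.ne').symm
      _ ≤ _ := by gcongr
  have hΓ : 1 ≤ geomConst a := (one_le_div (by linarith)).2 (by linarith)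
  have hΓ0 := geomConst_pos ha
  have h3 : Finset.Ioc b n ⊆ Finset.Ioc b t ∪ insert (t + 1) (Finset.Ioc (t + 1) n) := by
    intro s hs
    simp only [Finset.mem_union, Finset.mem_insert, Finset.mem_Ioc] at hs ⊢
    omega
  have h4 : dec a (t + 1) ξ ≤ 1 := dec_le_one _ _ _
  calc ∑ s ∈ Finset.Ioc b n, dec a s ξ
      ≤ ∑ s ∈ Finset.Ioc b t ∪ insert (t + 1) (Finset.Ioc (t + 1) n), dec a s ξ :=
        Finset.sum_le_sum_of_subset_of_nonneg h3 fun s _ _ => dec_nonneg a s ξ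
    _ ≤ (∑ s ∈ Finset.Ioc b t, dec a s ξ) +
          ∑ s ∈ insert (t + 1) (Finset.Ioc (t + 1) n), dec a s ξ := by
        rw [← Finset.sum_union_inter]
        exact le_add_of_nonneg_right (Finset.sum_nonneg fun s _ => dec_nonneg a s ξ)
    _ = (∑ s ∈ Finset.Ioc b t, dec a s ξ) + (dec a (t + 1) ξ +
          ∑ s ∈ Finset.Ioc (t + 1) n, dec a s ξ) := by
        rw [Finset.sum_insert (by simp)]
    _ ≤ geomConst a * 1 + (1 + geomConst a * 1) := by
        refine add_le_add ?_ (add_le_add h4 ?_)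
        · exact (sum_dec_le_left ha b t ξ).trans (by gcongr)
        · exact (sum_dec_le_right ha (t + 1) n ξ).trans (by gcongr)
    _ ≤ _ := by linarith

namespace Mollifier

variable {φ : Rd d → ℂ} {C : ℝ}

theorem norm_fourier_le_one (hφ : Mollifier φ C) (ξ : Rd d) : ‖𝓕 φ ξ‖ ≤ 1 :=
  (NiceFun.norm_fourier_le φ ξ).trans hφ.integral_norm.le

theorem norm_fourier_sub_one_le (hφ : Mollifier φ C) (ξ : Rd d) : ‖𝓕 φ ξ - 1‖ ≤ 2 :=
  (norm_sub_le _ _).trans (by rw [norm_one]; linarith [hφ.norm_fourier_le_one ξ])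

/-- The high-frequency part of the mollifier, against powers of order at most one. -/
theorem norm_fourier_sub_one_le_rpow (hφ : Mollifier φ C) {c : ℝ} (hc : 0 ≤ c) (hc1 : c ≤ 1)
    (ξ : Rd d) : ‖𝓕 φ ξ - 1‖ ≤ 2 * C * ‖ξ‖ ^ c := by
  have h1 := hφ.one_le
  rcases le_total ‖ξ‖ 1 with h | h
  · calc ‖𝓕 φ ξ - 1‖ ≤ C * ‖ξ‖ := hφ.fourier_sub ξ
      _ = C * ‖ξ‖ ^ (1 : ℝ) := by rw [Real.rpow_one]
      _ ≤ C * ‖ξ‖ ^ c := by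
          rcases eq_or_lt_of_le (norm_nonneg ξ) with h0 | h0
          · rw [← h0, Real.zero_rpow one_ne_zero]
            have := Real.rpow_nonneg le_rfl c
            nlinarith
          · exact mul_le_mul_of_nonneg_left (Real.rpow_le_rpow_of_exponent_ge h0 h hc1) (by linarith)
      _ ≤ _ := by
          have := Real.rpow_nonneg (norm_nonneg ξ) c
          nlinarith
  · have h2 := Real.one_le_rpow h hc
    exact (hφ.norm_fourier_sub_one_le ξ).trans (by nlinarith)

/-- The low-frequency part of the mollifier, against powers of order at most one. -/
theorem norm_fourier_mul_rpow_le (hφ : Mollifier φ C) {c : ℝ} (hc : 0 ≤ c) (hc1 : c ≤ 1)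
    (ξ : Rd d) : ‖𝓕 φ ξ‖ * ‖ξ‖ ^ c ≤ C := by
  have h1 := hφ.one_le
  rcases le_total ‖ξ‖ 1 with h | h
  · calc ‖𝓕 φ ξ‖ * ‖ξ‖ ^ c ≤ 1 * 1 := by
          gcongr
          · exact hφ.norm_fourier_le_one ξ
          · exact Real.rpow_le_one (norm_nonneg _) h hc
      _ ≤ C := by linarith
  · refine le_trans ?_ (hφ.fourier_mul ξ)
    gcongr
    exact (Real.rpow_le_rpow_of_exponent_le h hc1).trans (Real.rpow_one _).le

/-- The error equals `-(φ̂ - 1) Σ_{s>t} - φ̂ Σ_{s≤t}`. With `V = ‖2^t ξ‖ ^ a` the two sums are of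
size `V⁻¹` and `V`, while `φ̂ - 1` and `φ̂` are bounded by multiples of `min(1, V²)` and `min(1,
V⁻²)`. The powers of order `2a` are available because `2a ≤ 1`. -/
theorem norm_multiplier_le (hφ : Mollifier φ C) {a : ℝ} (ha : 0 < a) (ha2 : a ≤ 1 / 2)
    {k : ℤ → ℂ} {β : ℝ} (hβ : 0 ≤ β) {ξ : Rd d} (hξ : ξ ≠ 0) (hk : ∀ s, ‖k s‖ ≤ β * dec a s ξ)
    {b t n : ℤ} (hbt : b ≤ t) (htn : t ≤ n) :
    ‖∑ s ∈ Finset.Ioc t n, k s - 𝓕 φ ((2 : ℝ) ^ t • ξ) * ∑ s ∈ Finset.Ioc b n, k s‖ ≤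
      4 * C * geomConst a * β * dec a t ξ := by
  set η := (2 : ℝ) ^ t • ξ with hη
  have hη0 : 0 < ‖η‖ := norm_pos_iff.2 (smul_ne_zero (by positivity) hξ)
  set V := ‖η‖ ^ a with hV
  have hV0 : 0 < V := Real.rpow_pos_of_pos hη0 a
  have hVV : V * V = ‖η‖ ^ (2 * a) := by
    rw [hV, ← Real.rpow_add hη0]; congr 1; ring
  have hΓ := geomConst_pos ha
  have hC := hφ.one_le
  have hsum : ∀ i j, ‖∑ s ∈ Finset.Ioc i j, k s‖ ≤ β * ∑ s ∈ Finset.Ioc i j, dec a s ξ := by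
    intro i j
    rw [Finset.mul_sum]
    exact norm_sum_le_of_le _ fun s _ => hk s
  have hS₁ : ‖∑ s ∈ Finset.Ioc b t, k s‖ ≤ β * (geomConst a * V) :=
    (hsum b t).trans (mul_le_mul_of_nonneg_left (sum_dec_le_left ha b t ξ) hβ)
  have hS₂ : ‖∑ s ∈ Finset.Ioc t n, k s‖ ≤ β * (geomConst a * V⁻¹) :=
    (hsum t n).trans (mul_le_mul_of_nonneg_left (sum_dec_le_right ha t n ξ) hβ)
  have hsplit : ∑ s ∈ Finset.Ioc b n, k s =
      ∑ s ∈ Finset.Ioc b t, k s + ∑ s ∈ Finset.Ioc t n, k s := by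
    rw [← Finset.sum_union (Finset.Ioc_disjoint_Ioc_of_le le_rfl),
      Finset.Ioc_union_Ioc_eq_Ioc hbt htn]
  -- A common form of the two regimes: `X` is `V` for low and `V⁻¹` for high frequencies.
  have hsub : ∀ X : ℝ, ‖𝓕 φ η - 1‖ ≤ 2 * C * (X * V) → ‖𝓕 φ η‖ ≤ 2 * C * (X * V⁻¹) →
      ‖∑ s ∈ Finset.Ioc t n, k s - 𝓕 φ η * ∑ s ∈ Finset.Ioc b n, k s‖ ≤
        4 * C * geomConst a * β * X := by
    intro X h1 h2
    calc _ = ‖-((𝓕 φ η - 1) * ∑ s ∈ Finset.Ioc t n, k s) - 𝓕 φ η * ∑ s ∈ Finset.Ioc b t, k s‖ := by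
          rw [hsplit]; congr 1; ring
      _ ≤ ‖𝓕 φ η - 1‖ * ‖∑ s ∈ Finset.Ioc t n, k s‖ + ‖𝓕 φ η‖ * ‖∑ s ∈ Finset.Ioc b t, k s‖ := by
          refine (norm_sub_le _ _).trans ?_
          rw [norm_neg, norm_mul, norm_mul]
      _ ≤ 2 * C * (X * V) * (β * (geomConst a * V⁻¹)) +
            2 * C * (X * V⁻¹) * (β * (geomConst a * V)) := by
          gcongr
          · exact (norm_nonneg _).trans h1
          · exact (norm_nonneg _).trans h2
      _ = _ := by field_simp; ring
  have hlow := hφ.norm_fourier_mul_rpow_le (c := 2 * a) (by linarith) (by linarith) η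
  have hhigh := hφ.norm_fourier_sub_one_le_rpow (c := 2 * a) (by linarith) (by linarith) η
  rw [← hVV] at hlow hhigh
  rw [dec, ← hη, ← hV]
  rcases le_total V V⁻¹ with h | h
  · rw [min_eq_left h]
    refine hsub V hhigh ?_
    rw [mul_inv_cancel₀ hV0.ne']
    linarith [hφ.norm_fourier_le_one η]
  · rw [min_eq_right h]
    refine hsub V⁻¹ ?_ ?_
    · rw [inv_mul_cancel₀ hV0.ne']
      linarith [hφ.norm_fourier_sub_one_le η]
    · rw [← mul_inv, ← div_eq_mul_inv, le_div_iff₀ (by positivity)]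
      linarith

/-- Averages of a mollified function are controlled by averages over cubes. -/
theorem enorm_dil_conv_le (hφ : Mollifier φ C) (u : Rd d → ℂ) (t : ℤ) (x : Rd d) :
    ‖(dil φ t ⋆[ContinuousLinearMap.mul ℂ ℂ, volume] u) x‖ₑ ≤
      ENNReal.ofReal C * 3 ^ d * triAvg t (fun y => ‖u y‖ₑ) x := by
  have hv : ENNReal.ofReal (2 ^ (-(t * (d : ℤ)))) = (cellVol d t)⁻¹ := by
    rw [cellVol, ← ENNReal.ofReal_pow (by positivity), ← zpow_natCast, ← zpow_mul, zpow_neg,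
      ENNReal.ofReal_inv_of_pos (by positivity)]
  have h3 : (3 : ℝ≥0∞) ^ d ≠ 0 := by positivity
  calc _ ≤ ∫⁻ y, ‖dil φ t (x - y)‖ₑ * ‖u y‖ₑ := enorm_conv_le _ _ _
    _ ≤ ∫⁻ y, (tri t x).indicator
          (fun y => ENNReal.ofReal C * (cellVol d t)⁻¹ * ‖u y‖ₑ) y := by
        gcongr with y
        by_cases hy : y ∈ tri t x
        · rw [Set.indicator_of_mem hy]
          gcongr
          rw [← hv, ← ENNReal.ofReal_mul (by linarith [hφ.one_le]), ← ofReal_norm]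
          exact ENNReal.ofReal_le_ofReal (hφ.norm_dil_le t _)
        · rw [Set.indicator_of_notMem hy]
          have : dil φ t (x - y) = 0 := by
            by_contra h
            refine hy (mem_tri_of_supNorm_le ?_)
            rw [supNorm_sub_comm]
            have h1 := hφ.dil_supp t h
            have h2 : (0 : ℝ) < 2 ^ t := by positivity
            exact (supNorm_le_norm _).trans (by linarith)
          simp [this]
    _ = ENNReal.ofReal C * (cellVol d t)⁻¹ * ∫⁻ y in tri t x, ‖u y‖ₑ := by
        rw [lintegral_indicator (measurableSet_tri t x), lintegral_const_mul' _ _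
          (ENNReal.mul_ne_top (by simp) (ENNReal.inv_ne_top.2 (cellVol_ne_zero t)))]
    _ = _ := by
        rw [triAvg, volume_tri, ENNReal.mul_inv (.inl h3) (.inl (by simp))]
        calc _ = ENNReal.ofReal C * (3 ^ d * (3 ^ d)⁻¹) * (cellVol d t)⁻¹ *
              ∫⁻ y in tri t x, ‖u y‖ₑ := by
                rw [ENNReal.mul_inv_cancel h3 (by simp), mul_one]
          _ = _ := by ring

end Mollifier

theorem enorm_sq_add_le (x y : ℝ≥0∞) : (x + y) ^ 2 ≤ 4 * (x ^ 2 + y ^ 2) := by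
  calc (x + y) ^ 2 ≤ (2 * max x y) ^ 2 := by
        gcongr
        rw [two_mul]
        exact add_le_add (le_max_left _ _) (le_max_right _ _)
    _ = 4 * (max x y) ^ 2 := by rw [mul_pow]; norm_num
    _ ≤ 4 * (x ^ 2 + y ^ 2) := by
        gcongr
        rcases le_total x y with h | h
        · rw [max_eq_right h]; exact le_add_self
        · rw [max_eq_left h]; exact le_self_add

/-- The maximal truncations of a family with decaying multipliers are bounded on `L²`. -/
theorem exists_lintegral_truncSup_sq_le (d : ℕ) {a : ℝ} (ha : 0 < a) (ha2 : a ≤ 1 / 2) :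
    ∃ D : ℝ, 0 < D ∧ ∀ (K : ℤ → Rd d → ℂ) (β : ℝ), (∀ s, NiceFun (K s)) → 0 ≤ β →
      (∀ s ξ, ‖𝓕 (K s) ξ‖ ≤ β * dec a s ξ) → ∀ f, NiceFun f → ∀ b n,
        ∫⁻ x, truncSup K f x b n ^ 2 ≤ ENNReal.ofReal (D * β) ^ 2 * ∫⁻ x, ‖f x‖ₑ ^ 2 := by
  obtain ⟨φ, C, hφ⟩ := exists_mollifier d
  have hC := hφ.one_le
  have hΓ := geomConst_pos ha
  set Γ := geomConst a with hΓdef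
  set E₁ : ℝ := (C * 3 ^ d) ^ 2 * (8 * 3 ^ d) * (3 * Γ) ^ 2 with hE₁
  set E₂ : ℝ := (4 * C * Γ) ^ 2 * (3 * Γ) with hE₂
  have hE : 0 < 32 * (E₁ + E₂) := by positivity
  refine ⟨√(32 * (E₁ + E₂)), Real.sqrt_pos.2 hE, fun K β hKn hβ hK f hf b n => ?_⟩
  set u : ℤ → Rd d → ℂ := fun s => K s ⋆[ContinuousLinearMap.mul ℂ ℂ, volume] f with hu
  have hun : ∀ s, NiceFun (u s) := fun s => (hKn s).conv hf
  set R : ℤ → Rd d → ℂ := fun t x => ∑ s ∈ Finset.Ioc t n, u s x with hR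
  have hRn : ∀ t, NiceFun (R t) := fun t => NiceFun.sum _ fun s _ => hun s
  have hRf : ∀ t ξ, 𝓕 (R t) ξ = (∑ s ∈ Finset.Ioc t n, 𝓕 (K s) ξ) * 𝓕 f ξ := by
    intro t ξ
    simp only [hR]
    rw [NiceFun.fourier_sum _ (fun s _ => hun s), Finset.sum_mul]
    exact Finset.sum_congr rfl fun s _ => (hKn s).fourier_conv hf ξ
  -- The tail `R t` is compared with the mollification of the full sum `R b` at scale `2^t`. The
  -- supremum of the mollifications is a maximal function of `R b`; that of the errors is bounded by
  -- their square sum.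
  set e : ℤ → Rd d → ℂ := fun t x =>
    R t x - (dil φ t ⋆[ContinuousLinearMap.mul ℂ ℂ, volume] R b) x with he
  have hen : ∀ t, NiceFun (e t) := fun t => (hRn t).sub ((hφ.niceFun_dil t).conv (hRn b))
  have hef : ∀ t ξ, 𝓕 (e t) ξ = (∑ s ∈ Finset.Ioc t n, 𝓕 (K s) ξ -
      𝓕 φ ((2 : ℝ) ^ t • ξ) * ∑ s ∈ Finset.Ioc b n, 𝓕 (K s) ξ) * 𝓕 f ξ := by
    intro t ξ
    simp only [he]
    rw [(hRn t).fourier_sub ((hφ.niceFun_dil t).conv (hRn b)),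
      (hφ.niceFun_dil t).fourier_conv (hRn b), hRf, hRf, fourier_dil]
    ring
  -- At the origin, where the geometric sums have no crossover, all multipliers vanish since `0 ^ a
  -- = 0`.
  have hne : ∀ ξ : Rd d, ξ ≠ 0 ∨ ∀ s, 𝓕 (K s) ξ = 0 := by
    intro ξ
    by_cases h : ξ = 0
    · refine Or.inr fun s => ?_
      have := hK s ξ
      rw [h, dec, smul_zero, norm_zero, Real.zero_rpow ha.ne'] at this
      rw [h]
      simpa using this
    · exact Or.inl h
  -- the `L²` norm of the sum and of the error terms
  have hU : ∫⁻ x, ‖R b x‖ₑ ^ 2 ≤ ENNReal.ofReal ((3 * Γ) ^ 2 * β ^ 2) * ∫⁻ x, ‖f x‖ₑ ^ 2 := by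
    rw [← (hRn b).lintegral_fourier_sq, ← hf.lintegral_fourier_sq,
      ← lintegral_const_mul' _ _ ENNReal.ofReal_ne_top]
    refine lintegral_mono fun ξ => ?_
    rw [hRf, enorm_mul, mul_pow]
    gcongr
    rw [← ofReal_norm, ← ENNReal.ofReal_pow (norm_nonneg _), ← mul_pow]
    refine ENNReal.ofReal_le_ofReal (pow_le_pow_left₀ (norm_nonneg _) ?_ 2)
    rcases hne ξ with hξ | hξ
    · calc _ ≤ ∑ s ∈ Finset.Ioc b n, β * dec a s ξ := norm_sum_le_of_le _ fun s _ => hK s ξ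
        _ ≤ β * (3 * Γ) := by
            rw [← Finset.mul_sum]
            exact mul_le_mul_of_nonneg_left (sum_dec_le ha b n hξ) hβ
        _ = _ := mul_comm _ _
    · simp only [hξ, Finset.sum_const_zero, norm_zero]
      positivity
  have hEsum : ∑ t ∈ Finset.Icc b n, ∫⁻ x, ‖e t x‖ₑ ^ 2 ≤
      ENNReal.ofReal (E₂ * β ^ 2) * ∫⁻ x, ‖f x‖ₑ ^ 2 := by
    have h1 : ∀ t, ∫⁻ x, ‖e t x‖ₑ ^ 2 = ∫⁻ ξ, ‖𝓕 (e t) ξ‖ₑ ^ 2 := fun t =>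
      (hen t).lintegral_fourier_sq.symm
    simp only [h1]
    have hc : ∀ t, Continuous (𝓕 (e t)) := fun t =>
      VectorFourier.fourierIntegral_continuous Real.continuous_fourierChar continuous_inner
        (hen t).integrable
    rw [← lintegral_finsetSum _ fun t _ => (hc t).measurable.enorm.pow_const 2,
      ← hf.lintegral_fourier_sq, ← lintegral_const_mul' _ _ ENNReal.ofReal_ne_top]
    refine lintegral_mono fun ξ => ?_
    simp only [hef, enorm_mul, mul_pow]
    rw [← Finset.sum_mul]
    gcongr
    simp only [← ofReal_norm, ← ENNReal.ofReal_pow (norm_nonneg _)]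
    rw [← ENNReal.ofReal_sum_of_nonneg fun _ _ => by positivity]
    refine ENNReal.ofReal_le_ofReal ?_
    rcases hne ξ with hξ | hξ
    · calc _ ≤ ∑ t ∈ Finset.Icc b n, (4 * C * Γ * β) ^ 2 * dec a t ξ := by
            refine Finset.sum_le_sum fun t ht => ?_
            obtain ⟨h1, h2⟩ := Finset.mem_Icc.1 ht
            have h3 := hφ.norm_multiplier_le ha ha2 hβ hξ (fun s => hK s ξ) h1 h2
            calc _ ≤ (4 * C * Γ * β * dec a t ξ) ^ 2 := pow_le_pow_left₀ (norm_nonneg _) h3 2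
              _ = (4 * C * Γ * β) ^ 2 * (dec a t ξ * dec a t ξ) := by ring
              _ ≤ (4 * C * Γ * β) ^ 2 * (dec a t ξ * 1) := by
                  gcongr
                  · exact dec_nonneg _ _ _
                  · exact dec_le_one _ _ _
              _ = _ := by ring
        _ ≤ (4 * C * Γ * β) ^ 2 * (3 * Γ) := by
            rw [← Finset.mul_sum]
            gcongr
            -- The errors are indexed by `t ≥ b`, hence the half-open interval starts at `b - 1`.
            refine le_trans (Finset.sum_le_sum_of_subset_of_nonneg (t := Finset.Ioc (b - 1) n)
              (fun s hs => ?_) fun s _ _ => dec_nonneg a s ξ) (sum_dec_le ha (b - 1) n hξ)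
            simp only [Finset.mem_Icc, Finset.mem_Ioc] at hs ⊢
            omega
        _ = _ := by rw [hE₂]; ring
    · simp only [hξ, Finset.sum_const_zero, mul_zero, sub_zero, norm_zero]
      simp only [ne_eq, OfNat.ofNat_ne_zero, not_false_eq_true, zero_pow, Finset.sum_const_zero]
      positivity
  -- the pointwise bound
  set G : Rd d → ℝ≥0∞ := fun x => ENNReal.ofReal C * 3 ^ d *
    ⨆ (j : ℤ) (_ : j ≤ n), triAvg j (fun y => ‖R b y‖ₑ) x with hG
  have hRle : ∀ t, b ≤ t → t ≤ n → ∀ x, ‖R t x‖ₑ ^ 2 ≤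
      4 * (G x ^ 2 + ∑ t ∈ Finset.Icc b n, ‖e t x‖ₑ ^ 2) := by
    intro t h1 h2 x
    have h3 : R t x = (dil φ t ⋆[ContinuousLinearMap.mul ℂ ℂ, volume] R b) x + e t x := by
      simp only [he]; ring
    have h4 : ‖(dil φ t ⋆[ContinuousLinearMap.mul ℂ ℂ, volume] R b) x‖ₑ ≤ G x := by
      refine (hφ.enorm_dil_conv_le (R b) t x).trans ?_
      simp only [hG]
      gcongr
      exact le_iSup₂_of_le (f := fun (j : ℤ) (_ : j ≤ n) => triAvg j (fun y => ‖R b y‖ₑ) x) t h2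
        le_rfl
    calc ‖R t x‖ₑ ^ 2 ≤ (G x + ‖e t x‖ₑ) ^ 2 := by
          rw [h3]
          gcongr
          exact (enorm_add_le _ _).trans (by gcongr)
      _ ≤ 4 * (G x ^ 2 + ‖e t x‖ₑ ^ 2) := enorm_sq_add_le _ _
      _ ≤ _ := by
          gcongr
          exact Finset.single_le_sum (f := fun t => ‖e t x‖ₑ ^ 2) (fun _ _ => zero_le)
            (Finset.mem_Icc.2 ⟨h1, h2⟩)
  -- Each truncation is a difference `R t₁ - R t₂` of tails; squaring sums of two terms gives `32 =
  -- 4 · (4 + 4)`.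
  have hpt : ∀ x, truncSup K f x b n ^ 2 ≤
      32 * (G x ^ 2 + ∑ t ∈ Finset.Icc b n, ‖e t x‖ₑ ^ 2) := by
    intro x
    set X := 32 * (G x ^ 2 + ∑ t ∈ Finset.Icc b n, ‖e t x‖ₑ ^ 2) with hX
    have hsq : (X ^ (1 / 2 : ℝ)) ^ 2 = X := by
      rw [← ENNReal.rpow_natCast, ← ENNReal.rpow_mul]; norm_num
    rw [← hsq]
    gcongr
    refine truncSup_le fun t₁ t₂ h1 h2 h3 => le_of_sq_le_sq ?_
    rw [hsq]
    have h4 : trunc K f x t₁ t₂ = R t₁ x + -R t₂ x := by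
      simp only [hR, trunc]
      rw [← Finset.Ioc_union_Ioc_eq_Ioc h1 h2,
        Finset.sum_union (Finset.Ioc_disjoint_Ioc_of_le le_rfl)]
      ring
    calc ‖trunc K f x t₁ t₂‖ₑ ^ 2 ≤ (‖R t₁ x‖ₑ + ‖R t₂ x‖ₑ) ^ 2 := by
          rw [h4]
          gcongr
          exact (enorm_add_le _ _).trans (by rw [enorm_neg])
      _ ≤ 4 * (‖R t₁ x‖ₑ ^ 2 + ‖R t₂ x‖ₑ ^ 2) := enorm_sq_add_le _ _
      _ ≤ 4 * (4 * (G x ^ 2 + ∑ t ∈ Finset.Icc b n, ‖e t x‖ₑ ^ 2) +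
            4 * (G x ^ 2 + ∑ t ∈ Finset.Icc b n, ‖e t x‖ₑ ^ 2)) := by
          gcongr
          · exact hRle t₁ h3 (h1.trans h2) x
          · exact hRle t₂ (h3.trans h1) h2 x
      _ = X := by rw [hX]; ring
  have hGint : ∫⁻ x, G x ^ 2 ≤ ENNReal.ofReal (E₁ * β ^ 2) * ∫⁻ x, ‖f x‖ₑ ^ 2 := by
    obtain ⟨M, hM⟩ := (hRn b).bdd
    have h1 := lintegral_iSup_triAvg_sq n (fun y => ‖R b y‖ₑ) (hRn b).meas.enorm
      (M := ENNReal.ofReal M) ENNReal.ofReal_ne_top fun x => by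
        rw [← ofReal_norm]; exact ENNReal.ofReal_le_ofReal (hM x)
    have h3 : (3 : ℝ≥0∞) ^ d = ENNReal.ofReal (3 ^ d) := by
      rw [ENNReal.ofReal_pow (by norm_num)]; norm_num
    have h8 : (8 : ℝ≥0∞) = ENNReal.ofReal 8 := by norm_num
    calc ∫⁻ x, G x ^ 2 = (ENNReal.ofReal C * 3 ^ d) ^ 2 *
          ∫⁻ x, (⨆ (j : ℤ) (_ : j ≤ n), triAvg j (fun y => ‖R b y‖ₑ) x) ^ 2 := by
          simp only [hG, mul_pow _ (iSup _)]
          rw [lintegral_const_mul' _ _ (ENNReal.pow_ne_top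
            (ENNReal.mul_ne_top ENNReal.ofReal_ne_top (by simp)))]
      _ ≤ (ENNReal.ofReal C * 3 ^ d) ^ 2 * (8 * 3 ^ d *
            (ENNReal.ofReal ((3 * Γ) ^ 2 * β ^ 2) * ∫⁻ x, ‖f x‖ₑ ^ 2)) := by
          gcongr
          exact h1.trans (by gcongr)
      _ = _ := by
          rw [h3, h8, ← ENNReal.ofReal_mul (by linarith), ← ENNReal.ofReal_mul (by norm_num),
            ← ENNReal.ofReal_pow (by positivity), ← mul_assoc, ← mul_assoc,
            ← ENNReal.ofReal_mul (by positivity), ← ENNReal.ofReal_mul (by positivity)]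
          congr 2
          rw [hE₁]; ring
  calc ∫⁻ x, truncSup K f x b n ^ 2
      ≤ ∫⁻ x, 32 * (G x ^ 2 + ∑ t ∈ Finset.Icc b n, ‖e t x‖ₑ ^ 2) := lintegral_mono hpt
    _ = 32 * ((∫⁻ x, G x ^ 2) + ∑ t ∈ Finset.Icc b n, ∫⁻ x, ‖e t x‖ₑ ^ 2) := by
        have hm : Measurable fun x => ∑ t ∈ Finset.Icc b n, ‖e t x‖ₑ ^ 2 :=
          Finset.measurable_sum _ fun t _ => (hen t).meas.enorm.pow_const 2
        rw [lintegral_const_mul' _ _ (by norm_num), lintegral_add_right _ hm,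
          lintegral_finsetSum _ fun t _ => (hen t).meas.enorm.pow_const 2]
    _ ≤ 32 * (ENNReal.ofReal (E₁ * β ^ 2) * (∫⁻ x, ‖f x‖ₑ ^ 2) +
          ENNReal.ofReal (E₂ * β ^ 2) * ∫⁻ x, ‖f x‖ₑ ^ 2) := by gcongr
    _ = _ := by
        rw [← add_mul, ← ENNReal.ofReal_add (by positivity) (by positivity), ← mul_assoc,
          show (32 : ℝ≥0∞) = ENNReal.ofReal 32 by norm_num, ← ENNReal.ofReal_mul (by norm_num),
          ← ENNReal.ofReal_pow (by positivity), mul_pow, Real.sq_sqrt hE.le]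
        congr 2
        ring

/-! ### Mollified kernels -/

/-- A family of bounded kernels at the scales `2 ^ s` with multipliers of order `2 a`. -/
structure NiceFamily (a : ℝ) (K : ℤ → Rd d → ℂ) : Prop where
  nice : ∀ s, NiceFun (K s)
  supp : ∀ s x, K s x ≠ 0 → supNorm x < 2 ^ (s - 2)
  bound : ∀ s x, ‖K s x‖ ≤ 2 ^ (-(s * (d : ℤ)))
  fourier : ∀ s ξ, ‖𝓕 (K s) ξ‖ ≤ dec (2 * a) s ξ

/-- The kernels mollified at the scales `2 ^ (s - Δ)`. -/
def mollify (φ : Rd d → ℂ) (K : ℤ → Rd d → ℂ) (Δ : ℕ) (s : ℤ) : Rd d → ℂ :=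
  dil φ (s - Δ) ⋆[ContinuousLinearMap.mul ℂ ℂ, volume] K s

theorem ofReal_zpow_neg_mul (d : ℕ) (s : ℤ) :
    ENNReal.ofReal (2 ^ (-(s * (d : ℤ)))) = (cellVol d s)⁻¹ := by
  rw [cellVol, ← ENNReal.ofReal_pow (by positivity), ← zpow_natCast, ← zpow_mul, zpow_neg,
    ENNReal.ofReal_inv_of_pos (by positivity)]

namespace Mollifier

variable {φ : Rd d → ℂ} {C : ℝ}

theorem lintegral_enorm_dil (hφ : Mollifier φ C) (t : ℤ) : ∫⁻ x, ‖dil φ t x‖ₑ = 1 := by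
  rw [← ofReal_integral_norm_eq_lintegral_enorm (hφ.niceFun_dil t).integrable, integral_norm_dil,
    hφ.integral_norm, ENNReal.ofReal_one]

theorem enorm_dil_sub_le (hφ : Mollifier φ C) (t : ℤ) (x y : Rd d) :
    ‖dil φ t x - dil φ t y‖ₑ ≤
      (cellVol d t)⁻¹ * ENNReal.ofReal (C * √d * (2 ^ (-t) * supNorm (x - y))) := by
  have hC := hφ.one_le
  rw [← ofReal_zpow_neg_mul, ← ENNReal.ofReal_mul (by positivity), ← ofReal_norm]
  refine ENNReal.ofReal_le_ofReal ?_
  rw [dil, dil, ← mul_sub, norm_mul, Complex.norm_real, Real.norm_of_nonneg (by positivity)]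
  gcongr
  calc _ ≤ C * ‖(2 : ℝ) ^ (-t) • x - (2 : ℝ) ^ (-t) • y‖ := hφ.lip _ _
    _ = C * (2 ^ (-t) * ‖x - y‖) := by
        rw [← smul_sub, norm_smul, Real.norm_of_nonneg (by positivity)]
    _ ≤ C * (2 ^ (-t) * (√d * supNorm (x - y))) := by gcongr; exact norm_le_supNorm _
    _ = _ := by ring

theorem lintegral_enorm_dil_sub_le (hφ : Mollifier φ C) (t : ℤ) (x y : Rd d) :
    ∫⁻ z, ‖dil φ t (x - z) - dil φ t (y - z)‖ₑ ≤
      2 * 3 ^ d * ENNReal.ofReal (C * √d * (2 ^ (-t) * supNorm (x - y))) := by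
  set c := (cellVol d t)⁻¹ * ENNReal.ofReal (C * √d * (2 ^ (-t) * supNorm (x - y))) with hc
  have hmem : ∀ w z : Rd d, z ∉ tri t w → dil φ t (w - z) = 0 := by
    intro w z hz
    by_contra h
    refine hz (mem_tri_of_supNorm_le ?_)
    rw [supNorm_sub_comm]
    have h1 := hφ.dil_supp t h
    have h2 : (0 : ℝ) < 2 ^ t := by positivity
    exact (supNorm_le_norm _).trans (by linarith)
  calc ∫⁻ z, ‖dil φ t (x - z) - dil φ t (y - z)‖ₑ
      ≤ ∫⁻ z, (tri t x ∪ tri t y).indicator (fun _ => c) z := by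
        gcongr with z
        by_cases hz : z ∈ tri t x ∪ tri t y
        · rw [Set.indicator_of_mem hz]
          refine (hφ.enorm_dil_sub_le t _ _).trans (le_of_eq ?_)
          rw [sub_sub_sub_cancel_right]
        · rw [Set.mem_union, not_or] at hz
          rw [hmem x z hz.1, hmem y z hz.2, sub_zero, enorm_zero]
          exact zero_le
    _ = c * volume (tri t x ∪ tri t y) := by
        rw [lintegral_indicator ((measurableSet_tri t x).union (measurableSet_tri t y)),
          setLIntegral_const]
    _ ≤ c * (3 ^ d * cellVol d t + 3 ^ d * cellVol d t) := by
        gcongr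
        exact (measure_union_le _ _).trans (by rw [volume_tri, volume_tri])
    _ = 2 * 3 ^ d * ENNReal.ofReal (C * √d * (2 ^ (-t) * supNorm (x - y))) *
          ((cellVol d t)⁻¹ * cellVol d t) := by rw [hc]; ring
    _ = _ := by rw [ENNReal.inv_mul_cancel (cellVol_ne_zero t) (cellVol_ne_top t), mul_one]

end Mollifier

namespace NiceFamily

variable {φ : Rd d → ℂ} {C a : ℝ} {K : ℤ → Rd d → ℂ}

theorem enorm_le (hK : NiceFamily a K) (s : ℤ) (x : Rd d) : ‖K s x‖ₑ ≤ (cellVol d s)⁻¹ := by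
  rw [← ofReal_zpow_neg_mul, ← ofReal_norm]
  exact ENNReal.ofReal_le_ofReal (hK.bound s x)

theorem niceFun_mollify (hK : NiceFamily a K) (hφ : Mollifier φ C) (Δ : ℕ) (s : ℤ) :
    NiceFun (mollify φ K Δ s) :=
  (hφ.niceFun_dil _).conv (hK.nice s)

theorem enorm_mollify_le (hK : NiceFamily a K) (hφ : Mollifier φ C) (Δ : ℕ) (s : ℤ) (x : Rd d) :
    ‖mollify φ K Δ s x‖ₑ ≤ (cellVol d s)⁻¹ := by
  calc _ ≤ ∫⁻ y, ‖dil φ (s - Δ) (x - y)‖ₑ * ‖K s y‖ₑ := enorm_conv_le _ _ _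
    _ ≤ ∫⁻ y, ‖dil φ (s - Δ) (x - y)‖ₑ * (cellVol d s)⁻¹ := by
        gcongr with y; exact hK.enorm_le s y
    _ = _ := by
        rw [lintegral_mul_const' _ _ (ENNReal.inv_ne_top.2 (cellVol_ne_zero s)),
          lintegral_sub_left_eq_self (fun y => ‖dil φ (s - Δ) y‖ₑ), hφ.lintegral_enorm_dil,
          one_mul]

/-- The kernel has range `2^s / 4` and the mollifier adds at most `2^s / 4`, which is why its
support has radius `1/4`. -/
theorem mollify_supp (hK : NiceFamily a K) (hφ : Mollifier φ C) (Δ : ℕ) (s : ℤ) {x : Rd d}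
    (hx : mollify φ K Δ s x ≠ 0) : supNorm x < 2 ^ (s - 1) := by
  obtain ⟨y, hy⟩ : ∃ y, dil φ (s - Δ) (x - y) * K s y ≠ 0 := by
    by_contra hcon
    simp only [not_exists, not_not] at hcon
    exact hx (by rw [mollify, conv_eq]; simp [hcon])
  have h1 := hφ.dil_supp _ (left_ne_zero_of_mul hy)
  have h2 := hK.supp s y (right_ne_zero_of_mul hy)
  have h3 : (2 : ℝ) ^ (s - Δ) ≤ 2 ^ s := zpow_le_zpow_right₀ (by norm_num) (by omega)
  have h4 := supNorm_add_le (x - y) y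
  rw [sub_add_cancel] at h4
  have h5 := supNorm_le_norm (x - y)
  rw [zpow_sub₀ two_ne_zero] at h2 ⊢
  norm_num at h2 ⊢
  have h6 : (0 : ℝ) < 2 ^ s := by positivity
  linarith

theorem enorm_mollify_sub_le (hK : NiceFamily a K) (hφ : Mollifier φ C) (Δ : ℕ) (s : ℤ)
    (x y : Rd d) : ‖mollify φ K Δ s x - mollify φ K Δ s y‖ₑ ≤
      ENNReal.ofReal (2 * 3 ^ d * C * (√d + 1)) * (cellVol d s)⁻¹ *
        ENNReal.ofReal (2 ^ ((Δ : ℤ) - s) * supNorm (x - y)) := by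
  have hC := hφ.one_le
  have e1 : mollify φ K Δ s x - mollify φ K Δ s y =
      ∫ z, (dil φ (s - Δ) (x - z) - dil φ (s - Δ) (y - z)) * K s z := by
    rw [mollify, conv_eq, conv_eq, ← integral_sub]
    · simp only [sub_mul]
    · exact (hK.nice s).integrable_mul_sub (hφ.niceFun_dil _).integrable x
    · exact (hK.nice s).integrable_mul_sub (hφ.niceFun_dil _).integrable y
  calc _ ≤ ∫⁻ z, ‖(dil φ (s - Δ) (x - z) - dil φ (s - Δ) (y - z)) * K s z‖ₑ := by
        rw [e1]; exact enorm_integral_le_lintegral_enorm _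
    _ ≤ ∫⁻ z, ‖dil φ (s - Δ) (x - z) - dil φ (s - Δ) (y - z)‖ₑ * (cellVol d s)⁻¹ := by
        gcongr with z
        rw [enorm_mul]
        gcongr
        exact hK.enorm_le s z
    _ ≤ 2 * 3 ^ d * ENNReal.ofReal (C * √d * (2 ^ (-(s - Δ)) * supNorm (x - y))) *
          (cellVol d s)⁻¹ := by
        rw [lintegral_mul_const' _ _ (ENNReal.inv_ne_top.2 (cellVol_ne_zero s))]
        gcongr
        exact hφ.lintegral_enorm_dil_sub_le _ x y
    _ = ENNReal.ofReal (2 * 3 ^ d * C * √d) * (cellVol d s)⁻¹ *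
        ENNReal.ofReal (2 ^ ((Δ : ℤ) - s) * supNorm (x - y)) := by
        rw [mul_right_comm (ENNReal.ofReal _), ← ENNReal.ofReal_mul (by positivity),
          show (2 : ℝ≥0∞) * 3 ^ d = ENNReal.ofReal (2 * 3 ^ d) by
            rw [ENNReal.ofReal_mul (by norm_num), ENNReal.ofReal_pow (by norm_num)]; norm_num,
          ← ENNReal.ofReal_mul (by positivity), neg_sub]
        congr 2
        ring
    _ ≤ _ := by gcongr; linarith

theorem fourier_mollify (hK : NiceFamily a K) (hφ : Mollifier φ C) (Δ : ℕ) (s : ℤ) (ξ : Rd d) :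
    𝓕 (mollify φ K Δ s) ξ = 𝓕 φ ((2 : ℝ) ^ (s - Δ) • ξ) * 𝓕 (K s) ξ := by
  rw [mollify, (hφ.niceFun_dil _).fourier_conv (hK.nice s), fourier_dil]

end NiceFamily

/-- Half of the decay exponent `2a` is given up to absorb a factor of order `a`; it pays for the
gain in the mollification depth. -/
theorem dec_two_mul_mul_le {a : ℝ} (ha : 0 < a) (s : ℤ) (ξ : Rd d) :
    dec (2 * a) s ξ * ‖(2 : ℝ) ^ s • ξ‖ ^ a ≤ dec a s ξ := by
  set η := (2 : ℝ) ^ s • ξ with hη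
  rcases eq_or_lt_of_le (norm_nonneg η) with h0 | h0
  · rw [← h0, Real.zero_rpow ha.ne', mul_zero]
    exact dec_nonneg _ _ _
  set V := ‖η‖ ^ a with hV
  have hV0 : 0 < V := Real.rpow_pos_of_pos h0 a
  have hVV : ‖η‖ ^ (2 * a) = V * V := by
    rw [hV, ← Real.rpow_add h0]; congr 1; ring
  rw [dec, dec, ← hη, ← hV, hVV]
  refine le_min ?_ ?_
  · calc _ ≤ 1 * V := by
          gcongr
          rcases le_total (V * V) 1 with h | h
          · exact (min_le_left _ _).trans h
          · exact (min_le_right _ _).trans (inv_le_one_of_one_le₀ h)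
      _ = V := one_mul V
  · calc _ ≤ (V * V)⁻¹ * V := by gcongr; exact min_le_right _ _
      _ = V⁻¹ := by field_simp

theorem dec_two_mul_le {a : ℝ} (ha : 0 < a) (s : ℤ) (ξ : Rd d) :
    dec (2 * a) s ξ ≤ dec a s ξ := by
  set η := (2 : ℝ) ^ s • ξ with hη
  rcases eq_or_lt_of_le (norm_nonneg η) with h0 | h0
  · rw [dec, ← hη, ← h0, Real.zero_rpow (by positivity)]
    simpa using dec_nonneg _ _ _
  set V := ‖η‖ ^ a with hV
  have hV0 : 0 < V := Real.rpow_pos_of_pos h0 a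
  have hVV : ‖η‖ ^ (2 * a) = V * V := by
    rw [hV, ← Real.rpow_add h0]; congr 1; ring
  rw [dec, dec, ← hη, ← hV, hVV]
  rcases le_total V 1 with h | h
  · have h1 : V * V ≤ V := by nlinarith
    have h2 : V ≤ V⁻¹ := h.trans ((one_le_inv₀ hV0).2 h)
    exact (min_le_left _ _).trans (le_min h1 (h1.trans h2))
  · have h1 : (V * V)⁻¹ ≤ V⁻¹ := by gcongr; nlinarith
    have h2 : V⁻¹ ≤ V := (inv_le_one_of_one_le₀ h).trans h
    exact (min_le_right _ _).trans (le_min (h1.trans h2) h1)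

namespace NiceFamily

variable {φ : Rd d → ℂ} {C a : ℝ} {K : ℤ → Rd d → ℂ}

/-- The factor `φ̂(2^(s-Δ) ξ) - 1` is at most `2C ‖2^(s-Δ) ξ‖ ^ a = 2C 2^(-aΔ) ‖2^s ξ‖ ^ a`, and the
last power is absorbed by half of the decay of the kernel. -/
theorem norm_fourier_sub_mollify_le (hK : NiceFamily a K) (hφ : Mollifier φ C) (ha : 0 < a)
    (ha2 : a ≤ 1 / 2) (Δ : ℕ) (s : ℤ) (ξ : Rd d) :
    ‖𝓕 (fun x => K s x - mollify φ K Δ s x) ξ‖ ≤ 2 * C * ((2 : ℝ) ^ (-a)) ^ Δ * dec a s ξ := by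
  have hC := hφ.one_le
  rw [(hK.nice s).fourier_sub (hK.niceFun_mollify hφ Δ s), hK.fourier_mollify hφ]
  have h1 : ‖(2 : ℝ) ^ (s - Δ) • ξ‖ ^ a = ((2 : ℝ) ^ (-a)) ^ Δ * ‖(2 : ℝ) ^ s • ξ‖ ^ a := by
    have h2 : (0 : ℝ) < 2 ^ a := by positivity
    rw [norm_zpow_smul_rpow, norm_zpow_smul_rpow, zpow_sub₀ h2.ne', Real.rpow_neg (by norm_num),
      inv_pow, zpow_natCast]
    ring
  calc _ = ‖𝓕 φ ((2 : ℝ) ^ (s - Δ) • ξ) - 1‖ * ‖𝓕 (K s) ξ‖ := by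
        rw [← norm_mul, ← norm_neg]; congr 1; ring
    _ ≤ 2 * C * ‖(2 : ℝ) ^ (s - Δ) • ξ‖ ^ a * dec (2 * a) s ξ := by
        gcongr
        · exact hφ.norm_fourier_sub_one_le_rpow ha.le (by linarith) _
        · exact hK.fourier s ξ
    _ = 2 * C * ((2 : ℝ) ^ (-a)) ^ Δ * (dec (2 * a) s ξ * ‖(2 : ℝ) ^ s • ξ‖ ^ a) := by
        rw [h1]; ring
    _ ≤ _ := by gcongr; exact dec_two_mul_mul_le ha s ξ

end NiceFamily

/-- The depths of the mollifications. -/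
def lev : ℕ → ℕ
  | 0 => 0
  | N + 1 => 2 ^ (N + 1)

theorem lev_le_succ (N : ℕ) : lev N ≤ lev (N + 1) := by
  cases N with
  | zero => simp [lev]
  | succ N => simp only [lev]; gcongr <;> omega

theorem lev_succ_le (N : ℕ) : lev (N + 1) ≤ 2 * lev N + 2 := by
  cases N with
  | zero => simp [lev]
  | succ N => simp only [lev]; rw [pow_succ]; omega

/-- The difference of two consecutive mollifications. -/
def layer (φ : Rd d → ℂ) (K : ℤ → Rd d → ℂ) : ℕ → ℤ → Rd d → ℂ
  | 0, s => mollify φ K 0 s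
  | N + 1, s => fun x => mollify φ K (lev (N + 1)) s x - mollify φ K (lev N) s x

/-- The layers cost `2^(lev N)` in the Lipschitz constants and gain the power `lev N` of `2^(-a/2)`
on `L²`, with a constant uniform over all families. The second statement shows that the remainder
after `N` layers is negligible on `L²`; the third gives the local integrability of the maximal
truncation. -/
theorem smoothFamily_layer (d : ℕ) {a : ℝ} (ha : 0 < a) (ha2 : a ≤ 1 / 2) {φ : Rd d → ℂ} {C : ℝ}
    (hφ : Mollifier φ C) :
    ∃ D : ℝ, 0 < D ∧ ∀ K : ℤ → Rd d → ℂ, NiceFamily a K →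
      (∀ N, SmoothFamily (ENNReal.ofReal D) (lev N)
        (ENNReal.ofReal (D * ((2 : ℝ) ^ (-(a / 2))) ^ lev N)) (layer φ K N)) ∧
      (∀ N, ∀ f, NiceFun f → ∀ b n,
        ∫⁻ x, truncSup (fun s x => K s x - mollify φ K (lev N) s x) f x b n ^ 2 ≤
          ENNReal.ofReal (D * ((2 : ℝ) ^ (-(a / 2))) ^ lev N) ^ 2 * ∫⁻ x, ‖f x‖ₑ ^ 2) ∧
      ∀ f, NiceFun f → ∀ b n, ∫⁻ x, truncSup K f x b n ^ 2 ≤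
        ENNReal.ofReal D ^ 2 * ∫⁻ x, ‖f x‖ₑ ^ 2 := by
  obtain ⟨D₀, hD₀, hL2⟩ := exists_lintegral_truncSup_sq_le d ha ha2
  have hC := hφ.one_le
  set A : ℝ := 2 * 3 ^ d * C * (√d + 1) with hA
  have h3 : (1 : ℝ) ≤ 3 ^ d := one_le_pow₀ (by norm_num)
  have hA1 : 1 ≤ A := by
    rw [hA]
    have : 1 ≤ 2 * (3 ^ d : ℝ) := by linarith
    calc (1 : ℝ) = 1 * 1 * 1 := by norm_num
      _ ≤ 2 * 3 ^ d * C * (√d + 1) := by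
          gcongr
          linarith [Real.sqrt_nonneg (d : ℝ)]
  set q : ℝ := 2 ^ (-a) with hq
  set r : ℝ := 2 ^ (-(a / 2)) with hr
  have hq0 : 0 < q := by positivity
  have hr0 : 0 < r := by positivity
  have hqr : q = r ^ 2 := by
    rw [hq, hr, ← Real.rpow_natCast, ← Real.rpow_mul (by norm_num)]; congr 1; push_cast; ring
  have hr1 : r ≤ 1 := Real.rpow_le_one_of_one_le_of_nonpos (by norm_num) (by linarith)
  have hq1 : q ≤ 1 := by rw [hqr]; exact pow_le_one₀ hr0.le hr1
  have hq2 : 1 ≤ 2 * q := by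
    have : (2 : ℝ) ^ (-1 : ℝ) ≤ q := Real.rpow_le_rpow_of_exponent_le (by norm_num) (by linarith)
    rw [Real.rpow_neg_one] at this
    linarith
  -- The layer `N + 1` contains the error of the shallower depth `lev N`, about half of `lev (N +
  -- 1)`. Thus the rate drops from `q = 2^(-a)` to `r = √q`; the factor 2 pays for the additive 2 in
  -- `lev_succ_le`.
  have hqlev : ∀ N, q ^ lev N ≤ 2 * r ^ lev (N + 1) := by
    intro N
    calc q ^ lev N = q ^ lev N * 1 := (mul_one _).symm
      _ ≤ q ^ lev N * (2 * q) := by gcongr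
      _ = 2 * r ^ (2 * lev N + 2) := by rw [hqr, ← pow_mul, pow_add]; ring
      _ ≤ 2 * r ^ lev (N + 1) := by
          gcongr 2 * ?_
          exact pow_le_pow_of_le_one hr0.le hr1 (lev_succ_le N)
  set D : ℝ := max (2 * A) (D₀ * (8 * C)) with hD
  have hDpos : 0 < D := lt_of_lt_of_le (by linarith) (le_max_left _ _)
  have hDle : ∀ {β : ℝ}, 0 ≤ β → ∀ {γ : ℝ}, β ≤ 8 * C * γ → 0 ≤ γ →
      ENNReal.ofReal (D₀ * β) ≤ ENNReal.ofReal (D * γ) := by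
    intro β hβ γ h hγ
    refine ENNReal.ofReal_le_ofReal ?_
    calc D₀ * β ≤ D₀ * (8 * C * γ) := by gcongr
      _ = D₀ * (8 * C) * γ := by ring
      _ ≤ D * γ := by gcongr; exact le_max_right _ _
  refine ⟨D, hDpos, fun K hK => ?_⟩
  have hsubn : ∀ Δ s, NiceFun fun x => K s x - mollify φ K Δ s x := fun Δ s =>
    (hK.nice s).sub (hK.niceFun_mollify hφ Δ s)
  have hlayn : ∀ N s, NiceFun (layer φ K N s) := by
    intro N s
    cases N with
    | zero => exact hK.niceFun_mollify hφ 0 s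
    | succ N => exact (hK.niceFun_mollify hφ _ s).sub (hK.niceFun_mollify hφ _ s)
  have hlayf : ∀ N s ξ, ‖𝓕 (layer φ K N s) ξ‖ ≤ 8 * C * r ^ lev N * dec a s ξ := by
    intro N s ξ
    have hdec := dec_nonneg a s ξ
    cases N with
    | zero =>
      simp only [layer, lev, pow_zero, mul_one]
      rw [hK.fourier_mollify hφ, norm_mul]
      calc _ ≤ 1 * dec a s ξ := by
            gcongr
            · exact hφ.norm_fourier_le_one _
            · exact (hK.fourier s ξ).trans (dec_two_mul_le ha s ξ)
        _ ≤ 8 * C * dec a s ξ := by gcongr; linarith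
    | succ N =>
      have e1 : layer φ K (N + 1) s = fun x => (K s x - mollify φ K (lev N) s x) -
          (K s x - mollify φ K (lev (N + 1)) s x) := by
        ext x; simp only [layer]; ring
      rw [e1, (hsubn _ s).fourier_sub (hsubn _ s)]
      calc _ ≤ 2 * C * q ^ lev N * dec a s ξ + 2 * C * q ^ lev (N + 1) * dec a s ξ :=
            (norm_sub_le _ _).trans (add_le_add (hK.norm_fourier_sub_mollify_le hφ ha ha2 _ s ξ)
              (hK.norm_fourier_sub_mollify_le hφ ha ha2 _ s ξ))
        _ ≤ 2 * C * q ^ lev N * dec a s ξ + 2 * C * q ^ lev N * dec a s ξ := by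
            gcongr 2 * C * q ^ lev N * dec a s ξ + 2 * C * ?_ * dec a s ξ
            exact pow_le_pow_of_le_one hq0.le hq1 (lev_le_succ N)
        _ = 4 * C * q ^ lev N * dec a s ξ := by ring
        _ ≤ 4 * C * (2 * r ^ lev (N + 1)) * dec a s ξ := by gcongr; exact hqlev N
        _ = _ := by ring
  have hDA : ENNReal.ofReal A + ENNReal.ofReal A ≤ ENNReal.ofReal D := by
    rw [← ENNReal.ofReal_add (by linarith) (by linarith), ← two_mul]
    exact ENNReal.ofReal_le_ofReal (le_max_left _ _)
  have hA1' : 1 ≤ ENNReal.ofReal A := by rwa [ENNReal.one_le_ofReal]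
  refine ⟨fun N => ?_, fun N f hf b n => ?_, fun f hf b n => ?_⟩
  · have hlip : ∀ s x y, ‖layer φ K N s x - layer φ K N s y‖ₑ ≤
        ENNReal.ofReal D * (cellVol d s)⁻¹ *
          ENNReal.ofReal (2 ^ ((lev N : ℤ) - s) * supNorm (x - y)) := by
      intro s x y
      cases N with
      | zero =>
        refine (hK.enorm_mollify_sub_le hφ 0 s x y).trans ?_
        simp only [lev]
        gcongr
        exact le_trans (by linarith) (le_max_left _ _)
      | succ N =>
        have h1 := hK.enorm_mollify_sub_le hφ (lev (N + 1)) s x y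
        have h2 := hK.enorm_mollify_sub_le hφ (lev N) s x y
        calc _ = ‖(mollify φ K (lev (N + 1)) s x - mollify φ K (lev (N + 1)) s y) -
              (mollify φ K (lev N) s x - mollify φ K (lev N) s y)‖ₑ := by
              simp only [layer]; congr 1; ring
          _ ≤ _ := enorm_sub_le
          _ ≤ _ := add_le_add h1 h2
          _ ≤ ENNReal.ofReal A * (cellVol d s)⁻¹ *
                ENNReal.ofReal (2 ^ ((lev (N + 1) : ℤ) - s) * supNorm (x - y)) +
              ENNReal.ofReal A * (cellVol d s)⁻¹ *
                ENNReal.ofReal (2 ^ ((lev (N + 1) : ℤ) - s) * supNorm (x - y)) := by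
              gcongr
              · exact supNorm_nonneg _
              · norm_num
              · exact_mod_cast lev_le_succ N
          _ = (ENNReal.ofReal A + ENNReal.ofReal A) * (cellVol d s)⁻¹ *
                ENNReal.ofReal (2 ^ ((lev (N + 1) : ℤ) - s) * supNorm (x - y)) := by ring
          _ ≤ _ := by gcongr
    refine ⟨fun s => ?_, fun s x hx => ?_, fun s x => ?_, hlip, fun f hf b n => ?_⟩
    · refine (LipschitzWith.of_dist_le_mul (K := (D * 2 ^ (-(s * (d : ℤ))) *
        2 ^ ((lev N : ℤ) - s)).toNNReal) fun x y => ?_).continuous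
      rw [dist_eq_norm, dist_eq_norm, Real.coe_toNNReal _ (by positivity)]
      have h1 := hlip s x y
      rw [← ofReal_zpow_neg_mul, ← ENNReal.ofReal_mul hDpos.le, ← ENNReal.ofReal_mul (by positivity),
        ← ofReal_norm, ENNReal.ofReal_le_ofReal_iff (mul_nonneg (by positivity)
          (mul_nonneg (by positivity) (supNorm_nonneg _)))] at h1
      refine h1.trans ?_
      rw [mul_assoc _ ((2 : ℝ) ^ ((lev N : ℤ) - s))]
      gcongr
      exact supNorm_le_norm _
    · cases N with
      | zero => exact hK.mollify_supp hφ 0 s hx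
      | succ N =>
        by_cases h : mollify φ K (lev (N + 1)) s x = 0
        · refine hK.mollify_supp hφ (lev N) s fun h' => hx ?_
          simp only [layer]
          rw [h, h', sub_zero]
        · exact hK.mollify_supp hφ _ s h
    · cases N with
      | zero =>
        calc _ ≤ 1 * (cellVol d s)⁻¹ := by
              rw [one_mul]; exact hK.enorm_mollify_le hφ 0 s x
          _ ≤ _ := by
              gcongr
              exact hA1'.trans (le_self_add.trans hDA)
      | succ N =>
        calc _ ≤ ‖mollify φ K (lev (N + 1)) s x‖ₑ + ‖mollify φ K (lev N) s x‖ₑ := enorm_sub_le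
          _ ≤ (cellVol d s)⁻¹ + (cellVol d s)⁻¹ :=
              add_le_add (hK.enorm_mollify_le hφ _ s x) (hK.enorm_mollify_le hφ _ s x)
          _ = (1 + 1) * (cellVol d s)⁻¹ := by ring
          _ ≤ _ := by
              gcongr
              exact le_trans (by gcongr) hDA
    · refine (hL2 (layer φ K N) _ (hlayn N) (by positivity) (hlayf N) f hf b n).trans ?_
      gcongr ?_ ^ 2 * _
      exact hDle (by positivity) le_rfl (by positivity)
  · refine (hL2 _ _ (hsubn (lev N)) (by positivity)
      (hK.norm_fourier_sub_mollify_le hφ ha ha2 (lev N)) f hf b n).trans ?_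
    gcongr ?_ ^ 2 * _
    refine hDle (by positivity) ?_ (by positivity)
    have h1 : q ^ lev N ≤ r ^ lev N := by
      gcongr
      rw [hqr]
      nlinarith
    have h2 : 0 < r ^ lev N := by positivity
    calc 2 * C * q ^ lev N ≤ 2 * C * r ^ lev N := by gcongr
      _ ≤ 8 * C * r ^ lev N := by gcongr; norm_num
  · refine (hL2 K 1 hK.nice zero_le_one
      (fun s ξ => ((hK.fourier s ξ).trans (dec_two_mul_le ha s ξ)).trans (one_mul _).ge)
      f hf b n).trans ?_
    gcongr ?_ ^ 2 * _
    have := hDle (β := 1) zero_le_one (γ := 1) (by linarith) zero_le_one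
    rwa [mul_one D] at this

/-! ### The sparse bound for the maximal truncations -/

theorem truncSup_kernel_add_le {K G H : ℤ → Rd d → ℂ} (hG : ∀ s, NiceFun (G s))
    (hH : ∀ s, NiceFun (H s)) (hK : ∀ s x, K s x = G s x + H s x) {f : Rd d → ℂ} (hf : NiceFun f)
    (x : Rd d) (a b : ℤ) : truncSup K f x a b ≤ truncSup G f x a b + truncSup H f x a b := by
  refine truncSup_le fun t₁ t₂ h1 h2 h3 => ?_
  have : trunc K f x t₁ t₂ = trunc G f x t₁ t₂ + trunc H f x t₁ t₂ := by
    rw [trunc, trunc, trunc, ← Finset.sum_add_distrib]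
    refine Finset.sum_congr rfl fun s _ => ?_
    rw [conv_eq, conv_eq, conv_eq, ← integral_add (hf.integrable_mul_sub (hG s).integrable x)
      (hf.integrable_mul_sub (hH s).integrable x)]
    simp only [hK, add_mul]
  rw [this]
  exact (enorm_add_le _ _).trans (add_le_add (le_truncSup h1 h2 h3) (le_truncSup h1 h2 h3))

theorem NiceFun.lintegral_sq_ne_top {f : Rd d → ℂ} (hf : NiceFun f) :
    ∫⁻ x, ‖f x‖ₑ ^ 2 ≠ ∞ := by
  have h := hf.memLp_two.eLpNorm_ne_top
  rw [eLpNorm_eq_lintegral_rpow_enorm_toReal (by norm_num) (by norm_num)] at h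
  intro hcon
  simp [hcon] at h

theorem NiceFun.measurable_truncSup {K : ℤ → Rd d → ℂ} (hK : ∀ s, NiceFun (K s)) {f : Rd d → ℂ}
    (hf : NiceFun f) (b n : ℤ) : Measurable fun x => truncSup K f x b n :=
  SparseMaxTrunc.measurable_truncSup (fun s => (hK s).measurable_conv hf) (σ := fun _ => b)
    measurable_const n

/-- The sum over the layers. -/
theorem tsum_lev_le {x : ℝ≥0∞} (hx : x ≤ 1) :
    ∑' N, ((lev N : ℝ≥0∞) + 1) * x ^ lev N ≤ 7 * (1 - x)⁻¹ := by
  have h1 : (1 : ℝ≥0∞) ≤ (1 - x)⁻¹ := by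
    rw [ENNReal.one_le_inv]; exact tsub_le_self
  -- Cauchy condensation: for lacunary depths the weight `lev N` is absorbed by the gaps, so the sum
  -- is comparable to `Σ x^k = (1 - x)⁻¹` and not to its square.
  have h2 := ENNReal.tsum_condensed_le (f := fun k => x ^ k)
    fun m n _ hmn => pow_le_pow_right_of_le_one' hx hmn
  rw [ENNReal.tsum_geometric, pow_one] at h2
  rw [tsum_eq_zero_add' ENNReal.summable]
  have h3 : ∀ N, ((lev (N + 1) : ℝ≥0∞) + 1) * x ^ lev (N + 1) ≤
      2 * (2 ^ (N + 1) * x ^ 2 ^ (N + 1)) := by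
    intro N
    simp only [lev]
    rw [← mul_assoc]
    gcongr
    push_cast
    rw [two_mul]
    gcongr
    exact one_le_pow₀ (by norm_num)
  have h4 : ∑' N : ℕ, (2 : ℝ≥0∞) ^ (N + 1) * x ^ 2 ^ (N + 1) ≤ ∑' N : ℕ, 2 ^ N * x ^ 2 ^ N :=
    ENNReal.tsum_comp_le_tsum_of_injective (add_left_injective 1) fun N : ℕ => 2 ^ N * x ^ 2 ^ N
  calc _ ≤ 1 + ∑' N : ℕ, 2 * (2 ^ (N + 1) * x ^ 2 ^ (N + 1)) :=
        add_le_add (by simp [lev]) (ENNReal.tsum_le_tsum h3)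
    _ ≤ 1 + 2 * ∑' N : ℕ, 2 ^ N * x ^ 2 ^ N := by
        rw [ENNReal.tsum_mul_left]
        exact add_le_add le_rfl (mul_le_mul_right h4 2)
    _ ≤ (1 - x)⁻¹ + 2 * ((1 - x)⁻¹ + 2 * (1 - x)⁻¹) := by
        gcongr
        exact h2.trans (by gcongr; exact hx.trans h1)
    _ = _ := by ring

/-- Bernoulli's inequality `(1/2)^u ≤ 1 - u/2`. With `u` proportional to `ε` this produces the
factor `1/ε`. -/
theorem inv_one_sub_rpow_le {u : ℝ} (hu : 0 < u) (hu1 : u ≤ 1) :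
    (1 - ENNReal.ofReal (2 ^ (-u)))⁻¹ ≤ ENNReal.ofReal (2 / u) := by
  have h1 : (2 : ℝ) ^ (-u) ≤ 1 - u / 2 := by
    have := rpow_one_add_le_one_add_mul_self (s := -(1 / 2)) (by norm_num) hu.le hu1
    rw [Real.rpow_neg (by norm_num), ← Real.inv_rpow (by norm_num)]
    norm_num at this ⊢
    linarith
  rw [← inv_inv (ENNReal.ofReal (2 / u)), ENNReal.inv_le_inv, ← ENNReal.ofReal_inv_of_pos
    (by positivity), ← ENNReal.ofReal_one, ← ENNReal.ofReal_sub _ (by positivity), inv_div]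
  exact ENNReal.ofReal_le_ofReal (by linarith)

/-- The bilinear bound for finitely many scales, uniformly over the families. -/
theorem exists_lintegral_truncSup_le_sparseSup (d : ℕ) {a : ℝ} (ha : 0 < a) (ha2 : a ≤ 1 / 2) :
    ∃ D : ℝ, 0 < D ∧ ∀ K : ℤ → Rd d → ℂ, NiceFamily a K → ∀ f₁ f₂, NiceFun f₁ → NiceFun f₂ →
      (∀ b n, ∫⁻ x, truncSup K f₁ x b n ^ 2 ≤ ENNReal.ofReal D ^ 2 * ∫⁻ x, ‖f₁ x‖ₑ ^ 2) ∧
      ∀ ε : ℝ, 0 < ε → ε < 1 → ∀ (b : ℤ) (n : ℕ),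
        ∫⁻ x, truncSup K f₁ x b (b + n) * ‖f₂ x‖ₑ ≤
          ENNReal.ofReal (D / ε) * sparseSup (1 + ε) f₁ f₂ := by
  obtain ⟨φ, C, hφ⟩ := exists_mollifier d
  obtain ⟨E, hE, hlay⟩ := smoothFamily_layer d ha ha2 hφ
  set c : ℝ := 2 * (8 * 3 ^ d * (4 * 108 ^ d) ^ 2) * (3 ^ d * 32) with hc
  have hc0 : 0 < c := by rw [hc]; positivity
  set D : ℝ := max E (c * (4 * E) * (7 * (8 / a))) with hD
  have hD0 : 0 < D := lt_of_lt_of_le hE (le_max_left _ _)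
  refine ⟨D, hD0, fun K hK f₁ f₂ hf₁ hf₂ => ?_⟩
  obtain ⟨hS, hT, hL⟩ := hlay K hK
  refine ⟨fun b n => (hL f₁ hf₁ b n).trans ?_, fun ε hε hε1 b n => ?_⟩
  · gcongr
    exact le_max_left _ _
  set r : ℝ := 2 ^ (-(a / 2)) with hr
  have hr0 : 0 < r := by positivity
  have hr1 : r < 1 := Real.rpow_lt_one_of_one_lt_of_neg (by norm_num) (by linarith)
  set T : ℕ → ℤ → Rd d → ℂ := fun N s x => K s x - mollify φ K (lev N) s x with hTdef
  have hTn : ∀ N s, NiceFun (T N s) := fun N s => (hK.nice s).sub (hK.niceFun_mollify hφ _ s)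
  have hlayn : ∀ N s, NiceFun (layer φ K N s) := by
    intro N s
    cases N with
    | zero => exact hK.niceFun_mollify hφ 0 s
    | succ N => exact (hK.niceFun_mollify hφ _ s).sub (hK.niceFun_mollify hφ _ s)
  -- The first `N + 1` layers telescope to the mollification at depth `lev N`, leaving the remainder
  -- `T N`.
  have hpt : ∀ N x, truncSup K f₁ x b (b + n) ≤
      ∑ M ∈ Finset.range (N + 1), truncSup (layer φ K M) f₁ x b (b + n) +
        truncSup (T N) f₁ x b (b + n) := by
    intro N x
    induction N with
    | zero =>
      rw [Finset.sum_range_one]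
      exact truncSup_kernel_add_le (hlayn 0) (hTn 0) (fun s y => by simp [hTdef, layer, lev]) hf₁ x
        b (b + n)
    | succ N ih =>
      rw [Finset.sum_range_succ, add_assoc]
      refine ih.trans (add_le_add le_rfl ?_)
      exact truncSup_kernel_add_le (hlayn (N + 1)) (hTn (N + 1))
        (fun s y => by simp [hTdef, layer]) hf₁ x b (b + n)
  set c₁ := (∫⁻ x, ‖f₁ x‖ₑ ^ 2) ^ (1 / 2 : ℝ) with hc₁
  set c₂ := (∫⁻ x, ‖f₂ x‖ₑ ^ 2) ^ (1 / 2 : ℝ) with hc₂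
  have hsq : ∀ X : ℝ≥0∞, (X ^ (1 / 2 : ℝ)) ^ 2 = X := fun X => by
    rw [← ENNReal.rpow_natCast, ← ENNReal.rpow_mul]; norm_num
  have hc₁t : c₁ ≠ ∞ := by simp [hc₁, hf₁.lintegral_sq_ne_top]
  have hc₂t : c₂ ≠ ∞ := by simp [hc₂, hf₂.lintegral_sq_ne_top]
  have htail : ∀ N, ∫⁻ x, truncSup (T N) f₁ x b (b + n) * ‖f₂ x‖ₑ ≤
      ENNReal.ofReal (E * r ^ lev N) * c₁ * c₂ := by
    intro N
    refine le_of_sq_le_sq ((sq_lintegral_mul_le (NiceFun.measurable_truncSup (hTn N) hf₁ b (b + n))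
      hf₂.meas.enorm).trans ?_)
    rw [mul_pow, mul_pow, hsq, hsq]
    exact mul_le_mul_left (hT N f₁ hf₁ b (b + n)) _
  set I : ℕ → ℝ≥0∞ := fun N => ∫⁻ x, truncSup (layer φ K N) f₁ x b (b + n) * ‖f₂ x‖ₑ with hI
  -- The remainders tend to zero by Cauchy-Schwarz and the decay `r ^ lev N`, the `L²` norms of `f₁`
  -- and `f₂` being finite.
  have hmain : ∫⁻ x, truncSup K f₁ x b (b + n) * ‖f₂ x‖ₑ ≤ ∑' N, I N := by
    have hlim : Filter.Tendsto (fun N => ∑' N, I N + ENNReal.ofReal (E * r ^ lev N) * c₁ * c₂)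
        Filter.atTop (nhds (∑' N, I N + 0)) := by
      refine Filter.Tendsto.add tendsto_const_nhds ?_
      have h1 : Filter.Tendsto lev Filter.atTop Filter.atTop := by
        refine Filter.tendsto_atTop_mono (f := fun N => N) (fun N => ?_) Filter.tendsto_id
        cases N with
        | zero => simp
        | succ N => exact Nat.lt_two_pow_self.le
      have h2 : Filter.Tendsto (fun N => ENNReal.ofReal (E * r ^ lev N)) Filter.atTop
          (nhds (ENNReal.ofReal (E * 0))) :=
        (ENNReal.continuous_ofReal.tendsto _).comp
          (((tendsto_pow_atTop_nhds_zero_of_lt_one hr0.le hr1).comp h1).const_mul E)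
      rw [mul_zero, ENNReal.ofReal_zero] at h2
      have h3 := ENNReal.Tendsto.mul_const h2 (b := c₁ * c₂) (Or.inr (ENNReal.mul_ne_top hc₁t hc₂t))
      simpa only [zero_mul, mul_assoc] using h3
    rw [add_zero] at hlim
    refine ge_of_tendsto' hlim fun N => ?_
    calc _ ≤ ∫⁻ x, (∑ M ∈ Finset.range (N + 1),
          truncSup (layer φ K M) f₁ x b (b + n) * ‖f₂ x‖ₑ +
            truncSup (T N) f₁ x b (b + n) * ‖f₂ x‖ₑ) := by
          refine lintegral_mono fun x => ?_
          rw [← Finset.sum_mul, ← add_mul]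
          gcongr
          exact hpt N x
      _ = ∑ M ∈ Finset.range (N + 1), I M +
            ∫⁻ x, truncSup (T N) f₁ x b (b + n) * ‖f₂ x‖ₑ := by
          have hm : Measurable fun x => truncSup (T N) f₁ x b (b + n) * ‖f₂ x‖ₑ :=
            (NiceFun.measurable_truncSup (hTn N) hf₁ b (b + n)).mul hf₂.meas.enorm
          rw [lintegral_add_right _ hm, lintegral_finsetSum]
          exact fun M _ => (NiceFun.measurable_truncSup (hlayn M) hf₁ b (b + n)).mul hf₂.meas.enorm
      _ ≤ _ := add_le_add (ENNReal.sum_le_tsum _) (htail N)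
  -- the individual layers
  set y : ℝ≥0∞ := ENNReal.ofReal (2 ^ (-(a / 4))) with hy
  have hy0 : y ≠ 0 := by simp only [hy, ne_eq, ENNReal.ofReal_eq_zero, not_le]; positivity
  have hyt : y ≠ ∞ := ENNReal.ofReal_ne_top
  have hy1 : y ≤ 1 := by
    rw [hy, ENNReal.ofReal_le_one]
    exact Real.rpow_le_one_of_one_le_of_nonpos (by norm_num) (by linarith)
  -- Here `y² = r`: one half of the `L²` decay pays for the height `t = y^(-L)`, the other half
  -- remains. The ratio of the final series is `x = 2^(-aε/4)`.
  set x : ℝ≥0∞ := y ^ ε with hx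
  have hx1 : x ≤ 1 := ENNReal.rpow_le_one hy1 hε.le
  have hyx : y ≤ x := by
    calc y = y ^ (1 : ℝ) := (ENNReal.rpow_one y).symm
      _ ≤ y ^ ε := ENNReal.rpow_le_rpow_of_exponent_ge hy1 hε1.le
  have hry : ENNReal.ofReal r = y ^ 2 := by
    rw [hy, ← ENNReal.ofReal_pow (by positivity), hr, ← Real.rpow_natCast,
      ← Real.rpow_mul (by norm_num)]
    congr 2
    push_cast
    ring
  set S := sparseSup (1 + ε) f₁ f₂ with hSdef
  have hIle : ∀ N, I N ≤ ENNReal.ofReal c * ENNReal.ofReal (4 * E) * S *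
      (((lev N : ℝ≥0∞) + 1) * x ^ lev N) := by
    intro N
    set L := lev N with hLdef
    have hyL : y ^ L ≠ 0 := pow_ne_zero _ hy0
    have hyLt : y ^ L ≠ ∞ := ENNReal.pow_ne_top hyt
    -- With `t = y^(-L)` and `p = 1 + ε` one has `t^(1-p) = x^L`. Since `B = E y^(2L)`, also `B t =
    -- E y^L ≤ E x^L`, so both terms decay at least like `x^L`.
    have key := (hS N).lintegral_truncSup_le_sparseSup b n hf₁ hf₂ (p := 1 + ε) (by linarith)
      (by linarith) (t := (y ^ L)⁻¹) (by rw [ENNReal.one_le_inv]; exact pow_le_one' hy1 L)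
      (ENNReal.inv_ne_top.2 hyL)
    have hB : ENNReal.ofReal (E * r ^ L) = ENNReal.ofReal E * (y ^ L * y ^ L) := by
      rw [ENNReal.ofReal_mul hE.le, ENNReal.ofReal_pow hr0.le, hry]
      ring
    have ht : ((y ^ L)⁻¹) ^ (1 - (1 + ε)) = x ^ L := by
      rw [show 1 - (1 + ε) = -ε by ring, ENNReal.inv_rpow, ENNReal.rpow_neg, inv_inv, hx,
        ← ENNReal.rpow_natCast, ← ENNReal.rpow_natCast, ← ENNReal.rpow_mul, ← ENNReal.rpow_mul,
        mul_comm]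
    rw [ht, hB, ← hLdef] at key
    have hcof : ENNReal.ofReal c = 2 * (8 * 3 ^ d * (4 * 108 ^ d) ^ 2) * (3 ^ d * 32) := by
      have : c = ((2 * (8 * 3 ^ d * (4 * 108 ^ d) ^ 2) * (3 ^ d * 32) : ℕ) : ℝ) := by
        rw [hc]; push_cast; ring
      rw [this, ENNReal.ofReal_natCast]
      push_cast
      ring
    have hE4 : ENNReal.ofReal (4 * E) = 4 * ENNReal.ofReal E := by
      rw [ENNReal.ofReal_mul (by norm_num)]; norm_num
    have hyx' : y ^ L ≤ x ^ L := by gcongr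
    have hyL1 : y ^ L ≤ 1 := pow_le_one' hy1 L
    have hxL1 : x ^ L ≤ 1 := pow_le_one' hx1 L
    refine key.trans ?_
    rw [hcof, hE4]
    calc _ = 2 * (8 * 3 ^ d * (4 * 108 ^ d) ^ 2) * (3 ^ d * 32) * S *
          (ENNReal.ofReal E * ((2 * L + 2) + y ^ L * y ^ L) * x ^ L +
            ENNReal.ofReal E * (y ^ L * (y ^ L * (y ^ L)⁻¹))) := by ring
      _ ≤ 2 * (8 * 3 ^ d * (4 * 108 ^ d) ^ 2) * (3 ^ d * 32) * S *
          (ENNReal.ofReal E * ((2 * L + 2) + 1 * 1) * x ^ L +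
            ENNReal.ofReal E * (x ^ L * 1)) := by
          rw [ENNReal.mul_inv_cancel hyL hyLt]
          gcongr
      _ = 2 * (8 * 3 ^ d * (4 * 108 ^ d) ^ 2) * (3 ^ d * 32) * S *
          (ENNReal.ofReal E * (2 * L + 4) * x ^ L) := by ring
      _ ≤ 2 * (8 * 3 ^ d * (4 * 108 ^ d) ^ 2) * (3 ^ d * 32) * S *
          (ENNReal.ofReal E * (4 * L + 4) * x ^ L) := by
          gcongr
          norm_num
      _ = _ := by ring
  have hxr : x = ENNReal.ofReal (2 ^ (-(a / 4 * ε))) := by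
    rw [hx, hy, ENNReal.ofReal_rpow_of_pos (by positivity), ← Real.rpow_mul (by norm_num), neg_mul]
  calc _ ≤ ∑' N, I N := hmain
    _ ≤ ∑' N, ENNReal.ofReal c * ENNReal.ofReal (4 * E) * S *
          (((lev N : ℝ≥0∞) + 1) * x ^ lev N) := ENNReal.tsum_le_tsum hIle
    _ ≤ ENNReal.ofReal c * ENNReal.ofReal (4 * E) * S * (7 * (1 - x)⁻¹) := by
        rw [ENNReal.tsum_mul_left]
        gcongr
        exact tsum_lev_le hx1
    _ ≤ ENNReal.ofReal c * ENNReal.ofReal (4 * E) * S *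
          (ENNReal.ofReal 7 * ENNReal.ofReal (2 / (a / 4 * ε))) := by
        gcongr
        · norm_num
        · rw [hxr]
          exact inv_one_sub_rpow_le (by positivity) (by nlinarith)
    _ = ENNReal.ofReal (c * (4 * E) * (7 * (8 / a)) / ε) * S := by
        rw [mul_right_comm, ← ENNReal.ofReal_mul hc0.le, ← ENNReal.ofReal_mul (by norm_num),
          ← ENNReal.ofReal_mul (by positivity)]
        congr 2
        field_simp
        ring
    _ ≤ _ := by
        gcongr
        exact le_max_right _ _

/-! ### From bilinear bounds to sparse bounds -/

theorem avg_congr_ae {f g : Rd d → ℂ} (h : f =ᵐ[volume] g) (p : ℝ) (Q : Cube d) :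
    avg p f Q = avg p g Q := by
  rw [avg, avg, eLpNorm_congr_ae (g := Q.toSet.indicator g)]
  filter_upwards [h] with x hx
  by_cases hxQ : x ∈ Q.toSet
  · rw [Set.indicator_of_mem hxQ, Set.indicator_of_mem hxQ, hx]
  · rw [Set.indicator_of_notMem hxQ, Set.indicator_of_notMem hxQ]

/-- A measurable version is cut off to the closed support of `f` and to the set where it does not
exceed the essential supremum. -/
theorem LinftyZero.exists_niceFun {f : Rd d → ℂ} (hf : LinftyZero f) :
    ∃ g, NiceFun g ∧ f =ᵐ[volume] g := by
  obtain ⟨hm, hs⟩ := hf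
  set M : ℝ≥0∞ := eLpNorm f ∞ volume with hM
  have hMt : M ≠ ∞ := hm.2.ne
  set u := hm.1.mk f with hu
  have hum : Measurable u := hm.1.stronglyMeasurable_mk.measurable
  set s : Set (Rd d) := tsupport f ∩ {x | ‖u x‖ₑ ≤ M} with hsdef
  have hsm : MeasurableSet s :=
    (isClosed_tsupport f).measurableSet.inter (measurableSet_le hum.enorm measurable_const)
  obtain ⟨R, hR⟩ := hs.isCompact.isBounded.subset_closedBall 0
  refine ⟨s.indicator u, ⟨hum.indicator hsm, ⟨M.toReal, fun x => ?_⟩, ⟨R, fun x hx => ?_⟩⟩, ?_⟩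
  · by_cases hx : x ∈ s
    · rw [Set.indicator_of_mem hx, ← toReal_enorm]
      exact ENNReal.toReal_mono hMt hx.2
    · rw [Set.indicator_of_notMem hx, norm_zero]
      exact ENNReal.toReal_nonneg
  · refine Set.indicator_of_notMem (fun h => ?_) _
    have := hR h.1
    rw [mem_closedBall_zero_iff] at this
    linarith
  · have h2 : ∀ᵐ x, ‖f x‖ₑ ≤ M := by
      rw [hM, eLpNorm_exponent_top]
      exact ae_le_eLpNormEssSup
    filter_upwards [hm.1.ae_eq_mk, h2] with x hx hx2
    by_cases hxs : x ∈ tsupport f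
    · rw [Set.indicator_of_mem]
      · exact hx
      · refine ⟨hxs, ?_⟩
        rw [Set.mem_ofPred_eq, hu, ← hx]
        exact hx2
    · rw [Set.indicator_of_notMem fun h => hxs h.1]
      exact image_eq_zero_of_notMem_tsupport hxs

/-- The sparse bound asks for one collection, whereas `sparseSup` is a supremum that need not be
attained; doubling the constant leaves room for a near maximizer. -/
theorem hasSparseBound_of_le {T : (Rd d → ℂ) → Rd d → ℝ≥0∞} {p : ℝ} {c : ℝ≥0} (hc : c ≠ 0)
    (hT : ∀ f g, f =ᵐ[volume] g → T f = T g) (hm : ∀ f, NiceFun f → AEMeasurable (T f) volume)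
    (hloc : ∀ f, NiceFun f → ∀ B : Set (Rd d), IsCompact B → ∫⁻ x in B, T f x < ∞)
    (hle : ∀ f₁ f₂, NiceFun f₁ → NiceFun f₂ →
      ∫⁻ x, T f₁ x * ‖f₂ x‖ₑ ≤ c * sparseSup p f₁ f₂) : HasSparseBound T p p (2 * c) := by
  refine ⟨fun f hf => ?_, fun f₁ f₂ hf₁ hf₂ => ?_⟩
  · obtain ⟨g, hg, hfg⟩ := hf.exists_niceFun
    rw [hT f g hfg]
    exact ⟨hm g hg, hloc g hg⟩
  obtain ⟨g₁, hg₁, hfg₁⟩ := hf₁.exists_niceFun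
  obtain ⟨g₂, hg₂, hfg₂⟩ := hf₂.exists_niceFun
  have e1 : ∫⁻ x, T f₁ x * ‖f₂ x‖ₑ = ∫⁻ x, T g₁ x * ‖g₂ x‖ₑ := by
    rw [hT f₁ g₁ hfg₁]
    refine lintegral_congr_ae ?_
    filter_upwards [hfg₂] with x hx
    rw [hx]
  simp only [e1, fun Q => avg_congr_ae hfg₁ p Q, fun Q => avg_congr_ae hfg₂ p Q]
  set I := ∫⁻ x, T g₁ x * ‖g₂ x‖ₑ with hI
  have hfin : I ≠ ∞ := by
    obtain ⟨M, hM⟩ := hg₂.bdd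
    obtain ⟨R, hR⟩ := hg₂.supp
    refine ne_top_of_le_ne_top (b := (∫⁻ x in Metric.closedBall 0 R, T g₁ x) *
      ENNReal.ofReal M) ?_ ?_
    · exact ENNReal.mul_ne_top (hloc g₁ hg₁ _ (isCompact_closedBall 0 R)).ne ENNReal.ofReal_ne_top
    · rw [← lintegral_mul_const' _ _ ENNReal.ofReal_ne_top,
        ← lintegral_indicator Metric.isClosed_closedBall.measurableSet]
      refine lintegral_mono fun x => ?_
      by_cases hx : x ∈ Metric.closedBall (0 : Rd d) R
      · rw [Set.indicator_of_mem hx]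
        gcongr
        rw [← ofReal_norm]
        exact ENNReal.ofReal_le_ofReal (hM x)
      · rw [hR x (by simpa using hx)]
        simp
  by_cases h0 : I = 0
  · refine ⟨∅, ⟨Set.countable_empty, fun _ => ∅, by simp, by simp⟩, ?_⟩
    rw [h0]
    exact zero_le
  have h2c : ((2 * c : ℝ≥0) : ℝ≥0∞) ≠ 0 := by simpa using hc
  -- The strict inequality needs `0 < I < ∞`. Finiteness comes from local integrability; for `I = 0`
  -- the empty collection works.
  have hlt : I / (2 * c : ℝ≥0) < sparseSup p g₁ g₂ := by
    have h1 : I / (2 * c : ℝ≥0) < I / c := by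
      refine ENNReal.div_lt_div_left h0 hfin ?_
      rw [ENNReal.coe_lt_coe]
      exact lt_mul_of_one_lt_left (pos_iff_ne_zero.2 hc) (by norm_num)
    refine h1.trans_le (ENNReal.div_le_of_le_mul ?_)
    rw [mul_comm]
    exact hle g₁ g₂ hg₁ hg₂
  simp only [sparseSup, lt_iSup_iff] at hlt
  obtain ⟨S, hS, hlt⟩ := hlt
  refine ⟨S, hS, ?_⟩
  rw [mul_comm]
  exact (ENNReal.div_le_iff h2c ENNReal.coe_ne_top).1 hlt.le

/-! ### Kernel families -/

theorem min_rpow_le_dec {α a : ℝ} (ha : 0 < a) (haα : a ≤ α) (s : ℤ) (ξ : Rd d) :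
    min (‖(2 : ℝ) ^ s • ξ‖ ^ α) (‖(2 : ℝ) ^ s • ξ‖ ^ (-α)) ≤ dec a s ξ := by
  rw [dec, ← Real.rpow_neg (norm_nonneg _)]
  set u := ‖(2 : ℝ) ^ s • ξ‖ with hu
  have hu0 : 0 ≤ u := norm_nonneg _
  rcases eq_or_lt_of_le hu0 with h0 | h0
  · rw [← h0, Real.zero_rpow (ha.trans_le haα).ne',
      Real.zero_rpow ha.ne']
    exact le_min (min_le_left _ _) ((min_le_left _ _).trans (Real.rpow_nonneg le_rfl _))
  rcases le_total u 1 with h | h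
  · have h1 : u ^ α ≤ u ^ a := Real.rpow_le_rpow_of_exponent_ge h0 h haα
    have h2 : u ^ α ≤ u ^ (-a) := Real.rpow_le_rpow_of_exponent_ge h0 h (by linarith)
    exact (min_le_left _ _).trans (le_min h1 h2)
  · have h1 : u ^ (-α) ≤ u ^ a := Real.rpow_le_rpow_of_exponent_le h (by linarith)
    have h2 : u ^ (-α) ≤ u ^ (-a) := Real.rpow_le_rpow_of_exponent_le h (by linarith)
    exact (min_le_right _ _).trans (le_min h1 h2)

/-- Modifying the kernels on null sets turns the almost everywhere bounds into pointwise ones and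
changes neither Fourier transforms nor convolutions. -/
theorem IsKernelFamily.exists_niceFamily {α a : ℝ} {K : ℤ → Rd d → ℂ} (hK : IsKernelFamily α K)
    (ha : 0 < a) (haα : 2 * a ≤ α) :
    ∃ K' : ℤ → Rd d → ℂ, NiceFamily a K' ∧ ∀ s, K s =ᵐ[volume] K' s := by
  set u : ℤ → Rd d → ℂ := fun s => (hK.meas s).mk (K s) with hu
  have hum : ∀ s, Measurable (u s) := fun s => (hK.meas s).stronglyMeasurable_mk.measurable
  set A : ℤ → Set (Rd d) := fun s =>
    {x | supNorm x < 2 ^ (s - 2)} ∩ {x | ‖u s x‖ ≤ 2 ^ (-(s * (d : ℤ)))} with hA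
  have hAm : ∀ s, MeasurableSet (A s) := fun s =>
    (measurableSet_lt measurable_supNorm measurable_const).inter
      (measurableSet_le (hum s).norm measurable_const)
  have hae : ∀ s, K s =ᵐ[volume] (A s).indicator (u s) := by
    intro s
    filter_upwards [(hK.meas s).ae_eq_mk, hK.bound s] with x hx hx2
    by_cases hxs : supNorm x < 2 ^ (s - 2)
    · rw [Set.indicator_of_mem]
      · exact hx
      · refine ⟨hxs, ?_⟩
        rw [Set.mem_ofPred_eq]
        simp only [hu]
        rw [← hx]
        exact hx2
    · rw [Set.indicator_of_notMem fun h => hxs h.1]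
      by_contra h
      exact hxs (hK.supp s x h).2
  have hsupp : ∀ s x, (A s).indicator (u s) x ≠ 0 → supNorm x < 2 ^ (s - 2) := by
    intro s x hx
    by_contra h
    exact hx (Set.indicator_of_notMem (fun h' => h h'.1) _)
  have hbd : ∀ s x, ‖(A s).indicator (u s) x‖ ≤ 2 ^ (-(s * (d : ℤ))) := by
    intro s x
    by_cases hx : x ∈ A s
    · rw [Set.indicator_of_mem hx]
      exact hx.2
    · rw [Set.indicator_of_notMem hx, norm_zero]
      positivity
  refine ⟨fun s => (A s).indicator (u s), ⟨fun s => ⟨(hum s).indicator (hAm s), ⟨_, hbd s⟩,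
    ⟨√d * 2 ^ (s - 2), fun x hx => ?_⟩⟩, hsupp, hbd, fun s ξ => ?_⟩, hae⟩
  · by_contra h
    have h1 := norm_le_supNorm x
    have h2 : √d * supNorm x ≤ √d * 2 ^ (s - 2) := by
      gcongr
      exact (hsupp s x h).le
    linarith
  · rw [← Real.fourier_congr_ae (hae s)]
    exact (hK.fourier s ξ).trans (min_rpow_le_dec (by linarith) haα s ξ)

/-- The equality holds at every point, because each convolution is an integral in which null sets do
not count. -/
theorem maxTrunc_congr_ae {K K' : ℤ → Rd d → ℂ} {f g : Rd d → ℂ}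
    (hK : ∀ s, K s =ᵐ[volume] K' s) (hf : f =ᵐ[volume] g) : maxTrunc K f = maxTrunc K' g := by
  have : ∀ s x, (K s ⋆[ContinuousLinearMap.mul ℂ ℂ, volume] f) x =
      (K' s ⋆[ContinuousLinearMap.mul ℂ ℂ, volume] g) x := by
    intro s x
    rw [conv_eq, conv_eq]
    refine integral_congr_ae ?_
    filter_upwards [hf, (quasiMeasurePreserving_sub_left volume x).ae_eq_comp (hK s)] with y h1 h2
    simp only [Function.comp_apply] at h2
    rw [h1, h2]
  ext x
  simp only [maxTrunc, trunc, this]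

/-- An increasing exhaustion by finite ranges of levels, suited to monotone convergence. -/
theorem maxTrunc_eq_iSup (K : ℤ → Rd d → ℂ) (f : Rd d → ℂ) (x : Rd d) :
    maxTrunc K f x = ⨆ m : ℕ, truncSup K f x (-(m : ℤ)) (-(m : ℤ) + (2 * m : ℕ)) := by
  refine le_antisymm ?_ (iSup_le fun m => truncSup_le fun t₁ t₂ h _ _ => ?_)
  · refine iSup_le fun t₁ => iSup_le fun t₂ => iSup_le fun h => ?_
    refine le_iSup_of_le (max t₁.natAbs t₂.natAbs) (le_truncSup h ?_ ?_) <;> omega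
  · exact le_iSup_of_le t₁ (le_iSup₂_of_le t₂ h le_rfl)

theorem monotone_truncSup (K : ℤ → Rd d → ℂ) (f : Rd d → ℂ) (x : Rd d) :
    Monotone fun m : ℕ => truncSup K f x (-(m : ℤ)) (-(m : ℤ) + (2 * m : ℕ)) := by
  intro m n hmn
  refine truncSup_mono K f x ?_ ?_ <;> push_cast <;> omega

namespace NiceFamily

variable {a : ℝ} {K : ℤ → Rd d → ℂ}

theorem measurable_maxTrunc (hK : NiceFamily a K) {f : Rd d → ℂ} (hf : NiceFun f) :
    Measurable (maxTrunc K f) := by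
  simp only [funext (maxTrunc_eq_iSup K f)]
  exact Measurable.iSup fun m => NiceFun.measurable_truncSup hK.nice hf _ _

end NiceFamily

/-- The sparse bound for the maximal truncations of the regularized families. -/
theorem exists_maxTrunc_bound (d : ℕ) {a : ℝ} (ha : 0 < a) (ha2 : a ≤ 1 / 2) :
    ∃ D : ℝ, 0 < D ∧ ∀ K : ℤ → Rd d → ℂ, NiceFamily a K → ∀ f₁, NiceFun f₁ →
      (∀ B : Set (Rd d), IsCompact B → ∫⁻ x in B, maxTrunc K f₁ x < ∞) ∧
      ∀ f₂, NiceFun f₂ → ∀ ε : ℝ, 0 < ε → ε < 1 →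
        ∫⁻ x, maxTrunc K f₁ x * ‖f₂ x‖ₑ ≤
          ENNReal.ofReal (D / ε) * sparseSup (1 + ε) f₁ f₂ := by
  obtain ⟨D, hD, h⟩ := exists_lintegral_truncSup_le_sparseSup d ha ha2
  refine ⟨D, hD, fun K hK f₁ hf₁ => ⟨fun B hB => ?_, fun f₂ hf₂ ε hε hε1 => ?_⟩⟩
  · have h1 := (h K hK f₁ f₁ hf₁ hf₁).1
    simp only [maxTrunc_eq_iSup]
    rw [lintegral_iSup (fun m => NiceFun.measurable_truncSup hK.nice hf₁ _ _)
      fun m n hmn x => monotone_truncSup K f₁ x hmn]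
    have hfin : volume B + ENNReal.ofReal D ^ 2 * ∫⁻ x, ‖f₁ x‖ₑ ^ 2 < ∞ :=
      ENNReal.add_lt_top.2 ⟨hB.measure_lt_top, ENNReal.mul_lt_top (by simp)
        hf₁.lintegral_sq_ne_top.lt_top⟩
    refine lt_of_le_of_lt (iSup_le fun m => ?_) hfin
    -- From `X ≤ 1 + X²`, the uniform `L²` bound gives integrability on compact sets.
    calc _ ≤ ∫⁻ x in B, (1 + truncSup K f₁ x (-(m : ℤ)) (-(m : ℤ) + (2 * m : ℕ)) ^ 2) := by
          refine lintegral_mono fun x => ?_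
          set X := truncSup K f₁ x (-(m : ℤ)) (-(m : ℤ) + (2 * m : ℕ)) with hX
          rcases le_total X 1 with hX1 | hX1
          · exact hX1.trans le_self_add
          · refine le_trans ?_ le_add_self
            rw [sq]
            exact le_mul_of_one_le_left' hX1
      _ ≤ _ := by
          rw [lintegral_add_left measurable_const, setLIntegral_one]
          gcongr
          exact (setLIntegral_le_lintegral _ _).trans (h1 _ _)
  · have h2 := (h K hK f₁ f₂ hf₁ hf₂).2 ε hε hε1
    simp only [maxTrunc_eq_iSup, ENNReal.iSup_mul]
    have hm : ∀ m : ℕ, Measurable fun x =>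
        truncSup K f₁ x (-(m : ℤ)) (-(m : ℤ) + (2 * m : ℕ)) * ‖f₂ x‖ₑ := fun m =>
      (NiceFun.measurable_truncSup hK.nice hf₁ _ _).mul hf₂.meas.enorm
    rw [lintegral_iSup hm fun m n hmn x => mul_le_mul_left (monotone_truncSup K f₁ x hmn) _]
    exact iSup_le fun m => h2 _ _

theorem exists_sparseNorm_maxTrunc_le (d : ℕ) {α : ℝ} (hα : 0 < α) :
    ∃ C : ℝ, 0 < C ∧ ∀ ε : ℝ, 0 < ε → ε < 1 → ∀ K : ℤ → Rd d → ℂ, IsKernelFamily α K →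
      sparseNorm (maxTrunc K) (1 + ε) (1 + ε) ≤ ENNReal.ofReal (C / ε) := by
  -- The layers require decay of order `2a` with `2a ≤ 1`; any larger exponent `α` implies it.
  set a : ℝ := min α 1 / 2 with ha
  have ha0 : 0 < a := by have := lt_min hα one_pos; linarith
  have ha1 : 2 * a ≤ α := by have := min_le_left α 1; linarith
  have ha2 : a ≤ 1 / 2 := by have := min_le_right α 1; linarith
  obtain ⟨D, hD, h⟩ := exists_maxTrunc_bound d ha0 ha2
  refine ⟨2 * D, by positivity, fun ε hε hε1 K hK => ?_⟩
  obtain ⟨K', hK', hKK⟩ := hK.exists_niceFamily ha0 ha1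
  have hcongr : ∀ f, maxTrunc K f = maxTrunc K' f := fun f =>
    maxTrunc_congr_ae hKK Filter.EventuallyEq.rfl
  have hpos : 0 < D / ε := by positivity
  have key : HasSparseBound (maxTrunc K) (1 + ε) (1 + ε) (2 * (D / ε).toNNReal) := by
    refine hasSparseBound_of_le (by simpa using hpos)
      (fun f g hfg => maxTrunc_congr_ae (fun _ => Filter.EventuallyEq.rfl) hfg)
      (fun f hf => ?_) (fun f hf => ?_) fun f₁ f₂ hf₁ hf₂ => ?_
    · rw [hcongr]
      exact (hK'.measurable_maxTrunc hf).aemeasurable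
    · rw [hcongr]
      exact (h K' hK' f hf).1
    · rw [hcongr]
      exact (h K' hK' f₁ hf₁).2 f₂ hf₂ ε hε hε1
  refine key.sparseNorm_le.trans (le_of_eq ?_)
  rw [mul_div_assoc, ENNReal.ofReal_mul (by norm_num), ENNReal.coe_mul]
  simp [ENNReal.ofReal]

/-! ### Homogeneous kernels and polar coordinates -/

/-- A symbol satisfying `IsRoughSymbol` with all conditions holding everywhere. -/
structure NiceSymbol (Ω : UnitSphere d → ℂ) : Prop where
  meas : Measurable Ω
  bound : ∀ θ, ‖Ω θ‖ ≤ 1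
  mean_zero : ∫ θ, Ω θ ∂(surfaceMeasure d) = 0

theorem IsRoughSymbol.exists_niceSymbol {Ω : UnitSphere d → ℂ} (hΩ : IsRoughSymbol Ω) :
    ∃ Ω', NiceSymbol Ω' ∧ Ω =ᵐ[surfaceMeasure d] Ω' := by
  set g := hΩ.meas.mk Ω with hg
  have hgm : Measurable g := hΩ.meas.stronglyMeasurable_mk.measurable
  have hae : Ω =ᵐ[surfaceMeasure d] {θ | ‖g θ‖ ≤ 1}.indicator g := by
    filter_upwards [hΩ.meas.ae_eq_mk, hΩ.bound] with θ h1 h2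
    have h3 : θ ∈ {θ | ‖g θ‖ ≤ 1} := by
      show ‖g θ‖ ≤ 1
      rw [hg, ← h1]
      exact h2
    rw [Set.indicator_of_mem h3, h1]
  refine ⟨_, ⟨hgm.indicator (measurableSet_le hgm.norm measurable_const), fun θ => ?_, ?_⟩, hae⟩
  · by_cases h : θ ∈ {θ | ‖g θ‖ ≤ 1}
    · rw [Set.indicator_of_mem h]
      exact h
    · rw [Set.indicator_of_notMem h]
      simp
  · rw [← integral_congr_ae hae, hΩ.mean_zero]

theorem roughKernel_zero (Ω : UnitSphere d → ℂ) : roughKernel Ω 0 = 0 := by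
  simp [roughKernel]

theorem roughKernel_of_ne (Ω : UnitSphere d → ℂ) {t : Rd d} (ht : t ≠ 0) :
    roughKernel Ω t = Ω (direction t ht) / ((‖t‖ ^ d : ℝ) : ℂ) := by
  simp [roughKernel, ht]

theorem roughKernel_smul (Ω : UnitSphere d → ℂ) {l : ℝ} (hl : 0 < l) (t : Rd d) :
    roughKernel Ω (l • t) = ((l ^ d)⁻¹ : ℝ) * roughKernel Ω t := by
  rcases eq_or_ne t 0 with rfl | ht
  · simp [roughKernel_zero]
  have hlt : l • t ≠ 0 := smul_ne_zero hl.ne' ht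
  rw [roughKernel_of_ne Ω ht, roughKernel_of_ne Ω hlt]
  have h1 : direction (l • t) hlt = direction t ht := by
    ext1
    simp only [direction, norm_smul, Real.norm_of_nonneg hl.le, smul_smul]
    congr 1
    field_simp
  rw [h1, norm_smul, Real.norm_of_nonneg hl.le, mul_pow]
  push_cast
  rw [mul_comm, div_mul_eq_div_div_swap]
  field_simp

theorem NiceSymbol.norm_roughKernel_le {Ω : UnitSphere d → ℂ} (hΩ : NiceSymbol Ω) (t : Rd d) :
    ‖roughKernel Ω t‖ ≤ (‖t‖ ^ d)⁻¹ := by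
  rcases eq_or_ne t 0 with rfl | ht
  · rw [roughKernel_zero]
    simp
  · rw [roughKernel_of_ne Ω ht, norm_div, Complex.norm_real, Real.norm_of_nonneg (by positivity),
      div_eq_mul_inv]
    exact mul_le_of_le_one_left (by positivity) (hΩ.bound _)

theorem NiceSymbol.measurable_roughKernel {Ω : UnitSphere d → ℂ} (hΩ : NiceSymbol Ω) :
    Measurable (roughKernel Ω) := by
  classical
  have h1 : Measurable fun t : ({0} : Set (Rd d)) => (0 : ℂ) := measurable_const
  have h2 : Measurable fun t : (({0} : Set (Rd d))ᶜ : Set (Rd d)) =>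
      Ω (direction t.1 t.2) / ((‖t.1‖ ^ d : ℝ) : ℂ) := by
    refine (hΩ.meas.comp ?_).div (by fun_prop)
    refine Measurable.subtype_mk ?_
    fun_prop
  exact Measurable.dite h1 h2 (measurableSet_singleton 0)

theorem integral_polar (hd : d ≠ 0) (F : Rd d → ℂ) :
    ∫ x, F x = ∫ p : UnitSphere d × Set.Ioi (0 : ℝ), F (p.2.1 • p.1.1)
      ∂((surfaceMeasure d).prod (Measure.volumeIoiPow (d - 1))) := by
  have : Nonempty (Fin d) := ⟨⟨0, Nat.pos_of_ne_zero hd⟩⟩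
  calc ∫ x, F x = ∫ x : ({(0)}ᶜ : Set (Rd d)), F x.1 ∂(volume.comap Subtype.val) := by
        rw [integral_subtype_comap (measurableSet_singleton _).compl F, restrict_compl_singleton]
    _ = _ := by
      have h := (Measure.measurePreserving_homeomorphUnitSphereProd
        (volume : Measure (Rd d))).integral_comp (Homeomorph.measurableEmbedding _)
        (fun p => F (p.2.1 • p.1.1))
      rw [finrank_euclideanSpace, Fintype.card_fin] at h
      rw [surfaceMeasure, ← h]
      refine integral_congr_ae (Filter.Eventually.of_forall fun x => ?_)
      have hx : x.1 ≠ 0 := x.2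
      simp [smul_smul, hx]

/-- In polar coordinates a null set of directions spans a null cone. In dimension 0 the kernels
vanish. -/
theorem roughKernel_ae_eq {Ω Ω' : UnitSphere d → ℂ} (h : Ω =ᵐ[surfaceMeasure d] Ω') :
    roughKernel Ω =ᵐ[volume] roughKernel Ω' := by
  rcases Nat.eq_zero_or_pos d with rfl | hd
  · refine Filter.Eventually.of_forall fun x => ?_
    rw [Subsingleton.elim x 0, roughKernel_zero, roughKernel_zero]
  have : Nonempty (Fin d) := ⟨⟨0, hd⟩⟩
  have hm := Measure.measurePreserving_homeomorphUnitSphereProd (volume : Measure (Rd d))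
  have h1 := hm.quasiMeasurePreserving.ae (Measure.quasiMeasurePreserving_fst.ae h)
  rw [← restrict_compl_singleton (μ := volume) (0 : Rd d)]
  refine (ae_restrict_iff_subtype (measurableSet_singleton _).compl).2 ?_
  filter_upwards [h1] with x hx
  have hx0 : x.1 ≠ 0 := x.2
  have he : (homeomorphUnitSphereProd (Rd d) x).1 = direction x.1 hx0 := by
    ext1
    simp [direction]
  rw [he] at hx
  rw [roughKernel_of_ne Ω hx0, roughKernel_of_ne Ω' hx0, hx]

/-- The dyadic shell `{1/16 < |x|_∞ ≤ 1/8}`. -/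
def shell (d : ℕ) : Set (Rd d) := {x | 1 / 16 < supNorm x ∧ supNorm x ≤ 1 / 8}

theorem measurableSet_shell : MeasurableSet (shell d) :=
  (measurableSet_lt measurable_const measurable_supNorm).inter
    (measurableSet_le measurable_supNorm measurable_const)

theorem NiceSymbol.norm_roughKernel_le_of_le {Ω : UnitSphere d → ℂ} (hΩ : NiceSymbol Ω)
    {t : Rd d} {r : ℝ} (hr : 0 < r) (ht : r ≤ ‖t‖) : ‖roughKernel Ω t‖ ≤ (r ^ d)⁻¹ :=
  (hΩ.norm_roughKernel_le t).trans (by gcongr)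

theorem isBounded_of_supNorm_le (r : ℝ) :
    Bornology.IsBounded {x : Rd d | supNorm x ≤ r} :=
  isBounded_iff_forall_norm_le.2 ⟨√d * r, fun x hx => (norm_le_supNorm x).trans
    (mul_le_mul_of_nonneg_left hx (Real.sqrt_nonneg _))⟩

theorem NiceSymbol.integrable_shell {Ω : UnitSphere d → ℂ} (hΩ : NiceSymbol Ω) :
    Integrable ((shell d).indicator (roughKernel Ω)) := by
  rw [integrable_indicator_iff measurableSet_shell]
  refine IntegrableOn.of_bound ?_ hΩ.measurable_roughKernel.aestronglyMeasurable (((1 / 16) ^ d)⁻¹)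
    ((ae_restrict_iff' measurableSet_shell).2 (Filter.Eventually.of_forall fun x hx => ?_))
  · exact ((isBounded_of_supNorm_le (1 / 8)).subset fun x hx => hx.2).measure_lt_top
  · exact hΩ.norm_roughKernel_le_of_le (by norm_num) (hx.1.le.trans (supNorm_le_norm x))

theorem supNorm_pos {x : Rd d} (hx : x ≠ 0) : 0 < supNorm x := by
  refine lt_of_le_of_ne (supNorm_nonneg x) fun h => hx ?_
  have h1 := norm_le_supNorm x
  rw [← h, mul_zero] at h1
  exact norm_le_zero_iff.1 h1

/-- Along a ray the integrand is `r^(d-1) r^(-d) = 1/r`, over an interval whose endpoints have ratio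
2. Their position depends on the direction, but the integral `log 2` does not, so shells in the
maximum norm preserve the cancellation of `Ω`. -/
theorem integral_radial_shell (hd : d ≠ 0) (Ω : UnitSphere d → ℂ) (θ : UnitSphere d) :
    ∫ r : Set.Ioi (0 : ℝ), (shell d).indicator (roughKernel Ω) (r.1 • θ.1)
      ∂(Measure.volumeIoiPow (d - 1)) = Real.log 2 * Ω θ := by
  have hθn : ‖θ.1‖ = 1 := mem_sphere_zero_iff_norm.1 θ.2
  have hθ : θ.1 ≠ 0 := by
    intro h
    rw [h, norm_zero] at hθn
    exact zero_ne_one hθn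
  have hk : roughKernel Ω θ.1 = Ω θ := by
    rw [roughKernel_of_ne Ω hθ, hθn]
    have : direction θ.1 hθ = θ := by
      ext1
      simp [direction, hθn]
    simp [this]
  set m := supNorm θ.1 with hm
  have hm0 : 0 < m := supNorm_pos hθ
  have hab : 1 / (16 * m) ≤ 1 / (8 * m) := by gcongr; norm_num
  simp only [Measure.volumeIoiPow, ENNReal.ofReal]
  rw [integral_withDensity_eq_integral_smul (measurable_subtype_coe.pow_const _).real_toNNReal,
    integral_subtype_comap measurableSet_Ioi fun r : ℝ => Real.toNNReal (r ^ (d - 1)) •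
      (shell d).indicator (roughKernel Ω) (r • θ.1)]
  have h1 : ∀ r ∈ Set.Ioi (0 : ℝ), Real.toNNReal (r ^ (d - 1)) •
      (shell d).indicator (roughKernel Ω) (r • θ.1) =
      (Set.Ioc (1 / (16 * m)) (1 / (8 * m))).indicator (fun r => ((r⁻¹ : ℝ) : ℂ) * Ω θ) r := by
    intro r hr
    have hr0 : 0 < r := hr
    have hiff : r • θ.1 ∈ shell d ↔ r ∈ Set.Ioc (1 / (16 * m)) (1 / (8 * m)) := by
      simp only [shell, Set.mem_ofPred_eq, supNorm_smul, abs_of_pos hr0, Set.mem_Ioc]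
      rw [div_lt_iff₀ (by positivity : 0 < 16 * m), le_div_iff₀ (by positivity : 0 < 8 * m), ← hm]
      constructor <;> rintro ⟨h1, h2⟩ <;> constructor <;> linarith
    by_cases h : r • θ.1 ∈ shell d
    · rw [Set.indicator_of_mem h, Set.indicator_of_mem (hiff.1 h), roughKernel_smul Ω hr0, hk,
        NNReal.smul_def, Real.coe_toNNReal _ (by positivity), Complex.real_smul, ← mul_assoc,
        ← Complex.ofReal_mul]
      congr 2
      obtain ⟨k, rfl⟩ := Nat.exists_eq_succ_of_ne_zero hd
      simp only [Nat.succ_eq_add_one, Nat.add_sub_cancel, pow_succ]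
      field_simp
    · rw [Set.indicator_of_notMem h, Set.indicator_of_notMem fun h' => h (hiff.2 h'), smul_zero]
  rw [setIntegral_congr_fun measurableSet_Ioi h1, setIntegral_indicator measurableSet_Ioc,
    Set.inter_eq_self_of_subset_right, integral_mul_const,
    integral_complex_ofReal, ← intervalIntegral.integral_of_le hab, integral_inv_of_pos (by positivity) (by positivity)]
  · congr 3
    field_simp
    norm_num
  · intro r hr
    exact lt_trans (by positivity) hr.1

theorem NiceSymbol.integral_shell (hd : d ≠ 0) {Ω : UnitSphere d → ℂ} (hΩ : NiceSymbol Ω) :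
    ∫ x, (shell d).indicator (roughKernel Ω) x = 0 := by
  have hne : Nonempty (Fin d) := ⟨⟨0, Nat.pos_of_ne_zero hd⟩⟩
  rw [integral_polar hd]
  by_cases hi : Integrable (fun p : UnitSphere d × Set.Ioi (0 : ℝ) =>
      (shell d).indicator (roughKernel Ω) (p.2.1 • p.1.1))
      ((surfaceMeasure d).prod (Measure.volumeIoiPow (d - 1)))
  · have : IsFiniteMeasure (surfaceMeasure d) := by
      unfold surfaceMeasure
      infer_instance
    rw [integral_prod _ hi]
    simp only [integral_radial_shell hd]
    rw [integral_const_mul, hΩ.mean_zero, mul_zero]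
  · exact integral_undef hi

/-! ### The Fourier transform of a shell of the rough kernel -/

open Set in
-- An exact primitive on an interval gives `2 / (2π|v|) ≤ 1/|v|`; the other bound is the length.
theorem enorm_setIntegral_exp_le (v : ℝ) {s : Set ℝ} {a b : ℝ} (hs : s = Ioc a b)
    (hs' : s ⊆ Ioc 1 2) :
    ‖∫ l in s, Complex.exp (-(2 * Real.pi * v * Complex.I) * l)‖ₑ ≤ min 1 ‖v‖ₑ⁻¹ := by
  have hnorm : ∀ l : ℝ, ‖Complex.exp (-(2 * Real.pi * v * Complex.I) * l)‖ = 1 := fun l => by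
    have : -(2 * Real.pi * v * Complex.I) * l = ((-(2 * Real.pi * v * l) : ℝ) : ℂ) * Complex.I := by
      push_cast; ring
    rw [this, Complex.norm_exp_ofReal_mul_I]
  refine le_min ?_ ?_
  · calc _ ≤ ∫⁻ l in s, ‖Complex.exp (-(2 * Real.pi * v * Complex.I) * l)‖ₑ :=
          enorm_integral_le_lintegral_enorm _
      _ = volume s := by
          simp_rw [← ofReal_norm, hnorm]
          simp
      _ ≤ volume (Ioc (1 : ℝ) 2) := measure_mono hs'
      _ = 1 := by norm_num [Real.volume_Ioc]
  · rcases eq_or_ne v 0 with rfl | hv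
    · simp
    rcases le_total b a with hab | hab
    · simp [hs, Ioc_eq_empty (not_lt.2 hab)]
    have hc : -(2 * Real.pi * v * Complex.I) ≠ 0 := by simp [hv, Real.pi_ne_zero]
    rw [hs, ← intervalIntegral.integral_of_le hab, integral_exp_mul_complex hc, ← ofReal_norm,
      ← ofReal_norm, ← ENNReal.ofReal_inv_of_pos (norm_pos_iff.2 hv)]
    refine ENNReal.ofReal_le_ofReal ?_
    rw [norm_div]
    have h1 : ‖-(2 * Real.pi * v * Complex.I)‖ = 2 * Real.pi * |v| := by
      simp [abs_of_pos Real.pi_pos]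
    have h2 := norm_sub_le (Complex.exp (-(2 * Real.pi * v * Complex.I) * b))
      (Complex.exp (-(2 * Real.pi * v * Complex.I) * a))
    rw [hnorm, hnorm] at h2
    have hv' : 0 < |v| := abs_pos.2 hv
    rw [h1, Real.norm_eq_abs, div_le_iff₀ (by positivity)]
    have h3 : |v|⁻¹ * (2 * Real.pi * |v|) = 2 * Real.pi := by field_simp
    rw [h3]
    have := Real.pi_gt_three
    linarith

/-- The points some multiple of which with a factor in `(1, 2]` lies in `shell d`. -/
def wideShell (d : ℕ) : Set (Rd d) := {x | 1 / 32 ≤ supNorm x ∧ supNorm x ≤ 1 / 8}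

theorem measurableSet_wideShell : MeasurableSet (wideShell d) :=
  (measurableSet_le measurable_const measurable_supNorm).inter
    (measurableSet_le measurable_supNorm measurable_const)

theorem mem_wideShell_of_smul {l : ℝ} (hl : l ∈ Set.Ioc (1 : ℝ) 2) {y : Rd d}
    (h : l • y ∈ shell d) : y ∈ wideShell d := by
  obtain ⟨h1, h2⟩ := h
  obtain ⟨hl1, hl2⟩ := hl
  have h3 := supNorm_nonneg y
  rw [supNorm_smul, abs_of_pos (by linarith)] at h1 h2
  constructor <;> nlinarith

theorem smul_mem_shell_eq_Ioc {y : Rd d} (hy : y ∈ wideShell d) :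
    {l : ℝ | l ∈ Set.Ioc (1 : ℝ) 2 ∧ l • y ∈ shell d} =
      Set.Ioc (max 1 (1 / (16 * supNorm y))) (min 2 (1 / (8 * supNorm y))) := by
  have hm : 0 < supNorm y := lt_of_lt_of_le (by norm_num) hy.1
  ext l
  simp only [shell, Set.mem_ofPred_eq, supNorm_smul, Set.mem_Ioc, max_lt_iff, le_min_iff]
  rw [div_lt_iff₀ (by positivity : 0 < 16 * supNorm y),
    le_div_iff₀ (by positivity : 0 < 8 * supNorm y)]
  constructor
  · rintro ⟨⟨h1, h2⟩, h3, h4⟩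
    rw [abs_of_pos (by linarith)] at h3 h4
    exact ⟨⟨h1, by linarith⟩, h2, by linarith⟩
  · rintro ⟨⟨h1, h2⟩, h3, h4⟩
    rw [abs_of_pos (by linarith)]
    exact ⟨⟨h1, h3⟩, by linarith, by linarith⟩

/-- The Fourier integral is averaged over the dilations `x = l y`, `1 < l ≤ 2`. After interchanging
the integrals, the inner one in `l` is purely oscillatory, so decay comes from the radial variable
and no regularity of `Ω` is used. The factor `32 ^ d` bounds the kernel on the wide shell. -/
theorem NiceSymbol.enorm_fourier_shell_le {Ω : UnitSphere d → ℂ} (hΩ : NiceSymbol Ω) (ξ : Rd d) :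
    ‖𝓕 ((shell d).indicator (roughKernel Ω)) ξ‖ₑ ≤
      32 ^ d * ∫⁻ y in wideShell d, min 1 ‖inner ℝ y ξ‖ₑ⁻¹ := by
  set F := (shell d).indicator (roughKernel Ω) with hF
  set A : ℂ := 𝓕 F ξ with hA
  set e : ℝ → Rd d → ℂ := fun l y => Complex.exp (-(2 * Real.pi * (inner ℝ y ξ : ℝ) * Complex.I) * l)
    with he
  set H : ℝ → Rd d → ℂ := fun l y =>
    {p : ℝ × Rd d | p.1 • p.2 ∈ shell d}.indicator (fun p => e p.1 p.2 * roughKernel Ω p.2) (l, y)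
    with hH
  -- The Jacobian `l^d` cancels the homogeneity of the kernel, so only the phase and the cutoff
  -- depend on `l`.
  have hslice : ∀ l : ℝ, l ∈ Set.Ioc (1 : ℝ) 2 → ∫ y, H l y = A := by
    intro l hl
    have hl0 : 0 < l := by linarith [hl.1]
    have h1 := Measure.integral_comp_smul volume (fun x => Real.fourierChar (-inner ℝ x ξ) • F x) l
    rw [← Real.fourier_eq, ← hA, finrank_euclideanSpace, Fintype.card_fin,
      abs_of_pos (by positivity)] at h1
    have h2 : ∀ y, H l y = ((l ^ d : ℝ) : ℂ) * (Real.fourierChar (-inner ℝ (l • y) ξ) • F (l • y)) := by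
      intro y
      by_cases hy : l • y ∈ shell d
      · rw [hF, Set.indicator_of_mem hy, roughKernel_smul Ω hl0]
        simp only [hH]
        rw [Set.indicator_of_mem (show (l, y) ∈ {p : ℝ × Rd d | p.1 • p.2 ∈ shell d} from hy)]
        rw [Circle.smul_def, Real.fourierChar_apply, smul_eq_mul, real_inner_smul_left]
        simp only [he]
        have h3 : -(2 * Real.pi * (inner ℝ y ξ : ℝ) * Complex.I) * l =
          ((2 * Real.pi * (-(l * inner ℝ y ξ)) : ℝ) : ℂ) * Complex.I := by push_cast; ring
        rw [h3]
        have h4 : ((l ^ d : ℝ) : ℂ) ≠ 0 := by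
          exact_mod_cast (pow_pos hl0 d).ne'
        push_cast at h4 ⊢
        field_simp
      · rw [hF, Set.indicator_of_notMem hy]
        simp only [hH]
        rw [Set.indicator_of_notMem (show (l, y) ∉ {p : ℝ × Rd d | p.1 • p.2 ∈ shell d} from hy)]
        simp
    simp only [h2]
    rw [integral_const_mul, h1, Complex.real_smul, ← mul_assoc, ← Complex.ofReal_mul,
      mul_inv_cancel₀ (by positivity), Complex.ofReal_one, one_mul]
  have hHm : Measurable (Function.uncurry H) := by
    have h1 : MeasurableSet {p : ℝ × Rd d | p.1 • p.2 ∈ shell d} :=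
      measurableSet_shell.preimage (by fun_prop)
    have h2 : Measurable fun p : ℝ × Rd d => e p.1 p.2 * roughKernel Ω p.2 := by
      refine Measurable.mul ?_ (hΩ.measurable_roughKernel.comp measurable_snd)
      simp only [he]
      fun_prop
    exact h2.indicator h1
  have he1 : ∀ l y, ‖e l y‖ = 1 := fun l y => by
    have : -(2 * Real.pi * (inner ℝ y ξ : ℝ) * Complex.I) * l =
        ((-(2 * Real.pi * inner ℝ y ξ * l) : ℝ) : ℂ) * Complex.I := by push_cast; ring
    simp only [he]
    rw [this, Complex.norm_exp_ofReal_mul_I]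
  have hker : ∀ y ∈ wideShell d, ‖roughKernel Ω y‖ ≤ 32 ^ d := fun y hy => by
    refine (hΩ.norm_roughKernel_le_of_le (r := 1 / 32) (by norm_num)
      (hy.1.trans (supNorm_le_norm y))).trans (le_of_eq ?_)
    rw [one_div, inv_pow, inv_inv]
  have hHb : ∀ l ∈ Set.Ioc (1 : ℝ) 2, ∀ y, ‖H l y‖ ≤ (wideShell d).indicator (fun _ => 32 ^ d) y := by
    intro l hl y
    simp only [hH]
    by_cases hy : l • y ∈ shell d
    · have hw := mem_wideShell_of_smul hl hy
      rw [Set.indicator_of_mem (show (l, y) ∈ {p : ℝ × Rd d | p.1 • p.2 ∈ shell d} from hy),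
        Set.indicator_of_mem hw, norm_mul, he1, one_mul]
      exact hker y hw
    · rw [Set.indicator_of_notMem (show (l, y) ∉ {p : ℝ × Rd d | p.1 • p.2 ∈ shell d} from hy),
        norm_zero]
      exact Set.indicator_nonneg (fun _ _ => by positivity) _
  have hwfin : volume (wideShell d) ≠ ∞ :=
    ((isBounded_of_supNorm_le (1 / 8)).subset fun x hx => hx.2).measure_lt_top.ne
  have hint : Integrable (Function.uncurry H) ((volume.restrict (Set.Ioc (1 : ℝ) 2)).prod volume) := by
    have hdom : Integrable (fun p : ℝ × Rd d => (wideShell d).indicator (fun _ => (32 : ℝ) ^ d) p.2)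
        ((volume.restrict (Set.Ioc (1 : ℝ) 2)).prod volume) := by
      refine Integrable.comp_snd ?_ _
      exact (integrable_indicator_iff measurableSet_wideShell).2 (integrableOn_const hwfin)
    refine hdom.mono' hHm.aestronglyMeasurable ?_
    have hq : ∀ᵐ p ∂((volume.restrict (Set.Ioc (1 : ℝ) 2)).prod (volume : Measure (Rd d))),
        p.1 ∈ Set.Ioc (1 : ℝ) 2 :=
      Measure.quasiMeasurePreserving_fst.ae (ae_restrict_mem measurableSet_Ioc)
    filter_upwards [hq] with p hp
    exact hHb p.1 hp p.2
  have hswap : A = ∫ y, ∫ l in Set.Ioc (1 : ℝ) 2, H l y := by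
    rw [← integral_integral_swap hint, setIntegral_congr_fun measurableSet_Ioc hslice]
    simp
    norm_num
  have hinner : ∀ y, ‖∫ l in Set.Ioc (1 : ℝ) 2, H l y‖ₑ ≤
      (wideShell d).indicator (fun y => 32 ^ d * min 1 ‖inner ℝ y ξ‖ₑ⁻¹) y := by
    intro y
    by_cases hy : y ∈ wideShell d
    · rw [Set.indicator_of_mem hy]
      have h1 : MeasurableSet {l : ℝ | l • y ∈ shell d} :=
        measurableSet_shell.preimage (by fun_prop)
      have h2 : ∀ l, H l y =
          {l : ℝ | l • y ∈ shell d}.indicator (fun l => e l y * roughKernel Ω y) l := fun l => rfl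
      simp only [h2]
      rw [setIntegral_indicator h1, integral_mul_const, enorm_mul, mul_comm]
      refine mul_le_mul' ?_ (enorm_setIntegral_exp_le _ (smul_mem_shell_eq_Ioc hy)
        Set.inter_subset_left)
      rw [← ofReal_norm]
      refine (ENNReal.ofReal_le_ofReal (hker y hy)).trans (le_of_eq ?_)
      rw [ENNReal.ofReal_pow (by norm_num)]
      norm_num
    · rw [Set.indicator_of_notMem hy]
      have h0 : ∀ l ∈ Set.Ioc (1 : ℝ) 2, H l y = 0 := fun l hl => by
        simp only [hH]
        exact Set.indicator_of_notMem (s := {p : ℝ × Rd d | p.1 • p.2 ∈ shell d}) (a := (l, y))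
          (fun h => hy (mem_wideShell_of_smul hl h)) _
      rw [setIntegral_congr_fun measurableSet_Ioc h0]
      simp
  rw [hswap]
  calc _ ≤ ∫⁻ y, ‖∫ l in Set.Ioc (1 : ℝ) 2, H l y‖ₑ := enorm_integral_le_lintegral_enorm _
    _ ≤ ∫⁻ y, (wideShell d).indicator (fun y => 32 ^ d * min 1 ‖inner ℝ y ξ‖ₑ⁻¹) y :=
        lintegral_mono hinner
    _ = _ := by
        rw [lintegral_indicator measurableSet_wideShell, lintegral_const_mul' _ _ (by simp)]

theorem integrable_indicator_abs_rpow (r : ℝ) :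
    Integrable ((Set.Icc (-r) r).indicator fun t : ℝ => |t| ^ (-(1 / 2) : ℝ)) := by
  rcases lt_or_ge r 0 with hr | hr
  · rw [Set.Icc_eq_empty (by linarith)]
    simp
  have h1 : IntegrableOn (fun t : ℝ => t ^ (-(1 / 2) : ℝ)) (Set.Ioc 0 r) :=
    (intervalIntegrable_iff_integrableOn_Ioc_of_le hr).1
      (intervalIntegral.intervalIntegrable_rpow' (by norm_num))
  set g : ℝ → ℝ := (Set.Ioc 0 r).indicator fun t : ℝ => t ^ (-(1 / 2) : ℝ) with hg
  have hgi : Integrable g := (integrable_indicator_iff measurableSet_Ioc).2 h1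
  refine (hgi.add hgi.comp_neg).congr (Filter.Eventually.of_forall fun t => ?_)
  simp only [Pi.add_apply, hg, Set.indicator_apply, Set.mem_Ioc, Set.mem_Icc]
  rcases lt_trichotomy t 0 with ht | rfl | ht
  · rw [if_neg (by intro h; linarith [h.1]), abs_of_neg ht, zero_add]
    refine if_congr ⟨fun h => ⟨by linarith [h.2], by linarith⟩, fun h => ⟨by linarith, by linarith [h.1]⟩⟩ rfl rfl
  · simp [Real.zero_rpow]
  · rw [if_neg (c := 0 < -t ∧ -t ≤ r) (fun h => by linarith [h.1]), abs_of_pos ht, add_zero]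
    exact if_congr ⟨fun h => ⟨by linarith, h.2⟩, fun h => ⟨ht, h.2⟩⟩ rfl rfl

/-- On a box the integrand factors over the coordinates, and `|t|^(-1/2)` is integrable on an
interval. -/
theorem lintegral_box_enorm_rpow_lt_top (i : Fin d) (r : ℝ) :
    ∫⁻ y in {y : Rd d | supNorm y ≤ r}, ‖y i‖ₑ ^ (-(1 / 2) : ℝ) < ∞ := by
  rcases lt_or_ge r 0 with hr | hr
  · have : {y : Rd d | supNorm y ≤ r} = ∅ := by
      ext y
      simpa using hr.trans_le (supNorm_nonneg y)
    simp [this]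
  set f : Fin d → ℝ → ℝ := fun j => if j = i then
    (Set.Icc (-r) r).indicator fun t : ℝ => |t| ^ (-(1 / 2) : ℝ)
    else (Set.Icc (-r) r).indicator fun _ => 1 with hf
  have hint : Integrable fun z : Fin d → ℝ => ∏ j, f j (z j) := by
    refine Integrable.fintype_prod fun j => ?_
    by_cases hj : j = i
    · simp only [hf, if_pos hj]
      exact integrable_indicator_abs_rpow r
    · simp only [hf, if_neg hj]
      exact (integrable_indicator_iff measurableSet_Icc).2 (integrableOn_const (by simp))
  have hpre := (PiLp.volume_preserving_ofLp (Fin d)).integrable_comp_of_integrable hint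
  refine lt_of_le_of_lt ?_ hpre.2
  rw [← lintegral_indicator (measurableSet_le measurable_supNorm measurable_const)]
  have hne : ∀ᵐ y : Rd d, y i ≠ 0 := by
    have h1 : ∀ᵐ t : ℝ, t ≠ 0 := by simp [ae_iff]
    exact (PiLp.volume_preserving_ofLp (Fin d)).quasiMeasurePreserving.ae
      ((Measure.quasiMeasurePreserving_eval (fun _ => volume) i).ae h1)
  refine lintegral_mono_ae ?_
  filter_upwards [hne] with y hy
  by_cases h : y ∈ {y : Rd d | supNorm y ≤ r}
  · rw [Set.indicator_of_mem h]
    have hmem : ∀ j, y j ∈ Set.Icc (-r) r := fun j => abs_le.1 ((supNorm_le_iff hr).1 h j)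
    have h1 : ∏ j, f j (y j) = |y i| ^ (-(1 / 2) : ℝ) := by
      rw [Finset.prod_eq_single i]
      · simp only [hf, if_pos]
        exact Set.indicator_of_mem (hmem i) _
      · intro j _ hj
        simp only [hf, if_neg hj]
        exact Set.indicator_of_mem (hmem j) _
      · simp
    simp only [Function.comp_apply]
    rw [h1, ← ofReal_norm, ← ofReal_norm, Real.norm_eq_abs,
      ENNReal.ofReal_rpow_of_pos (abs_pos.2 hy), Real.norm_of_nonneg (by positivity)]
  · rw [Set.indicator_of_notMem h]
    exact zero_le

theorem min_one_inv_le_rpow (v : ℝ≥0∞) : min 1 v⁻¹ ≤ v ^ (-(1 / 2) : ℝ) := by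
  rw [ENNReal.rpow_neg, ← ENNReal.inv_rpow]
  rcases le_total v⁻¹ 1 with h | h
  · refine (min_le_right _ _).trans ?_
    calc v⁻¹ = v⁻¹ ^ (1 : ℝ) := (ENNReal.rpow_one _).symm
      _ ≤ _ := ENNReal.rpow_le_rpow_of_exponent_ge h (by norm_num)
  · refine (min_le_left _ _).trans ?_
    calc (1 : ℝ≥0∞) = 1 ^ (1 / 2 : ℝ) := (ENNReal.one_rpow _).symm
      _ ≤ _ := ENNReal.rpow_le_rpow h (by norm_num)

/-- The reflection carrying `ξ` to `‖ξ‖ e_i` preserves the ball and the measure. -/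
theorem lintegral_ball_inner_rpow (i : Fin d) {ξ : Rd d} (r : ℝ) :
    ∫⁻ y in {y : Rd d | ‖y‖ ≤ r}, ‖(inner ℝ y ξ : ℝ)‖ₑ ^ (-(1 / 2) : ℝ) =
      ∫⁻ y in {y : Rd d | ‖y‖ ≤ r}, ‖‖ξ‖ * y i‖ₑ ^ (-(1 / 2) : ℝ) := by
  set w : Rd d := ‖ξ‖ • EuclideanSpace.single i (1 : ℝ) with hw
  have hnorm : ‖ξ‖ = ‖w‖ := by simp [hw, norm_smul]
  set R := (Submodule.span ℝ {ξ - w})ᗮ.reflection with hR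
  have hRξ : R ξ = w := Submodule.reflection_sub hnorm
  have hinner : ∀ y, inner ℝ (R y) ξ = ‖ξ‖ * y i := fun y => by
    rw [← R.inner_map_map, hRξ, hR, Submodule.reflection_reflection, hw, real_inner_smul_right,
      EuclideanSpace.inner_single_right]
    simp
  have hball : MeasurableSet {y : Rd d | ‖y‖ ≤ r} := measurableSet_le measurable_norm measurable_const
  have hm : Measurable ({y : Rd d | ‖y‖ ≤ r}.indicator
      fun y => ‖(inner ℝ y ξ : ℝ)‖ₑ ^ (-(1 / 2) : ℝ)) := by
    refine Measurable.indicator ?_ hball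
    have : Measurable fun y : Rd d => (inner ℝ y ξ : ℝ) := by fun_prop
    exact this.enorm.pow_const _
  rw [← lintegral_indicator hball, ← lintegral_indicator hball,
    ← R.measurePreserving.lintegral_comp hm]
  refine lintegral_congr fun y => ?_
  simp only [Set.indicator_apply, Set.mem_ofPred_eq, R.norm_map, hinner]

/-- For `d ≥ 2` the decay `‖ξ‖^(-1/2)` suffices, and the power `-1/2` of the inner product is
integrable. For `d = 1` the full power 1 is needed; it is available because `|⟨y, ξ⟩| = |y||ξ|` is
bounded below on the shell. -/
theorem exists_lintegral_wideShell_le (hd : d ≠ 0) :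
    ∃ C : ℝ≥0∞, C ≠ ∞ ∧ ∀ ξ : Rd d, 1 ≤ ‖ξ‖ →
      ∫⁻ y in wideShell d, min 1 ‖inner ℝ y ξ‖ₑ⁻¹ ≤ C * ‖ξ‖ₑ ^ (-(1 / (d : ℝ))) := by
  have hwfin : volume (wideShell d) ≠ ∞ :=
    ((isBounded_of_supNorm_le (1 / 8)).subset fun x hx => hx.2).measure_lt_top.ne
  rcases Nat.lt_or_ge d 2 with hd2 | hd2
  · obtain rfl : d = 1 := by omega
    refine ⟨32 * volume (wideShell 1), ENNReal.mul_ne_top (by simp) hwfin, fun ξ hξ => ?_⟩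
    have h1 : ∀ y ∈ wideShell 1, min 1 ‖inner ℝ y ξ‖ₑ⁻¹ ≤ 32 * ‖ξ‖ₑ⁻¹ := fun y hy => by
      refine (min_le_right _ _).trans ?_
      have h2 : ‖(inner ℝ y ξ : ℝ)‖ₑ = ‖y‖ₑ * ‖ξ‖ₑ := by
        have h3 : ∀ z : Rd 1, ‖z‖ = |z 0| := fun z => by
          rw [EuclideanSpace.norm_eq]
          simp [Real.sqrt_sq_eq_abs]
        rw [← ofReal_norm, ← ofReal_norm, ← ofReal_norm, ← ENNReal.ofReal_mul (norm_nonneg _), h3, h3]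
        simp [PiLp.inner_apply, mul_comm]
      have h4 : (32 : ℝ≥0∞)⁻¹ ≤ ‖y‖ₑ := by
        have h5 : 1 / 32 ≤ ‖y‖ := hy.1.trans (supNorm_le_norm y)
        rw [← ofReal_norm]
        refine le_trans (le_of_eq ?_) (ENNReal.ofReal_le_ofReal h5)
        rw [one_div, ENNReal.ofReal_inv_of_pos (by norm_num)]
        norm_num
      rw [h2, ENNReal.mul_inv (Or.inr enorm_ne_top) (Or.inl enorm_ne_top)]
      gcongr
      rw [← inv_inv (32 : ℝ≥0∞)]
      exact ENNReal.inv_le_inv.2 h4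
    calc _ ≤ ∫⁻ y in wideShell 1, 32 * ‖ξ‖ₑ⁻¹ := setLIntegral_mono measurable_const h1
      _ = _ := by
        rw [setLIntegral_const]
        simp only [Nat.cast_one, div_one, ENNReal.rpow_neg_one]
        ring
  · set i : Fin d := ⟨0, by omega⟩
    set r : ℝ := √d * (1 / 8)
    refine ⟨∫⁻ y in {y : Rd d | supNorm y ≤ r}, ‖y i‖ₑ ^ (-(1 / 2) : ℝ),
      (lintegral_box_enorm_rpow_lt_top i r).ne, fun ξ hξ => ?_⟩
    have hξ0 : ‖ξ‖ₑ ≠ 0 := by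
      rw [enorm_ne_zero, ← norm_pos_iff]
      linarith
    have hexp : ‖ξ‖ₑ ^ (-(1 / 2) : ℝ) ≤ ‖ξ‖ₑ ^ (-(1 / (d : ℝ))) := by
      refine ENNReal.rpow_le_rpow_of_exponent_le ?_ ?_
      · rw [← ofReal_norm]
        exact ENNReal.one_le_ofReal.2 hξ
      · have : (2 : ℝ) ≤ d := by exact_mod_cast hd2
        exact neg_le_neg (one_div_le_one_div_of_le (by norm_num) this)
    calc _ ≤ ∫⁻ y in {y : Rd d | ‖y‖ ≤ r}, ‖(inner ℝ y ξ : ℝ)‖ₑ ^ (-(1 / 2) : ℝ) := by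
          refine (lintegral_mono fun y => min_one_inv_le_rpow _).trans (lintegral_mono_set fun y hy => ?_)
          exact (norm_le_supNorm y).trans (by unfold r; gcongr; exact hy.2)
      _ = ∫⁻ y in {y : Rd d | ‖y‖ ≤ r}, ‖ξ‖ₑ ^ (-(1 / 2) : ℝ) * ‖y i‖ₑ ^ (-(1 / 2) : ℝ) := by
          rw [lintegral_ball_inner_rpow i]
          refine lintegral_congr fun y => ?_
          rw [enorm_mul, enorm_norm, ENNReal.mul_rpow_of_ne_top enorm_ne_top enorm_ne_top]
      _ = ‖ξ‖ₑ ^ (-(1 / 2) : ℝ) * ∫⁻ y in {y : Rd d | ‖y‖ ≤ r}, ‖y i‖ₑ ^ (-(1 / 2) : ℝ) := by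
          rw [lintegral_const_mul' _ _ ?_]
          rw [ENNReal.rpow_neg]
          simp [hξ0]
      _ ≤ ‖ξ‖ₑ ^ (-(1 / (d : ℝ))) * ∫⁻ y in {y : Rd d | supNorm y ≤ r}, ‖y i‖ₑ ^ (-(1 / 2) : ℝ) :=
          mul_le_mul' hexp (lintegral_mono_set fun y hy => (supNorm_le_norm y).trans hy)
      _ = _ := mul_comm _ _

/-- Since the shell of the kernel has integral zero, 1 may be subtracted from the exponential, which
is then `O(‖ξ‖)` on the bounded support. -/
theorem NiceSymbol.fourier_shell_le_of_norm_le {Ω : UnitSphere d → ℂ} (hΩ : NiceSymbol Ω)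
    (hd : d ≠ 0) (ξ : Rd d) :
    ‖𝓕 ((shell d).indicator (roughKernel Ω)) ξ‖ ≤
      (2 * Real.pi * √d * 16 ^ d * volume.real (shell d)) * ‖ξ‖ := by
  set F := (shell d).indicator (roughKernel Ω) with hF
  have hFi : Integrable F := hΩ.integrable_shell
  have h1 : 𝓕 F ξ = ∫ x, ((Real.fourierChar (-inner ℝ x ξ) : ℂ) - 1) * F x := by
    have h2 : Integrable fun x => (Real.fourierChar (-inner ℝ x ξ) : ℂ) * F x := by
      have := (Real.fourierIntegral_convergent_iff (μ := volume) (f := F) ξ).2 hFi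
      simpa [Circle.smul_def] using this
    simp_rw [sub_mul, one_mul]
    rw [integral_sub h2 hFi, hΩ.integral_shell hd, sub_zero, Real.fourier_eq]
    simp [Circle.smul_def]
  have hfin : volume (shell d) ≠ ∞ :=
    ((isBounded_of_supNorm_le (1 / 8)).subset fun x hx => hx.2).measure_lt_top.ne
  have hptw : ∀ x, ‖((Real.fourierChar (-inner ℝ x ξ) : ℂ) - 1) * F x‖ ≤
      (shell d).indicator (fun _ => 2 * Real.pi * √d * 16 ^ d * ‖ξ‖) x := by
    intro x
    by_cases hx : x ∈ shell d
    · rw [hF, Set.indicator_of_mem hx, Set.indicator_of_mem hx, norm_mul]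
      have h3 : ‖(Real.fourierChar (-inner ℝ x ξ) : ℂ) - 1‖ ≤ 2 * Real.pi * (√d * ‖ξ‖) := by
        rw [Real.fourierChar_apply]
        have h4 := Real.norm_exp_I_mul_ofReal_sub_one_le (x := 2 * Real.pi * -inner ℝ x ξ)
        rw [mul_comm] at h4
        refine h4.trans ?_
        rw [norm_mul, norm_neg, Real.norm_of_nonneg (by positivity)]
        gcongr
        refine (norm_inner_le_norm x ξ).trans ?_
        gcongr
        refine (norm_le_supNorm x).trans (mul_le_of_le_one_right (Real.sqrt_nonneg _) ?_)
        exact hx.2.trans (by norm_num)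
      have h5 : ‖roughKernel Ω x‖ ≤ 16 ^ d := by
        refine (hΩ.norm_roughKernel_le_of_le (r := 1 / 16) (by norm_num)
          (hx.1.le.trans (supNorm_le_norm x))).trans (le_of_eq ?_)
        rw [one_div, inv_pow, inv_inv]
      calc _ ≤ 2 * Real.pi * (√d * ‖ξ‖) * 16 ^ d := by gcongr
        _ = _ := by ring
    · rw [hF, Set.indicator_of_notMem hx, Set.indicator_of_notMem hx]
      simp
  rw [h1]
  refine (norm_integral_le_of_norm_le ((integrable_indicator_iff measurableSet_shell).2
    (integrableOn_const hfin)) (Filter.Eventually.of_forall hptw)).trans (le_of_eq ?_)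
  rw [integral_indicator measurableSet_shell, setIntegral_const, smul_eq_mul]
  ring

/-! ### The dyadic decomposition of the rough kernel -/

/-- The restriction of the rough kernel to the dyadic shell `{2^(s-4) < |x|_∞ ≤ 2^(s-3)}`. -/
def roughPiece (Ω : UnitSphere d → ℂ) (s : ℤ) : Rd d → ℂ :=
  {x | (2 : ℝ) ^ (s - 4) < supNorm x ∧ supNorm x ≤ (2 : ℝ) ^ (s - 3)}.indicator (roughKernel Ω)

/-- By homogeneity all pieces are dilates of a single shell, so one Fourier estimate serves all
scales. -/
theorem roughPiece_eq_dil (Ω : UnitSphere d → ℂ) (s : ℤ) :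
    roughPiece Ω s = dil ((shell d).indicator (roughKernel Ω)) s := by
  ext x
  have h2 : (0 : ℝ) < 2 ^ s := by positivity
  have hiff : (2 : ℝ) ^ (-s) • x ∈ shell d ↔
      x ∈ {x : Rd d | (2 : ℝ) ^ (s - 4) < supNorm x ∧ supNorm x ≤ (2 : ℝ) ^ (s - 3)} := by
    simp only [shell, Set.mem_ofPred_eq, supNorm_smul]
    rw [abs_of_pos (by positivity), zpow_neg, zpow_sub₀ (by norm_num), zpow_sub₀ (by norm_num),
      inv_mul_eq_div, lt_div_iff₀ h2, div_le_iff₀ h2]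
    norm_num
    constructor <;> rintro ⟨h3, h4⟩ <;> constructor <;> linarith
  rw [roughPiece, dil]
  by_cases h : (2 : ℝ) ^ (-s) • x ∈ shell d
  · rw [Set.indicator_of_mem h, Set.indicator_of_mem (hiff.1 h), roughKernel_smul Ω (by positivity),
      ← mul_assoc, ← Complex.ofReal_mul]
    have h3 : (2 : ℝ) ^ (-(s * (d : ℤ))) * (((2 : ℝ) ^ (-s)) ^ d)⁻¹ = 1 := by
      rw [← zpow_natCast, ← zpow_mul, ← zpow_neg, ← zpow_add₀ (by norm_num)]
      norm_num
    rw [h3, Complex.ofReal_one, one_mul]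
  · rw [Set.indicator_of_notMem h, Set.indicator_of_notMem fun h' => h (hiff.2 h'), mul_zero]

theorem fourier_const_mul (c : ℂ) (f : Rd d → ℂ) (ξ : Rd d) :
    𝓕 (fun x => c * f x) ξ = c * 𝓕 f ξ := by
  rw [Real.fourier_eq, Real.fourier_eq, ← integral_const_mul]
  refine integral_congr_ae (Filter.Eventually.of_forall fun x => ?_)
  simp only [Circle.smul_def, smul_eq_mul]
  ring

theorem measurableSet_supNorm_annulus (a b : ℝ) :
    MeasurableSet {x : Rd d | a < supNorm x ∧ supNorm x ≤ b} :=
  (measurableSet_lt measurable_const measurable_supNorm).inter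
    (measurableSet_le measurable_supNorm measurable_const)

theorem NiceSymbol.measurable_roughPiece {Ω : UnitSphere d → ℂ} (hΩ : NiceSymbol Ω) (s : ℤ) :
    Measurable (roughPiece Ω s) :=
  hΩ.measurable_roughKernel.indicator (measurableSet_supNorm_annulus _ _)

theorem NiceSymbol.norm_roughPiece_le {Ω : UnitSphere d → ℂ} (hΩ : NiceSymbol Ω) (s : ℤ)
    (x : Rd d) : ‖roughPiece Ω s x‖ ≤ 16 ^ d * 2 ^ (-(s * (d : ℤ))) := by
  rw [roughPiece]
  by_cases hx : x ∈ {x : Rd d | (2 : ℝ) ^ (s - 4) < supNorm x ∧ supNorm x ≤ (2 : ℝ) ^ (s - 3)}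
  · rw [Set.indicator_of_mem hx]
    refine (hΩ.norm_roughKernel_le_of_le (by positivity)
      (hx.1.le.trans (supNorm_le_norm x))).trans (le_of_eq ?_)
    rw [zpow_sub₀ (by norm_num), div_pow, inv_div, ← zpow_natCast ((2 : ℝ) ^ s), ← zpow_mul,
      zpow_neg]
    norm_num [div_eq_mul_inv]
  · rw [Set.indicator_of_notMem hx, norm_zero]
    positivity

/-- The factor `c` normalizes at once the size `16 ^ d`, the constant `A` for low frequencies and
the constant `B` for high ones. The bound `‖η‖` for low frequencies is stronger than required since
`1/d ≤ 1`. -/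
theorem exists_isKernelFamily_roughPiece (hd : d ≠ 0) :
    ∃ c : ℝ, 0 < c ∧ ∀ Ω : UnitSphere d → ℂ, NiceSymbol Ω →
      IsKernelFamily (1 / (d : ℝ)) fun s x => (c : ℂ) * roughPiece Ω s x := by
  obtain ⟨C, hC, hdecay⟩ := exists_lintegral_wideShell_le hd
  set A : ℝ := 2 * Real.pi * √d * 16 ^ d * volume.real (shell d) with hA
  set B : ℝ := 32 ^ d * C.toReal with hB
  have hA0 : 0 ≤ A := by positivity
  have hB0 : 0 ≤ B := by positivity
  have hS : (0 : ℝ) < 16 ^ d := by positivity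
  set c : ℝ := (16 ^ d + A + B)⁻¹ with hc
  have hc0 : 0 < c := by positivity
  have hcS : c * (16 ^ d + A + B) = 1 := inv_mul_cancel₀ (by positivity)
  have hd1 : (1 : ℝ) ≤ d := by exact_mod_cast Nat.one_le_iff_ne_zero.2 hd
  have hinv0 : 0 < 1 / (d : ℝ) := by positivity
  have hinv1 : 1 / (d : ℝ) ≤ 1 := by
    rw [div_le_one (by linarith)]
    exact hd1
  refine ⟨c, hc0, fun Ω hΩ => ⟨fun s => ?_, fun s x hx => ?_, fun s => ?_, fun s ξ => ?_⟩⟩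
  · exact ((hΩ.measurable_roughPiece s).const_mul _).aestronglyMeasurable
  · have h1 : roughPiece Ω s x ≠ 0 := right_ne_zero_of_mul hx
    have h2 := Set.mem_of_indicator_ne_zero h1
    exact ⟨h2.1, h2.2.trans_lt (zpow_lt_zpow_right₀ (by norm_num) (by omega))⟩
  · refine Filter.Eventually.of_forall fun x => ?_
    rw [norm_mul, Complex.norm_real, Real.norm_of_nonneg hc0.le]
    calc c * ‖roughPiece Ω s x‖ ≤ c * (16 ^ d * 2 ^ (-(s * (d : ℤ)))) := by
          gcongr
          exact hΩ.norm_roughPiece_le s x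
      _ = (c * 16 ^ d) * 2 ^ (-(s * (d : ℤ))) := by ring
      _ ≤ 1 * 2 ^ (-(s * (d : ℤ))) := by
          gcongr
          nlinarith
      _ = _ := one_mul _
  · rw [fourier_const_mul, roughPiece_eq_dil, fourier_dil, norm_mul, Complex.norm_real,
      Real.norm_of_nonneg hc0.le]
    set η := (2 : ℝ) ^ s • ξ with hη
    have h1 := hΩ.fourier_shell_le_of_norm_le hd η
    rw [← hA] at h1
    rcases eq_or_ne η 0 with h0 | h0
    · rw [h0, norm_zero, mul_zero] at h1
      rw [h0, le_antisymm h1 (norm_nonneg _)]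
      simp [Real.zero_rpow, hd]
    have hpos : 0 < ‖η‖ := norm_pos_iff.2 h0
    rcases le_total ‖η‖ 1 with hle | hge
    · have h2 : ‖η‖ ≤ ‖η‖ ^ (1 / (d : ℝ)) := by
        calc ‖η‖ = ‖η‖ ^ (1 : ℝ) := (Real.rpow_one _).symm
          _ ≤ _ := Real.rpow_le_rpow_of_exponent_ge hpos hle hinv1
      have h3 : ‖η‖ ^ (1 / (d : ℝ)) ≤ ‖η‖ ^ (-(1 / (d : ℝ))) :=
        Real.rpow_le_rpow_of_exponent_ge hpos hle (by linarith)
      have h4 : c * ‖𝓕 ((shell d).indicator (roughKernel Ω)) η‖ ≤ ‖η‖ := by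
        calc _ ≤ c * (A * ‖η‖) := by gcongr
          _ = (c * A) * ‖η‖ := by ring
          _ ≤ 1 * ‖η‖ := by
            gcongr
            nlinarith
          _ = _ := one_mul _
      exact le_min (h4.trans h2) ((h4.trans h2).trans h3)
    · have h3 : ‖η‖ ^ (-(1 / (d : ℝ))) ≤ ‖η‖ ^ (1 / (d : ℝ)) :=
        Real.rpow_le_rpow_of_exponent_le hge (by linarith)
      have h5 : ‖𝓕 ((shell d).indicator (roughKernel Ω)) η‖ ≤ B * ‖η‖ ^ (-(1 / (d : ℝ))) := by
        have h6 := (hΩ.enorm_fourier_shell_le η).trans (mul_le_mul_right (hdecay η hge) _)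
        rw [← ofReal_norm, ← ofReal_norm, ENNReal.ofReal_rpow_of_pos hpos,
          ← ENNReal.ofReal_toReal hC, ← ENNReal.ofReal_mul ENNReal.toReal_nonneg] at h6
        have h7 : (32 : ℝ≥0∞) ^ d = ENNReal.ofReal (32 ^ d) := by
          rw [ENNReal.ofReal_pow (by norm_num)]
          norm_num
        rw [h7, ← ENNReal.ofReal_mul (by positivity), ENNReal.ofReal_le_ofReal_iff (by positivity)]
          at h6
        rw [hB, mul_assoc]
        exact h6
      have h4 : c * ‖𝓕 ((shell d).indicator (roughKernel Ω)) η‖ ≤ ‖η‖ ^ (-(1 / (d : ℝ))) := by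
        calc _ ≤ c * (B * ‖η‖ ^ (-(1 / (d : ℝ)))) := by gcongr
          _ = (c * B) * ‖η‖ ^ (-(1 / (d : ℝ))) := by ring
          _ ≤ 1 * ‖η‖ ^ (-(1 / (d : ℝ))) := by
            gcongr
            nlinarith
          _ = _ := one_mul _
      exact le_min (h4.trans h3) h4

/-! ### Pointwise domination of the rough maximal singular integrals -/

theorem lintegral_comp_sub_le_hlMax (f : Rd d → ℂ) (x : Rd d) {r : ℝ} (hr : 0 < r) :
    ∫⁻ t in {t : Rd d | supNorm t ≤ r}, ‖f (x - t)‖ₑ ≤ ENNReal.ofReal (4 * r) ^ d * hlMax f x := by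
  -- Cubes are half-open, so one of half side `2r` is taken to contain the closed box of radius `r`
  -- around `x`.
  set Q : Cube d := ⟨WithLp.toLp 2 fun i => x i - 2 * r, 4 * r, by positivity⟩ with hQ
  have hmem : ∀ t : Rd d, supNorm t ≤ r → x - t ∈ Q.toSet := fun t ht i => by
    have h1 := abs_le.1 ((supNorm_le_iff hr.le).1 ht i)
    simp only [hQ, PiLp.sub_apply]
    constructor <;> linarith [h1.1, h1.2]
  have hx : x ∈ Q.toSet := by
    have := hmem 0 (by rw [supNorm_le_iff hr.le]; simp [hr.le])
    simpa using this
  have hvol : volume Q.toSet = ENNReal.ofReal (4 * r) ^ d := Q.volume_toSet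
  have havg : ∫⁻ y in Q.toSet, ‖f y‖ₑ = volume Q.toSet * avg 1 f Q := by
    rw [avg_eq one_pos]
    simp only [ENNReal.rpow_one, div_one]
    rw [← mul_assoc, ENNReal.mul_inv_cancel Q.volume_ne_zero Q.volume_ne_top, one_mul]
  calc _ = ∫⁻ t, {t : Rd d | supNorm t ≤ r}.indicator (fun t => ‖f (x - t)‖ₑ) t :=
        (lintegral_indicator (measurableSet_le measurable_supNorm measurable_const) _).symm
    _ ≤ ∫⁻ t, Q.toSet.indicator (fun y => ‖f y‖ₑ) (x - t) := by
        refine lintegral_mono fun t => ?_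
        by_cases ht : t ∈ {t : Rd d | supNorm t ≤ r}
        · rw [Set.indicator_of_mem ht, Set.indicator_of_mem (hmem t ht)]
        · rw [Set.indicator_of_notMem ht]
          exact zero_le
    _ = ∫⁻ y, Q.toSet.indicator (fun y => ‖f y‖ₑ) y := lintegral_sub_left_eq_self _ x
    _ = volume Q.toSet * avg 1 f Q := by rw [lintegral_indicator Q.measurableSet_toSet, havg]
    _ ≤ _ := by
        rw [hvol]
        gcongr
        exact le_iSup₂ (f := fun (Q : Cube d) (_ : x ∈ Q.toSet) => avg 1 f Q) Q hx

theorem NiceSymbol.integrableOn_mul_roughKernel {Ω : UnitSphere d → ℂ} (hΩ : NiceSymbol Ω)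
    {f : Rd d → ℂ} (hf : Integrable f) (x : Rd d) {s : Set (Rd d)} (hs : MeasurableSet s) {a : ℝ}
    (ha : 0 < a) (hsa : ∀ t ∈ s, a ≤ ‖t‖) :
    IntegrableOn (fun t => f (x - t) * roughKernel Ω t) s := by
  have h1 : Integrable fun t => f (x - t) := hf.comp_sub_left x
  refine Integrable.mono' (h1.norm.mul_const (a ^ d)⁻¹).integrableOn
    (h1.aestronglyMeasurable.mul hΩ.measurable_roughKernel.aestronglyMeasurable).restrict
    ((ae_restrict_iff' hs).2 (Filter.Eventually.of_forall fun t ht => ?_))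
  rw [norm_mul]
  gcongr
  exact hΩ.norm_roughKernel_le_of_le ha (hsa t ht)

theorem NiceSymbol.trunc_roughPiece {Ω : UnitSphere d → ℂ} (hΩ : NiceSymbol Ω) (c : ℂ)
    {f : Rd d → ℂ} (hf : Integrable f) (x : Rd d) {t₁ t₂ : ℤ} (ht : t₁ ≤ t₂) :
    trunc (fun s x => c * roughPiece Ω s x) f x t₁ t₂ =
      c * ∫ t in {t : Rd d | (2 : ℝ) ^ (t₁ - 3) < supNorm t ∧ supNorm t ≤ (2 : ℝ) ^ (t₂ - 3)},
        f (x - t) * roughKernel Ω t := by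
  induction t₂, ht using Int.leInduction with
  | base =>
    have : {t : Rd d | (2 : ℝ) ^ (t₁ - 3) < supNorm t ∧ supNorm t ≤ (2 : ℝ) ^ (t₁ - 3)} = ∅ := by
      ext t
      simp
    rw [this]
    simp [trunc]
  | succ m hm ih =>
    have h1 : Finset.Ioc t₁ (m + 1) = insert (m + 1) (Finset.Ioc t₁ m) := by
      ext k
      simp only [Finset.mem_Ioc, Finset.mem_insert]
      omega
    have h2 : (fun t => c * roughPiece Ω (m + 1) t) ⋆[ContinuousLinearMap.mul ℂ ℂ, volume] f =
        fun x => c * ∫ t in {t : Rd d | (2 : ℝ) ^ (m - 3) < supNorm t ∧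
          supNorm t ≤ (2 : ℝ) ^ (m + 1 - 3)}, f (x - t) * roughKernel Ω t := by
      ext x
      rw [← integral_indicator (measurableSet_supNorm_annulus _ _), ← integral_const_mul,
        convolution_def]
      refine integral_congr_ae (Filter.Eventually.of_forall fun t => ?_)
      have h3 : m + 1 - 4 = m - 3 := by omega
      simp only [roughPiece, ContinuousLinearMap.mul_apply', h3, Set.indicator_apply]
      split_ifs <;> ring
    rw [trunc] at ih ⊢
    rw [h1, Finset.sum_insert (by simp), ih, h2, ← mul_add, add_comm, ← setIntegral_union]
    · congr 3
      ext t
      have h4 : (2 : ℝ) ^ (t₁ - 3) ≤ 2 ^ (m - 3) :=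
        zpow_le_zpow_right₀ (by norm_num) (by omega)
      have h5 : (2 : ℝ) ^ (m - 3) ≤ 2 ^ (m + 1 - 3) :=
        zpow_le_zpow_right₀ (by norm_num) (by omega)
      simp only [Set.mem_union, Set.mem_ofPred_eq]
      constructor
      · rintro (⟨h6, h7⟩ | ⟨h6, h7⟩)
        · exact ⟨h6, h7.trans h5⟩
        · exact ⟨h4.trans_lt h6, h7⟩
      · rintro ⟨h6, h7⟩
        rcases le_or_gt (supNorm t) (2 ^ (m - 3)) with h8 | h8
        · exact Or.inl ⟨h6, h8⟩
        · exact Or.inr ⟨h8, h7⟩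
    · rw [Set.disjoint_left]
      rintro t ⟨_, h6⟩ ⟨h7, _⟩
      exact absurd h7 (not_lt.2 h6)
    · exact measurableSet_supNorm_annulus _ _
    · exact hΩ.integrableOn_mul_roughKernel hf x (measurableSet_supNorm_annulus _ _)
        (a := 2 ^ (t₁ - 3)) (by positivity) fun t ht => ht.1.le.trans (supNorm_le_norm t)
    · exact hΩ.integrableOn_mul_roughKernel hf x (measurableSet_supNorm_annulus _ _)
        (a := 2 ^ (m - 3)) (by positivity) fun t ht => ht.1.le.trans (supNorm_le_norm t)

theorem enorm_setIntegral_le_add {g : Rd d → ℂ} {A B D : Set (Rd d)} (hA : MeasurableSet A)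
    (hB : MeasurableSet B) (hD : MeasurableSet D) (hgA : IntegrableOn g A) (hgB : IntegrableOn g B)
    (hsub : ∀ t, (t ∈ A ↔ t ∈ B) ∨ t ∈ D) :
    ‖∫ t in A, g t‖ₑ ≤ ‖∫ t in B, g t‖ₑ + ∫⁻ t in D, ‖g t‖ₑ := by
  rw [← integral_indicator hA, ← integral_indicator hB, ← lintegral_indicator hD]
  have hA' := (integrable_indicator_iff hA).2 hgA
  have hB' := (integrable_indicator_iff hB).2 hgB
  have h1 : ∫ t, A.indicator g t = (∫ t, B.indicator g t) +
      ∫ t, (A.indicator g t - B.indicator g t) := by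
    rw [integral_sub hA' hB']
    ring
  rw [h1]
  refine (enorm_add_le _ _).trans (add_le_add le_rfl ?_)
  refine (enorm_integral_le_lintegral_enorm _).trans (lintegral_mono fun t => ?_)
  by_cases htD : t ∈ D
  · rw [Set.indicator_of_mem htD]
    by_cases htA : t ∈ A <;> by_cases htB : t ∈ B <;> simp [htA, htB]
  · have h2 := (hsub t).resolve_right htD
    by_cases htA : t ∈ A
    · simp [htA, h2.1 htA]
    · simp [htA, mt h2.2 htA]

/-- The kernel is at most `(r/2)^(-d)` here, against a cube of side `4r`: the quotient is 8. -/
theorem NiceSymbol.lintegral_transition_le {Ω : UnitSphere d → ℂ} (hΩ : NiceSymbol Ω)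
    (f : Rd d → ℂ) (x : Rd d) {r : ℝ} (hr : 0 < r) :
    ∫⁻ t in {t : Rd d | supNorm t ≤ r ∧ r / 2 ≤ ‖t‖}, ‖f (x - t) * roughKernel Ω t‖ₑ ≤
      8 ^ d * hlMax f x := by
  have hm : MeasurableSet {t : Rd d | supNorm t ≤ r ∧ r / 2 ≤ ‖t‖} :=
    (measurableSet_le measurable_supNorm measurable_const).inter
      (measurableSet_le measurable_const measurable_norm)
  calc _ ≤ ∫⁻ t in {t : Rd d | supNorm t ≤ r ∧ r / 2 ≤ ‖t‖},
        ENNReal.ofReal (((r / 2) ^ d)⁻¹) * ‖f (x - t)‖ₑ := by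
        refine setLIntegral_mono' hm fun t ht => ?_
        rw [enorm_mul, mul_comm]
        gcongr
        rw [← ofReal_norm]
        exact ENNReal.ofReal_le_ofReal (hΩ.norm_roughKernel_le_of_le (by positivity) ht.2)
    _ = ENNReal.ofReal (((r / 2) ^ d)⁻¹) *
        ∫⁻ t in {t : Rd d | supNorm t ≤ r ∧ r / 2 ≤ ‖t‖}, ‖f (x - t)‖ₑ :=
        lintegral_const_mul' _ _ (by simp)
    _ ≤ ENNReal.ofReal (((r / 2) ^ d)⁻¹) * (ENNReal.ofReal (4 * r) ^ d * hlMax f x) := by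
        gcongr
        exact (lintegral_mono_set fun t ht => ht.1).trans (lintegral_comp_sub_le_hlMax f x hr)
    _ = _ := by
        rw [← mul_assoc, ← ENNReal.ofReal_pow (by positivity), ← ENNReal.ofReal_mul (by positivity),
          ← inv_pow, ← mul_pow]
        have : (r / 2)⁻¹ * (4 * r) = 8 := by
          field_simp
          norm_num
        rw [this, ENNReal.ofReal_pow (by norm_num)]
        norm_num

theorem measurableSet_norm_annulus (a b : ℝ) :
    MeasurableSet {t : Rd d | a < ‖t‖ ∧ ‖t‖ < b} :=
  (measurableSet_lt measurable_const measurable_norm).inter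
    (measurableSet_lt measurable_norm measurable_const)

/-- The Euclidean annulus and the dyadic annulus in the maximum norm differ only where `|t|_∞ ≤ r`
and `r/2 ≤ |t|`, for `r = δ` or `r = 1/δ`; each such region costs `8 ^ d` times the maximal
function. For `δ ≥ 1` the annulus is empty. -/
theorem NiceSymbol.enorm_roughTrunc_le {Ω : UnitSphere d → ℂ} (hΩ : NiceSymbol Ω) {c : ℝ}
    (hc : 0 < c) {f : Rd d → ℂ} (hf : Integrable f) (x : Rd d) {δ : ℝ} (hδ : 0 < δ) :
    ‖roughTrunc Ω δ f x‖ₑ ≤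
      ENNReal.ofReal c⁻¹ * maxTrunc (fun s x => (c : ℂ) * roughPiece Ω s x) f x +
        2 * 8 ^ d * hlMax f x := by
  rcases le_or_gt 1 δ with h1 | h1
  · have : {t : Rd d | δ < ‖t‖ ∧ ‖t‖ < 1 / δ} = ∅ := by
      ext t
      simp only [Set.mem_ofPred_eq, Set.mem_empty_iff_false, iff_false, not_and, not_lt]
      intro h2
      rw [div_le_iff₀ hδ]
      nlinarith
    rw [roughTrunc, this]
    simp
  -- Both radii are rounded down to powers of 2. As the piece of index `s` ends at `2^(s-3)`, the
  -- truncation levels are `m₁ + 3` and `m₂ + 3`.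
  obtain ⟨m₁, hm₁, hm₁'⟩ := exists_mem_Ico_zpow hδ (one_lt_two : (1 : ℝ) < 2)
  obtain ⟨m₂, hm₂, hm₂'⟩ := exists_mem_Ico_zpow (one_div_pos.2 hδ) (one_lt_two : (1 : ℝ) < 2)
  rw [zpow_add_one₀ (by norm_num)] at hm₁' hm₂'
  have hδ1 : 1 < 1 / δ := by
    rw [lt_div_iff₀ hδ]
    linarith
  have hle : m₁ + 3 ≤ m₂ + 3 := by
    have h2 : (2 : ℝ) ^ m₁ < 2 ^ (0 : ℤ) := by
      rw [zpow_zero]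
      linarith
    have h3 : (2 : ℝ) ^ (0 : ℤ) < 2 ^ (m₂ + 1) := by
      rw [zpow_zero, zpow_add_one₀ (by norm_num)]
      linarith
    have h4 := (zpow_lt_zpow_iff_right₀ (one_lt_two : (1 : ℝ) < 2)).1 h2
    have h5 := (zpow_lt_zpow_iff_right₀ (one_lt_two : (1 : ℝ) < 2)).1 h3
    omega
  have htr := hΩ.trunc_roughPiece (c : ℂ) hf x hle
  rw [add_sub_cancel_right, add_sub_cancel_right] at htr
  set B := {t : Rd d | (2 : ℝ) ^ m₁ < supNorm t ∧ supNorm t ≤ (2 : ℝ) ^ m₂} with hB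
  set D : ℝ → Set (Rd d) := fun r => {t : Rd d | supNorm t ≤ r ∧ r / 2 ≤ ‖t‖} with hD
  have hDm : ∀ r, MeasurableSet (D r) := fun r =>
    (measurableSet_le measurable_supNorm measurable_const).inter
      (measurableSet_le measurable_const measurable_norm)
  have hp₁ : (0 : ℝ) < 2 ^ m₁ := by positivity
  have hsub : ∀ t, (t ∈ {t : Rd d | δ < ‖t‖ ∧ ‖t‖ < 1 / δ} ↔ t ∈ B) ∨ t ∈ D δ ∪ D (1 / δ) := by
    intro t
    have h6 := supNorm_le_norm t
    by_cases hD1 : t ∈ D δ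
    · exact Or.inr (Or.inl hD1)
    by_cases hD2 : t ∈ D (1 / δ)
    · exact Or.inr (Or.inr hD2)
    refine Or.inl ?_
    simp only [hD, Set.mem_ofPred_eq, not_and, not_le] at hD1 hD2
    simp only [hB, Set.mem_ofPred_eq]
    constructor
    · rintro ⟨h7, h8⟩
      constructor
      · by_contra h9
        have := hD1 (by linarith)
        linarith
      · by_contra h9
        have := hD2 (by linarith)
        linarith
    · rintro ⟨h7, h8⟩
      constructor
      · by_contra h9
        have := hD1 (by linarith)
        linarith
      · by_contra h9
        have := hD2 (by linarith)
        linarith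
  have hint := enorm_setIntegral_le_add (g := fun t => f (x - t) * roughKernel Ω t)
    (measurableSet_norm_annulus δ (1 / δ)) (measurableSet_supNorm_annulus _ _)
    ((hDm δ).union (hDm (1 / δ)))
    (hΩ.integrableOn_mul_roughKernel hf x (measurableSet_norm_annulus _ _) hδ fun t ht => ht.1.le)
    (hΩ.integrableOn_mul_roughKernel hf x (measurableSet_supNorm_annulus _ _) hp₁
      fun t ht => ht.1.le.trans (supNorm_le_norm t)) hsub
  refine hint.trans (add_le_add ?_ ?_)
  · have h7 : ∫ t in B, f (x - t) * roughKernel Ω t =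
        ((c⁻¹ : ℝ) : ℂ) * trunc (fun s x => (c : ℂ) * roughPiece Ω s x) f x (m₁ + 3) (m₂ + 3) := by
      rw [htr, ← mul_assoc, ← Complex.ofReal_mul, inv_mul_cancel₀ hc.ne', Complex.ofReal_one, one_mul]
    rw [h7, enorm_mul, ← ofReal_norm (((c⁻¹ : ℝ) : ℂ)), Complex.norm_real,
      Real.norm_of_nonneg (by positivity)]
    gcongr
    rw [maxTrunc]
    exact le_iSup_of_le (m₁ + 3) (le_iSup_of_le (m₂ + 3) (le_iSup_of_le hle le_rfl))
  · refine (lintegral_union_le _ _ _).trans ?_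
    rw [two_mul, add_mul]
    exact add_le_add (hΩ.lintegral_transition_le f x hδ)
      (hΩ.lintegral_transition_le f x (one_div_pos.2 hδ))

theorem roughTrunc_congr {Ω Ω' : UnitSphere d → ℂ} (h : Ω =ᵐ[surfaceMeasure d] Ω') (δ : ℝ)
    {f g : Rd d → ℂ} (hfg : f =ᵐ[volume] g) (x : Rd d) :
    roughTrunc Ω δ f x = roughTrunc Ω' δ g x := by
  refine setIntegral_congr_ae (measurableSet_norm_annulus _ _) ?_
  have h1 : ∀ᵐ t : Rd d, f (x - t) = g (x - t) :=
    (quasiMeasurePreserving_sub_left volume x).ae hfg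
  filter_upwards [h1, roughKernel_ae_eq h] with t h2 h3 _
  rw [h2, h3]

theorem roughMax_congr {Ω Ω' : UnitSphere d → ℂ} (h : Ω =ᵐ[surfaceMeasure d] Ω')
    {f g : Rd d → ℂ} (hfg : f =ᵐ[volume] g) : roughMax Ω f = roughMax Ω' g := by
  ext x
  simp only [roughMax, roughTrunc_congr h _ hfg]

theorem LinftyZero.integrable {f : Rd d → ℂ} (hf : LinftyZero f) : Integrable f := by
  obtain ⟨g, hg, hfg⟩ := hf.exists_niceFun
  exact hg.integrable.congr hfg.symm

theorem exists_roughMax_le (hd : d ≠ 0) :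
    ∃ C : ℝ, 0 < C ∧ ∀ Ω : UnitSphere d → ℂ, IsRoughSymbol Ω →
      ∃ K : ℤ → Rd d → ℂ, IsKernelFamily (1 / (d : ℝ)) K ∧
        ∀ f : Rd d → ℂ, LinftyZero f → ∀ x : Rd d,
          roughMax Ω f x ≤ ENNReal.ofReal C * (hlMax f x + maxTrunc K f x) := by
  obtain ⟨c, hc, hfam⟩ := exists_isKernelFamily_roughPiece hd
  refine ⟨c⁻¹ + 2 * 8 ^ d, by positivity, fun Ω hΩ => ?_⟩
  obtain ⟨Ω', hΩ', hae⟩ := hΩ.exists_niceSymbol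
  refine ⟨_, hfam Ω' hΩ', fun f hf x => ?_⟩
  rw [roughMax_congr hae (Filter.EventuallyEq.refl _ f)]
  refine iSup₂_le fun δ hδ => (hΩ'.enorm_roughTrunc_le hc hf.integrable x hδ).trans ?_
  have h8 : ENNReal.ofReal (2 * 8 ^ d) = 2 * 8 ^ d := by
    rw [ENNReal.ofReal_mul (by norm_num), ENNReal.ofReal_pow (by norm_num)]
    norm_num
  rw [ENNReal.ofReal_add (by positivity) (by positivity), h8, mul_add, add_comm]
  gcongr
  · exact le_add_self
  · exact le_self_add

theorem NiceFun.linftyZero {f : Rd d → ℂ} (hf : NiceFun f) : LinftyZero f := by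
  obtain ⟨C, hC⟩ := hf.bdd
  exact ⟨memLp_top_of_bound hf.meas.aestronglyMeasurable C (Filter.Eventually.of_forall hC),
    hf.hasCompactSupport⟩

/-! ### The Hardy-Littlewood maximal function -/

/-- A cube with side in `[2^m, 2^(m+1))` lies in the triple of level `m + 1` at any of its points,
whose side is at most 6 times larger. -/
theorem exists_avg_one_le_triAvg (f : Rd d → ℂ) (Q : Cube d) {x : Rd d} (hx : x ∈ Q.toSet) :
    ∃ j : ℤ, SparseMaxTrunc.avg 1 f Q ≤ 6 ^ d * triAvg j (fun y => ‖f y‖ₑ) x := by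
  obtain ⟨m, hm, hm'⟩ := exists_mem_Ico_zpow Q.side_pos (one_lt_two : (1 : ℝ) < 2)
  refine ⟨m + 1, ?_⟩
  have hsub : Q.toSet ⊆ tri (m + 1) x := fun y hy => by
    refine mem_tri_of_supNorm_le ((supNorm_le_iff (by positivity)).2 fun i => ?_)
    have h1 := hx i
    have h2 := hy i
    rw [PiLp.sub_apply, abs_le]
    constructor <;> linarith [h1.1, h1.2, h2.1, h2.2]
  have hvol : volume (tri (m + 1) x) ≤ 6 ^ d * volume Q.toSet := by
    rw [volume_tri, Q.volume_toSet, cellVol, ← mul_pow, ← mul_pow]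
    refine pow_le_pow_left' ?_ d
    rw [zpow_add_one₀ (by norm_num)]
    have h3 : (3 : ℝ≥0∞) = ENNReal.ofReal 3 := by norm_num
    have h6 : (6 : ℝ≥0∞) = ENNReal.ofReal 6 := by norm_num
    rw [h3, h6, ← ENNReal.ofReal_mul (by norm_num), ← ENNReal.ofReal_mul (by norm_num)]
    exact ENNReal.ofReal_le_ofReal (by linarith)
  have hinv : (volume Q.toSet)⁻¹ ≤ 6 ^ d * (volume (tri (m + 1) x))⁻¹ := by
    rw [← ENNReal.div_eq_inv_mul.trans (mul_comm _ _),
      ENNReal.le_div_iff_mul_le (Or.inl (volume_tri_ne_zero _ _)) (Or.inl (volume_tri_ne_top _ _))]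
    calc _ ≤ (volume Q.toSet)⁻¹ * (6 ^ d * volume Q.toSet) := by gcongr
      _ = 6 ^ d * ((volume Q.toSet)⁻¹ * volume Q.toSet) := by ring
      _ = 6 ^ d := by rw [ENNReal.inv_mul_cancel Q.volume_ne_zero Q.volume_ne_top, mul_one]
  rw [avg_eq one_pos, triAvg]
  simp only [ENNReal.rpow_one, div_one]
  calc _ ≤ (6 ^ d * (volume (tri (m + 1) x))⁻¹) * ∫⁻ y in tri (m + 1) x, ‖f y‖ₑ :=
        mul_le_mul' hinv (lintegral_mono_set hsub)
    _ = _ := mul_assoc _ _ _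

theorem hlMax_le_iSup_maxAvg (f : Rd d → ℂ) (x : Rd d) :
    hlMax f x ≤ 6 ^ d * ⨆ n : ℕ, ∑ r : Fin d → Fin 3,
      (triGrid r).maxAvg (n : ℤ) (fun y => ‖f y‖ₑ) x := by
  refine iSup₂_le fun Q hQ => ?_
  obtain ⟨j, hj⟩ := exists_avg_one_le_triAvg f Q hQ
  refine hj.trans (mul_le_mul_right ?_ _)
  obtain ⟨r, hr⟩ := exists_triAvg_eq j x
  rw [hr]
  refine le_iSup_of_le j.toNat ?_
  have h1 : (triGrid r).avg j (fun y => ‖f y‖ₑ) x ≤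
      (triGrid r).maxAvg (j.toNat : ℤ) (fun y => ‖f y‖ₑ) x :=
    le_iSup₂ (f := fun (i : ℤ) (_ : i ≤ (j.toNat : ℤ)) => (triGrid r).avg i (fun y => ‖f y‖ₑ) x) j
      (Int.self_le_toNat j)
  exact h1.trans (Finset.single_le_sum (f := fun r : Fin d → Fin 3 =>
    (triGrid r).maxAvg (j.toNat : ℤ) (fun y => ‖f y‖ₑ) x) (fun _ _ => zero_le) (Finset.mem_univ r))

/-- The maximal function over all cubes is reduced to the `3 ^ d` shifted grids at the cost `6 ^ d`,
whence `18 ^ d`. -/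
theorem lintegral_hlMax_mul_le {f₁ f₂ : Rd d → ℂ} (hf₁ : NiceFun f₁) (hf₂ : NiceFun f₂) :
    ∫⁻ x, hlMax f₁ x * ‖f₂ x‖ₑ ≤ 8 * 18 ^ d * sparseSup 1 f₁ f₂ := by
  obtain ⟨C, hC⟩ := hf₁.bdd
  have hM : ∀ x, ‖f₁ x‖ₑ ≤ ENNReal.ofReal C := fun x => by
    rw [← ofReal_norm]
    exact ENNReal.ofReal_le_ofReal (hC x)
  set F : Rd d → ℝ≥0∞ := fun y => ‖f₁ y‖ₑ with hF
  have hm : ∀ (n : ℕ) (r : Fin d → Fin 3),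
      Measurable fun x => (triGrid r).maxAvg (n : ℤ) F x * ‖f₂ x‖ₑ := fun n r =>
    ((triGrid r).measurable_maxAvg _ _).mul hf₂.meas.enorm
  have hms : ∀ n : ℕ, Measurable fun x =>
      ∑ r : Fin d → Fin 3, (triGrid r).maxAvg (n : ℤ) F x * ‖f₂ x‖ₑ := fun n =>
    Finset.measurable_fun_sum _ fun r _ => hm n r
  have hmono : Monotone fun (n : ℕ) (x : Rd d) =>
      ∑ r : Fin d → Fin 3, (triGrid r).maxAvg (n : ℤ) F x * ‖f₂ x‖ₑ := fun n k hnk x => by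
    refine Finset.sum_le_sum fun r _ => mul_le_mul_left ?_ _
    refine iSup₂_le fun j hj => ?_
    exact le_iSup₂ (f := fun (i : ℤ) (_ : i ≤ (k : ℤ)) => (triGrid r).avg i F x) j
      (hj.trans (by exact_mod_cast hnk))
  calc ∫⁻ x, hlMax f₁ x * ‖f₂ x‖ₑ
      ≤ ∫⁻ x, 6 ^ d * ⨆ n : ℕ, ∑ r : Fin d → Fin 3, (triGrid r).maxAvg (n : ℤ) F x * ‖f₂ x‖ₑ := by
        refine lintegral_mono fun x => ?_
        refine (mul_le_mul_left (hlMax_le_iSup_maxAvg f₁ x) _).trans (le_of_eq ?_)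
        rw [mul_assoc, ENNReal.iSup_mul]
        simp only [Finset.sum_mul, hF]
    _ = 6 ^ d * ⨆ n : ℕ, ∫⁻ x, ∑ r : Fin d → Fin 3, (triGrid r).maxAvg (n : ℤ) F x * ‖f₂ x‖ₑ := by
        rw [lintegral_const_mul' _ _ (by simp), lintegral_iSup hms hmono]
    _ ≤ 6 ^ d * ∑ _r : Fin d → Fin 3, 8 * sparseSup 1 f₁ f₂ := by
        refine mul_le_mul_right (iSup_le fun n => ?_) _
        rw [lintegral_finsetSum _ fun r _ => hm n r]
        exact Finset.sum_le_sum fun r _ =>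
          (triGrid r).lintegral_maxAvg_mul_le hf₁.meas hf₂.meas ENNReal.ofReal_ne_top hM n
    _ = _ := by
        have h18 : (18 : ℝ≥0∞) ^ d = 6 ^ d * 3 ^ d := by
          rw [← mul_pow]
          norm_num
        rw [h18, Finset.sum_const, Finset.card_univ, nsmul_eq_mul]
        simp only [Fintype.card_pi_const, Fintype.card_fin, Nat.cast_pow, Nat.cast_ofNat]
        ring

theorem avg_one_le_avg {f : Rd d → ℂ} (hf : Measurable f) {p : ℝ} (hp : 1 ≤ p) (Q : Cube d) :
    SparseMaxTrunc.avg 1 f Q ≤ SparseMaxTrunc.avg p f Q := by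
  have hp0 : 0 < p := by linarith
  have h := eLpNorm_le_eLpNorm_mul_rpow_measure_univ (p := 1) (q := ENNReal.ofReal p)
    (μ := volume.restrict Q.toSet) (f := f) (ENNReal.one_le_ofReal.2 hp) hf.aestronglyMeasurable
  rw [Measure.restrict_apply_univ, ENNReal.toReal_one, ENNReal.toReal_ofReal hp0.le,
    ENNReal.rpow_sub _ _ Q.volume_ne_zero Q.volume_ne_top] at h
  rw [avg, avg, eLpNorm_indicator_eq_eLpNorm_restrict Q.measurableSet_toSet,
    eLpNorm_indicator_eq_eLpNorm_restrict Q.measurableSet_toSet, ENNReal.ofReal_one]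
  have h0 : volume Q.toSet ^ (1 / (1 : ℝ)) ≠ 0 := by simpa using Q.volume_ne_zero
  have ht : volume Q.toSet ^ (1 / (1 : ℝ)) ≠ ∞ := by simpa using Q.volume_ne_top
  rw [ENNReal.div_le_iff h0 ht]
  refine h.trans (le_of_eq ?_)
  simp only [div_eq_mul_inv]
  ring

theorem sparseSup_one_le {f₁ f₂ : Rd d → ℂ} (hf₁ : Measurable f₁) (hf₂ : Measurable f₂) {p : ℝ}
    (hp : 1 ≤ p) : sparseSup 1 f₁ f₂ ≤ sparseSup p f₁ f₂ := by
  refine iSup₂_mono fun S _ => ENNReal.tsum_le_tsum fun Q => ?_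
  gcongr
  · exact avg_one_le_avg hf₁ hp _
  · exact avg_one_le_avg hf₂ hp _

theorem hlMax_le_of_bound {f : Rd d → ℂ} {M : ℝ≥0∞} (hM : ∀ x, ‖f x‖ₑ ≤ M) (x : Rd d) :
    hlMax f x ≤ M :=
  iSup₂_le fun Q _ => Grid.avg_le_of_bound one_pos hM Q

/-! ### The maximal rough singular integrals -/

theorem NiceSymbol.measurable_roughTrunc {Ω : UnitSphere d → ℂ} (hΩ : NiceSymbol Ω) {δ : ℝ}
    (hδ : 0 < δ) {f : Rd d → ℂ} (hf : NiceFun f) : Measurable (roughTrunc Ω δ f) := by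
  have hk : NiceFun ({t : Rd d | δ < ‖t‖ ∧ ‖t‖ < 1 / δ}.indicator (roughKernel Ω)) := by
    refine ⟨hΩ.measurable_roughKernel.indicator (measurableSet_norm_annulus _ _),
      ⟨(δ ^ d)⁻¹, fun t => ?_⟩, ⟨1 / δ, fun t ht => ?_⟩⟩
    · by_cases ht : t ∈ {t : Rd d | δ < ‖t‖ ∧ ‖t‖ < 1 / δ}
      · rw [Set.indicator_of_mem ht]
        exact hΩ.norm_roughKernel_le_of_le hδ ht.1.le
      · rw [Set.indicator_of_notMem ht, norm_zero]
        positivity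
    · exact Set.indicator_of_notMem (fun h => absurd h.2 (not_lt.2 ht.le)) _
  have h1 : roughTrunc Ω δ f =
      {t : Rd d | δ < ‖t‖ ∧ ‖t‖ < 1 / δ}.indicator (roughKernel Ω)
        ⋆[ContinuousLinearMap.mul ℂ ℂ, volume] f := by
    ext x
    rw [roughTrunc, ← integral_indicator (measurableSet_norm_annulus _ _), convolution_def]
    refine integral_congr_ae (Filter.Eventually.of_forall fun t => ?_)
    simp only [ContinuousLinearMap.mul_apply', Set.indicator_apply]
    split_ifs <;> ring
  rw [h1]
  exact hk.measurable_conv hf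

/-- For rationals decreasing to `δ` the annuli increase to that of `δ`, so the truncated integrals
converge. A countable supremum is needed for measurability. -/
theorem NiceSymbol.roughMax_eq_iSup_rat {Ω : UnitSphere d → ℂ} (hΩ : NiceSymbol Ω)
    {f : Rd d → ℂ} (hf : Integrable f) (x : Rd d) :
    roughMax Ω f x = ⨆ (q : ℚ) (_ : 0 < q), ‖roughTrunc Ω q f x‖ₑ := by
  refine le_antisymm (iSup₂_le fun δ hδ => ?_) (iSup₂_le fun q hq => ?_)
  · obtain ⟨u, hu, hδu, hlim⟩ := Real.exists_seq_rat_strictAnti_tendsto δ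
    have hu0 : ∀ n, (0 : ℝ) < u n := fun n => hδ.trans (hδu n)
    have hunion : {t : Rd d | δ < ‖t‖ ∧ ‖t‖ < 1 / δ} =
        ⋃ n, {t : Rd d | (u n : ℝ) < ‖t‖ ∧ ‖t‖ < 1 / (u n : ℝ)} := by
      ext t
      simp only [Set.mem_ofPred_eq, Set.mem_iUnion]
      constructor
      · rintro ⟨h1, h2⟩
        have hlim' : Filter.Tendsto (fun n => 1 / (u n : ℝ)) Filter.atTop (nhds (1 / δ)) :=
          tendsto_const_nhds.div hlim hδ.ne'
        exact ((hlim.eventually_lt_const h1).and (hlim'.eventually_const_lt h2)).exists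
      · rintro ⟨n, h1, h2⟩
        exact ⟨(hδu n).trans h1, h2.trans (one_div_lt_one_div_of_lt hδ (hδu n))⟩
    have htend := tendsto_setIntegral_of_monotone (μ := volume)
      (f := fun t => f (x - t) * roughKernel Ω t)
      (s := fun n => {t : Rd d | (u n : ℝ) < ‖t‖ ∧ ‖t‖ < 1 / (u n : ℝ)})
      (fun n => measurableSet_norm_annulus _ _) (fun n m hnm t ht => by
        have h3 : (u m : ℝ) ≤ u n := by exact_mod_cast hu.antitone hnm
        exact ⟨h3.trans_lt ht.1, ht.2.trans_le (one_div_le_one_div_of_le (hu0 m) h3)⟩) (by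
        rw [← hunion]
        exact hΩ.integrableOn_mul_roughKernel hf x (measurableSet_norm_annulus _ _) hδ
          fun t ht => ht.1.le)
    rw [← hunion] at htend
    refine le_of_tendsto' htend.enorm fun n => ?_
    exact le_iSup₂ (f := fun (q : ℚ) (_ : 0 < q) => ‖roughTrunc Ω q f x‖ₑ) (u n)
      (by exact_mod_cast hu0 n)
  · exact le_iSup₂ (f := fun (δ : ℝ) (_ : 0 < δ) => ‖roughTrunc Ω δ f x‖ₑ) (q : ℝ)
      (by exact_mod_cast hq)

theorem NiceSymbol.measurable_roughMax {Ω : UnitSphere d → ℂ} (hΩ : NiceSymbol Ω)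
    {f : Rd d → ℂ} (hf : NiceFun f) : Measurable (roughMax Ω f) := by
  have : roughMax Ω f = fun x => ⨆ (q : ℚ) (_ : 0 < q), ‖roughTrunc Ω q f x‖ₑ := by
    ext x
    exact hΩ.roughMax_eq_iSup_rat hf.integrable x
  rw [this]
  exact Measurable.iSup fun q => Measurable.iSup fun hq =>
    (hΩ.measurable_roughTrunc (by exact_mod_cast hq) hf).enorm

theorem exists_sparseNorm_roughMax_le (hd : d ≠ 0) :
    ∃ C : ℝ, 0 < C ∧ ∀ ε : ℝ, 0 < ε → ε < 1 → ∀ Ω : UnitSphere d → ℂ, IsRoughSymbol Ω →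
      sparseNorm (roughMax Ω) (1 + ε) (1 + ε) ≤ ENNReal.ofReal (C / ε) := by
  have hd1 : (1 : ℝ) ≤ d := by exact_mod_cast Nat.one_le_iff_ne_zero.2 hd
  set a : ℝ := 1 / (d : ℝ) / 2 with ha
  have ha0 : 0 < a := by positivity
  have ha2 : a ≤ 1 / 2 := by
    have : 1 / (d : ℝ) ≤ 1 := by
      rw [div_le_one (by linarith)]
      exact hd1
    rw [ha]
    linarith
  obtain ⟨C, hC, hdom⟩ := exists_roughMax_le hd
  obtain ⟨D, hD, h⟩ := exists_maxTrunc_bound d ha0 ha2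
  set E : ℝ := C * (8 * 18 ^ d + D) with hE
  have hE0 : 0 < E := by positivity
  refine ⟨2 * E, by positivity, fun ε hε hε1 Ω hΩ => ?_⟩
  obtain ⟨K, hK, hle⟩ := hdom Ω hΩ
  obtain ⟨K', hK', hKK⟩ := hK.exists_niceFamily ha0 (by rw [ha]; linarith)
  obtain ⟨Ω', hΩ', hΩΩ⟩ := hΩ.exists_niceSymbol
  have hle' : ∀ f, NiceFun f → ∀ x,
      roughMax Ω f x ≤ ENNReal.ofReal C * (hlMax f x + maxTrunc K' f x) := fun f hf x => by
    rw [← maxTrunc_congr_ae hKK (Filter.EventuallyEq.refl _ f)]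
    exact hle f hf.linftyZero x
  have hpos : 0 < E / ε := by positivity
  have key : HasSparseBound (roughMax Ω) (1 + ε) (1 + ε) (2 * (E / ε).toNNReal) := by
    refine hasSparseBound_of_le (by simpa using hpos)
      (fun f g hfg => roughMax_congr (Filter.EventuallyEq.refl _ Ω) hfg)
      (fun f hf => ?_) (fun f hf B hB => ?_) fun f₁ f₂ hf₁ hf₂ => ?_
    · rw [roughMax_congr hΩΩ (Filter.EventuallyEq.refl _ f)]
      exact (hΩ'.measurable_roughMax hf).aemeasurable
    · obtain ⟨M, hM⟩ := hf.bdd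
      have hM' : ∀ x, ‖f x‖ₑ ≤ ENNReal.ofReal M := fun x => by
        rw [← ofReal_norm]
        exact ENNReal.ofReal_le_ofReal (hM x)
      calc ∫⁻ x in B, roughMax Ω f x
          ≤ ∫⁻ x in B, ENNReal.ofReal C * (ENNReal.ofReal M + maxTrunc K' f x) := by
            refine lintegral_mono fun x => (hle' f hf x).trans ?_
            gcongr
            exact hlMax_le_of_bound hM' x
        _ = ENNReal.ofReal C * (ENNReal.ofReal M * volume B + ∫⁻ x in B, maxTrunc K' f x) := by
            rw [lintegral_const_mul' _ _ (by simp), lintegral_add_left measurable_const,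
              setLIntegral_const]
        _ < ∞ := ENNReal.mul_lt_top (by simp) (ENNReal.add_lt_top.2
            ⟨ENNReal.mul_lt_top (by simp) hB.measure_lt_top, (h K' hK' f hf).1 B hB⟩)
    · have hm : Measurable fun x => maxTrunc K' f₁ x * ‖f₂ x‖ₑ :=
        (hK'.measurable_maxTrunc hf₁).mul hf₂.meas.enorm
      have hS := sparseSup_one_le hf₁.meas hf₂.meas (p := 1 + ε) (by linarith)
      -- The maximal function contributes a constant free of `ε`, which is absorbed in `C/ε` because
      -- `ε < 1`.
      have hE' : ENNReal.ofReal C * (8 * 18 ^ d + ENNReal.ofReal (D / ε)) ≤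
          ENNReal.ofReal (E / ε) := by
        have h8 : (8 * 18 ^ d : ℝ≥0∞) = ENNReal.ofReal (8 * 18 ^ d) := by
          rw [ENNReal.ofReal_mul (by norm_num), ENNReal.ofReal_pow (by norm_num)]
          norm_num
        rw [h8, ← ENNReal.ofReal_add (by positivity) (by positivity), ← ENNReal.ofReal_mul hC.le]
        refine ENNReal.ofReal_le_ofReal ?_
        rw [hE, mul_div_assoc, add_div]
        gcongr
        rw [le_div_iff₀ hε]
        exact mul_le_of_le_one_right (by positivity) hε1.le
      calc ∫⁻ x, roughMax Ω f₁ x * ‖f₂ x‖ₑ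
          ≤ ∫⁻ x, ENNReal.ofReal C * (hlMax f₁ x * ‖f₂ x‖ₑ + maxTrunc K' f₁ x * ‖f₂ x‖ₑ) := by
            refine lintegral_mono fun x => ?_
            rw [← add_mul, ← mul_assoc]
            exact mul_le_mul_left (hle' f₁ hf₁ x) _
        _ = ENNReal.ofReal C * ((∫⁻ x, hlMax f₁ x * ‖f₂ x‖ₑ) +
              ∫⁻ x, maxTrunc K' f₁ x * ‖f₂ x‖ₑ) := by
            rw [lintegral_const_mul' _ _ (by simp), lintegral_add_right _ hm]
        _ ≤ ENNReal.ofReal C * (8 * 18 ^ d * sparseSup (1 + ε) f₁ f₂ +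
              ENNReal.ofReal (D / ε) * sparseSup (1 + ε) f₁ f₂) := by
            gcongr
            · exact (lintegral_hlMax_mul_le hf₁ hf₂).trans (mul_le_mul_right hS _)
            · exact (h K' hK' f₁ hf₁).2 f₂ hf₂ ε hε hε1
        _ = (ENNReal.ofReal C * (8 * 18 ^ d + ENNReal.ofReal (D / ε))) *
              sparseSup (1 + ε) f₁ f₂ := by ring
        _ ≤ _ := mul_le_mul_left hE' _
  refine key.sparseNorm_le.trans (le_of_eq ?_)
  rw [mul_div_assoc 2 E ε, ENNReal.ofReal_mul (by norm_num), ENNReal.coe_mul]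
  simp [ENNReal.ofReal]

end SparseMaxTrunc

end

/-! ### The three statements together -/

theorem theorem1p2 (d : ℕ) (hd : 1 ≤ d) :
    -- the sparse bound for the maximal truncations, uniformly over the kernel families
    (∀ α : ℝ, 0 < α → ∃ C : ℝ, 0 < C ∧ ∀ ε : ℝ, 0 < ε → ε < 1 →
      ∀ K : ℤ → SparseMaxTrunc.Rd d → ℂ, SparseMaxTrunc.IsKernelFamily α K →
        SparseMaxTrunc.sparseNorm (SparseMaxTrunc.maxTrunc K) (1 + ε) (1 + ε)
          ≤ ENNReal.ofReal (C / ε)) ∧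
    -- the pointwise domination of the rough maximal singular integrals
    (∃ C : ℝ, 0 < C ∧ ∀ Ω : SparseMaxTrunc.UnitSphere d → ℂ, SparseMaxTrunc.IsRoughSymbol Ω →
      ∃ K : ℤ → SparseMaxTrunc.Rd d → ℂ, SparseMaxTrunc.IsKernelFamily (1 / (d : ℝ)) K ∧
        ∀ f : SparseMaxTrunc.Rd d → ℂ, SparseMaxTrunc.LinftyZero f →
          ∀ x : SparseMaxTrunc.Rd d, SparseMaxTrunc.roughMax Ω f x ≤
            ENNReal.ofReal C * (SparseMaxTrunc.hlMax f x + SparseMaxTrunc.maxTrunc K f x)) ∧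
    -- the resulting sparse bound for the rough maximal singular integrals
    (∃ C : ℝ, 0 < C ∧ ∀ ε : ℝ, 0 < ε → ε < 1 →
      ∀ Ω : SparseMaxTrunc.UnitSphere d → ℂ, SparseMaxTrunc.IsRoughSymbol Ω →
        SparseMaxTrunc.sparseNorm (SparseMaxTrunc.roughMax Ω) (1 + ε) (1 + ε)
          ≤ ENNReal.ofReal (C / ε)) := by
  have hd0 : d ≠ 0 := Nat.one_le_iff_ne_zero.1 hd
  exact ⟨fun α hα => SparseMaxTrunc.exists_sparseNorm_maxTrunc_le d hα,
    SparseMaxTrunc.exists_roughMax_le hd0, SparseMaxTrunc.exists_sparseNorm_roughMax_le hd0⟩
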